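/- Work in the projective model, where $\mathbb{H}^3$ is the open unit ball of $\mathbb{R}^3$, and let $\mathcal{H}\cong S^2\times\mathbb{R}$ be the manifold of half spaces $\{x : \langle n,x\rangle\le c\}$, $\|n\|=1$, of $\mathbb{R}^3$. A hyperbolic polyhedron is a compact intersection of finitely many half spaces of $\mathbb{H}^3$. Let $\Gamma'$ be a finite simple $3$-connected planar graph (more than three vertices, not disconnected by removing at most two vertices), embedded in the sphere, and let $\Gamma$ be the simple planar graph obtained from $\Gamma'$ by adding an edge $e=ab$ joining two distinct non-adjacent vertices $a,b$ of a face of $\Gamma'$ (which is therefore non-triangular). Let $\Gamma$ be embedded in the sphere as well; write $F(\Gamma)$, $F(\Gamma')$ for the sets of faces. A marked polyhedron $(P,\phi)$ has $1$-skeleton $\Gamma$ if $\phi$ is a bijection from the vertices of $\Gamma$ to the vertices of $P$ such that $u,v$ are adjacent if and only if $[\phi(u),\phi(v)]$ is an edge of $P$. It has weak $1$-skeleton $(\Gamma,e)$ if $\phi$ is a bijection onto the vertices of $P$ that sends every edge of $\Gamma$ other than $e$ to an edge of $P$ and sends $e$ into a ($2$-dimensional) face of $P$, and every edge of $P$ comes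 from an edge of $\Gamma$. Let $\mathcal{P}_\Gamma\subseteq\mathcal{H}^{F(\Gamma)}$ (resp. $\mathcal{P}_\Gamma^e\subseteq\mathcal{H}^{F(\Gamma)}$) be the space of such marked polyhedra with $1$-skeleton $\Gamma$ (resp. weak $1$-skeleton $(\Gamma,e)$), where $(P,\phi)$ is recorded by the tuple $(\Pi_f)_{f}$ of half spaces with $P=\mathbb{H}^3\cap\bigcap_f\Pi_f$ and $\phi(v)\in\partial\Pi_f$ for all vertices $v$ of $f$; define $\mathcal{P}_{\Gamma'}\subseteq\mathcal{H}^{F(\Gamma')}$ in the same way. Let $\mathcal{A}_\Gamma,\mathcal{A}_\Gamma^e,\mathcal{A}_{\Gamma'}$ be the quotients of these spaces by the full isometry group $\mathrm{Iso}(\mathbb{H}^3)$, with the quotient topology; a real function on a quotient is called smooth at a class if its pullback is smooth at a representative, as a function on a subset of $\mathcal{H}^{F}$. Then, for some integer $n\ge 0$, with the smooth structures whose smooth functions are the ones just described, $\mathcal{A}_\Gamma$ is a smooth manifold of dimension $n+1$, $\mathcal{A}_{\Gamma'}$ is a smooth manifold of dimension $n$, and $\mathcal{A}_\Gamma^e$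 is a smooth manifold with boundary of dimension $n+1$ (all Hausdorff and second countable). The interior of $\mathcal{A}_\Gamma^e$ is $\mathcal{A}_\Gamma$: the natural map $\mathcal{A}_\Gamma\to\mathcal{A}_\Gamma^e$ is an open embedding and a local diffeomorphism with image the interior. The boundary of $\mathcal{A}_\Gamma^e$ is $\mathcal{A}_{\Gamma'}$: the natural map $\mathcal{A}_{\Gamma'}\to\mathcal{A}_\Gamma^e$, which sends the class of a marked polyhedron to the class of the same marked polyhedron, is a smooth embedding (a topological embedding that is an immersion) with image the boundary. -/

import Mathlib

open Set Topology
open scoped Manifold ContDiff RealInnerProductSpace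

noncomputable section

namespace HypPoly

/-! ### Three-connected graphs and cellular embeddings in the sphere -/

/-- `G` has more than three vertices and cannot be disconnected by removing at most two
vertices. -/
def ThreeConnected {V : Type*} (G : SimpleGraph V) : Prop :=
  3 < Nat.card V ∧
    ∀ S : Finset V, S.card ≤ 2 → (G.induce {v : V | v ∉ S}).Connected

/-- Two darts lie on the same face of the rotation system `rot` when they are in the same orbit of
the permutation "cross the edge, then turn to the next dart at the vertex reached". -/
def faceSetoid {V : Type*} {G : SimpleGraph V} (rot : Equiv.Perm G.Dart) : Setoid G.Dart :=
  Equiv.Perm.SameCycle.setoid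
    ((Function.Involutive.toPerm SimpleGraph.Dart.symm
      SimpleGraph.Dart.symm_involutive).trans rot)

/-- A cellular embedding of a connected graph in the (oriented) sphere, given by its rotation
system: for each vertex a cyclic order on the darts leaving it, such that the oriented closed
surface obtained by gluing a disc along each face has Euler characteristic `2`. -/
structure SphereEmbedding {V : Type*} (G : SimpleGraph V) where
  rot : Equiv.Perm G.Dart
  rot_fst : ∀ d, (rot d).fst = d.fst
  rot_cyclic : ∀ d d' : G.Dart, d.fst = d'.fst → rot.SameCycle d d'
  connected : G.Connected
  euler : Nat.card V + Nat.card (Quotient (faceSetoid rot)) = Nat.card G.edgeSet + 2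

namespace SphereEmbedding

variable {V : Type*} {G : SimpleGraph V}

/-- The faces of the cellularization of the sphere induced by the embedding. -/
def Face (M : SphereEmbedding G) : Type _ := Quotient (faceSetoid M.rot)

/-- The vertex `v` lies on (the boundary of) the face `f`. -/
def OnFace (M : SphereEmbedding G) (v : V) (f : M.Face) : Prop :=
  ∃ d : G.Dart, d.fst = v ∧ (Quotient.mk (faceSetoid M.rot) d : M.Face) = f

instance [Finite V] (M : SphereEmbedding G) : Finite M.Face :=
  haveI : Finite G.Dart :=
    Finite.of_injective SimpleGraph.Dart.toProd SimpleGraph.Dart.toProd_injective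
  Quotient.finite _

instance [Finite V] (M : SphereEmbedding G) : Fintype M.Face := Fintype.ofFinite _

end SphereEmbedding

/-! ### Hyperbolic space (projective model), half spaces, isometries -/

/-- Euclidean three-space. -/
abbrev E3 : Type := EuclideanSpace ℝ (Fin 3)

/-- The underlying set of hyperbolic space in the projective (Klein) model: the open unit ball,
in which geodesic segments are Euclidean segments. -/
def ball : Set E3 := Metric.ball 0 1

/-- The hyperbolic distance in the projective model. -/
def hypDist (x y : ball) : ℝ :=
  Real.arcosh ((1 - ⟪(x : E3), (y : E3)⟫) /
    (Real.sqrt (1 - ‖(x : E3)‖ ^ 2) * Real.sqrt (1 - ‖(y : E3)‖ ^ 2)))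

/-- The full isometry group of hyperbolic three-space. -/
def isoH3 : Subgroup (Equiv.Perm ball) where
  carrier := {g | ∀ x y, hypDist (g x) (g y) = hypDist x y}
  one_mem' := fun _ _ => rfl
  mul_mem' := by
    intro g h hg hh x y
    simp only [Equiv.Perm.coe_mul, Function.comp_apply]
    rw [hg, hh]
  inv_mem' := by
    intro g hg x y
    rw [← hg]
    simp

/-- The linear space `ℝ³ × ℝ` in which the manifold `S² × ℝ` of half spaces of `ℝ³` sits:
`(n, c)` with `‖n‖ = 1` stands for the half space `{x | ⟪n, x⟫ ≤ c}`. -/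
abbrev HalfParam : Type := E3 × ℝ

/-- The half space of `ℝ³` with parameter `h`. -/
def halfSpace (h : HalfParam) : Set E3 := {x | ⟪h.1, x⟫ ≤ h.2}

/-- The boundary plane of the half space with parameter `h`. -/
def wall (h : HalfParam) : Set E3 := {x | ⟪h.1, x⟫ = h.2}

/-- The part of hyperbolic space in the half space with parameter `h`. -/
def hypHalfSpace (h : HalfParam) : Set ball := {x | (x : E3) ∈ halfSpace h}

/-- The intersection in hyperbolic space of a family of half spaces. -/
def body {F : Type*} (p : F → HalfParam) : Set E3 := ball ∩ ⋂ f, halfSpace (p f)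

/-! ### Edges and faces of a polyhedron, (weak) one-skeleta -/

/-- The segment from `x` to `y` is an edge (a one-dimensional face) of `P`. -/
def IsEdge (P : Set E3) (x y : E3) : Prop := x ≠ y ∧ IsExtreme ℝ P (segment ℝ x y)

/-- `T` is a two-dimensional face of `P`. -/
def IsTwoFace (P T : Set E3) : Prop :=
  Convex ℝ T ∧ IsExtreme ℝ P T ∧ Module.finrank ℝ (vectorSpan ℝ T) = 2

variable {V : Type*}

/-- The marking `φ` identifies `G` with the one-skeleton of `P`. -/
def HasSkeleton (G : SimpleGraph V) (P : Set E3) (φ : V → E3) : Prop :=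
  Function.Injective φ ∧ range φ = extremePoints ℝ P ∧
    ∀ u v, G.Adj u v ↔ IsEdge P (φ u) (φ v)

/-- The marking `φ` exhibits `(G, {a, b})` as a weak one-skeleton of `P`: vertices correspond
bijectively, the edges of `G` other than `{a, b}` go to edges of `P`, the edge `{a, b}` goes into a
face of `P`, and `P` has no edges besides those coming from `G`. -/
def HasWeakSkeleton (G : SimpleGraph V) (a b : V) (P : Set E3) (φ : V → E3) : Prop :=
  Function.Injective φ ∧ range φ = extremePoints ℝ P ∧
    (∀ u v, G.Adj u v → s(u, v) ≠ s(a, b) → IsEdge P (φ u) (φ v)) ∧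
    (∃ T, IsTwoFace P T ∧ segment ℝ (φ a) (φ b) ⊆ T) ∧
    ∀ u v, IsEdge P (φ u) (φ v) → G.Adj u v

variable {G : SimpleGraph V}

/-- For every face `f`, the boundary of the half space `p f` contains the vertices of `f`. -/
def Incident (M : SphereEmbedding G) (p : M.Face → HalfParam) (φ : V → E3) : Prop :=
  ∀ f v, M.OnFace v f → φ v ∈ wall (p f)

/-- The space of marked compact hyperbolic polyhedra with one-skeleton `G`, as a subset of the
manifold of tuples of half spaces indexed by the faces of `G`. -/
def polySpace (M : SphereEmbedding G) : Set (M.Face → HalfParam) :=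
  {p | (∀ f, ‖(p f).1‖ = 1) ∧ IsCompact (body p) ∧
    ∃ φ, HasSkeleton G (body p) φ ∧ Incident M p φ}

/-- The space of marked compact hyperbolic polyhedra with weak one-skeleton `(G, {a, b})`. -/
def weakPolySpace (M : SphereEmbedding G) (a b : V) : Set (M.Face → HalfParam) :=
  {p | (∀ f, ‖(p f).1‖ = 1) ∧ IsCompact (body p) ∧
    ∃ φ, HasWeakSkeleton G a b (body p) φ ∧ Incident M p φ}

/-- Tuples of half spaces for two embedded graphs on the same vertex set describe the same
polyhedron with the same marking of its vertices. -/
def SameMarked {G' : SimpleGraph V} (M' : SphereEmbedding G') (p : M'.Face → HalfParam)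
    (M : SphereEmbedding G) (q : M.Face → HalfParam) : Prop :=
  body p = body q ∧ ∃ φ, range φ = extremePoints ℝ (body p) ∧ Incident M' p φ ∧ Incident M q φ

/-! ### Quotients by the isometry group -/

/-- Two tuples of half spaces are in the same orbit of the isometry group. -/
def isoSetoid {F : Type*} (S : Set (F → HalfParam)) : Setoid S where
  r p q := ∃ g ∈ isoH3, ∀ f, g '' hypHalfSpace (p.1 f) = hypHalfSpace (q.1 f)
  iseqv :=
    { refl := fun _ => ⟨1, isoH3.one_mem, fun _ => by simp⟩
      symm := by
        rintro p q ⟨g, hg, h⟩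
        refine ⟨g⁻¹, isoH3.inv_mem hg, fun f => ?_⟩
        rw [← h f, ← image_comp]
        simp
      trans := by
        rintro p q r ⟨g, hg, h⟩ ⟨k, hk, h'⟩
        refine ⟨k * g, isoH3.mul_mem hk hg, fun f => ?_⟩
        rw [← h' f, ← h f, ← image_comp]
        rfl }

/-- The quotient by the isometry group, with the quotient topology. -/
abbrev Moduli {F : Type*} (S : Set (F → HalfParam)) : Type _ := Quotient (isoSetoid S)

/-- The class of a tuple. -/
def cls {F : Type*} {S : Set (F → HalfParam)} (p : S) : Moduli S :=
  Quotient.mk (isoSetoid S) p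

/-- The space of polyhedra with one-skeleton `G`, up to isometry. -/
abbrev ASpace (M : SphereEmbedding G) : Type _ := Moduli (polySpace M)

/-- The space of polyhedra with weak one-skeleton `(G, {a, b})`, up to isometry. -/
abbrev AWeakSpace (M : SphereEmbedding G) (a b : V) : Type _ := Moduli (weakPolySpace M a b)

/-- The given atlas makes the quotient of `S` a smooth manifold (with boundary, if the model has
one), Hausdorff and second countable, carrying the smooth structure induced from the manifold of
tuples of half spaces: a real function on the quotient is smooth at a class if and only if its
pullback to `S` is smooth there as a function on a subset of the ambient space. -/
def IsQuotientManifold {F : Type*} [Fintype F] (S : Set (F → HalfParam)) {n : ℕ} {H : Type*}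
    [TopologicalSpace H] (I : ModelWithCorners ℝ (EuclideanSpace ℝ (Fin n)) H)
    [ChartedSpace H (Moduli S)] : Prop :=
  T2Space (Moduli S) ∧ SecondCountableTopology (Moduli S) ∧ IsManifold I ∞ (Moduli S) ∧
    ∀ (h : Moduli S → ℝ) (p : S),
      ContMDiffAt I 𝓘(ℝ, ℝ) ∞ h (cls p) ↔
        ContDiffWithinAt ℝ ∞
          (Function.extend Subtype.val (fun q : S => h (cls q)) (fun _ => 0)) S p.1

end HypPoly

end

open HypPoly

set_option linter.unusedSectionVars false

namespace HypPoly

/-! ### Exactness by counting -/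

/-! A polyhedron is described by its half spaces together with the positions of its vertices. These
data satisfy one incidence equation per corner (a vertex on a face), one equation making each normal
a unit vector, and six equations fixing the isometry. If `E` is the number of edges, there are `2E +
F + 6` equations in `4F + 3V` unknowns, so by Euler's formula the expected dimension is `E`. The
integer `n` of the theorem is therefore the number of edges of the smaller graph, and adding the
edge gives `n + 1`. The work lies in showing that the equations are independent, that they are
locally the only conditions, and that the quotient by isometries is the set of normalised solutions.

Independence. A linear relation between the differentials reduces to a stress: weights on corners in
equilibrium at every vertex and every face (`linearIndependent_eqn`). The corners are the edges of a
simple bipartite graph on the sphere, with the vertices and faces of the map as its nodes. By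
Euler's formula every nonempty set of corners meets some vertex or some face at most three times
(`SphereEmbedding.exists_low_degree`). At most three wall normals at a vertex are linearly
independent, and at most three vertices of a polyhedron are affinely independent. So a stress
vanishes on some corner of its support, and is zero (`IsStrict.no_stress`).

Combinatorics. Whatever the given embedding in the sphere, its faces are the facets of the
polyhedron. The edge cycle of a facet bounds a set of faces mod 2, and the vertices off the facet
are connected, so this set can be chosen to touch only the facet; comparing facets gives a bijection
(`facet_bijection`). With one extra edge in the graph, exactly two faces merge into one facet
(`facet_merge`). Hence a polyhedron with one-skeleton `G` is a strict realisation: vertices lie on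
the walls of their faces and strictly inside all others. Conversely a strict realisation has the
right one-skeleton by a local-to-global convexity argument (`IsStrict.local_cone`). Strictness is
open, so near a strict realisation only the equations matter.

Quotient. Isometries are Lorentz transformations (`exists_lorentz`). Lorentz Gram-Schmidt on four
chosen vertices in general position picks one representative of every orbit, smoothly in the half
spaces; this is `IsSlice`. The quotient is homeomorphic to the slice, and charts of the slice give
it a manifold structure with the required smooth functions (`isAtlas_chartedSpace`).

Boundary. A weak polyhedron that is not strict is flat: the half spaces of the two faces along the
new edge coincide, and it is a polyhedron for the smaller graph (`weak_cases`). Near it, take one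
more vertex `w` of one of the two faces and let `β` be its signed depth below the wall of the other.
The sign of `β` decides on which side the pair of faces folds: positive means convex and strict,
zero means flat, negative is not allowed (`strict_or_flat`). The equations stay independent when the
differential of `β` is added (`IsFlat.no_stress`), so `β` is the first coordinate of a boundary
chart. Interior and boundary are then the loci where the two half spaces differ or agree, and the
two natural maps are read off in the slices. -/

theorem finrank_le_one_of_const {k α : Type*} [Field k] [Fintype α] (S : Submodule k (α → k))
    (hS : ∀ x ∈ S, ∃ c, ∀ i, x i = c) : Module.finrank k S ≤ 1 := by
  have hle : S ≤ Submodule.span k {fun _ => 1} := by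
    intro x hx
    obtain ⟨c, hc⟩ := hS x hx
    exact Submodule.mem_span_singleton.2 ⟨c, by ext i; simp [hc i]⟩
  calc Module.finrank k S ≤ Module.finrank k (Submodule.span k {fun _ : α => (1 : k)}) :=
        Submodule.finrank_mono hle
    _ ≤ 1 := by
        simpa using finrank_span_le_card (R := k) ({fun _ : α => (1 : k)} : Set (α → k))

/-- A rank count: `f` has rank at least `|ι| - 1`, and `g`, having the rank of its transpose, at
least `|μ| - 1`. So the kernel of `g` has dimension at most `|κ| - |μ| + 1 = |ι| - 1`, and is filled
by the range of `f`. With Euler's formula as `hcard`, this is the vanishing of the first homology of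
the sphere. -/
theorem exact_of_card {k ι κ μ : Type*} [Field k] [Fintype ι] [Fintype κ] [Fintype μ]
    [DecidableEq κ] (f : (ι → k) →ₗ[k] (κ → k)) (g : (κ → k) →ₗ[k] (μ → k))
    (hgf : ∀ x, g (f x) = 0) (hf : ∀ x, f x = 0 → ∃ c, ∀ i, x i = c)
    (hg : ∀ z : μ → k, (∀ j, ∑ m, g (Pi.single j 1) m * z m = 0) → ∃ c, ∀ m, z m = c)
    (hcard : Fintype.card ι + Fintype.card μ = Fintype.card κ + 2) (y : κ → k) (hy : g y = 0) :
    ∃ x, f x = y := by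
  classical
  have h1 : Module.finrank k (LinearMap.ker f) ≤ 1 :=
    finrank_le_one_of_const _ fun x hx => hf x hx
  have h2 := f.finrank_range_add_finrank_ker
  set Q := LinearMap.toMatrix' g with hQ
  have h3 : Module.finrank k (LinearMap.ker Q.transpose.mulVecLin) ≤ 1 := by
    refine finrank_le_one_of_const _ fun z hz => hg z fun j => ?_
    have := congrFun (LinearMap.mem_ker.1 hz) j
    simpa only [Matrix.mulVecLin_apply, Matrix.mulVec, dotProduct, Matrix.transpose_apply, hQ,
      LinearMap.toMatrix'_apply, Pi.zero_apply] using this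
  have h4 := Q.transpose.mulVecLin.finrank_range_add_finrank_ker
  have h5 : Module.finrank k (LinearMap.range Q.transpose.mulVecLin) =
      Module.finrank k (LinearMap.range g) := by
    have := Q.rank_transpose
    rw [Matrix.rank, Matrix.rank] at this
    have hQg : Q.mulVecLin = g := by rw [← Matrix.toLin'_apply', hQ, Matrix.toLin'_toMatrix']
    rw [this, hQg]
  have h6 := g.finrank_range_add_finrank_ker
  simp only [Module.finrank_fintype_fun_eq_card] at h2 h4 h6
  have hle : LinearMap.range f ≤ LinearMap.ker g := by
    rintro _ ⟨x, rfl⟩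
    exact hgf x
  have heq : LinearMap.range f = LinearMap.ker g :=
    Submodule.eq_of_le_of_finrank_le hle (by omega)
  have : y ∈ LinearMap.range f := heq ▸ (LinearMap.mem_ker.2 hy)
  exact this

theorem zmod_two_add_self (x : ZMod 2) : x + x = 0 := CharTwo.add_self_eq_zero x

theorem zmod_two_eq_of_add {x y : ZMod 2} (h : x + y = 0) : x = y := by
  rw [eq_neg_of_add_eq_zero_left h, CharTwo.neg_eq]

theorem zmod_two_cases (x : ZMod 2) : x = 0 ∨ x = 1 := by
  revert x; decide

/-! ### Darts, vertices and faces of a planar map -/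

namespace SphereEmbedding

variable {V : Type*} {G : SimpleGraph V} (M : SphereEmbedding G)

/-- The face of a dart. -/
def face (d : G.Dart) : M.Face := Quotient.mk (faceSetoid M.rot) d

/-- Cross the edge, then turn to the next dart. -/
def step : Equiv.Perm G.Dart :=
  (Function.Involutive.toPerm SimpleGraph.Dart.symm SimpleGraph.Dart.symm_involutive).trans M.rot

theorem step_apply (d : G.Dart) : M.step d = M.rot d.symm := rfl

theorem step_fst (d : G.Dart) : (M.step d).fst = d.snd := by
  rw [step_apply, M.rot_fst]; rfl

theorem face_eq_iff {d d' : G.Dart} : M.face d = M.face d' ↔ M.step.SameCycle d d' :=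
  Quotient.eq (r := faceSetoid M.rot)

theorem face_step (d : G.Dart) : M.face (M.step d) = M.face d :=
  M.face_eq_iff.2 ((Equiv.Perm.sameCycle_apply_left).2 (Equiv.Perm.SameCycle.refl _ _))

/-- Going around a vertex, the face across an edge is the face of the next dart. Thus a dart `d`
also stands for a corner: the one at `d.fst` in the face of `d`, between the edges of `rot.symm d`
and `d`. -/
theorem face_symm (d : G.Dart) : M.face d.symm = M.face (M.rot d) := by
  rw [← M.face_step d.symm, step_apply, SimpleGraph.Dart.symm_symm]

theorem face_surjective : Function.Surjective M.face := Quotient.mk_surjective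

theorem onFace_iff {v : V} {f : M.Face} : M.OnFace v f ↔ ∃ d : G.Dart, d.fst = v ∧ M.face d = f :=
  Iff.rfl

theorem onFace_fst (d : G.Dart) : M.OnFace d.fst (M.face d) := ⟨d, rfl, rfl⟩

theorem onFace_snd (d : G.Dart) : M.OnFace d.snd (M.face d) :=
  ⟨M.step d, M.step_fst d, M.face_step d⟩

theorem onFace_fst_rot (d : G.Dart) : M.OnFace d.fst (M.face (M.rot d)) :=
  ⟨M.rot d, M.rot_fst d, rfl⟩

theorem onFace_snd_rot (d : G.Dart) : M.OnFace d.snd (M.face (M.rot d)) :=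
  ⟨d.symm, rfl, M.face_symm d⟩

/-- A function on darts that is invariant under turning and under reversal is constant. -/
theorem dart_const {X : Type*} (h : G.Dart → X) (h1 : ∀ d, h (M.rot d) = h d)
    (h2 : ∀ d, h d.symm = h d) (d d' : G.Dart) : h d = h d' := by
  have hv : ∀ d d' : G.Dart, d.fst = d'.fst → h d = h d' := by
    intro d d' hdd
    obtain ⟨i, hi⟩ := M.rot_cyclic d d' hdd
    have hinv : ∀ (j : ℤ) d, h ((M.rot ^ j) d) = h d := by
      intro j
      induction j using Int.induction_on with
      | zero => simp
      | succ n ih => intro d; rw [zpow_add_one, Equiv.Perm.mul_apply, ih, h1]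
      | pred n ih =>
        intro d
        rw [zpow_sub_one, Equiv.Perm.mul_apply, ih]
        have := h1 (M.rot⁻¹ d)
        rw [← Equiv.Perm.mul_apply, mul_inv_cancel, Equiv.Perm.one_apply] at this
        exact this.symm
    rw [← hi, hinv]
  have hw : ∀ (u v : V) (_ : G.Walk u v) (d d' : G.Dart), d.fst = u → d'.fst = v →
      h d = h d' := by
    intro u v p
    induction p with
    | nil => intro d d' hd hd'; exact hv d d' (hd.trans hd'.symm)
    | cons hadj p ih =>
      intro d d' hd hd'
      let e : G.Dart := ⟨(_, _), hadj⟩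
      rw [hv d e hd, ← h2 e]
      exact ih e.symm d' rfl hd'
  obtain ⟨p⟩ := M.connected.preconnected d.fst d'.fst
  exact hw _ _ p d d' rfl rfl

/-- A property of the darts of one face that is inherited by the next dart holds on all of it. -/
theorem face_induction [Finite V] {P : G.Dart → Prop} (d : G.Dart) (h0 : P d)
    (hs : ∀ e, M.face e = M.face d → P e → P (M.step e)) (e : G.Dart) (he : M.face e = M.face d) :
    P e := by
  have : Finite G.Dart :=
    Finite.of_injective SimpleGraph.Dart.toProd SimpleGraph.Dart.toProd_injective
  obtain ⟨n, -, hn⟩ := (M.face_eq_iff.1 he.symm).exists_pow_eq'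
  have : ∀ k : ℕ, M.face ((M.step ^ k) d) = M.face d ∧ P ((M.step ^ k) d) := by
    intro k
    induction k with
    | zero => exact ⟨rfl, h0⟩
    | succ k ih =>
      rw [pow_succ', Equiv.Perm.mul_apply]
      exact ⟨(M.face_step _).trans ih.1, hs _ ih.1 ih.2⟩
  exact hn ▸ (this n).2

end SphereEmbedding

/-! ### Homology of the sphere mod 2 -/

section Homology

open Classical in
/-- Finite graphs have finitely many darts. -/
noncomputable instance dartFintype {V : Type*} [Finite V] (G : SimpleGraph V) : Fintype G.Dart :=
  have : Finite G.Dart :=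
    Finite.of_injective SimpleGraph.Dart.toProd SimpleGraph.Dart.toProd_injective
  Fintype.ofFinite _

namespace SphereEmbedding

variable {V : Type*} {G : SimpleGraph V} [Finite V] (M : SphereEmbedding G)

open Classical in
theorem sum_rot (h : G.Dart → ZMod 2) (v : V) :
    ∑ d : G.Dart with d.fst = v, h (M.rot d) = ∑ d : G.Dart with d.fst = v, h d := by
  refine Finset.sum_equiv M.rot (fun d => ?_) (fun d _ => rfl)
  simp [M.rot_fst]

open Classical in
theorem sum_step (h : G.Dart → ZMod 2) (f : M.Face) :
    ∑ d : G.Dart with M.face d = f, h (M.step d) = ∑ d : G.Dart with M.face d = f, h d := by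
  refine Finset.sum_equiv M.step (fun d => ?_) (fun d _ => rfl)
  simp [M.face_step]

open Classical in
-- Around a vertex every dart bounds two corners, so its value is counted twice.
theorem vertex_coboundary_sum (h : G.Dart → ZMod 2) (v : V) :
    ∑ d : G.Dart with d.fst = v, (h d + h (M.rot.symm d)) = 0 := by
  rw [Finset.sum_add_distrib, ← M.sum_rot (fun d => h (M.rot.symm d))]
  simp [zmod_two_add_self]

open Classical in
-- Each side of a face bounds two of its corners: `rot.symm (step d)` is the reverse of `d`, and `h`
-- does not see the reversal.
theorem face_coboundary_sum (h : G.Dart → ZMod 2) (hs : ∀ d, h d.symm = h d) (f : M.Face) :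
    ∑ d : G.Dart with M.face d = f, (h d + h (M.rot.symm d)) = 0 := by
  rw [Finset.sum_add_distrib, ← M.sum_step (fun d => h (M.rot.symm d))]
  simp [step_apply, hs, zmod_two_add_self]

open Classical in
theorem sum_edge (F : G.Dart → ZMod 2) (d : G.Dart) :
    ∑ e : G.Dart with e.edge = d.edge, F e = F d + F d.symm := by
  have : (Finset.univ.filter fun e : G.Dart => e.edge = d.edge) = {d, d.symm} := by
    ext e; simp [SimpleGraph.dart_edge_eq_iff]
  rw [this, Finset.sum_pair (SimpleGraph.Dart.symm_ne d).symm]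

theorem euler_card [Fintype V] [Fintype G.edgeSet] :
    Fintype.card M.Face + Fintype.card V = Fintype.card G.edgeSet + 2 := by
  have h : Nat.card V + Nat.card M.Face = Nat.card G.edgeSet + 2 := M.euler
  simp only [Nat.card_eq_fintype_card] at h
  omega

theorem exists_edge_dart {V : Type*} {G : SimpleGraph V} (e : G.edgeSet) : ∃ d : G.Dart, (⟨d.edge, d.edge_mem⟩ : G.edgeSet) = e := by
  obtain ⟨e, he⟩ := e
  induction e using Sym2.ind with
  | _ x y => exact ⟨⟨(x, y), he⟩, rfl⟩

open Classical in
/-- Every even set of edges of a planar map bounds a set of faces. -/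
theorem exists_face_potential (c : Sym2 V → ZMod 2)
    (hc : ∀ v, ∑ d : G.Dart with d.fst = v, c d.edge = 0) :
    ∃ A : M.Face → ZMod 2, ∀ d : G.Dart, c d.edge = A (M.face d) + A (M.face d.symm) := by
  have : Fintype V := Fintype.ofFinite V
  let f : (M.Face → ZMod 2) →ₗ[ZMod 2] (G.edgeSet → ZMod 2) :=
    { toFun := fun A e => ∑ d : G.Dart with d.edge = (e : Sym2 V), A (M.face d)
      map_add' := fun A B => by ext e; simp [Finset.sum_add_distrib]
      map_smul' := fun r A => by ext e; simp [Finset.mul_sum] }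
  let g : (G.edgeSet → ZMod 2) →ₗ[ZMod 2] (V → ZMod 2) :=
    { toFun := fun c v => ∑ d : G.Dart with d.fst = v, c ⟨d.edge, d.edge_mem⟩
      map_add' := fun A B => by ext e; simp [Finset.sum_add_distrib]
      map_smul' := fun r A => by ext e; simp [Finset.mul_sum] }
  have hfd : ∀ A (d : G.Dart), f A ⟨d.edge, d.edge_mem⟩ = A (M.face d) + A (M.face d.symm) :=
    fun A d => sum_edge (fun d => A (M.face d)) d
  suffices hex : ∃ A, f A = fun e : G.edgeSet => c (e : Sym2 V) by
    obtain ⟨A, hA⟩ := hex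
    refine ⟨A, fun d => ?_⟩
    rw [← hfd, hA]
  -- Cellular chains: `f` is the boundary from faces to edges and `g` from edges to vertices. Both
  -- kernel conditions come from connectedness of the graph.
  refine exact_of_card f g ?_ ?_ ?_ ?_ _ (by ext v; exact hc v)
  · intro A
    ext v
    change ∑ d : G.Dart with d.fst = v, f A ⟨d.edge, d.edge_mem⟩ = 0
    simp_rw [hfd, M.face_symm]
    rw [Finset.sum_add_distrib, M.sum_rot (fun d => A (M.face d))]
    exact zmod_two_add_self _
  · intro A hA
    have h1 : ∀ d : G.Dart, A (M.face d.symm) = A (M.face d) := fun d =>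
      (zmod_two_eq_of_add ((hfd A d).symm.trans (by rw [hA]; rfl))).symm
    rcases isEmpty_or_nonempty G.Dart with hE | ⟨⟨d0⟩⟩
    · exact ⟨0, fun i => (hE.false (M.face_surjective i).choose).elim⟩
    · refine ⟨A (M.face d0), fun i => ?_⟩
      obtain ⟨d, rfl⟩ := M.face_surjective i
      exact M.dart_const (fun d => A (M.face d)) (fun d => by rw [← M.face_symm, h1]) h1 d d0
  · intro z hz
    have h1 : ∀ d : G.Dart, z d.fst = z d.snd := by
      intro d
      have h := hz ⟨d.edge, d.edge_mem⟩
      change ∑ v, (∑ e : G.Dart with e.fst = v,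
        (Pi.single (⟨d.edge, d.edge_mem⟩ : G.edgeSet) (1 : ZMod 2) : G.edgeSet → ZMod 2)
          ⟨e.edge, e.edge_mem⟩) * z v = 0 at h
      have h' : ∑ e : G.Dart with e.edge = d.edge, z e.fst = 0 := by
        rw [← h, Finset.sum_filter]
        simp_rw [Finset.sum_filter, Finset.sum_mul]
        rw [Finset.sum_comm]
        refine Finset.sum_congr rfl fun e _ => ?_
        simp [Pi.single_apply, Subtype.ext_iff]
      rw [sum_edge (fun e => z e.fst)] at h'
      exact zmod_two_eq_of_add h'
    obtain ⟨v0⟩ := M.connected.nonempty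
    refine ⟨z v0, fun m => ?_⟩
    obtain ⟨p⟩ := M.connected.preconnected m v0
    induction p with
    | nil => rfl
    | cons hadj p ih => exact (h1 ⟨(_, _), hadj⟩).trans ih
  · exact M.euler_card

open Classical in
/-- Every set of corners of a planar map that is even at all vertices and faces bounds a set of
edges. -/
theorem exists_edge_potential (hdart : ∀ v : V, ∃ d : G.Dart, d.fst = v) (c : G.Dart → ZMod 2)
    (hv : ∀ v, ∑ d : G.Dart with d.fst = v, c d = 0)
    (hf : ∀ f, ∑ d : G.Dart with M.face d = f, c d = 0) :
    ∃ h : G.Dart → ZMod 2, (∀ d, h d.symm = h d) ∧ ∀ d, c d = h d + h (M.rot.symm d) := by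
  have : Fintype V := Fintype.ofFinite V
  -- This is the chain complex of the radial map: its nodes are the vertices and faces of `M`, its
  -- edges are the corners (darts), and its faces are quadrilaterals, one around each edge of `M`.
  let f : (G.edgeSet → ZMod 2) →ₗ[ZMod 2] (G.Dart → ZMod 2) :=
    { toFun := fun h d => h ⟨d.edge, d.edge_mem⟩ +
        h ⟨(M.rot.symm d).edge, (M.rot.symm d).edge_mem⟩
      map_add' := fun A B => by ext e; simp; ring
      map_smul' := fun r A => by ext e; simp; ring }
  let g : (G.Dart → ZMod 2) →ₗ[ZMod 2] (V ⊕ M.Face → ZMod 2) :=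
    { toFun := fun c => Sum.elim (fun v => ∑ d : G.Dart with d.fst = v, c d)
        (fun f => ∑ d : G.Dart with M.face d = f, c d)
      map_add' := fun A B => by ext (e | e) <;> simp [Finset.sum_add_distrib]
      map_smul' := fun r A => by ext (e | e) <;> simp [Finset.mul_sum] }
  have hsymm : ∀ (h : G.edgeSet → ZMod 2) (d : G.Dart),
      h ⟨d.symm.edge, d.symm.edge_mem⟩ = h ⟨d.edge, d.edge_mem⟩ := fun h d => by
    congr 2; exact d.edge_symm
  suffices hex : ∃ h, f h = c by
    obtain ⟨h, hh⟩ := hex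
    exact ⟨fun d => h ⟨d.edge, d.edge_mem⟩, hsymm h, fun d => by rw [← hh]; rfl⟩
  refine exact_of_card f g ?_ ?_ ?_ ?_ c (by ext (v | v); exacts [hv v, hf v])
  · intro h
    ext (v | v)
    · exact M.vertex_coboundary_sum (fun d => h ⟨d.edge, d.edge_mem⟩) v
    · exact M.face_coboundary_sum (fun d => h ⟨d.edge, d.edge_mem⟩) (hsymm h) v
  · intro h hh
    have h1 : ∀ d : G.Dart, h ⟨(M.rot d).edge, (M.rot d).edge_mem⟩ = h ⟨d.edge, d.edge_mem⟩ := by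
      intro d
      have := zmod_two_eq_of_add (congrFun hh (M.rot d))
      simpa using this
    obtain ⟨d0, -⟩ := hdart M.connected.nonempty.some
    refine ⟨h ⟨d0.edge, d0.edge_mem⟩, fun i => ?_⟩
    obtain ⟨d, rfl⟩ := exists_edge_dart i
    exact M.dart_const (fun d => h ⟨d.edge, d.edge_mem⟩) h1 (hsymm h) d d0
  · intro z hz
    have h1 : ∀ d : G.Dart, z (Sum.inl d.fst) = z (Sum.inr (M.face d)) := by
      intro d
      have h := hz d
      refine zmod_two_eq_of_add ?_
      rw [← h, Fintype.sum_sum_type]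
      change _ = ∑ v, (∑ e : G.Dart with e.fst = v, (Pi.single d (1 : ZMod 2) : G.Dart → ZMod 2) e)
        * z (Sum.inl v) +
        ∑ v, (∑ e : G.Dart with M.face e = v, (Pi.single d (1 : ZMod 2) : G.Dart → ZMod 2) e)
        * z (Sum.inr v)
      congr 1
      · simp [Finset.sum_pi_single']
      · simp [Finset.sum_pi_single']
    have h2 : ∀ d, z (Sum.inr (M.face (M.rot d))) = z (Sum.inr (M.face d)) := fun d => by
      rw [← h1, ← h1, M.rot_fst]
    obtain ⟨d0, -⟩ := hdart M.connected.nonempty.some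
    have h3 : ∀ d, z (Sum.inr (M.face d)) = z (Sum.inr (M.face d0)) := fun d =>
      M.dart_const (fun d => z (Sum.inr (M.face d))) h2 (fun d => by rw [M.face_symm, h2]) d d0
    refine ⟨z (Sum.inr (M.face d0)), ?_⟩
    rintro (v | i)
    · obtain ⟨d, rfl⟩ := hdart v
      rw [h1, h3]
    · obtain ⟨d, rfl⟩ := M.face_surjective i
      exact h3 d
  -- The Euler formula of the radial map: `E + (V + F) = 2E + 2`.
  · have h1 := M.euler_card
    have h2 := G.dart_card_eq_twice_card_edges
    rw [← SimpleGraph.edgeFinset_card] at h1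
    have h3 : Fintype.card G.Dart = 2 * G.edgeFinset.card := by
      rw [← h2]; convert rfl
    rw [Fintype.card_sum, h3, ← SimpleGraph.edgeFinset_card]
    omega

end SphereEmbedding

end Homology

end HypPoly

/-! ### Sparsity of the vertex-face incidences of a planar map -/

namespace HypPoly

namespace SphereEmbedding

variable {V : Type*} {G : SimpleGraph V} [Finite V] (M : SphereEmbedding G)

open Classical in
theorem exists_other_of_sum_eq_zero {α : Type*} (s : Finset α) (b : α → ZMod 2)
    (hs : ∑ i ∈ s, b i = 0) {i : α} (hi : i ∈ s) (hb : b i ≠ 0) : ∃ j ∈ s, j ≠ i ∧ b j ≠ 0 := by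
  by_contra! h
  rw [Finset.sum_eq_single_of_mem i hi h] at hs
  exact hb hs

/-- The equivalence of darts used to count the regions cut out by a set `K` of corners. -/
def regionRel (K : Finset G.Dart) (d e : G.Dart) : Prop :=
  e = d.symm ∨ (d ∉ K ∧ e = M.rot.symm d)

open Classical in
/-- The corner set of a planar map is `3`-degenerate: every nonempty set of corners meets some
vertex or some face in at most three corners. -/
theorem exists_low_degree (hinj : ∀ d d' : G.Dart, d.fst = d'.fst → M.face d = M.face d' → d = d')
    (hdart : ∀ v : V, ∃ d : G.Dart, d.fst = v) (K : Finset G.Dart) (hK : K.Nonempty) :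
    (∃ d ∈ K, (K.filter fun e => e.fst = d.fst).card ≤ 3) ∨
      ∃ d ∈ K, (K.filter fun e => M.face e = M.face d).card ≤ 3 := by
  by_contra! hcon
  obtain ⟨hV, hF⟩ := hcon
  -- If all degrees were at least four, `K` would meet at most `|K|/4` vertices and at most `|K|/4`
  -- faces. The proof counts the regions that `K` cuts out of the sphere, from below by homology and
  -- from above by their boundaries.
  have hXV : 4 * (K.image fun d => d.fst).card ≤ K.card := by
    refine Finset.mul_card_image_le_card _ _ fun v hv => ?_
    obtain ⟨d, hd, rfl⟩ := Finset.mem_image.1 hv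
    exact hV d hd
  have hXF : 4 * (K.image fun d => M.face d).card ≤ K.card := by
    refine Finset.mul_card_image_le_card _ _ fun v hv => ?_
    obtain ⟨d, hd, rfl⟩ := Finset.mem_image.1 hv
    exact hF d hd
  let Cl := Quot (M.regionRel K)
  let q : G.Dart → Cl := Quot.mk _
  have hq1 : ∀ d : G.Dart, q d.symm = q d := fun d => (Quot.sound (r := M.regionRel K) (Or.inl rfl)).symm
  have hq2 : ∀ d ∉ K, q (M.rot.symm d) = q d := fun d hd => (Quot.sound (r := M.regionRel K) (Or.inr ⟨hd, rfl⟩)).symm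
  have hfin : Finite Cl := Quot.finite _
  have hft : Fintype Cl := Fintype.ofFinite _
  let D : (Cl → ZMod 2) →ₗ[ZMod 2] (K → ZMod 2) :=
    { toFun := fun u d => u (q d) + u (q (M.rot.symm d))
      map_add' := fun A B => by ext e; simp; ring
      map_smul' := fun r A => by ext e; simp; ring }
  let g : (K → ZMod 2) →ₗ[ZMod 2]
      ((K.image fun d => d.fst) ⊕ (K.image fun d => M.face d) → ZMod 2) :=
    { toFun := fun c => Sum.elim (fun v => ∑ d : K with d.1.fst = (v : V), c d)
        (fun f => ∑ d : K with M.face d.1 = (f : M.Face), c d)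
      map_add' := fun A B => by ext (e | e) <;> simp [Finset.sum_add_distrib]
      map_smul' := fun r A => by ext (e | e) <;> simp [Finset.mul_sum] }
  -- A set of corners in `K` that is even at every vertex and face is a coboundary of edges. That
  -- potential does not jump across corners outside `K`, so it descends to the regions.
  have hrange : LinearMap.ker g ≤ LinearMap.range D := by
    intro c hc
    have hc' := LinearMap.mem_ker.1 hc
    let c' : G.Dart → ZMod 2 := fun d => if h : d ∈ K then c ⟨d, h⟩ else 0
    have hsum : ∀ p : G.Dart → Prop, ∑ d : G.Dart with p d, c' d = ∑ d : K with p d.1, c d := by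
      intro p
      rw [Finset.sum_filter, Finset.sum_filter,
        ← Finset.sum_subset (Finset.subset_univ K) (by intro d _ hd; simp [c', hd]),
        ← Finset.sum_coe_sort K]
      refine Finset.sum_congr rfl fun d _ => ?_
      simp [c']
    obtain ⟨h, hh1, hh2⟩ := M.exists_edge_potential hdart c'
      (fun v => by
        rw [hsum]
        by_cases hv : v ∈ K.image fun d => d.fst
        · exact congrFun hc' (Sum.inl ⟨v, hv⟩)
        · refine Finset.sum_eq_zero fun d hd => (hv ?_).elim
          exact Finset.mem_image.2 ⟨d, d.2, (Finset.mem_filter.1 hd).2⟩)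
      (fun v => by
        rw [hsum]
        by_cases hv : v ∈ K.image fun d => M.face d
        · exact congrFun hc' (Sum.inr ⟨v, hv⟩)
        · refine Finset.sum_eq_zero fun d hd => (hv ?_).elim
          exact Finset.mem_image.2 ⟨d, d.2, (Finset.mem_filter.1 hd).2⟩)
    refine ⟨Quot.lift h ?_, ?_⟩
    · rintro d e (rfl | ⟨hd, rfl⟩)
      · exact (hh1 d).symm
      · have := hh2 d
        simp only [c', hd, dite_false] at this
        exact zmod_two_eq_of_add this.symm
    · ext d
      have := hh2 d.1
      simp only [c', d.2, dite_true] at this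
      exact this.symm
  have hg := g.finrank_range_add_finrank_ker
  have hg' : Module.finrank (ZMod 2) (LinearMap.range g) ≤ _ := Submodule.finrank_le _
  have hD := D.finrank_range_add_finrank_ker
  have hker : 0 < Module.finrank (ZMod 2) (LinearMap.ker D) := by
    have hne : LinearMap.ker D ≠ ⊥ := by
      refine (Submodule.ne_bot_iff _).2 ⟨fun _ => 1, ?_, ?_⟩
      · ext d; exact zmod_two_add_self _
      · intro h
        have := congrFun h (q hK.choose)
        simp at this
    have : Nontrivial (LinearMap.ker D) := Submodule.nontrivial_iff_ne_bot.2 hne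
    exact Module.finrank_pos
  have hle := Submodule.finrank_mono hrange
  simp only [Module.finrank_fintype_fun_eq_card, Fintype.card_sum, Fintype.card_coe] at hg hg' hD
  -- The kernel of `g` has dimension at least `|K|/2`, and constants lie in the kernel of `D`, so
  -- there are at least `|K|/2 + 1` regions.
  have hCl : K.card + 2 ≤ 2 * Fintype.card Cl := by omega
  -- every region has at least four boundary corners
  let b : Cl → G.Dart → ZMod 2 := fun r d =>
    (if q d = r then 1 else 0) + (if q (M.rot.symm d) = r then 1 else 0)
  have hbK : ∀ r d, b r d ≠ 0 → d ∈ K := by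
    intro r d h
    by_contra hd
    apply h
    simp only [b, hq2 d hd]
    exact zmod_two_add_self _
  have hb4 : ∀ r, 4 ≤ (K.filter fun d => b r d ≠ 0).card := by
    intro r
    -- A region without boundary would contain every dart, but there are at least two regions.
    obtain ⟨d, hd⟩ : ∃ d, b r d ≠ 0 := by
      by_contra! h
      have h1 : ∀ d, (if q (M.rot.symm d) = r then (1 : ZMod 2) else 0) =
        (if q d = r then 1 else 0) := fun d => (zmod_two_eq_of_add (h d)).symm
      obtain ⟨d0, rfl⟩ := Quot.exists_rep r
      have h2 : ∀ d, q d = q d0 := by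
        intro d
        have := M.dart_const (fun d => (if q d = q d0 then (1 : ZMod 2) else 0))
          (fun d => by have := h1 (M.rot d); rw [Equiv.symm_apply_apply] at this; exact this.symm)
          (fun d => by simp only [hq1]) d d0
        simpa using this
      have : Fintype.card Cl ≤ 1 := by
        rw [Fintype.card_le_one_iff]
        intro x y
        obtain ⟨x, rfl⟩ := Quot.exists_rep x
        obtain ⟨y, rfl⟩ := Quot.exists_rep y
        exact (h2 x).trans (h2 y).symm
      have := hK.card_pos
      omega
    have hv : ∀ d, b r d ≠ 0 → ∃ e, e.fst = d.fst ∧ e ≠ d ∧ b r e ≠ 0 := by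
      intro d hd
      obtain ⟨e, he, h⟩ := exists_other_of_sum_eq_zero _ _
        (M.vertex_coboundary_sum (fun d => (if q d = r then (1 : ZMod 2) else 0)) d.fst)
        (i := d) (by simp) hd
      exact ⟨e, (Finset.mem_filter.1 he).2, h⟩
    have hf : ∀ d, b r d ≠ 0 → ∃ e, M.face e = M.face d ∧ e ≠ d ∧ b r e ≠ 0 := by
      intro d hd
      obtain ⟨e, he, h⟩ := exists_other_of_sum_eq_zero _ _
        (M.face_coboundary_sum (fun d => (if q d = r then (1 : ZMod 2) else 0))
          (fun d => by simp only [hq1]) (M.face d))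
        (i := d) (by simp) hd
      exact ⟨e, (Finset.mem_filter.1 he).2, h⟩
    -- The boundary of a region is even at each vertex and face. Starting from one corner this gives
    -- a second at its vertex, a third in its face and a fourth in the face of the second; `hinj`
    -- keeps them distinct, since no cycle of the incidence graph has length two.
    obtain ⟨d2, h2, h2', h2b⟩ := hv d hd
    obtain ⟨d3, h3, h3', h3b⟩ := hf d hd
    obtain ⟨d4, h4, h4', h4b⟩ := hf d2 h2b
    have hne : M.face d ≠ M.face d2 := fun h => h2' (hinj d2 d h2 h.symm)
    have h32 : d3 ≠ d2 := fun h => hne (by rw [← h3, h])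
    have h41 : d4 ≠ d := fun h => hne (by rw [← h4, h])
    have h43 : d4 ≠ d3 := fun h => hne (by rw [← h3, ← h4, h])
    have hsub : ({d, d2, d3, d4} : Finset G.Dart) ⊆ K.filter fun d => b r d ≠ 0 := by
      intro x hx
      simp only [Finset.mem_insert, Finset.mem_singleton] at hx
      rw [Finset.mem_filter]
      rcases hx with rfl | rfl | rfl | rfl
      exacts [⟨hbK _ _ hd, hd⟩, ⟨hbK _ _ h2b, h2b⟩, ⟨hbK _ _ h3b, h3b⟩, ⟨hbK _ _ h4b, h4b⟩]
    refine le_trans ?_ (Finset.card_le_card hsub)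
    rw [Finset.card_insert_of_notMem, Finset.card_insert_of_notMem, Finset.card_insert_of_notMem,
      Finset.card_singleton] <;> simp [h2'.symm, h3'.symm, h41.symm, h32.symm, h4'.symm, h43.symm]
  -- A corner borders at most two regions. With four corners for each region, there are at most
  -- `|K|/2` regions, against the lower bound.
  have hcount : ∑ r : Cl, (K.filter fun d => b r d ≠ 0).card ≤ 2 * K.card := by
    simp_rw [Finset.card_filter]
    rw [Finset.sum_comm, mul_comm, ← smul_eq_mul]
    refine Finset.sum_le_card_nsmul _ _ _ fun d _ => ?_
    rw [← Finset.card_filter]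
    calc _ ≤ ({q d, q (M.rot.symm d)} : Finset Cl).card := by
          refine Finset.card_le_card fun r hr => ?_
          simp only [Finset.mem_filter, b] at hr
          simp only [Finset.mem_insert, Finset.mem_singleton]
          by_contra! hne
          exact hr.2 (by simp [hne.1.symm, hne.2.symm])
      _ ≤ 2 := Finset.card_le_two
  have h4 : 4 * Fintype.card Cl ≤ ∑ r : Cl, (K.filter fun d => b r d ≠ 0).card := by
    rw [mul_comm, ← smul_eq_mul, ← Finset.card_univ]
    exact Finset.card_nsmul_le_sum _ _ _ fun r _ => hb4 r
  omega

end SphereEmbedding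

end HypPoly

/-! ### Facets of a polytope and faces of a planar map -/

namespace HypPoly

/-- Every vertex has a neighbour besides any two given vertices. -/
def MinDegThree {V : Type*} (G : SimpleGraph V) : Prop :=
  ∀ v x y, ∃ u, G.Adj v u ∧ u ≠ x ∧ u ≠ y

/-- The incidence properties of the vertex sets of the facets of a polytope with graph `G`. -/
structure FacetSystem {V ι : Type*} (G : SimpleGraph V) (T : ι → Set V) : Prop where
  two_nbrs : ∀ t, ∀ v ∈ T t, ∃ u₁ u₂, u₁ ≠ u₂ ∧ ∀ u, (G.Adj v u ∧ u ∈ T t) ↔ u = u₁ ∨ u = u₂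
  compl_nonempty : ∀ t, ∃ v, v ∉ T t
  compl_conn : ∀ t, ∀ u ∉ T t, ∀ v ∉ T t, Relation.ReflTransGen (fun x y => G.Adj x y ∧ y ∉ T t) u v
  nonempty : ∀ t, (T t).Nonempty
  conn : ∀ t, ∀ u ∈ T t, ∀ v ∈ T t, Relation.ReflTransGen (fun x y => G.Adj x y ∧ y ∈ T t) u v
  edge_two : ∀ u v, G.Adj u v → ∃ t t', t ≠ t' ∧ u ∈ T t ∧ v ∈ T t ∧ u ∈ T t' ∧ v ∈ T t'
  three : ∀ t t' u v w, u ≠ v → u ≠ w → v ≠ w → u ∈ T t → v ∈ T t → w ∈ T t →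
    u ∈ T t' → v ∈ T t' → w ∈ T t' → t = t'
  two : ∀ t t' u v, t ≠ t' → u ≠ v → u ∈ T t → v ∈ T t → u ∈ T t' → v ∈ T t' → G.Adj u v
  sep : ∀ u v, u ≠ v → ∃ t, v ∈ T t ∧ u ∉ T t

namespace SphereEmbedding

/-- The incidence properties of a planar map whose faces fit together as those of a polytope. -/
structure Polyhedral {V : Type*} {G : SimpleGraph V} (M : SphereEmbedding G) : Prop where
  exists_dart : ∀ v, ∃ d : G.Dart, d.fst = v
  rot_ne : ∀ d, M.rot d ≠ d
  rot_rot_ne : ∀ d, M.rot (M.rot d) ≠ d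
  dart_unique : ∀ d d' : G.Dart, d.fst = d'.fst → M.face d = M.face d' → d = d'
  edge_faces : ∀ d f, M.OnFace d.fst f → M.OnFace d.snd f → f = M.face d ∨ f = M.face (M.rot d)
  three : ∀ f f' u v w, u ≠ v → u ≠ w → v ≠ w → M.OnFace u f → M.OnFace v f → M.OnFace w f →
    M.OnFace u f' → M.OnFace v f' → M.OnFace w f' → f = f'
  sep : ∀ u v, u ≠ v → ∃ f, M.OnFace v f ∧ ¬ M.OnFace u f
  two : ∀ f f' u v, f ≠ f' → u ≠ v → M.OnFace u f → M.OnFace v f → M.OnFace u f' →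
    M.OnFace v f' → G.Adj u v

variable {V : Type*} {G : SimpleGraph V} (M : SphereEmbedding G)

theorem rot_zpow_mem {s : Set G.Dart} (hs : ∀ d, d ∈ s ↔ M.rot d ∈ s) (d : G.Dart) (hd : d ∈ s)
    (i : ℤ) : (M.rot ^ i) d ∈ s := by
  induction i using Int.induction_on generalizing d with
  | zero => simpa
  | succ n ih => rw [zpow_add_one, Equiv.Perm.mul_apply]; exact ih _ ((hs d).1 hd)
  | pred n ih =>
    rw [zpow_sub_one, Equiv.Perm.mul_apply]
    refine ih _ ((hs _).2 ?_)
    rwa [← Equiv.Perm.mul_apply, mul_inv_cancel]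

theorem mem_of_rot_mem {s : Set G.Dart} (hs : ∀ d, d ∈ s ↔ M.rot d ∈ s) {d d' : G.Dart}
    (h : d.fst = d'.fst) (hd : d ∈ s) : d' ∈ s := by
  obtain ⟨i, hi⟩ := M.rot_cyclic d d' h
  exact hi ▸ M.rot_zpow_mem hs d hd i

/-- A rotation-invariant function of the darts at a vertex is constant. -/
theorem rot_const {X : Type*} (h : G.Dart → X) (v : V)
    (hr : ∀ d : G.Dart, d.fst = v → h (M.rot d) = h d) {d d' : G.Dart} (hd : d.fst = v)
    (hd' : d'.fst = v) : h d = h d' := by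
  have := M.mem_of_rot_mem (s := {e | e.fst = v → h e = h d}) (fun e => by
    simp only [mem_ofPred_eq, M.rot_fst]
    exact forall_congr' fun he => by rw [hr e he]) (hd.trans hd'.symm) (fun _ => rfl)
  exact (this hd').symm

/-- The darts at a vertex form one cycle of `rot`, so a fixed dart would be the only one there. -/
theorem rot_ne_of_minDeg (hdeg : MinDegThree G) (d : G.Dart) : M.rot d ≠ d := by
  intro h
  obtain ⟨u, hu, hu1, -⟩ := hdeg d.fst d.snd d.snd
  have hm : (⟨(d.fst, u), hu⟩ : G.Dart) ∈ ({d} : Set G.Dart) :=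
    M.mem_of_rot_mem (s := {d}) (fun e => by
      simp only [mem_singleton_iff]
      exact ⟨fun he => he ▸ h, fun he => M.rot.injective (he.trans h.symm)⟩) (d := d) rfl rfl
  rw [mem_singleton_iff] at hm
  exact hu1 (by rw [← hm])

theorem rot_rot_ne_of_minDeg (hdeg : MinDegThree G) (d : G.Dart) : M.rot (M.rot d) ≠ d := by
  intro h
  obtain ⟨u, hu, hu1, hu2⟩ := hdeg d.fst d.snd (M.rot d).snd
  have hm : (⟨(d.fst, u), hu⟩ : G.Dart) ∈ ({d, M.rot d} : Set G.Dart) :=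
    M.mem_of_rot_mem (s := {d, M.rot d}) (fun e => by
      simp only [mem_insert_iff, mem_singleton_iff]
      constructor
      · rintro (rfl | rfl)
        exacts [Or.inr rfl, Or.inl h]
      · rintro (he | he)
        · exact Or.inr (M.rot.injective (he.trans h.symm))
        · exact Or.inl (M.rot.injective he)) (d := d) rfl (Or.inl rfl)
  rcases hm with hm | hm
  · exact hu1 (by rw [← hm])
  · exact hu2 (by rw [← (show _ = _ from hm)])

theorem step_ne_symm (hr : ∀ d, M.rot d ≠ d) (d : G.Dart) : M.step d ≠ d.symm := hr d.symm

/-- Three consecutive vertices of a face are distinct. -/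
theorem face_three (hr : ∀ d, M.rot d ≠ d) (d : G.Dart) :
    d.fst ≠ d.snd ∧ d.fst ≠ (M.step d).snd ∧ d.snd ≠ (M.step d).snd := by
  refine ⟨d.fst_ne_snd, fun h => ?_, fun h => ?_⟩
  · refine M.step_ne_symm hr d (SimpleGraph.Dart.ext _ _ (Prod.ext ?_ ?_))
    · exact M.step_fst d
    · exact h.symm
  · exact (M.step d).fst_ne_snd ((M.step_fst d).trans h)

theorem exists_three_onFace (hr : ∀ d, M.rot d ≠ d) (f : M.Face) :
    ∃ u v w, u ≠ v ∧ u ≠ w ∧ v ≠ w ∧ M.OnFace u f ∧ M.OnFace v f ∧ M.OnFace w f := by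
  obtain ⟨d, rfl⟩ := M.face_surjective f
  obtain ⟨h1, h2, h3⟩ := M.face_three hr d
  refine ⟨_, _, _, h1, h2, h3, M.onFace_fst d, M.onFace_snd d, ?_⟩
  rw [← M.face_step d]
  exact M.onFace_snd _

theorem symm_step_fst (d : G.Dart) : (M.step.symm d).snd = d.fst := by
  rw [← M.step_fst, Equiv.apply_symm_apply]

theorem face_symm_step (d : G.Dart) : M.face (M.step.symm d) = M.face d := by
  rw [← M.face_step, Equiv.apply_symm_apply]

end SphereEmbedding

/-! ### The facet that contains a given face -/

section Facets

variable {V ι : Type*} [Finite V] {G₀ G : SimpleGraph V} (M : SphereEmbedding G) {T : ι → Set V}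

namespace SphereEmbedding

open Classical in
-- The edges of a facet form a cycle, hence bound a set of faces mod 2. No edge of this cycle
-- touches a vertex off the facet, and those vertices are connected, so the potential is constant on
-- the faces meeting them and can be normalised to zero there. It then selects only faces whose
-- vertices all lie on the facet.
theorem exists_facet_potential (hle : G₀ ≤ G) (hT : FacetSystem G₀ T)
    (hdart : ∀ v : V, ∃ d : G.Dart, d.fst = v) (t : ι) :
    ∃ A : M.Face → ZMod 2,
      (∀ d : G.Dart, (if G₀.Adj d.fst d.snd ∧ d.fst ∈ T t ∧ d.snd ∈ T t then (1 : ZMod 2) else 0) =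
        A (M.face d) + A (M.face d.symm)) ∧
      ∀ v f, M.OnFace v f → v ∉ T t → A f = 0 := by
  let c : Sym2 V → ZMod 2 := fun e => if e ∈ G₀.edgeSet ∧ ∀ x ∈ e, x ∈ T t then 1 else 0
  have hcd : ∀ d : G.Dart, c d.edge =
      if G₀.Adj d.fst d.snd ∧ d.fst ∈ T t ∧ d.snd ∈ T t then (1 : ZMod 2) else 0 := by
    intro d
    simp [c, SimpleGraph.Dart.edge]
  obtain ⟨A, hA⟩ := M.exists_face_potential c (by
    intro v
    simp_rw [hcd]
    by_cases hv : v ∈ T t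
    · obtain ⟨u₁, u₂, hne, hu⟩ := hT.two_nbrs t v hv
      let d₁ : G.Dart := ⟨(v, u₁), hle ((hu u₁).2 (Or.inl rfl)).1⟩
      let d₂ : G.Dart := ⟨(v, u₂), hle ((hu u₂).2 (Or.inr rfl)).1⟩
      have hd : d₁ ≠ d₂ := fun h => hne (congrArg (fun d : G.Dart => d.snd) h)
      have hsub : ({d₁, d₂} : Finset G.Dart) ⊆ Finset.univ.filter fun d => d.fst = v := by
        intro d
        simp only [Finset.mem_insert, Finset.mem_singleton, Finset.mem_filter, Finset.mem_univ,
          true_and]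
        rintro (rfl | rfl) <;> rfl
      rw [← Finset.sum_subset hsub, Finset.sum_pair hd, if_pos, if_pos]
      · exact zmod_two_add_self 1
      · exact ⟨((hu u₂).2 (Or.inr rfl)).1, hv, ((hu u₂).2 (Or.inr rfl)).2⟩
      · exact ⟨((hu u₁).2 (Or.inl rfl)).1, hv, ((hu u₁).2 (Or.inl rfl)).2⟩
      · intro d hd1 hd2
        rw [if_neg]
        rintro ⟨h1, h2, h3⟩
        obtain rfl : d.fst = v := (Finset.mem_filter.1 hd1).2
        apply hd2
        simp only [Finset.mem_insert, Finset.mem_singleton]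
        exact ((hu d.snd).1 ⟨h1, h3⟩).imp (fun h => SimpleGraph.Dart.ext _ _ (Prod.ext rfl h))
          (fun h => SimpleGraph.Dart.ext _ _ (Prod.ext rfl h))
    · refine Finset.sum_eq_zero fun d hd => if_neg ?_
      rintro ⟨-, h2, -⟩
      exact hv ((Finset.mem_filter.1 hd).2 ▸ h2))
  have h0 : ∀ d : G.Dart, d.fst ∉ T t → A (M.face d.symm) = A (M.face d) := by
    intro d hd
    have := hA d
    rw [hcd, if_neg (fun h => hd h.2.1)] at this
    exact (zmod_two_eq_of_add this.symm).symm
  have hv : ∀ d d' : G.Dart, d.fst ∉ T t → d.fst = d'.fst → A (M.face d) = A (M.face d') := by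
    intro d d' hd hdd
    refine M.rot_const (fun d => A (M.face d)) d.fst (fun e he => ?_) rfl hdd.symm
    rw [← M.face_symm, h0 e (he ▸ hd)]
  have hall : ∀ d d' : G.Dart, d.fst ∉ T t → d'.fst ∉ T t → A (M.face d) = A (M.face d') := by
    intro d d' hd hd'
    have hR := hT.compl_conn t _ hd _ hd'
    generalize hu : d.fst = u at hR
    generalize hw : d'.fst = w at hR
    induction hR using Relation.ReflTransGen.head_induction_on generalizing d with
    | refl => exact hv d d' hd (hu.trans hw.symm)
    | head hab _ ih =>
      let e : G.Dart := ⟨(_, _), hle hab.1⟩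
      rw [hv d e hd hu, ← h0 e (fun h => hd (hu.symm ▸ h))]
      exact ih e.symm hab.2 rfl
  obtain ⟨v0, hv0⟩ := hT.compl_nonempty t
  obtain ⟨d0, rfl⟩ := hdart v0
  -- The potential is determined up to a constant; subtracting its value at a vertex off the facet
  -- is adding it, mod 2.
  refine ⟨fun f => A f + A (M.face d0), fun d => ?_, ?_⟩
  · rw [← hcd, hA]
    have := zmod_two_add_self (A (M.face d0))
    linear_combination (-1 : ZMod 2) * this
  · rintro v f ⟨d, rfl, rfl⟩ hd
    change A (M.face d) + _ = 0
    rw [hall d d0 hd hv0]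
    exact zmod_two_add_self _

theorem exists_dart_of_minDeg (hle : G₀ ≤ G) (hdeg : MinDegThree G₀) (v : V) :
    ∃ d : G.Dart, d.fst = v := by
  obtain ⟨u, hu, -⟩ := hdeg v v v
  exact ⟨⟨(v, u), hle hu⟩, rfl⟩

theorem minDegThree_mono (hle : G₀ ≤ G) (hdeg : MinDegThree G₀) : MinDegThree G := fun v x y => by
  obtain ⟨u, hu, h⟩ := hdeg v x y
  exact ⟨u, hle hu, h⟩

/-- The faces of a planar map of a graph with at most one edge more than the graph of a polytope
lie in facets of that polytope. -/
theorem exists_facet_map (hle : G₀ ≤ G) (hT : FacetSystem G₀ T) (hdeg : MinDegThree G₀) {a b : V}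
    (hG : ∀ u v, G.Adj u v → G₀.Adj u v ∨ s(u, v) = s(a, b)) :
    ∃ ρ : M.Face → ι, (∀ v f, M.OnFace v f → v ∈ T (ρ f)) ∧
      (∀ d : G.Dart, G₀.Adj d.fst d.snd → ∀ t, d.fst ∈ T t → d.snd ∈ T t →
        (ρ (M.face d) = t ∧ ρ (M.face d.symm) ≠ t) ∨ (ρ (M.face d) ≠ t ∧ ρ (M.face d.symm) = t)) ∧
      ∀ d : G.Dart, ¬ G₀.Adj d.fst d.snd → ρ (M.face d) = ρ (M.face d.symm) := by
  classical
  have hr := M.rot_ne_of_minDeg (minDegThree_mono hle hdeg)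
  choose A hA1 hA2 using M.exists_facet_potential hle hT (exists_dart_of_minDeg hle hdeg)
  have hmem : ∀ t v f, A t f = 1 → M.OnFace v f → v ∈ T t := by
    intro t v f h1 hv
    by_contra hvt
    rw [hA2 t v f hv hvt] at h1
    exact zero_ne_one h1
  -- A face has three distinct vertices, and two facets sharing three vertices coincide.
  have huniq : ∀ t t' f, A t f = 1 → A t' f = 1 → t = t' := by
    intro t t' f h h'
    obtain ⟨u, v, w, h1, h2, h3, hu, hv, hw⟩ := M.exists_three_onFace hr f
    exact hT.three t t' u v w h1 h2 h3 (hmem _ _ _ h hu) (hmem _ _ _ h hv) (hmem _ _ _ h hw)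
      (hmem _ _ _ h' hu) (hmem _ _ _ h' hv) (hmem _ _ _ h' hw)
  have hone : ∀ d : G.Dart, G₀.Adj d.fst d.snd → ∀ t, d.fst ∈ T t → d.snd ∈ T t →
      (A t (M.face d) = 1 ∧ A t (M.face d.symm) = 0) ∨
      (A t (M.face d) = 0 ∧ A t (M.face d.symm) = 1) := by
    intro d hd t h1 h2
    have := hA1 t d
    rw [if_pos ⟨hd, h1, h2⟩] at this
    rcases zmod_two_cases (A t (M.face d)) with h | h <;>
      rcases zmod_two_cases (A t (M.face d.symm)) with h' | h' <;>
      rw [h, h'] at this <;> revert this <;> simp [h, h', zmod_two_add_self]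
  -- An edge lies in two facets, each selecting exactly one of its sides. By uniqueness they cannot
  -- both select the far side.
  have hG0 : ∀ d : G.Dart, G₀.Adj d.fst d.snd → ∃ t, A t (M.face d) = 1 := by
    intro d hd
    obtain ⟨t, t', hne, h1, h2, h3, h4⟩ := hT.edge_two _ _ hd
    rcases hone d hd t h1 h2 with h | h
    · exact ⟨t, h.1⟩
    rcases hone d hd t' h3 h4 with h' | h'
    · exact ⟨t', h'.1⟩
    exact (hne (huniq _ _ _ h.2 h'.2)).elim
  -- Two consecutive darts of a face cannot both be the extra edge, as the face would turn back on
  -- itself; so every face has a side in `G₀`.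
  have hex : ∀ f, ∃ t, A t f = 1 := by
    intro f
    obtain ⟨d, rfl⟩ := M.face_surjective f
    by_cases h1 : G₀.Adj d.fst d.snd
    · exact hG0 d h1
    by_cases h2 : G₀.Adj (M.step d).fst (M.step d).snd
    · rw [← M.face_step]; exact hG0 _ h2
    exfalso
    have e1 : d.edge = s(a, b) := (hG _ _ d.adj).resolve_left h1
    have e2 : (M.step d).edge = s(a, b) := (hG _ _ (M.step d).adj).resolve_left h2
    rcases (SimpleGraph.dart_edge_eq_iff _ _).1 (e2.trans e1.symm) with h | h
    · exact d.fst_ne_snd (by rw [← M.step_fst d, h])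
    · exact M.step_ne_symm hr d h
  choose ρ hρ using hex
  have hρ' : ∀ t f, ρ f = t ↔ A t f = 1 := fun t f =>
    ⟨fun h => h ▸ hρ f, fun h => huniq _ _ _ (hρ f) h⟩
  refine ⟨ρ, fun v f hv => hmem _ _ _ (hρ f) hv, fun d hd t h1 h2 => ?_, fun d hd => ?_⟩
  · simp only [ne_eq, hρ']
    rcases hone d hd t h1 h2 with h | h <;> simp [h]
  · rw [hρ', ← hρ (M.face d.symm)]
    have := hA1 (ρ (M.face d.symm)) d
    rw [if_neg (fun h => hd h.1)] at this
    exact zmod_two_eq_of_add this.symm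

variable {M} {ρ : M.Face → ι}

theorem exists_dart_of_mem (hle : G₀ ≤ G) (hT : FacetSystem G₀ T)
    (h2 : ∀ d : G.Dart, G₀.Adj d.fst d.snd → ∀ t, d.fst ∈ T t → d.snd ∈ T t →
      (ρ (M.face d) = t ∧ ρ (M.face d.symm) ≠ t) ∨ (ρ (M.face d) ≠ t ∧ ρ (M.face d.symm) = t))
    {t : ι} {v : V} (hv : v ∈ T t) : ∃ d : G.Dart, d.fst = v ∧ ρ (M.face d) = t := by
  obtain ⟨u₁, u₂, -, hu⟩ := hT.two_nbrs t v hv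
  obtain ⟨hadj, hu1⟩ := (hu u₁).2 (Or.inl rfl)
  let d : G.Dart := ⟨(v, u₁), hle hadj⟩
  rcases h2 d hadj t hv hu1 with h | h
  · exact ⟨d, rfl, h.1⟩
  · exact ⟨M.rot d, M.rot_fst d, by rw [← M.face_symm]; exact h.2⟩

/-- At a vertex a facet has only two edges. If both leave the vertex with the facet on their own
side, neither reverse does, so the dart that precedes each of them along its face has to be the
extra edge. One undirected edge cannot enter the same vertex as two different darts. -/
theorem dart_eq_of_facet (hT : FacetSystem G₀ T) {a b : V}
    (hG : ∀ u v, G.Adj u v → G₀.Adj u v ∨ s(u, v) = s(a, b))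
    (h1 : ∀ v f, M.OnFace v f → v ∈ T (ρ f))
    (h2 : ∀ d : G.Dart, G₀.Adj d.fst d.snd → ∀ t, d.fst ∈ T t → d.snd ∈ T t →
      (ρ (M.face d) = t ∧ ρ (M.face d.symm) ≠ t) ∨ (ρ (M.face d) ≠ t ∧ ρ (M.face d.symm) = t))
    {d d' : G.Dart} (hd : G₀.Adj d.fst d.snd) (hd' : G₀.Adj d'.fst d'.snd)
    (hdd : d.fst = d'.fst) (hρ : ρ (M.face d) = ρ (M.face d')) : d = d' := by
  by_contra hne
  set t := ρ (M.face d) with ht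
  have m1 : d.fst ∈ T t := h1 _ _ (M.onFace_fst d)
  have m2 : d.snd ∈ T t := h1 _ _ (M.onFace_snd d)
  have m3 : d'.snd ∈ T t := by rw [hρ]; exact h1 _ _ (M.onFace_snd d')
  have hsnd : d.snd ≠ d'.snd := fun h =>
    hne (SimpleGraph.Dart.ext _ _ (Prod.ext hdd h))
  obtain ⟨u₁, u₂, -, hu⟩ := hT.two_nbrs t d.fst m1
  have hu1 := (hu d.snd).1 ⟨hd, m2⟩
  have hu2 := (hu d'.snd).1 ⟨hdd ▸ hd', m3⟩
  have hs1 : ρ (M.face d.symm) ≠ t := (h2 d hd t m1 m2).elim (fun h => h.2)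
    (fun h => (h.1 rfl).elim)
  have hs2 : ρ (M.face d'.symm) ≠ t := (h2 d' hd' t (hdd ▸ m1) m3).elim (fun h => h.2)
    (fun h => (h.1 hρ.symm).elim)
  have hp : ∀ p : G.Dart, p.snd = d.fst → ρ (M.face p) = t → s(p.fst, p.snd) = s(a, b) := by
    intro p hps hpt
    refine (hG _ _ p.adj).resolve_left fun hp0 => ?_
    have hpm : p.fst ∈ T t := by rw [← hpt]; exact h1 _ _ (M.onFace_fst p)
    have hpd : p = d.symm ∨ p = d'.symm := by
      have hu3 := (hu p.fst).1 ⟨hps ▸ hp0.symm, hpm⟩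
      have : p.fst = d.snd ∨ p.fst = d'.snd := by
        rcases hu1 with h | h <;> rcases hu2 with h' | h' <;> rcases hu3 with h'' | h''
        all_goals first
          | exact absurd (h.trans h'.symm) hsnd
          | exact Or.inl (h''.trans h.symm)
          | exact Or.inr (h''.trans h'.symm)
      exact this.imp (fun h => SimpleGraph.Dart.ext _ _ (Prod.ext h hps))
        (fun h => SimpleGraph.Dart.ext _ _ (Prod.ext h (hps.trans hdd)))
    rcases hpd with rfl | rfl
    exacts [hs1 hpt, hs2 hpt]
  have e1 := hp _ (M.symm_step_fst d) (by rw [M.face_symm_step])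
  have e2 := hp _ ((M.symm_step_fst d').trans hdd.symm) (by rw [M.face_symm_step, ← hρ])
  rcases (SimpleGraph.dart_edge_eq_iff _ _).1 (e1.trans e2.symm) with h | h
  · exact hne (M.step.symm.injective h)
  · have h3 := M.symm_step_fst d
    have h4 := M.symm_step_fst d'
    rw [h] at h3
    exact (M.step.symm d').fst_ne_snd (h3.trans (hdd.trans h4.symm))

end SphereEmbedding

end Facets

end HypPoly

/-! ### Faces are facets, up to merging along one extra edge -/

namespace HypPoly

section Facets

variable {V ι : Type*} [Finite V] {G₀ G : SimpleGraph V} {T : ι → Set V}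

namespace SphereEmbedding

/-- The faces of a planar map of the graph of a polytope are the facets of the polytope. -/
theorem facet_bijection (M : SphereEmbedding G) (hT : FacetSystem G T) (hdeg : MinDegThree G) :
    ∃ ρ : M.Face → ι, Function.Bijective ρ ∧ (∀ v f, M.OnFace v f ↔ v ∈ T (ρ f)) ∧
      M.Polyhedral := by
  obtain ⟨v0⟩ := M.connected.nonempty
  obtain ⟨ρ, h1, h2, -⟩ := M.exists_facet_map le_rfl hT hdeg (a := v0) (b := v0)
    (fun u v h => Or.inl h)
  have huniq : ∀ d d' : G.Dart, d.fst = d'.fst → ρ (M.face d) = ρ (M.face d') → d = d' :=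
    fun d d' => dart_eq_of_facet (a := v0) (b := v0) hT (fun u v h => Or.inl h) h1 h2 d.adj d'.adj
  have hon : ∀ v f, M.OnFace v f ↔ v ∈ T (ρ f) := by
    intro v f
    refine ⟨h1 v f, fun hv => ?_⟩
    obtain ⟨d0, rfl⟩ := M.face_surjective f
    -- Walking along the facet keeps to the face: of the two sides of a facet edge one maps to this
    -- facet, and uniqueness of its dart at the current vertex identifies it with the face being
    -- followed.
    have hR := hT.conn _ _ (h1 _ _ (M.onFace_fst d0)) v hv
    clear hv
    induction hR with
    | refl => exact M.onFace_fst d0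
    | @tail b c _ hbc ih =>
      have hb : b ∈ T (ρ (M.face d0)) := h1 _ _ ih
      obtain ⟨d, rfl, hd⟩ := M.onFace_iff.1 ih
      let e : G.Dart := ⟨(d.fst, c), hbc.1⟩
      rcases h2 e hbc.1 _ hb hbc.2 with h | h
      · have : e = d := huniq e d rfl (by rw [h.1, hd])
        rw [← hd, ← this]
        exact M.onFace_snd e
      · have : M.step e.symm = d := huniq _ d (M.step_fst _) (by rw [M.face_step, h.2, hd])
        rw [← hd, ← this, M.face_step]
        exact M.onFace_fst e.symm
  have hinj : Function.Injective ρ := by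
    intro f f' hff
    obtain ⟨d, rfl⟩ := M.face_surjective f
    obtain ⟨d', hd', rfl⟩ := M.onFace_iff.1 ((hon d.fst f').2 (hff ▸ h1 _ _ (M.onFace_fst d)))
    rw [huniq d d' hd'.symm hff]
  have hsurj : Function.Surjective ρ := by
    intro t
    obtain ⟨v, hv⟩ := hT.nonempty t
    obtain ⟨d, -, hd⟩ := exists_dart_of_mem le_rfl hT h2 hv
    exact ⟨_, hd⟩
  refine ⟨ρ, ⟨hinj, hsurj⟩, hon, ?_⟩
  refine
    { exists_dart := exists_dart_of_minDeg le_rfl hdeg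
      rot_ne := M.rot_ne_of_minDeg hdeg
      rot_rot_ne := M.rot_rot_ne_of_minDeg hdeg
      dart_unique := fun d d' h h' => huniq d d' h (congrArg ρ h')
      edge_faces := fun d f hf hs => ?_
      three := fun f f' u v w h1 h2 h3 hu hv hw hu' hv' hw' => ?_
      sep := fun u v huv => ?_
      two := fun f f' u v hff huv hu hv hu' hv' => ?_ }
  · rw [← M.face_symm]
    rcases h2 d d.adj (ρ f) (h1 _ _ hf) (h1 _ _ hs) with h | h
    · exact Or.inl (hinj h.1.symm)
    · exact Or.inr (hinj h.2.symm)
  · rw [hon] at hu hv hw hu' hv' hw'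
    exact hinj (hT.three _ _ u v w h1 h2 h3 hu hv hw hu' hv' hw')
  · obtain ⟨t, ht⟩ := hT.sep u v huv
    obtain ⟨f, rfl⟩ := hsurj t
    exact ⟨f, by simpa only [hon] using ht⟩
  · rw [hon] at hu hv hu' hv'
    exact hT.two _ _ u v (fun h => hff (hinj h)) huv hu hv hu' hv'

open Classical in
/-- Two vertices joined by a path are the odd vertices of a set of edges. -/
theorem exists_path_chain (hle : G₀ ≤ G) {u v : V} (p : G₀.Walk u v) :
    ∃ c : Sym2 V → ZMod 2, (∀ e ∉ G₀.edgeSet, c e = 0) ∧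
      ∀ x, ∑ d : G.Dart with d.fst = x, c d.edge =
        (if x = u then 1 else 0) + (if x = v then 1 else 0) := by
  induction p with
  | nil => exact ⟨0, fun _ _ => rfl, fun x => by simp [zmod_two_add_self]⟩
  | @cons u w v hadj p ih =>
    obtain ⟨c, hc1, hc2⟩ := ih
    refine ⟨fun e => c e + if e = s(u, w) then 1 else 0, fun e he => ?_, fun x => ?_⟩
    · simp only [hc1 e he, zero_add]
      exact if_neg fun h => he (by rw [h]; exact hadj)
    · rw [Finset.sum_add_distrib, hc2]
      have h3 : ∑ d : G.Dart with d.fst = x, (if d.edge = s(u, w) then (1 : ZMod 2) else 0) =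
          (if x = u then 1 else 0) + if x = w then 1 else 0 := by
        have := sum_edge (fun d : G.Dart => if d.fst = x then (1 : ZMod 2) else 0)
          ⟨(u, w), hle hadj⟩
        rw [Finset.sum_filter] at this ⊢
        simp only [eq_comm (a := x)]
        rw [show (if u = x then (1 : ZMod 2) else 0) + (if w = x then 1 else 0) = _ from
          this.symm]
        refine Finset.sum_congr rfl fun d _ => ?_
        change (if d.fst = x then (if d.edge = s(u, w) then (1 : ZMod 2) else 0) else 0) =
          if d.edge = s(u, w) then _ else _
        split_ifs <;> rfl
      rw [h3]
      have := zmod_two_add_self (if x = w then (1 : ZMod 2) else 0)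
      linear_combination this

/-- An edge that is not a bridge borders two different faces. -/
theorem face_ne_face_symm (M : SphereEmbedding G) (hle : G₀ ≤ G) (hconn : G₀.Preconnected)
    (d : G.Dart) (hd : ¬ G₀.Adj d.fst d.snd) : M.face d ≠ M.face d.symm := by
  classical
  intro hf
  obtain ⟨p⟩ := hconn d.fst d.snd
  obtain ⟨c, hc1, hc2⟩ := exists_path_chain hle p
  -- The path closed up by the edge of `d` is a cycle, so it bounds faces. It passes once through
  -- this edge, so the potential jumps there and the two sides differ.
  obtain ⟨A, hA⟩ := M.exists_face_potential (fun e => c e + if e = d.edge then 1 else 0) (by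
    intro x
    rw [Finset.sum_add_distrib, hc2]
    have := sum_edge (fun d : G.Dart => if d.fst = x then (1 : ZMod 2) else 0) d
    rw [Finset.sum_filter] at this ⊢
    have h2 : ∑ e : G.Dart, (if e.fst = x then (if e.edge = d.edge then (1 : ZMod 2) else 0)
        else 0) = (if d.fst = x then 1 else 0) + (if d.symm.fst = x then 1 else 0) := by
      rw [← this]
      refine Finset.sum_congr rfl fun e _ => ?_
      split_ifs <;> rfl
    rw [h2]
    simp only [eq_comm (b := x)]
    exact zmod_two_add_self _)
  have := hA d
  simp only [hf, if_true] at this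
  rw [hc1 _ hd, zmod_two_add_self, zero_add] at this
  exact one_ne_zero this

/-- `π` maps the faces of `M` to those of `M'`, merging the two faces along the dart `d`. -/
structure IsMerge (M : SphereEmbedding G) (d : G.Dart) {ι : Type*} (T : ι → Set V)
    (π : M.Face → ι) : Prop where
  mem : ∀ v f, M.OnFace v f → v ∈ T (π f)
  exists_face : ∀ t, ∀ v ∈ T t, ∃ f, π f = t ∧ M.OnFace v f
  eq_or : ∀ f g, π f = π g → f = g ∨ (f = M.face d ∧ g = M.face d.symm) ∨
    (f = M.face d.symm ∧ g = M.face d)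
  same : π (M.face d) = π (M.face d.symm)
  ne : M.face d ≠ M.face d.symm
  inter : ∀ v, M.OnFace v (M.face d) → M.OnFace v (M.face d.symm) → v = d.fst ∨ v = d.snd

/-- The extra edge lies in no facet cycle, so its two sides belong to the same facet. Euler's
formula for both maps leaves exactly one more face than there are facets, so there is no other
coincidence. The incidence properties of the faces follow from those of the facets, with separate
care for this one pair. -/
theorem facet_merge (M : SphereEmbedding G) (M' : SphereEmbedding G₀) (hle : G₀ ≤ G)
    (hT : FacetSystem G₀ T) (hdeg : MinDegThree G₀) (d : G.Dart) (hd : ¬ G₀.Adj d.fst d.snd)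
    (hG : ∀ u v, G.Adj u v → G₀.Adj u v ∨ s(u, v) = s(d.fst, d.snd)) :
    ∃ ρ : M.Face → ι, M.IsMerge d T ρ ∧ M.Polyhedral := by
  classical
  obtain ⟨ρ, h1, h2, h3⟩ := M.exists_facet_map hle hT hdeg hG
  obtain ⟨ρ', hb', -⟩ := M'.facet_bijection hT hdeg
  have hft : Fintype ι := Fintype.ofBijective ρ' hb'
  have hfv : Fintype V := Fintype.ofFinite V
  have hdeg' := minDegThree_mono hle hdeg
  have hr := M.rot_ne_of_minDeg hdeg'
  have hne := M.face_ne_face_symm hle M'.connected.preconnected d hd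
  have hex : ∀ t, ∀ v ∈ T t, ∃ f, ρ f = t ∧ M.OnFace v f := by
    intro t v hv
    obtain ⟨e, rfl, he⟩ := exists_dart_of_mem hle hT h2 hv
    exact ⟨_, he, M.onFace_fst e⟩
  have hsame := h3 d hd
  have hcard : Fintype.card M.Face = Fintype.card ι + 1 := by
    have e1 := M.euler_card
    have e2 := M'.euler_card
    rw [Fintype.card_of_bijective hb'] at e2
    have e3 : Fintype.card G.edgeSet = Fintype.card G₀.edgeSet + 1 := by
      rw [← SimpleGraph.edgeFinset_card, ← SimpleGraph.edgeFinset_card]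
      have : G.edgeFinset = insert d.edge G₀.edgeFinset := by
        ext e
        induction e using Sym2.ind with
        | _ x y =>
          simp only [SimpleGraph.mem_edgeFinset, SimpleGraph.mem_edgeSet, Finset.mem_insert]
          constructor
          · exact fun h => (hG x y h).symm
          · rintro (h | h)
            · rw [← SimpleGraph.mem_edgeSet, h]; exact d.edge_mem
            · exact hle h
      rw [this, Finset.card_insert_of_notMem]
      rw [SimpleGraph.mem_edgeFinset]
      exact hd
    omega
  -- Dropping one side of the extra edge keeps `ρ` surjective, and makes the cardinalities equal.
  have hinj : ∀ f g, f ≠ M.face d.symm → g ≠ M.face d.symm → ρ f = ρ g → f = g := by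
    let r : {f : M.Face // f ≠ M.face d.symm} → ι := fun f => ρ f
    have hrs : Function.Surjective r := by
      intro t
      obtain ⟨v, hv⟩ := hT.nonempty t
      obtain ⟨f, hf, -⟩ := hex t v hv
      by_cases hfd : f = M.face d.symm
      · exact ⟨⟨M.face d, hne⟩, by rw [← hf, hfd]; exact hsame⟩
      · exact ⟨⟨f, hfd⟩, hf⟩
    have hrb : Function.Bijective r := by
      rw [Fintype.bijective_iff_surjective_and_card]
      refine ⟨hrs, ?_⟩
      rw [Fintype.card_subtype_compl, hcard]
      simp
    intro f g hf hg hfg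
    exact congrArg Subtype.val (hrb.1 (a₁ := ⟨f, hf⟩) (a₂ := ⟨g, hg⟩) hfg)
  have heq : ∀ f g, ρ f = ρ g → f = g ∨ (f = M.face d ∧ g = M.face d.symm) ∨
      (f = M.face d.symm ∧ g = M.face d) := by
    intro f g hfg
    by_cases hf : f = M.face d.symm <;> by_cases hg : g = M.face d.symm
    · exact Or.inl (hf.trans hg.symm)
    · exact Or.inr (Or.inr ⟨hf, hinj _ _ hg hne (by rw [← hfg, hf, hsame])⟩)
    · exact Or.inr (Or.inl ⟨hinj _ _ hf hne (by rw [hfg, hg, hsame]), hg⟩)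
    · exact Or.inl (hinj _ _ hf hg hfg)
  have huniq : ∀ e e' : G.Dart, G₀.Adj e.fst e.snd → G₀.Adj e'.fst e'.snd → e.fst = e'.fst →
      ρ (M.face e) = ρ (M.face e') → e = e' := fun e e' he he' =>
    dart_eq_of_facet hT hG h1 h2 he he'
  have hnon : ∀ e : G.Dart, ¬ G₀.Adj e.fst e.snd → e = d ∨ e = d.symm := fun e he =>
    (SimpleGraph.dart_edge_eq_iff _ _).1 ((hG _ _ e.adj).resolve_left he)
  have hinter : ∀ v, M.OnFace v (M.face d) → M.OnFace v (M.face d.symm) →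
      v = d.fst ∨ v = d.snd := by
    rintro v ⟨e, rfl, he⟩ ⟨e', hee, he'⟩
    by_contra! hcon
    have g1 : G₀.Adj e.fst e.snd := by
      by_contra h
      rcases hnon e h with rfl | rfl
      exacts [hcon.1 rfl, hcon.2 rfl]
    have g2 : G₀.Adj e'.fst e'.snd := by
      by_contra h
      rcases hnon e' h with rfl | rfl
      exacts [hcon.1 hee.symm, hcon.2 hee.symm]
    have he2 : M.face e = M.face d := he
    have he2' : M.face e' = M.face d.symm := he'
    have : e = e' := huniq e e' g1 g2 hee.symm (by rw [he2, he2', hsame])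
    exact hne (by rw [← he2, ← he2', this])
  have hpair : ∀ f g u v, f ≠ g → ρ f = ρ g → u ≠ v → M.OnFace u f → M.OnFace v f →
      M.OnFace u g → M.OnFace v g → s(u, v) = s(d.fst, d.snd) := by
    intro f g u v hfg hρ huv hu hv hu' hv'
    have hu2 : u = d.fst ∨ u = d.snd := by
      rcases (heq f g hρ).resolve_left hfg with ⟨rfl, rfl⟩ | ⟨rfl, rfl⟩
      exacts [hinter u hu hu', hinter u hu' hu]
    have hv2 : v = d.fst ∨ v = d.snd := by
      rcases (heq f g hρ).resolve_left hfg with ⟨rfl, rfl⟩ | ⟨rfl, rfl⟩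
      exacts [hinter v hv hv', hinter v hv' hv]
    rcases hu2 with rfl | rfl <;> rcases hv2 with rfl | rfl
    exacts [(huv rfl).elim, rfl, Sym2.eq_swap, (huv rfl).elim]
  -- the dart after the new edge in its face
  have hstep : ∀ e : G.Dart, ¬ G₀.Adj e.fst e.snd → G₀.Adj (M.step e).fst (M.step e).snd := by
    intro e he
    by_contra h
    have e1 : (M.step e).edge = d.edge := (hG _ _ (M.step e).adj).resolve_left h
    have e2 : e.edge = d.edge := (hG _ _ e.adj).resolve_left he
    rcases (SimpleGraph.dart_edge_eq_iff _ _).1 (e1.trans e2.symm) with h | h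
    · exact e.fst_ne_snd (by rw [← M.step_fst e, h])
    · exact M.step_ne_symm hr e h
  -- The old dart leaving this vertex in the merged facet is already found as the successor of
  -- `e.symm`, which lies in the other of the two faces.
  have hmix : ∀ e e' : G.Dart, ¬ G₀.Adj e.fst e.snd → G₀.Adj e'.fst e'.snd → e.fst = e'.fst →
      M.face e = M.face e' → False := by
    intro e e' he he' hfst hf
    have hes : ¬ G₀.Adj e.symm.fst e.symm.snd := fun h => he h.symm
    have := huniq (M.step e.symm) e' (hstep _ hes) he' ((M.step_fst _).trans hfst)
      (by rw [M.face_step, ← hf]; exact (h3 e he).symm)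
    have hfe : M.face e = M.face e.symm := by rw [hf, ← this, M.face_step]
    rcases hnon e he with rfl | rfl
    · exact hne hfe
    · exact hne (hfe.trans (by rw [SimpleGraph.Dart.symm_symm])).symm
  refine ⟨ρ, ⟨h1, hex, heq, hsame, hne, hinter⟩, ?_⟩
  refine
    { exists_dart := exists_dart_of_minDeg hle hdeg
      rot_ne := hr
      rot_rot_ne := M.rot_rot_ne_of_minDeg hdeg'
      dart_unique := fun e e' h h' => ?_
      edge_faces := fun e f hf hs => ?_
      three := fun f f' u v w huv huw hvw hu hv hw hu' hv' hw' => ?_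
      sep := fun u v huv => ?_
      two := fun f f' u v hff huv hu hv hu' hv' => ?_ }
  · by_cases he : G₀.Adj e.fst e.snd <;> by_cases he' : G₀.Adj e'.fst e'.snd
    · exact huniq e e' he he' h (congrArg ρ h')
    · exact (hmix e' e he' he h.symm h'.symm).elim
    · exact (hmix e e' he he' h h').elim
    · rcases hnon e he with rfl | rfl <;> rcases hnon e' he' with rfl | rfl
      · rfl
      · exact (e.fst_ne_snd h).elim
      · exact (e'.snd_ne_fst h).elim
      · rfl
  · rw [← M.face_symm]
    by_cases he : G₀.Adj e.fst e.snd
    · have key : ∀ g, ρ g = ρ f → M.OnFace e.fst g → M.OnFace e.snd g → f = g := by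
        intro g hg hg1 hg2
        by_contra hfg
        have := hpair f g _ _ hfg hg.symm e.fst_ne_snd hf hs hg1 hg2
        apply hd
        rw [← SimpleGraph.mem_edgeSet, ← this]
        exact he
      rcases h2 e he (ρ f) (h1 _ _ hf) (h1 _ _ hs) with h | h
      · exact Or.inl (key _ h.1 (M.onFace_fst e) (M.onFace_snd e))
      · exact Or.inr (key _ h.2 (M.onFace_snd e.symm) (M.onFace_fst e.symm))
    · have hρf : ρ f = ρ (M.face e) := by
        by_contra h
        exact he (hT.two _ _ _ _ h e.fst_ne_snd (h1 _ _ hf) (h1 _ _ hs)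
          (h1 _ _ (M.onFace_fst e)) (h1 _ _ (M.onFace_snd e)))
      rcases heq _ _ hρf with h | ⟨h, -⟩ | ⟨h, -⟩
      · exact Or.inl h
      all_goals rcases hnon e he with rfl | rfl
      all_goals first
        | exact Or.inl h
        | exact Or.inr h
  · by_contra hff
    have hρ := hT.three _ _ u v w huv huw hvw (h1 _ _ hu) (h1 _ _ hv) (h1 _ _ hw)
      (h1 _ _ hu') (h1 _ _ hv') (h1 _ _ hw')
    have e1 := hpair f f' u v hff hρ huv hu hv hu' hv'
    have e2 := hpair f f' u w hff hρ huw hu hw hu' hw'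
    rcases Sym2.eq_iff.1 (e1.trans e2.symm) with h | h
    · exact hvw h.2
    · exact huw h.1
  · obtain ⟨t, ht, ht'⟩ := hT.sep u v huv
    obtain ⟨f, rfl, hf⟩ := hex t v ht
    exact ⟨f, hf, fun h => ht' (h1 _ _ h)⟩
  · by_cases hρ : ρ f = ρ f'
    · have := hpair f f' u v hff hρ huv hu hv hu' hv'
      rw [← SimpleGraph.mem_edgeSet, this]
      exact d.edge_mem
    · exact hle (hT.two _ _ u v hρ huv (h1 _ _ hu) (h1 _ _ hv) (h1 _ _ hu') (h1 _ _ hv'))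

end SphereEmbedding

end Facets

end HypPoly

namespace HypPoly

/-! ### Compact convex sets with finitely many extreme points -/

/-- Among at most three numbers, either at most one is negative or at most one is positive. After a
global change of sign a linear relation of length three thus has at most one negative coefficient,
and becomes a statement about convex combinations. -/
theorem exists_sign_index {ι : Type*} [Nonempty ι] (s : Finset ι) (hs : s.card ≤ 3) (α : ι → ℝ) :
    ∃ i₀, (∀ i ∈ s, i ≠ i₀ → 0 ≤ α i) ∨ ∀ i ∈ s, i ≠ i₀ → α i ≤ 0 := by
  classical
  have hdisj : Disjoint (s.filter fun i => α i < 0) (s.filter fun i => 0 < α i) :=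
    Finset.disjoint_filter.2 fun i _ h h' => lt_asymm h h'
  have hcard : (s.filter fun i => α i < 0).card + (s.filter fun i => 0 < α i).card ≤ 3 := by
    rw [← Finset.card_union_of_disjoint hdisj]
    exact (Finset.card_le_card (Finset.union_subset (Finset.filter_subset _ _)
      (Finset.filter_subset _ _))).trans hs
  have key : ∀ p : ι → Prop, (s.filter p).card ≤ 1 → ∃ i₀, ∀ i ∈ s, i ≠ i₀ → ¬ p i := by
    intro p hp
    rcases (s.filter p).eq_empty_or_nonempty with h | ⟨i₀, hi₀⟩
    · exact ⟨Classical.arbitrary ι, fun i hi _ hpi => by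
        have : i ∈ s.filter p := Finset.mem_filter.2 ⟨hi, hpi⟩
        rw [h] at this
        simp at this⟩
    · exact ⟨i₀, fun i hi hne hpi =>
        hne (Finset.card_le_one.1 hp _ (Finset.mem_filter.2 ⟨hi, hpi⟩) _ hi₀)⟩
  by_cases h1 : (s.filter fun i => α i < 0).card ≤ 1
  · obtain ⟨i₀, h⟩ := key _ h1
    exact ⟨i₀, Or.inl fun i hi hne => not_lt.1 (h i hi hne)⟩
  · obtain ⟨i₀, h⟩ := key (fun i => 0 < α i) (by omega)
    exact ⟨i₀, Or.inr fun i hi hne => not_lt.1 (h i hi hne)⟩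

section Vertices

variable {V : Type*} [Fintype V] {P : Set E3} {x : V → E3}

theorem eq_convexHull_of_extremePoints (hc : Convex ℝ P) (hk : IsCompact P)
    (hx : range x = extremePoints ℝ P) : P = convexHull ℝ (range x) := by
  rw [← closure_convexHull_extremePoints hk hc, ← hx]
  exact ((finite_range x).isClosed_convexHull ℝ).closure_eq

theorem exists_weights (y : E3) (hy : y ∈ convexHull ℝ (range x)) :
    ∃ w : V → ℝ, (∀ v, 0 ≤ w v) ∧ ∑ v, w v = 1 ∧ ∑ v, w v • x v = y := by
  classical
  have hconv : Convex ℝ ((fun w : V → ℝ => ∑ v, w v • x v) '' stdSimplex ℝ V) := by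
    have hlin : IsLinearMap ℝ (fun w : V → ℝ => ∑ v, w v • x v) := by
      refine ⟨fun a b => ?_, fun c a => ?_⟩
      · simp [add_smul, Finset.sum_add_distrib]
      · simp [Finset.smul_sum, mul_smul]
    exact (convex_stdSimplex ℝ V).is_linear_image hlin
  obtain ⟨w, ⟨h1, h2⟩, h3⟩ := convexHull_min (s := range x) (by
    rintro _ ⟨v, rfl⟩
    exact ⟨Pi.single v 1, single_mem_stdSimplex ℝ v, by
      simp [Pi.single_apply, ite_smul]⟩) hconv hy
  exact ⟨w, h1, h2, h3⟩

variable (hc : Convex ℝ P) (hinj : Function.Injective x) (hx : range x = extremePoints ℝ P)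

include hx in
theorem vertex_mem (v : V) : x v ∈ P := by
  have : x v ∈ extremePoints ℝ P := hx ▸ mem_range_self v
  exact this.1

include hx in
theorem vertex_extreme (v : V) {y z : E3} (hy : y ∈ P) (hz : z ∈ P)
    (h : x v ∈ openSegment ℝ y z) : y = x v := by
  have : x v ∈ extremePoints ℝ P := hx ▸ mem_range_self v
  exact this.2 hy hz h

include hc hx in
theorem add_comb_mem (v : V) (b : V → ℝ) (hb : ∀ u, 0 ≤ b u) (hb1 : ∑ u, b u ≤ 1) :
    x v + ∑ u, b u • (x u - x v) ∈ P := by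
  have h := hc.sum_mem (t := Finset.univ) (w := fun o : Option V => o.elim (1 - ∑ u, b u) b)
    (z := fun o : Option V => o.elim (x v) x)
    (by rintro (_ | u) _; exacts [sub_nonneg.2 hb1, hb u])
    (by simp [Fintype.sum_option])
    (by rintro (_ | u) _; exacts [vertex_mem hx v, vertex_mem hx u])
  simp only [Fintype.sum_option, Option.elim] at h
  convert h using 1
  simp only [smul_sub, Finset.sum_sub_distrib, sub_smul, one_smul, Finset.sum_smul]
  abel

include hc hinj hx in
/-- A vertex is not a convex combination of the other vertices. -/
theorem pos_comb (v : V) (a : V → ℝ) (ha : ∀ u, u ≠ v → 0 ≤ a u)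
    (h : ∑ u, a u • (x u - x v) = 0) (u : V) (hu : u ≠ v) : a u = 0 := by
  classical
  by_contra hne
  have hpos : 0 < a u := lt_of_le_of_ne (ha u hu) (Ne.symm hne)
  have hS : Convex ℝ (P \ {x v}) :=
    ((Convex.mem_extremePoints_iff_convex_sdiff hc).1 (hx ▸ mem_range_self v)).2
  set A := ∑ w ∈ Finset.univ.erase v, a w with hA
  have hApos : 0 < A := Finset.sum_pos' (fun w hw => ha w (Finset.ne_of_mem_erase hw))
    ⟨u, Finset.mem_erase.2 ⟨hu, Finset.mem_univ _⟩, hpos⟩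
  have hmem := hS.sum_mem (t := Finset.univ.erase v) (w := fun w => a w / A) (z := x)
    (fun w hw => div_nonneg (ha w (Finset.ne_of_mem_erase hw)) hApos.le)
    (by rw [← Finset.sum_div]; exact div_self hApos.ne')
    (fun w hw => ⟨vertex_mem hx w, fun hwv => Finset.ne_of_mem_erase hw (hinj hwv)⟩)
  have hsum : ∑ w ∈ Finset.univ.erase v, a w • (x w - x v) = 0 := by
    rw [← h, ← Finset.add_sum_erase Finset.univ _ (Finset.mem_univ v)]
    simp
  have : ∑ w ∈ Finset.univ.erase v, (a w / A) • x w = x v := by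
    simp only [smul_sub, Finset.sum_sub_distrib, ← Finset.sum_smul] at hsum
    rw [← hA, sub_eq_zero] at hsum
    simp only [div_eq_inv_mul, mul_smul]
    rw [← Finset.smul_sum, hsum, smul_smul, inv_mul_cancel₀ hApos.ne', one_smul]
  exact hmem.2 this

include hc hinj hx in
-- Of two vertices on one ray from `v`, the nearer would lie strictly between `v` and the farther,
-- and so would not be extreme.
theorem ray_unique {v u w : V} (hu : u ≠ v) {c : ℝ} (hcp : 0 ≤ c)
    (h : x w - x v = c • (x u - x v)) (hw : w ≠ v) : w = u := by
  have hw' : x w = x v + c • (x u - x v) := by rw [← h]; abel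
  rcases lt_trichotomy c 1 with h1 | h1 | h1
  · rcases hcp.eq_or_lt with h0 | h0
    · rw [← h0, zero_smul, add_zero] at hw'
      exact (hw (hinj hw')).elim
    · have := vertex_extreme hx w (vertex_mem hx v) (vertex_mem hx u)
        ⟨1 - c, c, by linarith, h0, by ring, by rw [hw', smul_sub, sub_smul, one_smul]; abel⟩
      exact (hw (hinj this.symm)).elim
  · refine hinj ?_
    rw [hw', h1, one_smul]; abel
  · have hc0 : c ≠ 0 := by linarith
    have := vertex_extreme hx u (vertex_mem hx v) (vertex_mem hx w)
      ⟨1 - c⁻¹, c⁻¹, by have := inv_lt_one_of_one_lt₀ h1; linarith, by positivity, by ring, by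
        rw [hw', smul_add, smul_smul, inv_mul_cancel₀ hc0, sub_smul]; module⟩
    exact (hu (hinj this.symm)).elim

include hc hinj hx in
/-- An edge direction is not a combination of other directions in the polytope. -/
theorem edge_comb {v u : V} (he : IsEdge P (x v) (x u)) {s : ℝ} (hs : 0 ≤ s) (a : V → ℝ)
    (ha : ∀ w, 0 ≤ a w) (h : s • (x u - x v) = ∑ w, a w • (x w - x v)) (w : V) (hwv : w ≠ v)
    (hwu : w ≠ u) : a w = 0 := by
  classical
  by_contra hne
  have huv : u ≠ v := fun h => he.1 (by rw [h])
  have hpos : 0 < a w := lt_of_le_of_ne (ha w) (Ne.symm hne)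
  set S := ∑ w, a w with hS
  have hSpos : 0 ≤ S := Finset.sum_nonneg fun w _ => ha w
  -- Small enough for all points below to stay in `P`. The point of the edge at parameter `t * s` is
  -- the midpoint of a move along `w` alone and a move along the remaining directions; extremality
  -- puts the first on the edge, so `w` lies on the ray through `u`.
  set t := 1 / (2 * (s + S + 1)) with ht
  have htpos : 0 < t := by positivity
  have htS : 2 * t * (s + S + 1) = 1 := by rw [ht]; field_simp
  have h1 := add_comb_mem hc hx v (Pi.single w (2 * t * a w))
    (fun u => by
      by_cases huw : u = w
      · subst huw; rw [Pi.single_eq_same]; positivity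
      · rw [Pi.single_eq_of_ne huw])
    (by
      rw [Finset.sum_pi_single']
      simp only [Finset.mem_univ, if_true]
      have := Finset.single_le_sum (fun i _ => ha i) (Finset.mem_univ w)
      nlinarith)
  have h2 := add_comb_mem hc hx v (fun u => if u = w then 0 else 2 * t * a u)
    (fun u => by
      split_ifs
      exacts [le_rfl, by have := ha u; positivity])
    (by
      calc _ ≤ ∑ u, 2 * t * a u := Finset.sum_le_sum fun u _ => by
            split_ifs
            exacts [by have := ha u; positivity, le_rfl]
        _ ≤ 1 := by rw [← Finset.mul_sum]; nlinarith)
  have e1 : ∑ u, (Pi.single w (2 * t * a w) : V → ℝ) u • (x u - x v) =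
      (2 * t * a w) • (x w - x v) := by
    rw [Finset.sum_eq_single w]
    · simp
    · intro b _ hb; simp [hb]
    · simp
  have e2 : ∑ u, (if u = w then 0 else 2 * t * a u) • (x u - x v) =
      (2 * t * s) • (x u - x v) - (2 * t * a w) • (x w - x v) := by
    rw [mul_smul _ s, h, Finset.smul_sum, eq_sub_iff_add_eq,
      ← Finset.add_sum_erase _ _ (Finset.mem_univ w),
      ← Finset.add_sum_erase _ (fun i => (2 * t) • a i • (x i - x v)) (Finset.mem_univ w)]
    simp only [if_true, zero_smul, zero_add, smul_smul]
    rw [add_comm]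
    congr 1
    refine Finset.sum_congr rfl fun i hi => ?_
    rw [if_neg (Finset.ne_of_mem_erase hi)]
  rw [e1] at h1
  rw [e2] at h2
  have hz : x v + (t * s) • (x u - x v) ∈ segment ℝ (x v) (x u) := by
    refine ⟨1 - t * s, t * s, by nlinarith, by positivity, by ring, ?_⟩
    module
  have hmem := he.2.left_mem_of_mem_openSegment h1 h2 hz
    ⟨1 / 2, 1 / 2, by norm_num, by norm_num, by norm_num, by module⟩
  obtain ⟨α, β, hα, hβ, hαβ, hseg⟩ := hmem
  have hk : 0 < 2 * t * a w := by positivity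
  have : x w - x v = (β / (2 * t * a w)) • (x u - x v) := by
    have e3 : (2 * t * a w) • (x w - x v) = β • (x u - x v) := by
      obtain rfl : α = 1 - β := by linarith
      rw [← sub_eq_zero] at hseg ⊢
      rw [← neg_eq_zero, ← hseg]
      module
    rw [div_eq_inv_mul, mul_smul, ← e3, smul_smul, inv_mul_cancel₀ hk.ne', one_smul]
  exact hwu (ray_unique hc hinj hx huv (div_nonneg hβ hk.le) this hwv)

include hc hinj hx in
-- A direction that cannot be dropped from a set generating the cone at `v` spans an extreme ray, so
-- the segment to `u` is an edge.
theorem exists_edge_cone_aux (v : V) (U : Finset V) (hvU : v ∉ U)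
    (hgen : ∀ y ∈ P, ∃ a : V → ℝ, (∀ u, 0 ≤ a u) ∧ (∀ u ∉ U, a u = 0) ∧
      y - x v = ∑ u, a u • (x u - x v)) (u : V) (hu : u ∈ U)
    (hmin : ∀ b : V → ℝ, (∀ w, 0 ≤ b w) → (∀ w ∉ U, b w = 0) → b u = 0 →
      x u - x v ≠ ∑ w, b w • (x w - x v)) : IsEdge P (x v) (x u) := by
  classical
  have huv : u ≠ v := fun h => hvU (h ▸ hu)
  refine ⟨fun h => huv (hinj h).symm, ?_, ?_⟩
  · exact hc.segment_subset (vertex_mem hx v) (vertex_mem hx u)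
  intro y₁ hy₁ y₂ hy₂ z hz hz'
  obtain ⟨a₁, ha₁, hU₁, h₁⟩ := hgen y₁ hy₁
  obtain ⟨a₂, ha₂, hU₂, h₂⟩ := hgen y₂ hy₂
  obtain ⟨α, β, hα, hβ, hαβ, rfl⟩ := hz'
  obtain ⟨s, t, hs, ht, hst, hzt⟩ := hz
  have hzt' : t • (x u - x v) = ∑ w, (α * a₁ w + β * a₂ w) • (x w - x v) := by
    have : t • (x u - x v) = α • (y₁ - x v) + β • (y₂ - x v) := by
      have hv : x v = s • x v + t • x v := by rw [← add_smul, hst, one_smul]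
      have hv' : x v = α • x v + β • x v := by rw [← add_smul, hαβ, one_smul]
      calc t • (x u - x v) = (s • x v + t • x u) - (s • x v + t • x v) := by module
        _ = (α • y₁ + β • y₂) - (α • x v + β • x v) := by rw [hzt, ← hv, ← hv']
        _ = _ := by module
    rw [this, h₁, h₂, Finset.smul_sum, Finset.smul_sum, ← Finset.sum_add_distrib]
    refine Finset.sum_congr rfl fun w _ => ?_
    rw [add_smul, mul_smul, mul_smul]
  have hb : ∀ w, 0 ≤ α * a₁ w + β * a₂ w := fun w =>
    add_nonneg (mul_nonneg hα.le (ha₁ w)) (mul_nonneg hβ.le (ha₂ w))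
  have hsplit : ∀ k : ℝ, ∑ w, (if w = u then k else α * a₁ w + β * a₂ w) • (x w - x v) =
      t • (x u - x v) + (k - (α * a₁ u + β * a₂ u)) • (x u - x v) := by
    intro k
    rw [hzt', ← Finset.add_sum_erase _ _ (Finset.mem_univ u),
      ← Finset.add_sum_erase _ (fun w => (α * a₁ w + β * a₂ w) • (x w - x v)) (Finset.mem_univ u)]
    rw [Finset.sum_congr rfl (g := fun w => (α * a₁ w + β * a₂ w) • (x w - x v))
      (fun w hw => by rw [if_neg (Finset.ne_of_mem_erase hw)])]
    simp only [if_true]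
    module
  -- Otherwise one could solve for the direction of `u` in terms of the other generators, against
  -- irredundancy.
  have hlt : t ≤ α * a₁ u + β * a₂ u := by
    by_contra! hlt
    have hk : 0 < t - (α * a₁ u + β * a₂ u) := sub_pos.2 hlt
    refine hmin (fun w => (t - (α * a₁ u + β * a₂ u))⁻¹ *
      (if w = u then 0 else α * a₁ w + β * a₂ w)) (fun w => ?_) (fun w hw => ?_) (by simp) ?_
    · have := hb w
      split_ifs <;> positivity
    · have : w ≠ u := fun h => hw (h ▸ hu)
      simp [this, hU₁ w hw, hU₂ w hw]
    · have := hsplit 0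
      simp only [mul_smul, ← Finset.smul_sum]
      rw [this, eq_inv_smul_iff₀ hk.ne']
      module
  -- Moving the direction of `u` to one side leaves a nonnegative combination equal to zero, so all
  -- other coefficients vanish since `v` is extreme.
  have hzero : ∀ w, w ≠ u → a₁ w = 0 := by
    intro w hw
    by_cases hwv : w = v
    · exact hU₁ w (hwv ▸ hvU)
    have := pos_comb hc hinj hx v (fun w => if w = u then (α * a₁ u + β * a₂ u) - t
      else α * a₁ w + β * a₂ w) (fun w _ => by
        split_ifs
        exacts [sub_nonneg.2 hlt, hb w]) (by rw [hsplit]; module) w hwv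
    simp only [hw, if_false] at this
    have h0 := mul_nonneg hα.le (ha₁ w)
    have h0' := mul_nonneg hβ.le (ha₂ w)
    have : α * a₁ w = 0 := by linarith
    exact (mul_eq_zero.1 this).resolve_left hα.ne'
  have hy : y₁ - x v = a₁ u • (x u - x v) := by
    rw [h₁, Finset.sum_eq_single u (fun w _ hw => by rw [hzero w hw, zero_smul]) (by simp)]
  have hle : a₁ u ≤ 1 := by
    by_contra! h1
    have hc0 : a₁ u ≠ 0 := by linarith
    have hy' : y₁ = x v + a₁ u • (x u - x v) := by rw [← hy]; abel
    have := vertex_extreme hx u (vertex_mem hx v) hy₁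
      ⟨1 - (a₁ u)⁻¹, (a₁ u)⁻¹, by have := inv_lt_one_of_one_lt₀ h1; linarith,
        by positivity, by ring, by
        rw [hy', smul_add, smul_smul, inv_mul_cancel₀ hc0, sub_smul]; module⟩
    exact huv (hinj this.symm)
  refine ⟨1 - a₁ u, a₁ u, by linarith, ha₁ u, by ring, ?_⟩
  have hy' : y₁ = x v + a₁ u • (x u - x v) := by rw [← hy]; abel
  rw [hy']
  module

include hc hinj hx in
/-- A polytope lies in the cone spanned at a vertex by the edges issuing from it. -/
theorem exists_edge_cone (hk : IsCompact P) (v : V) (y : E3) (hy : y ∈ P) :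
    ∃ a : V → ℝ, (∀ u, 0 ≤ a u) ∧ (∀ u, a u ≠ 0 → IsEdge P (x v) (x u)) ∧
      y - x v = ∑ u, a u • (x u - x v) := by
  classical
  let S : Set (Finset V) := {U | v ∉ U ∧ ∀ y ∈ P, ∃ a : V → ℝ, (∀ u, 0 ≤ a u) ∧
    (∀ u ∉ U, a u = 0) ∧ y - x v = ∑ u, a u • (x u - x v)}
  have hne : S.Nonempty := by
    refine ⟨Finset.univ.erase v, by simp, fun y hy => ?_⟩
    rw [eq_convexHull_of_extremePoints hc hk hx] at hy
    obtain ⟨w, h1, h2, h3⟩ := exists_weights y hy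
    refine ⟨fun u => if u = v then 0 else w u, fun u => ?_, fun u hu => ?_, ?_⟩
    · dsimp only
      split_ifs
      exacts [le_rfl, h1 u]
    · have : u = v := by simpa using hu
      simp [this]
    · rw [← h3]
      have : ∀ u, (if u = v then 0 else w u) • (x u - x v) = w u • (x u - x v) := by
        intro u
        split_ifs with h
        · rw [h]; simp
        · rfl
      simp only [this, smul_sub, Finset.sum_sub_distrib, ← Finset.sum_smul, h2, one_smul]
  -- In a minimal generating set of directions no direction is redundant, so each is an edge.
  obtain ⟨U, ⟨hvU, hgen⟩, hmin⟩ := (toFinite S).exists_minimal hne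
  obtain ⟨a, ha, haU, hya⟩ := hgen y hy
  refine ⟨a, ha, fun u hu => ?_, hya⟩
  have huU : u ∈ U := by
    by_contra h
    exact hu (haU u h)
  refine exists_edge_cone_aux hc hinj hx v U hvU hgen u huU fun b hb hbU hbu heq => ?_
  have hmem : U.erase u ∈ S := by
    refine ⟨fun h => hvU (Finset.mem_of_mem_erase h), fun y hy => ?_⟩
    obtain ⟨a, ha, haU, hya⟩ := hgen y hy
    refine ⟨fun w => (if w = u then 0 else a w) + a u * b w, fun w => ?_, fun w hw => ?_, ?_⟩
    · have h1 := ha w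
      have h2 := mul_nonneg (ha u) (hb w)
      dsimp only
      split_ifs <;> linarith
    · by_cases hwu : w = u
      · simp [hwu, hbu]
      · have : w ∉ U := fun h => hw (Finset.mem_erase.2 ⟨hwu, h⟩)
        simp [hwu, haU w this, hbU w this]
    · simp only [add_smul, Finset.sum_add_distrib, mul_smul, ← Finset.smul_sum]
      rw [← heq, hya, ← Finset.add_sum_erase _ _ (Finset.mem_univ u),
        ← Finset.add_sum_erase _ (fun w => (if w = u then 0 else a w) • (x w - x v))
          (Finset.mem_univ u)]
      rw [Finset.sum_congr rfl (g := fun w => (if w = u then 0 else a w) • (x w - x v))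
        (fun w hw => by rw [if_neg (Finset.ne_of_mem_erase hw)])]
      simp only [if_true, zero_smul, zero_add]
      abel
  have := hmin hmem (Finset.erase_subset u U)
  exact Finset.notMem_erase u U (this huU)

include hc hinj hx in
/-- At most three vertices are affinely independent. -/
theorem affine_indep (s : Finset V) (hs : s.card ≤ 3) (τ : V → ℝ) (hτ : ∀ v ∉ s, τ v = 0)
    (h0 : ∑ v, τ v = 0) (h1 : ∑ v, τ v • x v = 0) : τ = 0 := by
  classical
  rcases isEmpty_or_nonempty V with hV | hV
  · exact Subsingleton.elim _ _
  have key : ∀ τ : V → ℝ, (∀ v ∉ s, τ v = 0) → ∑ v, τ v = 0 → ∑ v, τ v • x v = 0 →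
      ∀ i₀, (∀ i ∈ s, i ≠ i₀ → 0 ≤ τ i) → τ = 0 := by
    intro τ hτ h0 h1 i₀ hi
    have hz : ∀ u, u ≠ i₀ → τ u = 0 := by
      refine pos_comb hc hinj hx i₀ τ (fun u hu => ?_) ?_
      · by_cases hus : u ∈ s
        exacts [hi u hus hu, (hτ u hus).ge]
      · simp only [smul_sub, Finset.sum_sub_distrib, h1, ← Finset.sum_smul, h0]
        simp
    ext u
    by_cases hu : u = i₀
    · rw [Finset.sum_eq_single i₀ (fun u _ hu => hz u hu) (by simp)] at h0
      rw [hu, h0]; rfl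
    · exact hz u hu
  obtain ⟨i₀, h | h⟩ := exists_sign_index s hs τ
  · exact key τ hτ h0 h1 i₀ h
  · have := key (-τ) (fun v hv => by simp [hτ v hv]) (by simp [h0]) (by simp [h1]) i₀
      (fun i hi hne => by simpa using h i hi hne)
    exact neg_eq_zero.1 this

include hc hinj hx in
/-- At most three edge directions at a vertex are linearly independent. -/
theorem edges_indep (v : V) (s : Finset V) (hs : s.card ≤ 3) (τ : V → ℝ)
    (hτ : ∀ v ∉ s, τ v = 0) (he : ∀ u ∈ s, IsEdge P (x v) (x u))
    (h1 : ∑ u, τ u • (x u - x v) = 0) : τ = 0 := by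
  classical
  have hvs : v ∉ s := fun h => (he v h).1 rfl
  have key : ∀ τ : V → ℝ, (∀ v ∉ s, τ v = 0) → ∑ u, τ u • (x u - x v) = 0 →
      ∀ i₀, (∀ i ∈ s, i ≠ i₀ → 0 ≤ τ i) → τ = 0 := by
    intro τ hτ h1 i₀ hi
    have hnn : ∀ u, u ≠ i₀ → 0 ≤ τ u := fun u hu => by
      by_cases hus : u ∈ s
      exacts [hi u hus hu, (hτ u hus).ge]
    have hfin : (∀ u, u ≠ v → τ u = 0) → τ = 0 := fun h => by
      ext u
      by_cases hu : u = v
      exacts [hτ u (hu ▸ hvs), h u hu]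
    by_cases h0 : 0 ≤ τ i₀
    · refine hfin (pos_comb hc hinj hx v τ (fun u _ => ?_) h1)
      by_cases hu : u = i₀
      exacts [hu ▸ h0, hnn u hu]
    · push Not at h0
      have hi₀ : i₀ ∈ s := by
        by_contra h
        rw [hτ _ h] at h0
        exact lt_irrefl _ h0
      -- The one negative term moves to the other side, expressing an edge direction as a
      -- nonnegative combination of others.
      have hz : ∀ w, w ≠ v → w ≠ i₀ → τ w = 0 := by
        intro w hwv hw
        have := edge_comb hc hinj hx (he i₀ hi₀) (neg_nonneg.2 h0.le)
          (fun w => if w = i₀ then 0 else τ w) (fun w => by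
            split_ifs with h
            exacts [le_rfl, hnn w h]) (by
          rw [← Finset.add_sum_erase _ _ (Finset.mem_univ i₀)] at h1 ⊢
          rw [Finset.sum_congr rfl (g := fun w => τ w • (x w - x v))
            (fun w hw => by rw [if_neg (Finset.ne_of_mem_erase hw)])]
          simp only [if_true, zero_smul, zero_add]
          rw [neg_smul]
          exact neg_eq_of_add_eq_zero_right h1) w hwv hw
        simpa [hw] using this
      refine hfin fun u hu => ?_
      by_cases hui : u = i₀
      · rw [Finset.sum_eq_single i₀ (fun w _ hw => ?_) (by simp)] at h1
        · rw [hui]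
          refine (smul_eq_zero.1 h1).resolve_right fun h => ?_
          exact (he i₀ hi₀).1 (sub_eq_zero.1 h).symm
        · by_cases hwv : w = v
          · rw [hwv, hτ v hvs, zero_smul]
          · rw [hz w hwv hw, zero_smul]
      · exact hz u hu hui
  have : Nonempty V := ⟨v⟩
  obtain ⟨i₀, h | h⟩ := exists_sign_index s hs τ
  · exact key τ hτ h1 i₀ h
  · have := key (-τ) (fun v hv => by simp [hτ v hv]) (by simp [h1]) i₀
      (fun i hi hne => by simpa using h i hi hne)
    exact neg_eq_zero.1 this

end Vertices

end HypPoly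

namespace HypPoly

/-! ### Linear algebra in three-space -/

theorem finrank_E3 : Module.finrank ℝ E3 = 3 := by simp

/-- Two vectors orthogonal to two independent vectors of three-space are parallel. -/
theorem parallel_of_orthogonal {n n' z r : E3} (hn : LinearIndependent ℝ ![n, n'])
    (h1 : ⟪n, z⟫ = 0) (h2 : ⟪n', z⟫ = 0) (h3 : ⟪n, r⟫ = 0) (h4 : ⟪n', r⟫ = 0) (hr : r ≠ 0) :
    ∃ β : ℝ, z = β • r := by
  set K := Submodule.span ℝ (range ![n, n']) with hK
  have hmem : ∀ y : E3, ⟪n, y⟫ = 0 → ⟪n', y⟫ = 0 → y ∈ Kᗮ := by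
    intro y hy hy'
    rw [Submodule.mem_orthogonal]
    intro u hu
    induction hu using Submodule.span_induction with
    | mem u hu =>
      obtain ⟨i, rfl⟩ := hu
      fin_cases i
      exacts [hy, hy']
    | zero => simp
    | add u v _ _ hu hv => rw [inner_add_left, hu, hv, add_zero]
    | smul c u _ hu => rw [inner_smul_left, hu, mul_zero]
  have hdim : Module.finrank ℝ K = 2 := by
    rw [hK, finrank_span_eq_card hn]; rfl
  have hdim' : Module.finrank ℝ Kᗮ = 1 := by
    have := K.finrank_add_finrank_orthogonal
    rw [finrank_E3, hdim] at this
    omega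
  have hr' : (⟨r, hmem r h3 h4⟩ : Kᗮ) ≠ 0 := fun h => hr (congrArg Subtype.val h)
  obtain ⟨c, hc⟩ := (finrank_eq_one_iff_of_nonzero' _ hr').1 hdim' ⟨z, hmem z h1 h2⟩
  exact ⟨c, (congrArg Subtype.val hc).symm⟩

/-- A vector orthogonal to three independent vectors of three-space vanishes. -/
theorem eq_zero_of_orthogonal {r : Fin 3 → E3} (hr : LinearIndependent ℝ r) {n : E3}
    (h : ∀ i, ⟪n, r i⟫ = 0) : n = 0 := by
  have htop : Submodule.span ℝ (range r) = ⊤ :=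
    hr.span_eq_top_of_card_eq_finrank (by simp)
  have : ∀ y ∈ Submodule.span ℝ (range r), ⟪n, y⟫ = 0 := by
    intro y hy
    induction hy using Submodule.span_induction with
    | mem u hu => obtain ⟨i, rfl⟩ := hu; exact h i
    | zero => simp
    | add u v _ _ hu hv => rw [inner_add_right, hu, hv, add_zero]
    | smul c u _ hu => rw [inner_smul_right, hu, mul_zero]
  exact inner_self_eq_zero.1 (this n (htop ▸ Submodule.mem_top))

theorem exists_orthogonal_not_parallel (n r : E3) : ∃ y : E3, ⟪n, y⟫ = 0 ∧ ∀ c : ℝ, y ≠ c • r := by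
  by_contra! h
  have hle : (ℝ ∙ n)ᗮ ≤ ℝ ∙ r := by
    intro y hy
    obtain ⟨c, hc⟩ := h y (Submodule.mem_orthogonal_singleton_iff_inner_right.1 hy)
    exact Submodule.mem_span_singleton.2 ⟨c, hc.symm⟩
  have h1 := (ℝ ∙ n).finrank_add_finrank_orthogonal
  have h2 : Module.finrank ℝ (ℝ ∙ n) ≤ 1 := (finrank_span_le_card ({n} : Set E3)).trans (by simp)
  have h3 : Module.finrank ℝ (ℝ ∙ r) ≤ 1 := (finrank_span_le_card ({r} : Set E3)).trans (by simp)
  have h4 := Submodule.finrank_mono hle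
  rw [finrank_E3] at h1
  omega

theorem linearIndependent_of_inner {n n' y : E3} (hn : n ≠ 0) (h1 : ⟪n, y⟫ = 0)
    (h2 : ⟪n', y⟫ ≠ 0) : LinearIndependent ℝ ![n, n'] := by
  rw [LinearIndependent.pair_iff]
  intro s t hst
  have : t = 0 := by
    have h := congrArg (fun z => ⟪z, y⟫) hst
    simp only [inner_add_left, inner_smul_left, h1, mul_zero, zero_add, inner_zero_left] at h
    exact (mul_eq_zero.1 h).resolve_right h2
  subst this
  simp only [zero_smul, add_zero] at hst
  exact ⟨(smul_eq_zero.1 hst).resolve_right hn, rfl⟩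

/-! ### Marked polyhedra -/

/-- `x` marks the vertices of the compact polyhedron `body p` by the vertices of its graph `G`, and
every half space of the family touches it in at least three vertices. -/
structure IsMarked {V F : Type*} (G : SimpleGraph V) (p : F → HalfParam) (x : V → E3) : Prop where
  unit : ∀ f, ‖(p f).1‖ = 1
  compact : IsCompact (body p)
  skeleton : HasSkeleton G (body p) x
  three : ∀ f, ∃ u v w, u ≠ v ∧ u ≠ w ∧ v ≠ w ∧ x u ∈ wall (p f) ∧ x v ∈ wall (p f) ∧
    x w ∈ wall (p f)

theorem convex_halfSpace (h : HalfParam) : Convex ℝ (halfSpace h) := by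
  intro y hy z hz a b ha hb hab
  simp only [halfSpace, mem_ofPred_eq, inner_add_right, inner_smul_right] at *
  calc a * ⟪h.1, y⟫ + b * ⟪h.1, z⟫ ≤ a * h.2 + b * h.2 :=
        add_le_add (mul_le_mul_of_nonneg_left hy ha) (mul_le_mul_of_nonneg_left hz hb)
    _ = h.2 := by rw [← add_mul, hab, one_mul]

theorem convex_body {F : Type*} (p : F → HalfParam) : Convex ℝ (body p) :=
  (convex_ball 0 1).inter (convex_iInter fun f => convex_halfSpace (p f))

theorem mem_body_iff {F : Type*} {p : F → HalfParam} {y : E3} :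
    y ∈ body p ↔ ‖y‖ < 1 ∧ ∀ f, ⟪(p f).1, y⟫ ≤ (p f).2 := by
  simp [body, ball, halfSpace]

/-- A nonempty compact polyhedron in the ball is the intersection of its half spaces. -/
theorem mem_body_of_le {F : Type*} {p : F → HalfParam} (hk : IsCompact (body p))
    (hne : (body p).Nonempty) {y : E3} (hy : ∀ f, ⟪(p f).1, y⟫ ≤ (p f).2) : y ∈ body p := by
  set Q : Set E3 := ⋂ f, halfSpace (p f) with hQ
  have hconn : IsPreconnected Q := (convex_iInter fun f => convex_halfSpace (p f)).isPreconnected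
  have hyQ : y ∈ Q := mem_iInter.2 hy
  refine ⟨?_, hyQ⟩
  by_contra hyb
  obtain ⟨z, hz⟩ := hne
  -- The intersection `Q` of the half spaces is connected. Compactness makes its part in the ball
  -- closed as well as relatively open, so a point of `Q` outside the ball would disconnect it.
  obtain ⟨w, hw, hw1, hw2⟩ := hconn ball (body p)ᶜ Metric.isOpen_ball hk.isClosed.isOpen_compl
    (fun w hw => by
      by_cases h : w ∈ ball
      exacts [Or.inl h, Or.inr fun h' => h h'.1])
    ⟨z, hz.2, hz.1⟩ ⟨y, hyQ, fun h => hyb h.1⟩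
  exact hw2 ⟨hw1, hw⟩

theorem exists_perturb {F : Type*} [Finite F] {p : F → HalfParam} {z y : E3}
    (hz : ∀ f, ⟪(p f).1, z⟫ ≤ (p f).2) (hy : ∀ f, ⟪(p f).1, z⟫ = (p f).2 → ⟪(p f).1, y⟫ = 0) :
    ∃ ε : ℝ, 0 < ε ∧ (∀ f, ⟪(p f).1, z + ε • y⟫ ≤ (p f).2) ∧
      ∀ f, ⟪(p f).1, z - ε • y⟫ ≤ (p f).2 := by
  have key : ∀ᶠ ε in 𝓝 (0 : ℝ), ∀ f, ⟪(p f).1, z + ε • y⟫ ≤ (p f).2 ∧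
      ⟪(p f).1, z - ε • y⟫ ≤ (p f).2 := by
    rw [Filter.eventually_all]
    intro f
    rcases (hz f).eq_or_lt with h | h
    · refine Filter.Eventually.of_forall fun ε => ?_
      simp only [inner_add_right, inner_sub_right, inner_smul_right, hy f h, h]
      simp
    · have h1 : ∀ᶠ ε in 𝓝 (0 : ℝ), ⟪(p f).1, z + ε • y⟫ < (p f).2 :=
        ContinuousAt.eventually_lt (f := fun ε : ℝ => ⟪(p f).1, z + ε • y⟫) (by fun_prop)
          continuousAt_const (by simpa using h)
      have h2 : ∀ᶠ ε in 𝓝 (0 : ℝ), ⟪(p f).1, z - ε • y⟫ < (p f).2 :=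
        ContinuousAt.eventually_lt (f := fun ε : ℝ => ⟪(p f).1, z - ε • y⟫) (by fun_prop)
          continuousAt_const (by simpa using h)
      filter_upwards [h1, h2] with ε h1 h2
      exact ⟨h1.le, h2.le⟩
  obtain ⟨ε, hε, h0⟩ := ((key.filter_mono nhdsWithin_le_nhds).and
    (self_mem_nhdsWithin (a := (0 : ℝ)) (s := Ioi 0))).exists
  exact ⟨ε, h0, fun f => (hε f).1, fun f => (hε f).2⟩

/-- A point of the polyhedron on the line through two vertices lies between them. -/
theorem mem_segment_of_line {V : Type*} [Fintype V] {x : V → E3} {P : Set E3} (hinj : Function.Injective x)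
    (hx : range x = extremePoints ℝ P) {u v : V} (huv : u ≠ v) {y : E3} (hy : y ∈ P) {β : ℝ} (hβ : y - x u = β • (x v - x u)) : y ∈ segment ℝ (x u) (x v) := by
  have hy' : y = x u + β • (x v - x u) := by rw [← hβ]; abel
  rcases lt_or_ge β 0 with h0 | h0
  · have hk : 0 < 1 - β := by linarith
    have := vertex_extreme hx u hy (vertex_mem hx v)
      ⟨1 / (1 - β), -β / (1 - β), by positivity, div_pos (by linarith) hk, by field_simp; ring, by
        rw [hy']
        have e1 : (1 / (1 - β)) * (1 - β) = 1 := by field_simp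
        have e2 : -β / (1 - β) = 1 - 1 / (1 - β) := by field_simp; ring
        rw [e2]
        have : (1 / (1 - β)) • (x u + β • (x v - x u)) + (1 - 1 / (1 - β)) • x v =
          ((1 / (1 - β)) * (1 - β)) • x u + (1 - (1 / (1 - β)) * (1 - β)) • x v := by module
        rw [this, e1]; simp⟩
    rw [this]
    exact left_mem_segment ℝ _ _
  rcases le_or_gt β 1 with h1 | h1
  · exact ⟨1 - β, β, by linarith, h0, by ring, by rw [hy']; module⟩
  · have hc0 : β ≠ 0 := by linarith
    have := vertex_extreme hx v (vertex_mem hx u) hy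
      ⟨1 - β⁻¹, β⁻¹, by have := inv_lt_one_of_one_lt₀ h1; linarith, by positivity, by ring, by
        rw [hy', smul_add, smul_smul, inv_mul_cancel₀ hc0, sub_smul]; module⟩
    exact (huv (hinj this)).elim

theorem wall_of_openSegment {n : HalfParam} {y z w : E3} (hy : ⟪n.1, y⟫ ≤ n.2)
    (hz : ⟪n.1, z⟫ ≤ n.2) (hw : w ∈ openSegment ℝ y z) (hwn : w ∈ wall n) : y ∈ wall n := by
  obtain ⟨a, b, ha, hb, hab, rfl⟩ := hw
  have h : ⟪n.1, a • y + b • z⟫ = n.2 := hwn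
  rw [inner_add_right, inner_smul_right, inner_smul_right] at h
  refine le_antisymm hy ?_
  by_contra! hlt
  have h1 := mul_lt_mul_of_pos_left hlt ha
  have h2 := mul_le_mul_of_nonneg_left hz hb.le
  have : a * n.2 + b * n.2 = n.2 := by rw [← add_mul, hab, one_mul]
  linarith

/-- An edge of a polyhedron lies in two walls. -/
theorem exists_two_walls_of_isEdge {V F : Type*} [Finite F] {p : F → HalfParam} {x : V → E3}
    {P : Set E3} (hle : ∀ v f, ⟪(p f).1, x v⟫ ≤ (p f).2)
    (hmem : ∀ y, (∀ f, ⟪(p f).1, y⟫ ≤ (p f).2) → y ∈ P) {u v : V} (huv : IsEdge P (x u) (x v)) :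
    ∃ f f', p f ≠ p f' ∧ x u ∈ wall (p f) ∧ x v ∈ wall (p f) ∧ x u ∈ wall (p f') ∧
      x v ∈ wall (p f') := by
  by_contra! hall
  obtain ⟨n, hn⟩ : ∃ n : E3, ∀ f, x u ∈ wall (p f) → x v ∈ wall (p f) → (p f).1 = n := by
    by_cases hex : ∃ f, x u ∈ wall (p f) ∧ x v ∈ wall (p f)
    · obtain ⟨f, hf, hf'⟩ := hex
      refine ⟨(p f).1, fun g hg hg' => ?_⟩
      by_contra hne
      exact hall f g (fun e => hne (by rw [e])) hf hf' hg hg'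
    · push Not at hex
      exact ⟨0, fun f hf hf' => (hex f hf hf').elim⟩
  -- With at most one wall through the edge, its midpoint can be moved both ways inside that wall
  -- and off the line of the edge, against extremality of the edge.
  obtain ⟨y, hy, hyr⟩ := exists_orthogonal_not_parallel n (x v - x u)
  set z := (1 / 2 : ℝ) • x u + (1 / 2 : ℝ) • x v with hz
  have hzin : ∀ f, ⟪(p f).1, z⟫ = 1 / 2 * ⟪(p f).1, x u⟫ + 1 / 2 * ⟪(p f).1, x v⟫ := fun f => by
    rw [hz, inner_add_right, inner_smul_right, inner_smul_right]
  have hact : ∀ f, ⟪(p f).1, z⟫ = (p f).2 → ⟪(p f).1, y⟫ = 0 := by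
    intro f hf
    have h1 := hle u f
    have h2 := hle v f
    rw [hzin] at hf
    rw [hn f (show ⟪(p f).1, x u⟫ = (p f).2 by linarith)
      (show ⟪(p f).1, x v⟫ = (p f).2 by linarith), hy]
  obtain ⟨ε, hε, h1, h2⟩ := exists_perturb (fun f => by
    have h1 := hle u f
    have h2 := hle v f
    rw [hzin]; linarith) hact
  have hmem := huv.2.left_mem_of_mem_openSegment (hmem _ h1)
    (hmem _ h2) (z := z) ⟨1 / 2, 1 / 2, by norm_num, by norm_num, by norm_num, rfl⟩
    ⟨1 / 2, 1 / 2, by norm_num, by norm_num, by norm_num, by module⟩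
  obtain ⟨a, b, -, -, hab, e⟩ := hmem
  obtain rfl : a = 1 - b := by linarith
  refine hyr (ε⁻¹ * (b - 1 / 2)) ?_
  have : ε • y = (b - 1 / 2) • (x v - x u) := by
    have e' : ε • y = ((1 - b) • x u + b • x v) - z := by rw [e]; abel
    rw [e', hz]
    module
  rw [mul_smul, ← this, smul_smul, inv_mul_cancel₀ hε.ne', one_smul]

/-! ### Vertices, edges and facets of a marked polyhedron -/

namespace IsMarked

variable {V F : Type*} [Fintype V] {G : SimpleGraph V} {p : F → HalfParam} {x : V → E3}

theorem inj (h : IsMarked G p x) : Function.Injective x := h.skeleton.1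

theorem range_eq (h : IsMarked G p x) : range x = extremePoints ℝ (body p) := h.skeleton.2.1

theorem adj_iff (h : IsMarked G p x) {u v : V} : G.Adj u v ↔ IsEdge (body p) (x u) (x v) :=
  h.skeleton.2.2 u v

theorem mem (h : IsMarked G p x) (v : V) : x v ∈ body p := vertex_mem h.range_eq v

theorem le (h : IsMarked G p x) (v : V) (f : F) : ⟪(p f).1, x v⟫ ≤ (p f).2 :=
  (mem_body_iff.1 (h.mem v)).2 f

theorem mem_body (h : IsMarked G p x) (v : V) {y : E3} (hy : ∀ f, ⟪(p f).1, y⟫ ≤ (p f).2) :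
    y ∈ body p := mem_body_of_le h.compact ⟨_, h.mem v⟩ hy

theorem normal_ne (h : IsMarked G p x) (f : F) : (p f).1 ≠ 0 := fun h0 => by
  have := h.unit f
  rw [h0, norm_zero] at this
  exact zero_ne_one this

theorem edge_cone (h : IsMarked G p x) (v : V) {y : E3} (hy : y ∈ body p) :
    ∃ a : V → ℝ, (∀ u, 0 ≤ a u) ∧ (∀ u, a u ≠ 0 → G.Adj v u) ∧
      y - x v = ∑ u, a u • (x u - x v) := by
  obtain ⟨a, h1, h2, h3⟩ := exists_edge_cone (convex_body p) h.inj h.range_eq h.compact v y hy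
  exact ⟨a, h1, fun u hu => h.adj_iff.2 (h2 u hu), h3⟩

theorem edges_not_coplanar (h : IsMarked G p x) {v : V} {u : Fin 3 → V}
    (hu : Function.Injective u) (hadj : ∀ i, G.Adj v (u i)) {n : E3}
    (hn : ∀ i, ⟪n, x (u i) - x v⟫ = 0) : n = 0 := by
  classical
  refine eq_zero_of_orthogonal (r := fun i => x (u i) - x v) ?_ hn
  rw [Fintype.linearIndependent_iff]
  intro g hg i
  have := edges_indep (convex_body p) h.inj h.range_eq v (Finset.univ.image u)
    (Finset.card_image_le.trans (by simp)) (Function.extend u g 0)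
    (fun w hw => by
      rw [Function.extend_apply']
      · rfl
      · rintro ⟨i, rfl⟩
        exact hw (Finset.mem_image_of_mem u (Finset.mem_univ i)))
    (fun w hw => by
      obtain ⟨i, -, rfl⟩ := Finset.mem_image.1 hw
      exact h.adj_iff.1 (hadj i))
    (by
      rw [← hg]
      symm
      refine Fintype.sum_of_injective u hu _ _ (fun w hw => ?_) (fun i => ?_)
      · rw [Function.extend_apply' _ _ _ (by simpa using hw)]
        simp
      · rw [hu.extend_apply])
  rw [← hu.extend_apply g 0 i, this]
  rfl

theorem exists_three_nbrs (hdeg : MinDegThree G) (v : V) :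
    ∃ u : Fin 3 → V, Function.Injective u ∧ ∀ i, G.Adj v (u i) := by
  obtain ⟨u₀, h₀, -⟩ := hdeg v v v
  obtain ⟨u₁, h₁, h₁₀, -⟩ := hdeg v u₀ u₀
  obtain ⟨u₂, h₂, h₂₀, h₂₁⟩ := hdeg v u₀ u₁
  refine ⟨![u₀, u₁, u₂], ?_, fun i => by fin_cases i <;> assumption⟩
  intro i j hij
  fin_cases i <;> fin_cases j <;> simp_all

/-- The vertices do not lie in one plane. -/
theorem exists_off_plane (h : IsMarked G p x) (hdeg : MinDegThree G) (v : V) {n : E3} (hn : n ≠ 0)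
    (c : ℝ) : ∃ w, ⟪n, x w⟫ ≠ c := by
  by_contra! hall
  obtain ⟨u, hu, hadj⟩ := exists_three_nbrs hdeg v
  exact hn (h.edges_not_coplanar hu hadj fun i => by rw [inner_sub_right, hall, hall, sub_self])

theorem not_collinear (h : IsMarked G p x) {u v w : V} (huv : u ≠ v) (huw : u ≠ w) (hvw : v ≠ w) :
    LinearIndependent ℝ ![x v - x u, x w - x u] := by
  classical
  rw [LinearIndependent.pair_iff]
  intro s t hst
  have := affine_indep (convex_body p) h.inj h.range_eq {u, v, w} Finset.card_le_three
    (Pi.single v s + Pi.single w t + Pi.single u (-(s + t)))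
    (fun i hi => by
      simp only [Finset.mem_insert, Finset.mem_singleton, not_or] at hi
      simp [hi.1, hi.2.1, hi.2.2])
    (by simp [Finset.sum_add_distrib])
    (by
      simp only [Pi.add_apply, add_smul, Finset.sum_add_distrib]
      simp only [Pi.single_apply, ite_smul, zero_smul, Finset.sum_ite_eq', Finset.mem_univ, if_true]
      rw [← hst]
      module)
  have h1 := congrFun this v
  have h2 := congrFun this w
  simp [huv.symm, hvw, hvw.symm, huw.symm] at h1 h2
  exact ⟨h1, h2⟩

/-- Parallel unit normals of two walls through a common point give equal or opposite half spaces.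
Opposite ones would squeeze the polyhedron into a plane. -/
theorem walls_indep (h : IsMarked G p x) (hdeg : MinDegThree G) {f f' : F} (hff : p f ≠ p f')
    {v : V} (hv : x v ∈ wall (p f)) (hv' : x v ∈ wall (p f')) :
    LinearIndependent ℝ ![(p f).1, (p f').1] := by
  rw [LinearIndependent.pair_iff' (h.normal_ne f)]
  intro a ha
  have hv2 : ⟪(p f).1, x v⟫ = (p f).2 := hv
  have hv2' : ⟪(p f').1, x v⟫ = (p f').2 := hv'
  have habs : |a| = 1 := by
    have := congrArg norm ha
    rwa [norm_smul, h.unit, h.unit, mul_one, Real.norm_eq_abs] at this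
  rw [← ha, inner_smul_left, hv2] at hv2'
  rcases (abs_eq zero_le_one).1 habs with rfl | rfl
  · exact hff (Prod.ext (by rw [← ha, one_smul]) (by rw [← hv2']; simp))
  · obtain ⟨w, hw⟩ := h.exists_off_plane hdeg v (h.normal_ne f) (p f).2
    have h1 := h.le w f
    have h2 := h.le w f'
    rw [← ha, inner_smul_left, ← hv2'] at h2
    simp only [map_neg, map_one, neg_mul, one_mul, neg_le_neg_iff] at h2
    exact hw (le_antisymm h1 h2)

theorem line_mem (h : IsMarked G p x) (hdeg : MinDegThree G) {f f' : F} (hff : p f ≠ p f')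
    {u v : V} (huv : u ≠ v) (hu : x u ∈ wall (p f)) (hu' : x u ∈ wall (p f'))
    (hv : x v ∈ wall (p f)) (hv' : x v ∈ wall (p f')) {y : E3} (hy : y ∈ wall (p f))
    (hy' : y ∈ wall (p f')) : ∃ β : ℝ, y - x u = β • (x v - x u) := by
  have hz : ∀ (n : HalfParam) (y z : E3), y ∈ wall n → z ∈ wall n → ⟪n.1, y - z⟫ = 0 := by
    intro n y z hy hz
    rw [inner_sub_right, show ⟪n.1, y⟫ = n.2 from hy, show ⟪n.1, z⟫ = n.2 from hz, sub_self]
  exact parallel_of_orthogonal (h.walls_indep hdeg hff hu hu') (hz _ _ _ hy hu) (hz _ _ _ hy' hu')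
    (hz _ _ _ hv hu) (hz _ _ _ hv' hu') (sub_ne_zero.2 fun e => huv (h.inj e).symm)

theorem three_common (h : IsMarked G p x) (hdeg : MinDegThree G) {f f' : F} {u v w : V}
    (huv : u ≠ v) (huw : u ≠ w) (hvw : v ≠ w) (hu : x u ∈ wall (p f)) (hv : x v ∈ wall (p f))
    (hw : x w ∈ wall (p f)) (hu' : x u ∈ wall (p f')) (hv' : x v ∈ wall (p f'))
    (hw' : x w ∈ wall (p f')) : p f = p f' := by
  by_contra hff
  obtain ⟨β, hβ⟩ := h.line_mem hdeg hff huv hu hu' hv hv' hw hw'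
  have := LinearIndependent.pair_iff.1 (h.not_collinear huv huw hvw) β (-1) (by rw [hβ]; module)
  norm_num at this

theorem adj_of_two_walls (h : IsMarked G p x) (hdeg : MinDegThree G) {f f' : F} (hff : p f ≠ p f')
    {u v : V} (huv : u ≠ v) (hu : x u ∈ wall (p f)) (hu' : x u ∈ wall (p f'))
    (hv : x v ∈ wall (p f)) (hv' : x v ∈ wall (p f')) : G.Adj u v := by
  rw [h.adj_iff]
  refine ⟨fun e => huv (h.inj e), (convex_body p).segment_subset (h.mem u) (h.mem v), ?_⟩
  intro y hy z hz w hw hw'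
  have hseg : ∀ n : HalfParam, x u ∈ wall n → x v ∈ wall n → w ∈ wall n := by
    intro n h1 h2
    obtain ⟨a, b, -, -, hab, rfl⟩ := hw
    change ⟪n.1, a • x u + b • x v⟫ = n.2
    rw [inner_add_right, inner_smul_right, inner_smul_right, show ⟪n.1, x u⟫ = n.2 from h1,
      show ⟪n.1, x v⟫ = n.2 from h2, ← add_mul, hab, one_mul]
  have hy2 := (mem_body_iff.1 hy).2
  have hz2 := (mem_body_iff.1 hz).2
  obtain ⟨β, hβ⟩ := h.line_mem hdeg hff huv hu hu' hv hv'
    (wall_of_openSegment (hy2 f) (hz2 f) hw' (hseg _ hu hv))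
    (wall_of_openSegment (hy2 f') (hz2 f') hw' (hseg _ hu' hv'))
  exact mem_segment_of_line h.inj h.range_eq huv hy hβ

/-- The walls through a vertex meet only there. -/
theorem normals_span [Finite F] (h : IsMarked G p x) (v : V) {y : E3}
    (hy : ∀ f, x v ∈ wall (p f) → ⟪(p f).1, y⟫ = 0) : y = 0 := by
  obtain ⟨ε, hε, h1, h2⟩ := exists_perturb (h.le v) hy
  have := vertex_extreme h.range_eq v (h.mem_body v h1) (h.mem_body v h2)
    ⟨1 / 2, 1 / 2, by norm_num, by norm_num, by norm_num, by module⟩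
  have : ε • y = 0 := by simpa using this
  exact (smul_eq_zero.1 this).resolve_left hε.ne'

theorem exists_wall_sep [Finite F] (h : IsMarked G p x) {u v : V} (huv : u ≠ v) :
    ∃ f, x v ∈ wall (p f) ∧ x u ∉ wall (p f) := by
  by_contra! hall
  have := h.normals_span v (y := x u - x v) fun f hf => by
    rw [inner_sub_right, show ⟪(p f).1, x v⟫ = (p f).2 from hf,
      show ⟪(p f).1, x u⟫ = (p f).2 from hall f hf, sub_self]
  exact huv (h.inj (sub_eq_zero.1 this))

theorem exists_two_walls [Finite F] (h : IsMarked G p x) {u v : V} (huv : G.Adj u v) :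
    ∃ f f', p f ≠ p f' ∧ x u ∈ wall (p f) ∧ x v ∈ wall (p f) ∧ x u ∈ wall (p f') ∧
      x v ∈ wall (p f') :=
  exists_two_walls_of_isEdge h.le (fun _ => h.mem_body u) (h.adj_iff.1 huv)

/-- In the cone of edges at `v`, the wall cuts out a face generated by the edges lying in the wall.
One edge would put all vertices of the wall on a single ray, and three edges at a vertex are never
coplanar. -/
theorem wall_nbrs (h : IsMarked G p x) (f : F) (v : V)
    (hv : x v ∈ wall (p f)) :
    ∃ u₁ u₂, u₁ ≠ u₂ ∧ ∀ u, (G.Adj v u ∧ x u ∈ wall (p f)) ↔ u = u₁ ∨ u = u₂ := by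
  classical
  have hv' : ⟪(p f).1, x v⟫ = (p f).2 := hv
  -- a vertex on the wall is a combination of neighbours on the wall
  have key : ∀ w, x w ∈ wall (p f) → ∃ a : V → ℝ, (∀ u, 0 ≤ a u) ∧
      (∀ u, a u ≠ 0 → G.Adj v u ∧ x u ∈ wall (p f)) ∧ x w - x v = ∑ u, a u • (x u - x v) := by
    intro w hw
    obtain ⟨a, h1, h2, h3⟩ := h.edge_cone v (h.mem w)
    refine ⟨a, h1, fun u hu => ⟨h2 u hu, ?_⟩, h3⟩
    have hs := congrArg (fun y => ⟪(p f).1, y⟫) h3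
    simp only [inner_sub_right, inner_sum, inner_smul_right] at hs
    rw [hv', show ⟪(p f).1, x w⟫ = (p f).2 from hw, sub_self] at hs
    have hz := (Finset.sum_eq_zero_iff_of_nonpos (fun u _ => mul_nonpos_of_nonneg_of_nonpos (h1 u)
      (sub_nonpos.2 (h.le u f)))).1 hs.symm u (Finset.mem_univ u)
    have := (mul_eq_zero.1 hz).resolve_left hu
    exact sub_eq_zero.1 this
  obtain ⟨w₁, w₂, hw₁v, hw₂v, hw₁₂, hw₁, hw₂⟩ : ∃ w₁ w₂, w₁ ≠ v ∧ w₂ ≠ v ∧ w₁ ≠ w₂ ∧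
      x w₁ ∈ wall (p f) ∧ x w₂ ∈ wall (p f) := by
    obtain ⟨a, b, c, hab, hac, hbc, ha, hb, hc⟩ := h.three f
    by_cases h1 : a = v
    · exact ⟨b, c, fun e => hab (h1.trans e.symm), fun e => hac (h1.trans e.symm), hbc, hb, hc⟩
    · by_cases h2 : b = v
      · exact ⟨a, c, h1, fun e => hbc (h2.trans e.symm), hac, ha, hc⟩
      · exact ⟨a, b, h1, h2, hab, ha, hb⟩
  have hne : ∀ w, w ≠ v → x w - x v ≠ 0 := fun w hw e => hw (h.inj (sub_eq_zero.1 e))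
  obtain ⟨u₁, hu₁⟩ : ∃ u, G.Adj v u ∧ x u ∈ wall (p f) := by
    obtain ⟨a, -, ha, hs⟩ := key w₁ hw₁
    by_contra! hall
    refine hne w₁ hw₁v (hs.trans (Finset.sum_eq_zero fun u _ => ?_))
    by_cases hu : a u = 0
    · rw [hu, zero_smul]
    · exact (hall u (ha u hu).1 (ha u hu).2).elim
  obtain ⟨u₂, hu₂, hne12⟩ : ∃ u, (G.Adj v u ∧ x u ∈ wall (p f)) ∧ u ≠ u₁ := by
    by_contra! hall
    have hray : ∀ w, w ≠ v → x w ∈ wall (p f) → w = u₁ := by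
      intro w hwv hw
      obtain ⟨a, ha0, ha, hs⟩ := key w hw
      rw [Finset.sum_eq_single u₁ (fun u _ hu => by
        by_cases h0 : a u = 0
        · rw [h0, zero_smul]
        · exact (hu (hall u (ha u h0))).elim) (by simp)] at hs
      exact ray_unique (convex_body p) h.inj h.range_eq hu₁.1.ne' (ha0 u₁) hs hwv
    exact hw₁₂ ((hray w₁ hw₁v hw₁).trans (hray w₂ hw₂v hw₂).symm)
  refine ⟨u₁, u₂, hne12.symm, fun u => ⟨fun hu => ?_, ?_⟩⟩
  · by_contra! hcon
    refine h.normal_ne f (h.edges_not_coplanar (v := v) (u := ![u₁, u₂, u]) ?_ ?_ ?_)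
    · intro i j hij
      have h1 := hcon.1.symm
      have h2 := hcon.2.symm
      fin_cases i <;> fin_cases j <;> simp_all
    · intro i
      fin_cases i
      exacts [hu₁.1, hu₂.1, hu.1]
    · intro i
      rw [inner_sub_right, hv', sub_eq_zero]
      fin_cases i
      exacts [hu₁.2, hu₂.2, hu.2]
  · rintro (rfl | rfl)
    exacts [hu₁, hu₂]

/-- From any vertex that does not maximise a linear functional some edge goes up. -/
theorem exists_improving (h : IsMarked G p x) {m : E3} {v w : V} (hvw : ⟪m, x v⟫ < ⟪m, x w⟫) :
    ∃ u, G.Adj v u ∧ ⟪m, x v⟫ < ⟪m, x u⟫ := by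
  by_contra! hall
  obtain ⟨a, h1, h2, h3⟩ := h.edge_cone v (h.mem w)
  have hs := congrArg (fun y => ⟪m, y⟫) h3
  simp only [inner_sub_right, inner_sum, inner_smul_right] at hs
  have : ∑ u, a u * (⟪m, x u⟫ - ⟪m, x v⟫) ≤ 0 := by
    refine Finset.sum_nonpos fun u _ => ?_
    by_cases hu : a u = 0
    · rw [hu, zero_mul]
    · exact mul_nonpos_of_nonneg_of_nonpos (h1 u) (sub_nonpos.2 (hall u (h2 u hu)))
  linarith

/-- The vertices above a level of an injective linear functional span a connected graph. -/
theorem upper_conn (h : IsMarked G p x) {m : E3} (hm : Function.Injective fun v => ⟪m, x v⟫)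
    {U : Set V} (hU : ∀ u v, u ∈ U → ⟪m, x u⟫ < ⟪m, x v⟫ → v ∈ U) (u v : V) (hu : u ∈ U)
    (hv : v ∈ U) : Relation.ReflTransGen (fun y z => G.Adj y z ∧ z ∈ U) u v := by
  let R : V → V → Prop := fun y z => G.Adj y z ∧ y ∈ U ∧ z ∈ U
  have hsymm : Std.Symm R := ⟨fun y z hyz => ⟨hyz.1.symm, hyz.2.2, hyz.2.1⟩⟩
  obtain ⟨w, -, hw⟩ := Set.exists_max_image (univ : Set V) (fun v => ⟪m, x v⟫) finite_univ
    ⟨u, mem_univ u⟩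
  have hreach : ∀ y ∈ U, Relation.ReflTransGen R y w := by
    by_contra! hB
    -- The simplex method: from the highest vertex of `U` not joined to the top, some edge goes up,
    -- and its end stays in `U` and is joined to the top.
    obtain ⟨y, ⟨hyU, hyw⟩, hmax⟩ := Set.exists_max_image {y | y ∈ U ∧ ¬ Relation.ReflTransGen R y w}
      (fun v => ⟪m, x v⟫) (toFinite _) hB
    have hne : y ≠ w := fun e => hyw (e ▸ Relation.ReflTransGen.refl)
    have hlt : ⟪m, x y⟫ < ⟪m, x w⟫ :=
      lt_of_le_of_ne (hw y (mem_univ y)) fun e => hne (hm e)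
    obtain ⟨z, hz, hyz⟩ := h.exists_improving hlt
    have hzU := hU y z hyU hyz
    by_cases hzw : Relation.ReflTransGen R z w
    · exact hyw (Relation.ReflTransGen.head ⟨hz, hyU, hzU⟩ hzw)
    · exact absurd (hmax z ⟨hzU, hzw⟩) (not_le.2 hyz)
  have huv : Relation.ReflTransGen R u v :=
    (hreach u hu).trans ((Relation.ReflTransGen.stdSymm (r := R)).symm _ _ (hreach v hv))
  have hle : R ≤ fun y z => G.Adj y z ∧ z ∈ U := fun y z hyz => ⟨hyz.1, hyz.2.2⟩
  exact Relation.ReflTransGen.mono hle _ _ huv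

/-- A slight tilt of the outer normal of the wall separates all vertices and still puts those on the
wall above the rest. So the facet is an upper set for this functional, and its complement one for
the negative; both are then connected. -/
theorem exists_generic (h : IsMarked G p x) (f : F) :
    ∃ m : E3, (Function.Injective fun v => ⟪m, x v⟫) ∧
      ∀ u v, x u ∈ wall (p f) → x v ∉ wall (p f) → ⟪m, x v⟫ < ⟪m, x u⟫ := by
  classical
  obtain ⟨g, hg⟩ : ∃ g : E3, ∀ u v, u ≠ v → ⟪g, x u - x v⟫ ≠ 0 := by
    obtain ⟨L, hL⟩ := Module.exists_dual_forall_apply_ne_zero (K := ℝ)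
      (fun e : {e : V × V // e.1 ≠ e.2} => x e.1.1 - x e.1.2)
      (fun e => sub_ne_zero.2 fun h' => e.2 (h.inj h'))
    refine ⟨(InnerProductSpace.toDual ℝ E3).symm (LinearMap.toContinuousLinearMap L),
      fun u v huv => ?_⟩
    rw [InnerProductSpace.toDual_symm_apply]
    exact hL ⟨(u, v), huv⟩
  set n := (p f).1 with hn
  have h1 : ∀ᶠ ε in 𝓝[>] (0 : ℝ), ∀ u v, x u ∈ wall (p f) → x v ∉ wall (p f) →
      ⟪n + ε • g, x v⟫ < ⟪n + ε • g, x u⟫ := by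
    simp only [Filter.eventually_all]
    intro u v hu hv
    refine Filter.Eventually.filter_mono nhdsWithin_le_nhds ?_
    refine ContinuousAt.eventually_lt (f := fun ε : ℝ => ⟪n + ε • g, x v⟫)
      (g := fun ε : ℝ => ⟪n + ε • g, x u⟫) (by fun_prop) (by fun_prop) ?_
    simp only [zero_smul, add_zero]
    rw [show ⟪n, x u⟫ = (p f).2 from hu]
    exact lt_of_le_of_ne (h.le v f) hv
  have h2 : ∀ᶠ ε in 𝓝[>] (0 : ℝ), ∀ u v, u ≠ v → ⟪n + ε • g, x u - x v⟫ ≠ 0 := by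
    simp only [Filter.eventually_all]
    intro u v huv
    by_cases h0 : ⟪n, x u - x v⟫ = 0
    · filter_upwards [self_mem_nhdsWithin] with ε hε
      rw [inner_add_left, h0, zero_add, inner_smul_left]
      exact mul_ne_zero (ne_of_gt (by simpa using hε)) (hg u v huv)
    · refine Filter.Eventually.filter_mono nhdsWithin_le_nhds ?_
      refine ContinuousAt.eventually_ne (g := fun ε : ℝ => ⟪n + ε • g, x u - x v⟫) (by fun_prop) ?_
      simpa using h0
  obtain ⟨ε, hε1, hε2⟩ := (h1.and h2).exists
  refine ⟨n + ε • g, fun u v huv => ?_, hε1⟩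
  by_contra hne
  refine hε2 u v hne ?_
  rw [inner_sub_right, sub_eq_zero]
  exact huv

/-- The vertex sets of the facets of a polyhedron. -/
def facet (p : F → HalfParam) (x : V → E3) (t : range p) : Set V := {v | x v ∈ wall t.1}

theorem facetSystem [Finite F] (h : IsMarked G p x) (hdeg : MinDegThree G) :
    FacetSystem G (facet p x) where
  two_nbrs := by
    rintro ⟨_, f, rfl⟩ v hv
    exact h.wall_nbrs f v hv
  compl_nonempty := by
    rintro ⟨_, f, rfl⟩
    obtain ⟨u, -⟩ := h.three f
    exact h.exists_off_plane hdeg u (h.normal_ne f) _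
  compl_conn := by
    rintro ⟨_, f, rfl⟩ u hu v hv
    obtain ⟨m, hm1, hm2⟩ := h.exists_generic f
    refine h.upper_conn (m := -m) (U := (facet p x ⟨_, f, rfl⟩)ᶜ) (fun a b hab => hm1 ?_) ?_ u v hu hv
    · simpa using hab
    · intro a b ha hab hb
      have := hm2 b a hb ha
      simp only [inner_neg_left] at hab
      linarith
  nonempty := by
    rintro ⟨_, f, rfl⟩
    obtain ⟨u, _, _, _, _, _, hu, _⟩ := h.three f
    exact ⟨u, hu⟩
  conn := by
    rintro ⟨_, f, rfl⟩ u hu v hv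
    obtain ⟨m, hm1, hm2⟩ := h.exists_generic f
    refine h.upper_conn (m := m) (U := facet p x ⟨_, f, rfl⟩) hm1 ?_ u v hu hv
    intro a b ha hab
    by_contra hb
    exact lt_asymm hab (hm2 a b ha hb)
  edge_two := by
    intro u v huv
    obtain ⟨f, f', hff, h1, h2, h3, h4⟩ := h.exists_two_walls huv
    exact ⟨⟨_, f, rfl⟩, ⟨_, f', rfl⟩, fun e => hff (congrArg Subtype.val e), h1, h2, h3, h4⟩
  three := by
    rintro ⟨_, f, rfl⟩ ⟨_, f', rfl⟩ u v w h1 h2 h3 hu hv hw hu' hv' hw'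
    exact Subtype.ext (h.three_common hdeg h1 h2 h3 hu hv hw hu' hv' hw')
  two := by
    rintro ⟨_, f, rfl⟩ ⟨_, f', rfl⟩ u v hff huv hu hv hu' hv'
    exact h.adj_of_two_walls hdeg (fun e => hff (Subtype.ext e)) huv hu hu' hv hv'
  sep := by
    intro u v huv
    obtain ⟨f, h1, h2⟩ := h.exists_wall_sep huv
    exact ⟨⟨_, f, rfl⟩, h1, h2⟩

end IsMarked

end HypPoly

/-! ### Strict realisations of a planar map -/

namespace HypPoly

variable {V : Type*} {G : SimpleGraph V}

/-- Points of hyperbolic space realising the incidences of `M` with the half spaces `p`. -/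
structure IsStrict (M : SphereEmbedding G) (p : M.Face → HalfParam) (x : V → E3) : Prop where
  unit : ∀ f, ‖(p f).1‖ = 1
  ball : ∀ v, ‖x v‖ < 1
  on : ∀ v f, M.OnFace v f → ⟪(p f).1, x v⟫ = (p f).2
  off : ∀ v f, ¬ M.OnFace v f → ⟪(p f).1, x v⟫ < (p f).2

namespace IsStrict

variable {M : SphereEmbedding G} {p : M.Face → HalfParam} {x : V → E3}

theorem le (h : IsStrict M p x) (v : V) (f : M.Face) : ⟪(p f).1, x v⟫ ≤ (p f).2 := by
  by_cases hf : M.OnFace v f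
  exacts [(h.on v f hf).le, (h.off v f hf).le]

theorem onFace_iff (h : IsStrict M p x) {v : V} {f : M.Face} : M.OnFace v f ↔ x v ∈ wall (p f) :=
  ⟨h.on v f, fun hv => by_contra fun hf => (h.off v f hf).ne hv⟩

theorem inner_eq_zero (h : IsStrict M p x) {u v : V} {f : M.Face} (hv : M.OnFace v f)
    (hu : M.OnFace u f) : ⟪(p f).1, x u - x v⟫ = 0 := by
  rw [inner_sub_right, h.on u f hu, h.on v f hv, sub_self]

theorem inner_neg (h : IsStrict M p x) {u v : V} {f : M.Face} (hv : M.OnFace v f)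
    (hu : ¬ M.OnFace u f) : ⟪(p f).1, x u - x v⟫ < 0 := by
  rw [inner_sub_right, h.on v f hv]
  linarith [h.off u f hu]

theorem inner_nonpos (h : IsStrict M p x) {u v : V} {f : M.Face} (hv : M.OnFace v f) :
    ⟪(p f).1, x u - x v⟫ ≤ 0 := by
  rw [inner_sub_right, h.on v f hv]
  linarith [h.le u f]

theorem normal_ne (h : IsStrict M p x) (f : M.Face) : (p f).1 ≠ 0 := fun h0 => by
  have := h.unit f
  rw [h0, norm_zero] at this
  exact zero_ne_one this

section Local

variable (hM : M.Polyhedral)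
include hM

/-- The only faces containing an edge are its two sides, so the following face around the vertex
excludes its other end. -/
theorem inner_rot_rot (h : IsStrict M p x) (d : G.Dart) :
    ⟪(p (M.face (M.rot (M.rot d)))).1, x d.snd - x d.fst⟫ < 0 := by
  have h1 : M.OnFace d.fst (M.face (M.rot (M.rot d))) := by
    have := M.onFace_fst (M.rot (M.rot d))
    rwa [M.rot_fst, M.rot_fst] at this
  refine h.inner_neg h1 fun h2 => ?_
  rcases hM.edge_faces d _ h1 h2 with e | e
  · exact hM.rot_rot_ne d (hM.dart_unique _ _ (by rw [M.rot_fst, M.rot_fst]) e)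
  · exact hM.rot_ne (M.rot d) (hM.dart_unique _ _ (by rw [M.rot_fst]) e)

theorem inner_rot_lt (h : IsStrict M p x) (d : G.Dart) :
    ⟪(p (M.face d)).1, x (M.rot d).snd - x d.fst⟫ < 0 := by
  refine h.inner_neg (M.onFace_fst d) fun h2 => ?_
  have h1 : M.OnFace (M.rot d).fst (M.face d) := by rw [M.rot_fst]; exact M.onFace_fst d
  rcases hM.edge_faces (M.rot d) _ h1 h2 with e | e
  · exact hM.rot_ne d (hM.dart_unique _ _ (by rw [M.rot_fst]) e).symm
  · exact hM.rot_rot_ne d (hM.dart_unique _ _ (by rw [M.rot_fst, M.rot_fst]) e).symm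

theorem edge_ne_zero (h : IsStrict M p x) (d : G.Dart) : x d.snd - x d.fst ≠ 0 := fun e => by
  have := h.inner_rot_rot hM d
  rw [e, inner_zero_right] at this
  exact lt_irrefl _ this

theorem normals_indep (h : IsStrict M p x) (d : G.Dart) :
    LinearIndependent ℝ ![(p (M.face d)).1, (p (M.face (M.rot d))).1] := by
  have e := h.inner_rot_rot hM (M.rot.symm d)
  rw [Equiv.apply_symm_apply] at e
  refine linearIndependent_of_inner (h.normal_ne _) (y := x (M.rot.symm d).snd -
    x (M.rot.symm d).fst) (h.inner_eq_zero ?_ ?_) e.ne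
  · have := M.onFace_fst_rot (M.rot.symm d)
    rwa [Equiv.apply_symm_apply] at this
  · have := M.onFace_snd_rot (M.rot.symm d)
    rwa [Equiv.apply_symm_apply] at this

/-- The walls of three consecutive faces at the vertex isolate the coefficients one after another:
the third sees only the first edge, the second only the last edge, and the first then gives the
middle coefficient. -/
theorem three_edges_indep (h : IsStrict M p x) (d : G.Dart) :
    LinearIndependent ℝ ![x d.snd - x d.fst, x (M.rot d).snd - x d.fst,
      x (M.rot (M.rot d)).snd - x d.fst] := by
  rw [Fintype.linearIndependent_iff]
  intro g hg
  rw [Fin.sum_univ_three] at hg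
  change g 0 • (x d.snd - x d.fst) + g 1 • (x (M.rot d).snd - x d.fst) +
    g 2 • (x (M.rot (M.rot d)).snd - x d.fst) = 0 at hg
  have f1 := M.rot_fst d
  have f2 := M.rot_fst (M.rot d)
  have a1 : ⟪(p (M.face (M.rot (M.rot d)))).1, x d.snd - x d.fst⟫ < 0 := h.inner_rot_rot hM d
  have a2 : ⟪(p (M.face (M.rot (M.rot d)))).1, x (M.rot d).snd - x d.fst⟫ = 0 := by
    have := h.inner_eq_zero (M.onFace_fst_rot (M.rot d)) (M.onFace_snd_rot (M.rot d))
    rwa [f1] at this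
  have a3 : ⟪(p (M.face (M.rot (M.rot d)))).1, x (M.rot (M.rot d)).snd - x d.fst⟫ = 0 := by
    have := h.inner_eq_zero (M.onFace_fst (M.rot (M.rot d))) (M.onFace_snd (M.rot (M.rot d)))
    rwa [f2, f1] at this
  have b1 : ⟪(p (M.face (M.rot d))).1, x d.snd - x d.fst⟫ = 0 :=
    h.inner_eq_zero (M.onFace_fst_rot d) (M.onFace_snd_rot d)
  have b2 : ⟪(p (M.face (M.rot d))).1, x (M.rot d).snd - x d.fst⟫ = 0 := by
    have := h.inner_eq_zero (M.onFace_fst (M.rot d)) (M.onFace_snd (M.rot d))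
    rwa [f1] at this
  have b3 : ⟪(p (M.face (M.rot d))).1, x (M.rot (M.rot d)).snd - x d.fst⟫ < 0 := by
    have := h.inner_rot_lt hM (M.rot d)
    rwa [f1] at this
  have c2 : ⟪(p (M.face d)).1, x (M.rot d).snd - x d.fst⟫ < 0 := h.inner_rot_lt hM d
  have g0 : g 0 = 0 := by
    have := congrArg (fun y => ⟪(p (M.face (M.rot (M.rot d)))).1, y⟫) hg
    simp only [inner_add_right, inner_smul_right, a2, a3, inner_zero_right, mul_zero,
      add_zero] at this
    exact (mul_eq_zero.1 this).resolve_right a1.ne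
  have g2 : g 2 = 0 := by
    have := congrArg (fun y => ⟪(p (M.face (M.rot d))).1, y⟫) hg
    simp only [inner_add_right, inner_smul_right, b1, b2, inner_zero_right, mul_zero, add_zero,
      zero_add] at this
    exact (mul_eq_zero.1 this).resolve_right b3.ne
  have g1 : g 1 = 0 := by
    have := congrArg (fun y => ⟪(p (M.face d)).1, y⟫) hg
    simp only [g0, g2, inner_add_right, inner_smul_right, inner_zero_right, zero_mul, add_zero,
      zero_add] at this
    exact (mul_eq_zero.1 this).resolve_right c2.ne
  intro i
  fin_cases i
  exacts [g0, g1, g2]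

/-- The three walls at consecutive edges of a vertex meet only there. -/
theorem eq_of_walls (h : IsStrict M p x) (d : G.Dart) {y : E3}
    (h0 : ⟪(p (M.face d)).1, y⟫ = 0) (h1 : ⟪(p (M.face (M.rot d))).1, y⟫ = 0)
    (h2 : ⟪(p (M.face (M.rot (M.rot d)))).1, y⟫ = 0) : y = 0 := by
  obtain ⟨β, hβ⟩ := parallel_of_orthogonal (h.normals_indep hM d) h0 h1
    (h.inner_eq_zero (M.onFace_fst d) (M.onFace_snd d))
    (h.inner_eq_zero (M.onFace_fst_rot d) (M.onFace_snd_rot d)) (h.edge_ne_zero hM d)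
  rw [hβ, inner_smul_right] at h2
  rw [hβ, (mul_eq_zero.1 h2).resolve_right (h.inner_rot_rot hM d).ne, zero_smul]

/-- A linear functional that decreases along the edges at a vertex decreases on the cone cut out
by the half spaces at that vertex. -/
theorem local_cone [Finite V] (h : IsStrict M p x) (v : V) {l y : E3}
    (hl : ∀ d : G.Dart, d.fst = v → ⟪l, x d.snd - x v⟫ ≤ 0)
    (hy : ∀ f, M.OnFace v f → ⟪(p f).1, y⟫ ≤ 0) : ⟪l, y⟫ ≤ 0 := by
  classical
  set D : Finset G.Dart := Finset.univ.filter fun d => d.fst = v with hD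
  have hmem : ∀ d, d ∈ D ↔ d.fst = v := fun d => by simp [hD]
  -- A functional positive on all edge directions at `v`, giving a cross-section of the cone in
  -- which extreme edges can be compared.
  set m : E3 := -∑ d ∈ D, (p (M.face d)).1 with hm
  have hin : ∀ z : E3, ⟪m, z⟫ = -∑ d ∈ D, ⟪(p (M.face d)).1, z⟫ := fun z => by
    rw [hm, inner_neg_left, sum_inner]
  have hpos : ∀ d ∈ D, 0 < ⟪m, x d.snd - x v⟫ := by
    intro d hd
    rw [hin, neg_pos]
    refine Finset.sum_neg' (fun e he => ?_) ⟨M.rot (M.rot d), ?_, ?_⟩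
    · have := M.onFace_fst e
      rw [(hmem e).1 he] at this
      exact h.inner_nonpos this
    · rw [hmem, M.rot_fst, M.rot_fst]
      exact (hmem d).1 hd
    · rw [← (hmem d).1 hd]
      exact h.inner_rot_rot hM d
  have hne : D.Nonempty := by
    obtain ⟨d, hd⟩ := hM.exists_dart v
    exact ⟨d, (hmem d).2 hd⟩
  -- At the edge maximising the ratio, `l - q • m` vanishes, and it is nonpositive along all the
  -- other edges. It is therefore a nonnegative combination of the normals of the two walls along
  -- that edge, which gives the inequality on the whole cone.
  obtain ⟨d, hdD, hmax⟩ := D.exists_max_image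
    (fun d => ⟪l, x d.snd - x v⟫ / ⟪m, x d.snd - x v⟫) hne
  obtain rfl := (hmem d).1 hdD
  set q : ℝ := ⟪l, x d.snd - x d.fst⟫ / ⟪m, x d.snd - x d.fst⟫ with hq
  have hq0 : q ≤ 0 := div_nonpos_of_nonpos_of_nonneg (hl d rfl) (hpos d hdD).le
  set l' : E3 := l - q • m with hl'
  have hl'in : ∀ z : E3, ⟪l', z⟫ = ⟪l, z⟫ - q * ⟪m, z⟫ := fun z => by
    rw [hl', inner_sub_left, inner_smul_left]; rfl
  have hl0 : ⟪l', x d.snd - x d.fst⟫ = 0 := by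
    rw [hl'in, hq, div_mul_cancel₀ _ (hpos d hdD).ne', sub_self]
  have hlD : ∀ e : G.Dart, e.fst = d.fst → ⟪l', x e.snd - x d.fst⟫ ≤ 0 := by
    intro e he
    have := hmax e ((hmem e).2 he)
    rw [div_le_iff₀ (hpos e ((hmem e).2 he))] at this
    rw [hl'in]
    linarith
  obtain ⟨c, hc⟩ := M.rot.surjective d
  have hcf : c.fst = d.fst := by rw [← hc, M.rot_fst]
  have hrf := M.rot_fst d
  have b0 := h.three_edges_indep hM c
  have i1 := h.inner_rot_lt hM d
  have i2 := h.inner_rot_rot hM c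
  have i3 := h.inner_eq_zero (M.onFace_fst_rot c) (M.onFace_snd_rot c)
  rw [hc, hcf] at b0 i2
  rw [hc, hcf] at i3
  set α := ⟪l', x (M.rot d).snd - x d.fst⟫ / ⟪(p (M.face d)).1, x (M.rot d).snd - x d.fst⟫ with hα
  set β := ⟪l', x c.snd - x d.fst⟫ / ⟪(p (M.face (M.rot d))).1, x c.snd - x d.fst⟫ with hβ
  -- Checked on the basis of three consecutive edges `c`, `d`, `rot d`: both normals vanish on `d`,
  -- and each of the other two edges is seen by just one of them.
  have hcomb : l' - α • (p (M.face d)).1 - β • (p (M.face (M.rot d))).1 = 0 := by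
    have hin' : ∀ z : E3, ⟪l' - α • (p (M.face d)).1 - β • (p (M.face (M.rot d))).1, z⟫ =
        ⟪l', z⟫ - α * ⟪(p (M.face d)).1, z⟫ - β * ⟪(p (M.face (M.rot d))).1, z⟫ := fun z => by
      rw [inner_sub_left, inner_sub_left, inner_smul_left, inner_smul_left]; rfl
    refine eq_zero_of_orthogonal b0 fun i => ?_
    rw [hin']
    fin_cases i
    · change _ - α * ⟪_, x c.snd - x d.fst⟫ - β * ⟪_, x c.snd - x d.fst⟫ = 0
      rw [i3, hβ, div_mul_cancel₀ _ i2.ne]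
      simp
    · change _ - α * ⟪_, x d.snd - x d.fst⟫ - β * ⟪_, x d.snd - x d.fst⟫ = 0
      rw [h.inner_eq_zero (M.onFace_fst d) (M.onFace_snd d),
        h.inner_eq_zero (M.onFace_fst_rot d) (M.onFace_snd_rot d)]
      change ⟪l', x d.snd - x d.fst⟫ - _ - _ = 0
      rw [hl0]; ring
    · change _ - α * ⟪_, x (M.rot d).snd - x d.fst⟫ - β * ⟪_, x (M.rot d).snd - x d.fst⟫ = 0
      have := h.inner_eq_zero (M.onFace_fst (M.rot d)) (M.onFace_snd (M.rot d))
      rw [hrf] at this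
      rw [this, hα, div_mul_cancel₀ _ i1.ne]
      simp
  have hα0 : 0 ≤ α := div_nonneg_of_nonpos (hlD _ hrf) i1.le
  have hβ0 : 0 ≤ β := div_nonneg_of_nonpos (hlD _ hcf) i2.le
  have e1 : ⟪l', y⟫ ≤ 0 := by
    have e : l' = α • (p (M.face d)).1 + β • (p (M.face (M.rot d))).1 := by
      rw [← sub_eq_zero, ← hcomb]; abel
    rw [e, inner_add_left, inner_smul_left, inner_smul_left]
    exact add_nonpos (mul_nonpos_of_nonneg_of_nonpos hα0 (hy _ (M.onFace_fst d)))
      (mul_nonpos_of_nonneg_of_nonpos hβ0 (hy _ (M.onFace_fst_rot d)))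
  have e2 : 0 ≤ ⟪m, y⟫ := by
    rw [hin, neg_nonneg]
    refine Finset.sum_nonpos fun e he => hy _ ?_
    rw [← (hmem e).1 he]
    exact M.onFace_fst e
  rw [hl'in] at e1
  have := mul_nonneg_of_nonpos_of_nonpos hq0 (neg_nonpos.2 e2)
  linarith

/-- Local convexity suffices. A functional separating a point of the half spaces from the hull of
the vertices is maximal at some vertex, hence decreases along its edges, and by the local cone lemma
is no larger anywhere in the half spaces. -/
theorem mem_convexHull [Finite V] (h : IsStrict M p x) {y : E3}
    (hy : ∀ f, ⟪(p f).1, y⟫ ≤ (p f).2) : y ∈ convexHull ℝ (range x) := by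
  by_contra hny
  have hne : Nonempty V := M.connected.nonempty
  obtain ⟨φ, u, hφ1, hφ2⟩ := geometric_hahn_banach_closed_point (convex_convexHull ℝ (range x))
    ((finite_range x).isClosed_convexHull ℝ) hny
  set l := (InnerProductSpace.toDual ℝ E3).symm φ with hl
  have hlφ : ∀ z, ⟪l, z⟫ = φ z := fun z => InnerProductSpace.toDual_symm_apply
  obtain ⟨v, -, hv⟩ := Set.exists_max_image (univ : Set V) (fun v => φ (x v)) finite_univ
    ⟨hne.some, mem_univ _⟩
  have := h.local_cone hM v (l := l) (y := y - x v) (fun d _ => by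
      rw [hlφ, map_sub]; linarith [hv d.snd (mem_univ _)]) (fun f hf => by
      rw [inner_sub_right, h.on v f hf]; linarith [hy f])
  rw [hlφ, map_sub] at this
  have := hφ1 (x v) (subset_convexHull ℝ _ (mem_range_self v))
  linarith

theorem body_eq [Finite V] (h : IsStrict M p x) : body p = convexHull ℝ (range x) := by
  refine Subset.antisymm (fun y hy => h.mem_convexHull hM (mem_body_iff.1 hy).2)
    (convexHull_min ?_ (convex_body p))
  rintro _ ⟨v, rfl⟩
  exact mem_body_iff.2 ⟨h.ball v, h.le v⟩

theorem range_eq [Finite V] (h : IsStrict M p x) : range x = extremePoints ℝ (body p) := by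
  refine Subset.antisymm ?_ ?_
  · rintro _ ⟨v, rfl⟩
    refine ⟨mem_body_iff.2 ⟨h.ball v, h.le v⟩, fun y hy z hz hv => ?_⟩
    obtain ⟨d, rfl⟩ := hM.exists_dart v
    have key : ∀ f, M.OnFace d.fst f → ⟪(p f).1, y - x d.fst⟫ = 0 := fun f hf => by
      have := wall_of_openSegment ((mem_body_iff.1 hy).2 f) ((mem_body_iff.1 hz).2 f) hv (h.on _ f hf)
      rw [inner_sub_right, h.on _ f hf, show ⟪(p f).1, y⟫ = (p f).2 from this, sub_self]
    refine sub_eq_zero.1 (h.eq_of_walls hM d (key _ (M.onFace_fst d)) (key _ (M.onFace_fst_rot d))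
      (key _ ?_))
    have := M.onFace_fst_rot (M.rot d)
    rwa [M.rot_fst] at this
  · rw [h.body_eq hM]
    exact extremePoints_convexHull_subset

theorem inj (h : IsStrict M p x) : Function.Injective x := by
  intro u v huv
  by_contra hne
  obtain ⟨f, h1, h2⟩ := hM.sep u v hne
  exact h2 (h.onFace_iff.2 (huv ▸ h.onFace_iff.1 h1))

theorem hasSkeleton [Finite V] (h : IsStrict M p x) : HasSkeleton G (body p) x := by
  have := Fintype.ofFinite V
  refine ⟨h.inj hM, h.range_eq hM, fun u v => ⟨fun huv => ?_, fun huv => ?_⟩⟩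
  · have hmem : ∀ w, x w ∈ body p := fun w => mem_body_iff.2 ⟨h.ball w, h.le w⟩
    let d : G.Dart := ⟨(u, v), huv⟩
    refine ⟨fun e => huv.ne (h.inj hM e), (convex_body p).segment_subset (hmem u) (hmem v), ?_⟩
    intro y hy z hz w hw hw'
    have hseg : ∀ f, M.OnFace u f → M.OnFace v f → ⟪(p f).1, y - x u⟫ = 0 := by
      intro f h1 h2
      have hwf : w ∈ wall (p f) := by
        obtain ⟨a, b, -, -, hab, rfl⟩ := hw
        change ⟪(p f).1, a • x u + b • x v⟫ = (p f).2
        rw [inner_add_right, inner_smul_right, inner_smul_right, h.on u f h1, h.on v f h2,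
          ← add_mul, hab, one_mul]
      have := wall_of_openSegment ((mem_body_iff.1 hy).2 f) ((mem_body_iff.1 hz).2 f) hw' hwf
      rw [inner_sub_right, h.on u f h1, show ⟪(p f).1, y⟫ = (p f).2 from this, sub_self]
    obtain ⟨β, hβ⟩ := parallel_of_orthogonal (h.normals_indep hM d)
      (hseg _ (M.onFace_fst d) (M.onFace_snd d)) (hseg _ (M.onFace_fst_rot d) (M.onFace_snd_rot d))
      (h.inner_eq_zero (M.onFace_fst d) (M.onFace_snd d))
      (h.inner_eq_zero (M.onFace_fst_rot d) (M.onFace_snd_rot d)) (h.edge_ne_zero hM d)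
    exact mem_segment_of_line (h.inj hM) (h.range_eq hM) huv.ne hy hβ
  · obtain ⟨f, f', hff, h1, h2, h3, h4⟩ := exists_two_walls_of_isEdge h.le (fun y hy => by
      rw [h.body_eq hM]; exact h.mem_convexHull hM hy) huv
    exact hM.two f f' u v (fun e => hff (by rw [e])) (fun e => huv.1 (by rw [e]))
      (h.onFace_iff.2 h1) (h.onFace_iff.2 h2) (h.onFace_iff.2 h3) (h.onFace_iff.2 h4)

/-- A strict realisation of a polyhedral map is a marked polyhedron. -/
theorem isMarked [Finite V] (h : IsStrict M p x) : IsMarked G p x where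
  unit := h.unit
  compact := by
    rw [h.body_eq hM]
    exact (finite_range x).isCompact_convexHull ℝ
  skeleton := h.hasSkeleton hM
  three := fun f => by
    obtain ⟨u, v, w, h1, h2, h3, hu, hv, hw⟩ := M.exists_three_onFace hM.rot_ne f
    exact ⟨u, v, w, h1, h2, h3, h.on u f hu, h.on v f hv, h.on w f hw⟩

theorem mem_polySpace [Finite V] (h : IsStrict M p x) : p ∈ polySpace M :=
  ⟨h.unit, (h.isMarked hM).compact, x, h.hasSkeleton hM, fun f v hv => h.on v f hv⟩

theorem injective [Finite V] (h : IsStrict M p x) : Function.Injective p := by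
  intro f f' hff
  obtain ⟨u, v, w, h1, h2, h3, hu, hv, hw⟩ := M.exists_three_onFace hM.rot_ne f
  refine hM.three f f' u v w h1 h2 h3 hu hv hw ?_ ?_ ?_ <;> rw [h.onFace_iff, ← hff] <;>
    rwa [← h.onFace_iff]

end Local

end IsStrict

theorem IsMarked.isTwoFace [Fintype V] {F : Type*} {p : F → HalfParam} {x : V → E3}
    (h : IsMarked G p x) (f : F) : IsTwoFace (body p) (body p ∩ wall (p f)) := by
  have hwall : Convex ℝ (wall (p f)) := by
    intro y hy z hz a b ha hb hab
    change ⟪(p f).1, a • y + b • z⟫ = (p f).2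
    rw [inner_add_right, inner_smul_right, inner_smul_right, show ⟪(p f).1, y⟫ = (p f).2 from hy,
      show ⟪(p f).1, z⟫ = (p f).2 from hz, ← add_mul, hab, one_mul]
  refine ⟨(convex_body p).inter hwall, ⟨inter_subset_left, ?_⟩, le_antisymm ?_ ?_⟩
  · intro y hy z hz w hw hw'
    exact ⟨hy, wall_of_openSegment ((mem_body_iff.1 hy).2 f) ((mem_body_iff.1 hz).2 f) hw' hw.2⟩
  · have hle : vectorSpan ℝ (body p ∩ wall (p f)) ≤ (ℝ ∙ (p f).1)ᗮ := by
      rw [vectorSpan_def, Submodule.span_le]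
      rintro _ ⟨y, hy, z, hz, rfl⟩
      refine Submodule.mem_orthogonal_singleton_iff_inner_right.2 ?_
      change ⟪(p f).1, y - z⟫ = 0
      rw [inner_sub_right, show ⟪(p f).1, y⟫ = (p f).2 from hy.2,
        show ⟪(p f).1, z⟫ = (p f).2 from hz.2, sub_self]
    have h1 := (ℝ ∙ (p f).1).finrank_add_finrank_orthogonal
    rw [finrank_span_singleton (h.normal_ne f), finrank_E3] at h1
    have := Submodule.finrank_mono hle
    omega
  · obtain ⟨u, v, w, h1, h2, h3, hu, hv, hw⟩ := h.three f
    have hle : Submodule.span ℝ (range ![x v - x u, x w - x u]) ≤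
        vectorSpan ℝ (body p ∩ wall (p f)) := by
      rw [Submodule.span_le]
      rintro _ ⟨i, rfl⟩
      fin_cases i
      · exact vsub_mem_vectorSpan ℝ ⟨h.mem v, hv⟩ ⟨h.mem u, hu⟩
      · exact vsub_mem_vectorSpan ℝ ⟨h.mem w, hw⟩ ⟨h.mem u, hu⟩
    have := Submodule.finrank_mono hle
    rw [finrank_span_eq_card (h.not_collinear h1 h2 h3)] at this
    simpa using this

theorem IsEdge.symm {P : Set E3} {x y : E3} (h : IsEdge P x y) : IsEdge P y x :=
  ⟨h.1.symm, by rw [segment_symm]; exact h.2⟩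

theorem isMarked_of_incident [Fintype V] {G₀ : SimpleGraph V} (M : SphereEmbedding G)
    (hr : ∀ d, M.rot d ≠ d) {p : M.Face → HalfParam} {x : V → E3} (hu : ∀ f, ‖(p f).1‖ = 1)
    (hc : IsCompact (body p)) (hs : HasSkeleton G₀ (body p) x) (hi : Incident M p x) :
    IsMarked G₀ p x :=
  ⟨hu, hc, hs, fun f => by
    obtain ⟨u, v, w, h1, h2, h3, hu, hv, hw⟩ := M.exists_three_onFace hr f
    exact ⟨u, v, w, h1, h2, h3, hi f u hu, hi f v hv, hi f w hw⟩⟩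

/-- Three vertices of the face determine its wall, so the facet found combinatorially is the half
space actually assigned to the face. -/
theorem facet_eq [Fintype V] {G₀ : SimpleGraph V} (M : SphereEmbedding G)
    (hr : ∀ d, M.rot d ≠ d) {p : M.Face → HalfParam} {x : V → E3} (h : IsMarked G₀ p x)
    (hdeg : MinDegThree G₀) (hi : Incident M p x) {ρ : M.Face → range p}
    (hρ : ∀ v f, M.OnFace v f → v ∈ IsMarked.facet p x (ρ f)) (f : M.Face) : (ρ f).1 = p f := by
  obtain ⟨u, v, w, h1, h2, h3, hu, hv, hw⟩ := M.exists_three_onFace hr f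
  obtain ⟨f', hf'⟩ := (ρ f).2
  rw [← hf']
  have key : ∀ v, M.OnFace v f → x v ∈ wall (p f') := fun v hv => hf' ▸ hρ v f hv
  exact h.three_common hdeg h1 h2 h3 (key u hu) (key v hv) (key w hw) (hi f u hu) (hi f v hv)
    (hi f w hw)

/-- Marked polyhedra with one-skeleton `G` are the strict realisations of `M`. -/
theorem exists_isStrict [Finite V] (M : SphereEmbedding G) (hdeg : MinDegThree G)
    {p : M.Face → HalfParam} (hp : p ∈ polySpace M) : M.Polyhedral ∧ ∃ x, IsStrict M p x := by
  have := Fintype.ofFinite V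
  obtain ⟨hu, hc, x, hs, hi⟩ := hp
  have hr := M.rot_ne_of_minDeg hdeg
  have h := isMarked_of_incident M hr hu hc hs hi
  obtain ⟨ρ, -, h2, h3⟩ := M.facet_bijection (h.facetSystem hdeg) hdeg
  have he := facet_eq M hr h hdeg hi fun v f hv => (h2 v f).1 hv
  refine ⟨h3, x, hu, fun v => (mem_body_iff.1 (h.mem v)).1, fun v f hv => hi f v hv,
    fun v f hv => lt_of_le_of_ne (h.le v f) fun e => hv ((h2 v f).2 ?_)⟩
  change x v ∈ wall (ρ f).1
  rw [he f]
  exact e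

/-- The vertices of a face. -/
def SphereEmbedding.verts (M : SphereEmbedding G) (f : M.Face) : Set V := {v | M.OnFace v f}

/-! ### Polyhedra with weak one-skeleton: strict or flat -/

section Weak

variable {G₀ : SimpleGraph V} {M : SphereEmbedding G} {M' : SphereEmbedding G₀} {d : G.Dart}
  {π : M.Face → M'.Face}

theorem SphereEmbedding.IsMerge.comp_equiv {ι : Type*} {T : ι → Set V}
    {ρ : M.Face → ι} (hρ : M.IsMerge d T ρ) (e : M'.Face ≃ ι)
    (hon : ∀ v t, M'.OnFace v t ↔ v ∈ T (e t)) : M.IsMerge d M'.verts fun f => e.symm (ρ f) where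
  mem v f hv := (hon v _).2 (by rw [e.apply_symm_apply]; exact hρ.mem v f hv)
  exists_face t v hv := by
    obtain ⟨f, hf, hvf⟩ := hρ.exists_face (e t) v ((hon v t).1 hv)
    exact ⟨f, by rw [hf, e.symm_apply_apply], hvf⟩
  eq_or f g hfg := hρ.eq_or f g (e.symm.injective hfg)
  same := congrArg e.symm hρ.same
  ne := hρ.ne
  inter := hρ.inter

theorem merge_surjective (hπ : M.IsMerge d M'.verts π) : Function.Surjective π := by
  intro t
  obtain ⟨e, rfl⟩ := M'.face_surjective t
  obtain ⟨f, hf, -⟩ := hπ.exists_face _ _ (M'.onFace_fst e)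
  exact ⟨f, hf⟩

theorem body_comp_merge (hπ : M.IsMerge d M'.verts π) (p' : M'.Face → HalfParam) :
    body (p' ∘ π) = body p' := by
  ext y
  rw [mem_body_iff, mem_body_iff]
  refine and_congr_right fun _ => ⟨fun h t => ?_, fun h f => h _⟩
  obtain ⟨f, rfl⟩ := merge_surjective hπ t
  exact h f

/-- A face shares three vertices with its image, and three vertices determine a face of `M'`. -/
theorem merge_unique (hr : ∀ d, M.rot d ≠ d) (hM' : M'.Polyhedral) {π' : M.Face → M'.Face}
    (hπ : M.IsMerge d M'.verts π) (hπ' : M.IsMerge d M'.verts π') : π = π' := by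
  funext f
  obtain ⟨u, v, w, h1, h2, h3, hu, hv, hw⟩ := M.exists_three_onFace hr f
  exact hM'.three _ _ u v w h1 h2 h3 (hπ.mem u f hu) (hπ.mem v f hv) (hπ.mem w f hw)
    (hπ'.mem u f hu) (hπ'.mem v f hv) (hπ'.mem w f hw)

theorem IsStrict.mem_weakPolySpace [Finite V] {p : M.Face → HalfParam} {x : V → E3}
    (h : IsStrict M p x) (hM : M.Polyhedral) (d : G.Dart) : p ∈ weakPolySpace M d.fst d.snd := by
  have := Fintype.ofFinite V
  have hm := h.isMarked hM
  refine ⟨h.unit, hm.compact, x, ⟨hm.inj, hm.range_eq, fun u v huv _ => hm.adj_iff.1 huv,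
    ⟨_, hm.isTwoFace (M.face d), ?_⟩, fun u v huv => hm.adj_iff.2 huv⟩, fun f v hv => h.on v f hv⟩
  exact (hm.isTwoFace (M.face d)).1.segment_subset ⟨hm.mem _, h.on _ _ (M.onFace_fst d)⟩
    ⟨hm.mem _, h.on _ _ (M.onFace_snd d)⟩

theorem IsStrict.comp_mem_weakPolySpace [Finite V] {p' : M'.Face → HalfParam} {x : V → E3}
    (h : IsStrict M' p' x) (hM' : M'.Polyhedral) (hπ : M.IsMerge d M'.verts π) (hle : G₀ ≤ G)
    (hG : ∀ u v, G.Adj u v → G₀.Adj u v ∨ s(u, v) = s(d.fst, d.snd)) :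
    p' ∘ π ∈ weakPolySpace M d.fst d.snd := by
  have := Fintype.ofFinite V
  have hm := h.isMarked hM'
  have hmem : ∀ v f, M.OnFace v f → x v ∈ wall (p' (π f)) := fun v f hv => h.on v _ (hπ.mem v f hv)
  have htf := hm.isTwoFace (π (M.face d))
  refine ⟨fun f => h.unit _, ?_, x, ?_, fun f v hv => hmem v f hv⟩ <;> rw [body_comp_merge hπ]
  · exact hm.compact
  · refine ⟨hm.inj, hm.range_eq, fun u v huv hne => hm.adj_iff.1 ((hG u v huv).resolve_right hne),
      ⟨_, htf, ?_⟩, fun u v huv => hle (hm.adj_iff.2 huv)⟩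
    exact htf.1.segment_subset ⟨hm.mem _, hmem _ _ (M.onFace_fst d)⟩
      ⟨hm.mem _, hmem _ _ (M.onFace_snd d)⟩

/-- A polyhedron with weak one-skeleton `(G, d)` has one-skeleton `G` or `G` without `d`. -/
theorem weak_cases [Finite V] (M' : SphereEmbedding G₀) (hle : G₀ ≤ G) (hdeg : MinDegThree G₀)
    (hd : ¬ G₀.Adj d.fst d.snd)
    (hG : ∀ u v, G.Adj u v → G₀.Adj u v ∨ s(u, v) = s(d.fst, d.snd)) {p : M.Face → HalfParam}
    (hp : p ∈ weakPolySpace M d.fst d.snd) :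
    p ∈ polySpace M ∨ M.Polyhedral ∧ ∃ (π : M.Face → M'.Face) (p' : M'.Face → HalfParam),
      M.IsMerge d M'.verts π ∧ p' ∈ polySpace M' ∧ p = p' ∘ π := by
  have := Fintype.ofFinite V
  obtain ⟨hu, hc, x, ⟨h1, h2, h3, -, h5⟩, hi⟩ := hp
  -- The only freedom in a weak skeleton is whether the special edge is an edge of the polyhedron.
  -- If not, the skeleton is `G₀` and the half spaces factor through the merging of faces.
  by_cases he : IsEdge (body p) (x d.fst) (x d.snd)
  · refine Or.inl ⟨hu, hc, x, ⟨h1, h2, fun u v => ⟨fun huv => ?_, h5 u v⟩⟩, hi⟩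
    by_cases hs : s(u, v) = s(d.fst, d.snd)
    · rcases Sym2.eq_iff.1 hs with ⟨rfl, rfl⟩ | ⟨rfl, rfl⟩
      exacts [he, he.symm]
    · exact h3 u v huv hs
  · right
    have hs : HasSkeleton G₀ (body p) x := by
      refine ⟨h1, h2, fun u v => ⟨fun huv => h3 u v (hle huv) fun hs => ?_, fun huv => ?_⟩⟩
      · rcases Sym2.eq_iff.1 hs with ⟨rfl, rfl⟩ | ⟨rfl, rfl⟩
        exacts [hd huv, hd huv.symm]
      · refine (hG u v (h5 u v huv)).resolve_right fun hs => he ?_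
        rcases Sym2.eq_iff.1 hs with ⟨rfl, rfl⟩ | ⟨rfl, rfl⟩
        exacts [huv, huv.symm]
    have hr := M.rot_ne_of_minDeg (SphereEmbedding.minDegThree_mono hle hdeg)
    have h := isMarked_of_incident M hr hu hc hs hi
    obtain ⟨ρ, hρ, hM⟩ := M.facet_merge M' hle (h.facetSystem hdeg) hdeg d hd hG
    have hρp := facet_eq M hr h hdeg hi hρ.mem
    obtain ⟨ρ', hb, hon, hM'⟩ := M'.facet_bijection (h.facetSystem hdeg) hdeg
    let e := Equiv.ofBijective ρ' hb
    have hπ : ∀ f, ρ' (e.symm (ρ f)) = ρ f := fun f => e.apply_symm_apply (ρ f)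
    have hpe : p = (fun t => (ρ' t).1) ∘ fun f => e.symm (ρ f) := by
      funext f
      simp only [Function.comp, hπ, hρp]
    have hm := hρ.comp_equiv e hon
    refine ⟨hM, _, fun t => (ρ' t).1, hm, ?_, hpe⟩
    have hb' := body_comp_merge hm fun t => (ρ' t).1
    rw [← hpe] at hb'
    refine ⟨fun t => ?_, hb' ▸ hc, x, hb' ▸ hs, fun t v hv => (hon v t).1 hv⟩
    obtain ⟨f, hf⟩ := (ρ' t).2
    simp only [← hf]
    exact hu f

/-- The faces of a planar map with one edge more than a polytope merge to those of the polytope. -/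
theorem exists_merge [Finite V] {M' : SphereEmbedding G₀} {p' : M'.Face → HalfParam} {x : V → E3}
    (h : IsStrict M' p' x) (hM' : M'.Polyhedral) (M : SphereEmbedding G) (hle : G₀ ≤ G)
    (hdeg : MinDegThree G₀) (hd : ¬ G₀.Adj d.fst d.snd)
    (hG : ∀ u v, G.Adj u v → G₀.Adj u v ∨ s(u, v) = s(d.fst, d.snd)) :
    M.Polyhedral ∧ ∃ π : M.Face → M'.Face, M.IsMerge d M'.verts π := by
  have := Fintype.ofFinite V
  have hm := h.isMarked hM'
  obtain ⟨ρ, hρ, hM⟩ := M.facet_merge M' hle (hm.facetSystem hdeg) hdeg d hd hG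
  let e := Equiv.ofInjective p' (h.injective hM')
  refine ⟨hM, _, hρ.comp_equiv e fun v t => h.onFace_iff⟩

end Weak

/-- Removing the only neighbours of `v` would cut it off from a fourth vertex. -/
theorem ThreeConnected.minDegThree [Finite V] (h : ThreeConnected G) : MinDegThree G := by
  classical
  have := Fintype.ofFinite V
  intro v x y
  by_contra! hall
  -- The vertex `v` itself must survive, also when it is one of `x`, `y`.
  set S : Finset V := ({x, y} : Finset V).erase v with hS
  have hvS : v ∉ S := by simp [hS]
  obtain ⟨w, hw⟩ : ∃ w, w ∉ insert v ({x, y} : Finset V) := by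
    by_contra! hc
    have h1 := Finset.card_le_card (fun w _ => hc w : (Finset.univ : Finset V) ⊆ _)
    have h2 := h.1
    rw [Nat.card_eq_fintype_card] at h2
    have h3 : (insert v ({x, y} : Finset V)).card ≤ 3 := Finset.card_le_three
    rw [Finset.card_univ] at h1
    omega
  simp only [Finset.mem_insert, Finset.mem_singleton, not_or] at hw
  have hwS : w ∉ S := by simp [hS, hw]
  obtain ⟨q⟩ := (h.2 S ((Finset.card_erase_le).trans Finset.card_le_two)).preconnected
    ⟨v, hvS⟩ ⟨w, hwS⟩
  cases q with
  | nil => exact hw.1 rfl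
  | @cons _ u _ hadj _ =>
    have hadj' : G.Adj v u.1 := hadj
    refine u.2 ?_
    by_cases hux : u.1 = x
    · exact Finset.mem_erase.2 ⟨hadj'.ne', by simp [hux]⟩
    · exact Finset.mem_erase.2 ⟨hadj'.ne', by simp [hall u.1 hadj' hux]⟩

end HypPoly

namespace HypPoly

/-! ### The Lorentz form -/

/-- The Lorentz form on `ℝ³ × ℝ`. -/
noncomputable def lor (X Y : HalfParam) : ℝ := ⟪X.1, Y.1⟫ - X.2 * Y.2

theorem lor_comm (X Y : HalfParam) : lor X Y = lor Y X := by
  simp only [lor, real_inner_comm, mul_comm]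

theorem lor_add_left (X Y Z : HalfParam) : lor (X + Y) Z = lor X Z + lor Y Z := by
  simp only [lor, Prod.fst_add, Prod.snd_add, inner_add_left]; ring

theorem lor_smul_left (c : ℝ) (X Z : HalfParam) : lor (c • X) Z = c * lor X Z := by
  simp only [lor, Prod.smul_fst, Prod.smul_snd, inner_smul_left, smul_eq_mul, conj_trivial]; ring

theorem lor_add_right (X Y Z : HalfParam) : lor X (Y + Z) = lor X Y + lor X Z := by
  rw [lor_comm, lor_add_left, lor_comm Y, lor_comm Z]

theorem lor_smul_right (c : ℝ) (X Z : HalfParam) : lor X (c • Z) = c * lor X Z := by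
  rw [lor_comm, lor_smul_left, lor_comm]

theorem lor_sub_left (X Y Z : HalfParam) : lor (X - Y) Z = lor X Z - lor Y Z := by
  simp only [lor, Prod.fst_sub, Prod.snd_sub, inner_sub_left]; ring

theorem lor_sub_right (X Y Z : HalfParam) : lor X (Y - Z) = lor X Y - lor X Z := by
  rw [lor_comm, lor_sub_left, lor_comm Y, lor_comm Z]

theorem lor_zero_left (X : HalfParam) : lor 0 X = 0 := by simp [lor]

theorem lor_zero_right (X : HalfParam) : lor X 0 = 0 := by simp [lor]

theorem lor_sum_left {ι : Type*} (s : Finset ι) (X : ι → HalfParam) (Z : HalfParam) :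
    lor (∑ i ∈ s, X i) Z = ∑ i ∈ s, lor (X i) Z := by
  classical
  induction s using Finset.induction_on with
  | empty => simp [lor_zero_left]
  | insert i s hi ih => rw [Finset.sum_insert hi, Finset.sum_insert hi, lor_add_left, ih]

theorem lor_sum_right {ι : Type*} (s : Finset ι) (X : ι → HalfParam) (Z : HalfParam) :
    lor Z (∑ i ∈ s, X i) = ∑ i ∈ s, lor Z (X i) := by
  rw [lor_comm, lor_sum_left]
  exact Finset.sum_congr rfl fun i _ => lor_comm _ _

theorem lor_self (X : HalfParam) : lor X X = ‖X.1‖ ^ 2 - X.2 ^ 2 := by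
  rw [lor, real_inner_self_eq_norm_sq]; ring

/-- The point of the hyperboloid over a point of the projective model. -/
noncomputable def lift (y : E3) : HalfParam := (Real.sqrt (1 - ‖y‖ ^ 2))⁻¹ • (y, (1 : ℝ))

/-- Central projection to the projective model. -/
noncomputable def proj (X : HalfParam) : E3 := X.2⁻¹ • X.1

theorem lift_scale_pos {y : E3} (hy : ‖y‖ < 1) : 0 < (Real.sqrt (1 - ‖y‖ ^ 2))⁻¹ := by
  have : ‖y‖ ^ 2 < 1 := by nlinarith [norm_nonneg y]
  exact inv_pos.2 (Real.sqrt_pos.2 (by linarith))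

theorem lift_snd_pos {y : E3} (hy : ‖y‖ < 1) : 0 < (lift y).2 := by
  simpa [lift] using lift_scale_pos hy

theorem lor_lift (h : HalfParam) (y : E3) :
    lor h (lift y) = (Real.sqrt (1 - ‖y‖ ^ 2))⁻¹ * (⟪h.1, y⟫ - h.2) := by
  rw [lift, lor_smul_right, lor, mul_one]

theorem lor_lift_lift (x y : E3) : lor (lift x) (lift y) =
    -((1 - ⟪x, y⟫) / (Real.sqrt (1 - ‖x‖ ^ 2) * Real.sqrt (1 - ‖y‖ ^ 2))) := by
  rw [lor_lift]
  simp only [lift, Prod.smul_fst, Prod.smul_snd, inner_smul_left, conj_trivial, smul_eq_mul]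
  rw [div_eq_mul_inv, mul_inv]
  ring

theorem lor_lift_self {y : E3} (hy : ‖y‖ < 1) : lor (lift y) (lift y) = -1 := by
  have : 0 < 1 - ‖y‖ ^ 2 := by nlinarith [norm_nonneg y]
  rw [lor_lift_lift, Real.mul_self_sqrt this.le, real_inner_self_eq_norm_sq, div_self this.ne']

theorem proj_lift {y : E3} (hy : ‖y‖ < 1) : proj (lift y) = y := by
  have h := (lift_scale_pos hy).ne'
  simp only [proj, lift, Prod.smul_fst, Prod.smul_snd, smul_eq_mul, mul_one, smul_smul]
  rw [inv_mul_cancel₀ h, one_smul]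

theorem norm_proj_lt {X : HalfParam} (h : 0 < X.2) (hX : lor X X < 0) : ‖proj X‖ < 1 := by
  rw [lor_self] at hX
  rw [proj, norm_smul, norm_inv, Real.norm_of_nonneg h.le, inv_mul_lt_one₀ h]
  exact lt_of_pow_lt_pow_left₀ 2 h.le (by linarith)

theorem lift_proj {X : HalfParam} (h : 0 < X.2) (hX : lor X X = -1) : lift (proj X) = X := by
  have h1 : 1 - ‖proj X‖ ^ 2 = (X.2⁻¹) ^ 2 := by
    rw [lor_self] at hX
    rw [proj, norm_smul, norm_inv, Real.norm_of_nonneg h.le, mul_pow]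
    field_simp
    linarith
  rw [lift, h1, Real.sqrt_sq (inv_pos.2 h).le, inv_inv]
  refine Prod.ext ?_ ?_
  · rw [Prod.smul_fst, proj, smul_smul, mul_inv_cancel₀ h.ne', one_smul]
  · rw [Prod.smul_snd, smul_eq_mul, mul_one]

theorem lor_nondegenerate {W : HalfParam} (h : ∀ y : E3, ‖y‖ < 1 → lor W (lift y) = 0) : W = 0 := by
  have key : ∀ y : E3, ‖y‖ < 1 → ⟪W.1, y⟫ = W.2 := fun y hy => by
    have := h y hy
    rw [lor_lift] at this
    linarith [(mul_eq_zero.1 this).resolve_left (lift_scale_pos hy).ne']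
  have h2 : W.2 = 0 := by rw [← key 0 (by simp), inner_zero_right]
  have h0 : 0 < 1 + ‖W.1‖ := by positivity
  have h1 := key ((1 + ‖W.1‖)⁻¹ • W.1) (by
    rw [norm_smul, norm_inv, Real.norm_of_nonneg h0.le, inv_mul_lt_one₀ h0]; linarith)
  rw [inner_smul_right, h2, mul_eq_zero, inner_self_eq_zero] at h1
  exact Prod.ext (h1.resolve_left (inv_pos.2 h0).ne') h2

/-- The Lorentz form is positive on the complement of a timelike vector. -/
theorem lor_pos_of_orthogonal {X u : HalfParam} (hX : lor X X < 0) (h : lor u X = 0) (hu : u ≠ 0) :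
    0 < lor u u := by
  rw [lor_self] at hX ⊢
  have h1 : ⟪u.1, X.1⟫ = u.2 * X.2 := by rw [lor] at h; linarith
  have h2 := abs_real_inner_le_norm u.1 X.1
  rw [h1] at h2
  have h3 : (u.2 * X.2) ^ 2 ≤ (‖u.1‖ * ‖X.1‖) ^ 2 := by
    rw [← sq_abs (u.2 * X.2)]; gcongr
  by_contra! hle
  have hX2 : 0 < X.2 ^ 2 := by nlinarith [sq_nonneg ‖X.1‖]
  have hn : ‖u.1‖ ^ 2 = 0 := by
    by_contra hne
    have : 0 < ‖u.1‖ ^ 2 := lt_of_le_of_ne (sq_nonneg _) (Ne.symm hne)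
    nlinarith
  have hu1 : u.1 = 0 := by simpa using hn
  have hu2 : u.2 * X.2 = 0 := by rw [← h1, hu1, inner_zero_left]
  refine hu (Prod.ext hu1 ((mul_eq_zero.1 hu2).resolve_right fun e => ?_))
  rw [e] at hX2; simp at hX2

theorem lor_neg_of_future {X Y : HalfParam} (hX : 0 < X.2) (hXX : lor X X < 0) (hY : 0 < Y.2)
    (hYY : lor Y Y < 0) : lor X Y < 0 := by
  rw [lor_self] at hXX hYY
  have h1 : ‖X.1‖ < X.2 := lt_of_pow_lt_pow_left₀ 2 hX.le (by linarith)
  have h2 : ‖Y.1‖ < Y.2 := lt_of_pow_lt_pow_left₀ 2 hY.le (by linarith)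
  have h3 := real_inner_le_norm X.1 Y.1
  have h4 := mul_lt_mul'' h1 h2 (norm_nonneg _) (norm_nonneg _)
  rw [lor]; linarith

theorem future_of_lor_neg {X Y : HalfParam} (hX : 0 < X.2) (hXX : lor X X < 0)
    (hYY : lor Y Y < 0) (hXY : lor X Y < 0) : 0 < Y.2 := by
  by_contra! hle
  have hYY' := hYY
  rw [lor_self] at hYY
  have hne : Y.2 ≠ 0 := fun e => by rw [e] at hYY; nlinarith [sq_nonneg ‖Y.1‖]
  have := lor_neg_of_future hX hXX (Y := (-1 : ℝ) • Y)
    (by simpa using lt_of_le_of_ne hle hne)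
    (by rw [lor_smul_left, lor_smul_right]; linarith)
  rw [lor_smul_right] at this
  linarith

/-- The base point of the hyperboloid. -/
def origin : HalfParam := (0, 1)

theorem lor_origin_self : lor origin origin = -1 := by simp [lor, origin]

theorem lor_origin (X : HalfParam) : lor X origin = -X.2 := by simp [lor, origin]

/-- Linear maps preserving the Lorentz form and the direction of time. -/
structure IsLorentz (A : HalfParam ≃ₗ[ℝ] HalfParam) : Prop where
  lor_map : ∀ X Y, lor (A X) (A Y) = lor X Y
  future : 0 < (A origin).2

namespace IsLorentz

variable {A : HalfParam ≃ₗ[ℝ] HalfParam}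

theorem symm (h : IsLorentz A) : IsLorentz A.symm where
  lor_map X Y := by rw [← h.lor_map, A.apply_symm_apply, A.apply_symm_apply]
  future := by
    have h1 := lor_origin (A.symm origin)
    rw [← h.lor_map, A.apply_symm_apply, lor_comm, lor_origin] at h1
    linarith [h.future]

theorem future_map (h : IsLorentz A) {X : HalfParam} (hX : 0 < X.2) (hXX : lor X X < 0) :
    0 < (A X).2 := by
  refine future_of_lor_neg h.future ?_ ?_ ?_
  · rw [h.lor_map, lor_origin_self]; norm_num
  · rwa [h.lor_map]
  · rw [h.lor_map, lor_comm, lor_origin]; linarith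

/-- The isometry induced on the projective model, as a map of `ℝ³`. -/
theorem lift_proj_map (h : IsLorentz A) {y : E3} (hy : ‖y‖ < 1) :
    lift (proj (A (lift y))) = A (lift y) :=
  lift_proj (h.future_map (lift_snd_pos hy) (by rw [lor_lift_self hy]; norm_num))
    (by rw [h.lor_map, lor_lift_self hy])

theorem norm_proj_map_lt (h : IsLorentz A) {y : E3} (hy : ‖y‖ < 1) : ‖proj (A (lift y))‖ < 1 :=
  norm_proj_lt (h.future_map (lift_snd_pos hy) (by rw [lor_lift_self hy]; norm_num))
    (by rw [h.lor_map, lor_lift_self hy]; norm_num)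

end IsLorentz

theorem norm_lt_of_ball (y : ball) : ‖(y : E3)‖ < 1 := by
  simpa [ball] using y.2

/-- The isometry of hyperbolic space induced by a Lorentz transformation. -/
noncomputable def isoOf {A : HalfParam ≃ₗ[ℝ] HalfParam} (h : IsLorentz A) : Equiv.Perm ball where
  toFun y := ⟨proj (A (lift y)), by simpa [ball] using h.norm_proj_map_lt (norm_lt_of_ball y)⟩
  invFun y :=
    ⟨proj (A.symm (lift y)), by simpa [ball] using h.symm.norm_proj_map_lt (norm_lt_of_ball y)⟩
  left_inv y := Subtype.ext (by
    change proj (A.symm (lift (proj (A (lift y))))) = y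
    rw [h.lift_proj_map (norm_lt_of_ball y), A.symm_apply_apply, proj_lift (norm_lt_of_ball y)])
  right_inv y := Subtype.ext (by
    change proj (A (lift (proj (A.symm (lift y))))) = y
    rw [h.symm.lift_proj_map (norm_lt_of_ball y), A.apply_symm_apply, proj_lift (norm_lt_of_ball y)])

theorem lift_isoOf {A : HalfParam ≃ₗ[ℝ] HalfParam} (h : IsLorentz A) (y : ball) :
    lift (isoOf h y) = A (lift y) :=
  h.lift_proj_map (norm_lt_of_ball y)

theorem hypDist_eq (x y : ball) : hypDist x y = Real.arcosh (-lor (lift x) (lift y)) := by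
  rw [lor_lift_lift, neg_neg]; rfl

theorem lor_lift_neg (x y : ball) : lor (lift x) (lift y) < 0 := by
  have hx := norm_lt_of_ball x
  have hy := norm_lt_of_ball y
  exact lor_neg_of_future (lift_snd_pos hx) (by rw [lor_lift_self hx]; norm_num) (lift_snd_pos hy)
    (by rw [lor_lift_self hy]; norm_num)

theorem mem_isoH3_iff {g : Equiv.Perm ball} :
    g ∈ isoH3 ↔ ∀ x y, lor (lift (g x)) (lift (g y)) = lor (lift x) (lift y) := by
  refine forall₂_congr fun x y => ?_
  rw [hypDist_eq, hypDist_eq]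
  refine ⟨fun h => ?_, fun h => by rw [h]⟩
  exact neg_injective (Real.strictMonoOn_arcosh.injOn (neg_pos.2 (lor_lift_neg _ _))
    (neg_pos.2 (lor_lift_neg _ _)) h)

theorem isoOf_mem {A : HalfParam ≃ₗ[ℝ] HalfParam} (h : IsLorentz A) : isoOf h ∈ isoH3 := by
  rw [mem_isoH3_iff]
  intro x y
  rw [lift_isoOf, lift_isoOf, h.lor_map]

theorem span_lift : Submodule.span ℝ (lift '' ball) = ⊤ := by
  have hmem : ∀ y : E3, ‖y‖ < 1 → (y, (1 : ℝ)) ∈ Submodule.span ℝ (lift '' ball) := by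
    intro y hy
    have h1 : lift y ∈ Submodule.span ℝ (lift '' ball) :=
      Submodule.subset_span ⟨y, by simpa [ball] using hy, rfl⟩
    have := Submodule.smul_mem _ (Real.sqrt (1 - ‖y‖ ^ 2)) h1
    rwa [lift, smul_smul, mul_inv_cancel₀ (inv_pos.1 (lift_scale_pos hy)).ne', one_smul] at this
  rw [eq_top_iff]
  rintro ⟨y, t⟩ -
  have h0 : 0 < 1 + ‖y‖ := by positivity
  have h1 := hmem ((1 + ‖y‖)⁻¹ • y) (by
    rw [norm_smul, norm_inv, Real.norm_of_nonneg h0.le, inv_mul_lt_one₀ h0]; linarith)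
  have h2 := hmem 0 (by simp)
  have : (y, t) = (1 + ‖y‖) • ((1 + ‖y‖)⁻¹ • y, (1 : ℝ)) + (t - (1 + ‖y‖)) • ((0 : E3), (1 : ℝ)) := by
    refine Prod.ext ?_ ?_
    · simp [smul_smul, mul_inv_cancel₀ h0.ne']
    · simp
  rw [this]
  exact Submodule.add_mem _ (Submodule.smul_mem _ _ h1) (Submodule.smul_mem _ _ h2)

/-- Isometries of the projective model come from Lorentz transformations. -/
theorem exists_lorentz {g : Equiv.Perm ball} (hg : g ∈ isoH3) :
    ∃ A : HalfParam ≃ₗ[ℝ] HalfParam, IsLorentz A ∧ ∀ y : ball, lift (g y) = A (lift y) := by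
  rw [mem_isoH3_iff] at hg
  let b := Module.Basis.ofSpan span_lift.ge
  let hft := FiniteDimensional.fintypeBasisIndex b
  have hb : ∀ i, ∃ y : ball, lift y = b i := fun i => by
    obtain ⟨y, hy, e⟩ := Module.Basis.ofSpan_subset span_lift.ge (mem_range_self i)
    exact ⟨⟨y, hy⟩, e⟩
  choose y hy using hb
  let A : HalfParam →ₗ[ℝ] HalfParam := b.constr ℝ fun i => lift (g (y i))
  have hA : ∀ X, A X = ∑ i, b.repr X i • lift (g (y i)) := fun X => b.constr_apply_fintype ℝ _ X
  have hrep : ∀ X, X = ∑ i, b.repr X i • lift (y i) := fun X => by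
    simp only [hy]; exact (b.sum_repr X).symm
  -- The map `A` is prescribed only on a basis of hyperboloid points. Pairing with the images of all
  -- points and nondegeneracy of the form show that it agrees with `g` everywhere and preserves the
  -- form.
  have hAl : ∀ (X : HalfParam) (z : ball), lor (A X) (lift (g z)) = lor X (lift z) := by
    intro X z
    conv_rhs => rw [hrep X]
    rw [hA, lor_sum_left, lor_sum_left]
    exact Finset.sum_congr rfl fun i _ => by rw [lor_smul_left, lor_smul_left, hg]
  have hlift : ∀ z : ball, lift (g z) = A (lift z) := by
    intro z
    rw [eq_comm, ← sub_eq_zero]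
    refine lor_nondegenerate fun w hw => ?_
    obtain ⟨w', hw'⟩ := g.surjective ⟨w, by simpa [ball] using hw⟩
    have : lift w = lift (g w') := by rw [hw']
    rw [this, lor_sub_left, hAl, hg, sub_self]
  have hlor : ∀ X Y, lor (A X) (A Y) = lor X Y := by
    intro X Y
    conv_rhs => rw [hrep Y]
    rw [hA Y, lor_sum_right, lor_sum_right]
    exact Finset.sum_congr rfl fun i _ => by rw [lor_smul_right, lor_smul_right, hAl]
  have hinj : Function.Injective A := by
    rw [injective_iff_map_eq_zero]
    intro X hX
    refine lor_nondegenerate fun w hw => ?_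
    rw [← hlor, hX, lor_zero_left]
  refine ⟨LinearEquiv.ofInjectiveEndo A hinj, ⟨hlor, ?_⟩, hlift⟩
  have h0 : origin = lift 0 := by simp [origin, lift]
  have := hlift ⟨0, by simp [ball]⟩
  rw [← h0] at this
  change 0 < (A origin).2
  rw [← this]
  exact lift_snd_pos (norm_lt_of_ball _)

/-! ### The action on half spaces -/

theorem mem_hypHalfSpace_iff {h : HalfParam} {y : ball} :
    y ∈ hypHalfSpace h ↔ lor h (lift y) ≤ 0 := by
  have hp := lift_scale_pos (norm_lt_of_ball y)
  change ⟪h.1, (y : E3)⟫ ≤ h.2 ↔ _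
  rw [lor_lift, ← sub_nonpos]
  refine ⟨fun hy => mul_nonpos_of_nonneg_of_nonpos hp.le hy, fun hy => ?_⟩
  by_contra! hc
  exact absurd hy (not_le.2 (mul_pos hp hc))

theorem inner_eq_iff_lor {h : HalfParam} {y : E3} (hy : ‖y‖ < 1) :
    ⟪h.1, y⟫ = h.2 ↔ lor h (lift y) = 0 := by
  rw [lor_lift, mul_eq_zero, or_iff_right (lift_scale_pos hy).ne', sub_eq_zero]

theorem inner_lt_iff_lor {h : HalfParam} {y : E3} (hy : ‖y‖ < 1) :
    ⟪h.1, y⟫ < h.2 ↔ lor h (lift y) < 0 := by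
  rw [lor_lift, ← smul_eq_mul, smul_neg_iff_of_pos_left (lift_scale_pos hy), sub_neg]

theorem fst_ne_zero_of_wall {h : HalfParam} (hh : h ≠ 0) {y : E3} (hy : ‖y‖ < 1)
    (hw : lor h (lift y) = 0) : h.1 ≠ 0 := fun h0 => by
  rw [← inner_eq_iff_lor hy, h0, inner_zero_left] at hw
  exact hh (Prod.ext h0 hw.symm)

theorem hypHalfSpace_smul {c : ℝ} (hc : 0 < c) (h : HalfParam) :
    hypHalfSpace (c • h) = hypHalfSpace h := by
  ext y
  rw [mem_hypHalfSpace_iff, mem_hypHalfSpace_iff, lor_smul_left]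
  exact ⟨fun h1 => by by_contra! h2; exact absurd h1 (not_le.2 (mul_pos hc h2)),
    fun h1 => mul_nonpos_of_nonneg_of_nonpos hc.le h1⟩

theorem image_isoOf {A : HalfParam ≃ₗ[ℝ] HalfParam} (hA : IsLorentz A) (h : HalfParam) :
    isoOf hA '' hypHalfSpace h = hypHalfSpace (A h) := by
  ext y
  constructor
  · rintro ⟨z, hz, rfl⟩
    rw [mem_hypHalfSpace_iff] at hz ⊢
    rwa [lift_isoOf, hA.lor_map]
  · intro hy
    obtain ⟨z, rfl⟩ := (isoOf hA).surjective y
    refine ⟨z, ?_, rfl⟩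
    rw [mem_hypHalfSpace_iff] at hy ⊢
    rwa [lift_isoOf, hA.lor_map] at hy

/-- A half space of hyperbolic space determines its parameter up to scale. -/
theorem eq_smul_of_hypHalfSpace_eq {h h' : HalfParam} (hn : h.1 ≠ 0) (hn' : h'.1 ≠ 0) (y : ball)
    (hy : ⟪h.1, (y : E3)⟫ = h.2) (he : hypHalfSpace h = hypHalfSpace h') :
    ∃ c : ℝ, 0 < c ∧ h' = c • h := by
  have hball : ∀ u : E3, ∀ᶠ ε in 𝓝[>] (0 : ℝ), (y : E3) + ε • u ∈ ball := fun u => by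
    refine Filter.Eventually.filter_mono nhdsWithin_le_nhds ?_
    have hc : ContinuousAt (fun ε : ℝ => (y : E3) + ε • u) 0 := by fun_prop
    exact hc.eventually (Metric.isOpen_ball.mem_nhds (by simpa using norm_lt_of_ball y))
  have hiff : ∀ z ∈ ball, ⟪h.1, z⟫ ≤ h.2 ↔ ⟪h'.1, z⟫ ≤ h'.2 := fun z hz =>
    Set.ext_iff.1 he ⟨z, hz⟩
  have hnn : 0 < ⟪h.1, h.1⟫ := real_inner_self_pos.2 hn
  have hnn' : 0 < ⟪h'.1, h'.1⟫ := real_inner_self_pos.2 hn'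
  -- If `y` were interior to the second half space, a short step out of the first would stay in the
  -- second.
  have hy' : ⟪h'.1, (y : E3)⟫ = h'.2 := by
    refine le_antisymm ((hiff y y.2).1 hy.le) ?_
    by_contra! hlt
    have h1 : ∀ᶠ ε in 𝓝[>] (0 : ℝ), ⟪h'.1, (y : E3) + ε • h.1⟫ < h'.2 := by
      refine Filter.Eventually.filter_mono nhdsWithin_le_nhds ?_
      exact ContinuousAt.eventually_lt (f := fun ε : ℝ => ⟪h'.1, (y : E3) + ε • h.1⟫) (by fun_prop)
        continuousAt_const (by simpa using hlt)
    obtain ⟨ε, ⟨h2, h3⟩, h4⟩ := ((h1.and (hball h.1)).and self_mem_nhdsWithin).exists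
    have h5 := (hiff _ h3).2 h2.le
    rw [inner_add_right, inner_smul_right, hy] at h5
    have : 0 < ε * ⟪h.1, h.1⟫ := mul_pos h4 hnn
    linarith
  have hcone : ∀ u : E3, ⟪h.1, u⟫ ≤ 0 → ⟪h'.1, u⟫ ≤ 0 := by
    intro u hu
    obtain ⟨ε, h3, h4⟩ := ((hball u).and self_mem_nhdsWithin).exists
    have h4 : 0 < ε := h4
    have h5 := (hiff _ h3).1 (by
      rw [inner_add_right, inner_smul_right, hy]
      linarith [mul_nonpos_of_nonneg_of_nonpos h4.le hu])
    rw [inner_add_right, inner_smul_right, hy'] at h5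
    by_contra! hc
    linarith [mul_pos h4 hc]
  set c := ⟪h'.1, h.1⟫ / ⟪h.1, h.1⟫ with hc
  -- The part of `h'.1` orthogonal to `h.1`. Both `w` and `-w` lie in the cone of the first half
  -- space, hence in that of the second, and this forces `w = 0`.
  set w := h'.1 - c • h.1 with hw
  have hwn : ⟪h.1, w⟫ = 0 := by
    rw [hw, inner_sub_right, inner_smul_right, hc, div_mul_cancel₀ _ hnn.ne', real_inner_comm,
      sub_self]
  have hwn' : ⟪h'.1, w⟫ = 0 := by
    refine le_antisymm (hcone w hwn.le) ?_
    have := hcone (-w) (by rw [inner_neg_right, hwn, neg_zero])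
    rw [inner_neg_right] at this
    linarith
  have hw0 : w = 0 := by
    rw [← inner_self_eq_zero (𝕜 := ℝ)]
    nth_rewrite 1 [hw]
    rw [inner_sub_left, inner_smul_left, hwn, hwn', mul_zero, sub_zero]
  have h1 : h'.1 = c • h.1 := sub_eq_zero.1 hw0
  refine ⟨c, ?_, Prod.ext h1 ?_⟩
  · have hc0 : 0 ≤ c := by
      refine div_nonneg ?_ hnn.le
      have := hcone (-h.1) (by rw [inner_neg_right]; linarith)
      rw [inner_neg_right] at this
      linarith
    refine lt_of_le_of_ne hc0 fun e => hn' ?_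
    rw [h1, ← e, zero_smul]
  · rw [Prod.smul_snd, ← hy', h1, inner_smul_left, hy]; rfl

/-- Rescaling a half space parameter to a unit normal. -/
noncomputable def unitize (h : HalfParam) : HalfParam := ‖h.1‖⁻¹ • h

theorem norm_unitize {h : HalfParam} (hn : h.1 ≠ 0) : ‖(unitize h).1‖ = 1 := by
  rw [unitize, Prod.smul_fst, norm_smul, norm_inv, norm_norm, inv_mul_cancel₀ (norm_ne_zero_iff.2 hn)]

theorem unitize_eq_self {h : HalfParam} (hn : ‖h.1‖ = 1) : unitize h = h := by
  rw [unitize, hn, inv_one, one_smul]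

theorem unitize_smul {c : ℝ} (hc : 0 < c) (h : HalfParam) : unitize (c • h) = unitize h := by
  rw [unitize, unitize, Prod.smul_fst, norm_smul, Real.norm_of_nonneg hc.le, mul_inv, smul_smul,
    mul_right_comm, inv_mul_cancel₀ hc.ne', one_mul]

theorem hypHalfSpace_unitize {h : HalfParam} (hn : h.1 ≠ 0) :
    hypHalfSpace (unitize h) = hypHalfSpace h :=
  hypHalfSpace_smul (inv_pos.2 (norm_pos_iff.2 hn)) h

end HypPoly

namespace HypPoly

/-! ### Gram-Schmidt frames for the Lorentz form -/

/-- Scaling to Lorentz norm one. -/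
noncomputable def unitVec (u : HalfParam) : HalfParam := (Real.sqrt (lor u u))⁻¹ • u

/-- The sign is positive because on a frame `X 0` has Lorentz square `-1`. The remaining steps have
the Euclidean sign, since the complement of `X 0` is positive definite. -/
noncomputable def gs₁ (X : Fin 4 → HalfParam) : HalfParam := X 1 + lor (X 1) (X 0) • X 0

noncomputable def gs₂ (X : Fin 4 → HalfParam) : HalfParam :=
  X 2 + lor (X 2) (X 0) • X 0 - lor (X 2) (unitVec (gs₁ X)) • unitVec (gs₁ X)

noncomputable def gs₃ (X : Fin 4 → HalfParam) : HalfParam :=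
  X 3 + lor (X 3) (X 0) • X 0 - lor (X 3) (unitVec (gs₁ X)) • unitVec (gs₁ X) -
    lor (X 3) (unitVec (gs₂ X)) • unitVec (gs₂ X)

/-- Coordinates with respect to the Gram-Schmidt frame of four vectors. -/
noncomputable def coords (X : Fin 4 → HalfParam) (W : HalfParam) : HalfParam :=
  (!₂[lor W (unitVec (gs₁ X)), lor W (unitVec (gs₂ X)), lor W (unitVec (gs₃ X))], -lor W (X 0))

/-- Four independent vectors, the first on the hyperboloid. -/
structure IsFrame (X : Fin 4 → HalfParam) : Prop where
  indep : LinearIndependent ℝ X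
  self : lor (X 0) (X 0) = -1
  future : 0 < (X 0).2

theorem lor_unitVec_self {u : HalfParam} (h : 0 < lor u u) :
    lor (unitVec u) (unitVec u) = 1 := by
  rw [unitVec, lor_smul_left, lor_smul_right, ← mul_assoc, ← mul_inv, Real.mul_self_sqrt h.le,
    inv_mul_cancel₀ h.ne']

theorem lor_unitVec_right (W u : HalfParam) :
    lor W (unitVec u) = (Real.sqrt (lor u u))⁻¹ * lor W u := lor_smul_right _ _ _

theorem lor_unitVec_eq_zero {u : HalfParam} {W : HalfParam} (h : lor W u = 0) :
    lor W (unitVec u) = 0 := by rw [lor_unitVec_right, h, mul_zero]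

theorem map_unitVec {A : HalfParam ≃ₗ[ℝ] HalfParam} (hA : IsLorentz A) (u : HalfParam) :
    unitVec (A u) = A (unitVec u) := by
  rw [unitVec, hA.lor_map, unitVec, map_smul]

theorem map_gs₁ {A : HalfParam ≃ₗ[ℝ] HalfParam} (hA : IsLorentz A) (X : Fin 4 → HalfParam) :
    gs₁ (fun i => A (X i)) = A (gs₁ X) := by
  simp only [gs₁, hA.lor_map, map_add, map_smul]

theorem map_gs₂ {A : HalfParam ≃ₗ[ℝ] HalfParam} (hA : IsLorentz A) (X : Fin 4 → HalfParam) :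
    gs₂ (fun i => A (X i)) = A (gs₂ X) := by
  simp only [gs₂, map_gs₁ hA, map_unitVec hA, hA.lor_map, map_add, map_sub, map_smul]

theorem map_gs₃ {A : HalfParam ≃ₗ[ℝ] HalfParam} (hA : IsLorentz A) (X : Fin 4 → HalfParam) :
    gs₃ (fun i => A (X i)) = A (gs₃ X) := by
  simp only [gs₃, map_gs₁ hA, map_gs₂ hA, map_unitVec hA, hA.lor_map, map_add, map_sub, map_smul]

/-- Everything in the frame is built from Lorentz products, so coordinates relative to it are
invariants of the orbit. -/
theorem coords_map {A : HalfParam ≃ₗ[ℝ] HalfParam} (hA : IsLorentz A) (X : Fin 4 → HalfParam)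
    (W : HalfParam) : coords (fun i => A (X i)) (A W) = coords X W := by
  simp only [coords, map_gs₁ hA, map_gs₂ hA, map_gs₃ hA, map_unitVec hA, hA.lor_map]

theorem coords_smul (X : Fin 4 → HalfParam) (c : ℝ) (W : HalfParam) :
    coords X (c • W) = c • coords X W := by
  simp only [coords, lor_smul_left]
  refine Prod.ext ?_ ?_
  · ext i; fin_cases i <;> simp
  · simp

namespace IsFrame

variable {X : Fin 4 → HalfParam}

theorem comb_ne_zero (h : IsFrame X) {a : Fin 4 → ℝ} {i : Fin 4} (ha : a i ≠ 0) :
    ∑ j, a j • X j ≠ 0 := fun e =>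
  ha (Fintype.linearIndependent_iff.1 h.indep a e i)

theorem gs₁_orth (h : IsFrame X) : lor (gs₁ X) (X 0) = 0 := by
  rw [gs₁, lor_add_left, lor_smul_left, h.self]; ring

theorem gs₁_pos (h : IsFrame X) : 0 < lor (gs₁ X) (gs₁ X) := by
  refine lor_pos_of_orthogonal (X := X 0) (by rw [h.self]; norm_num) h.gs₁_orth ?_
  have := h.comb_ne_zero (a := ![lor (X 1) (X 0), 1, 0, 0]) (i := 1) (by simp)
  rw [Fin.sum_univ_four] at this
  simpa [gs₁, add_comm] using this

theorem e₁_orth (h : IsFrame X) : lor (X 0) (unitVec (gs₁ X)) = 0 :=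
  lor_unitVec_eq_zero (by rw [lor_comm, h.gs₁_orth])

theorem e₁_self (h : IsFrame X) : lor (unitVec (gs₁ X)) (unitVec (gs₁ X)) = 1 :=
  lor_unitVec_self h.gs₁_pos

theorem gs₂_orth (h : IsFrame X) : lor (gs₂ X) (X 0) = 0 := by
  rw [gs₂, lor_sub_left, lor_add_left, lor_smul_left, lor_smul_left, h.self,
    lor_comm (unitVec (gs₁ X)) (X 0), h.e₁_orth]
  ring

theorem gs₂_orth₁ (h : IsFrame X) : lor (gs₂ X) (unitVec (gs₁ X)) = 0 := by
  rw [gs₂, lor_sub_left, lor_add_left, lor_smul_left, lor_smul_left, h.e₁_self, h.e₁_orth]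
  ring

theorem exists_e₁ (X : Fin 4 → HalfParam) : ∃ a b : ℝ, unitVec (gs₁ X) = a • X 0 + b • X 1 :=
  ⟨(Real.sqrt (lor (gs₁ X) (gs₁ X)))⁻¹ * lor (X 1) (X 0), (Real.sqrt (lor (gs₁ X) (gs₁ X)))⁻¹, by
    rw [unitVec]; nth_rewrite 3 [gs₁]; module⟩

theorem gs₂_pos (h : IsFrame X) : 0 < lor (gs₂ X) (gs₂ X) := by
  refine lor_pos_of_orthogonal (X := X 0) (by rw [h.self]; norm_num) h.gs₂_orth ?_
  obtain ⟨a, b, hab⟩ := exists_e₁ X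
  have := h.comb_ne_zero (a := ![lor (X 2) (X 0) - lor (X 2) (unitVec (gs₁ X)) * a,
    - lor (X 2) (unitVec (gs₁ X)) * b, 1, 0]) (i := 2) (by simp)
  rw [Fin.sum_univ_four] at this
  intro e
  refine this ?_
  rw [← e, gs₂]
  generalize lor (X 2) (unitVec (gs₁ X)) = t
  rw [hab]
  simp
  module

theorem e₂_orth (h : IsFrame X) : lor (X 0) (unitVec (gs₂ X)) = 0 :=
  lor_unitVec_eq_zero (by rw [lor_comm, h.gs₂_orth])

theorem e₂_orth₁ (h : IsFrame X) : lor (unitVec (gs₁ X)) (unitVec (gs₂ X)) = 0 :=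
  lor_unitVec_eq_zero (by rw [lor_comm, h.gs₂_orth₁])

theorem e₂_self (h : IsFrame X) : lor (unitVec (gs₂ X)) (unitVec (gs₂ X)) = 1 :=
  lor_unitVec_self h.gs₂_pos

theorem gs₃_orth (h : IsFrame X) : lor (gs₃ X) (X 0) = 0 := by
  rw [gs₃, lor_sub_left, lor_sub_left, lor_add_left, lor_smul_left, lor_smul_left, lor_smul_left,
    h.self, lor_comm (unitVec (gs₁ X)) (X 0), h.e₁_orth, lor_comm (unitVec (gs₂ X)) (X 0),
    h.e₂_orth]
  ring

theorem gs₃_orth₁ (h : IsFrame X) : lor (gs₃ X) (unitVec (gs₁ X)) = 0 := by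
  rw [gs₃, lor_sub_left, lor_sub_left, lor_add_left, lor_smul_left, lor_smul_left, lor_smul_left,
    h.e₁_self, h.e₁_orth, lor_comm (unitVec (gs₂ X)), h.e₂_orth₁]
  ring

theorem gs₃_orth₂ (h : IsFrame X) : lor (gs₃ X) (unitVec (gs₂ X)) = 0 := by
  rw [gs₃, lor_sub_left, lor_sub_left, lor_add_left, lor_smul_left, lor_smul_left, lor_smul_left,
    h.e₂_self, h.e₂_orth, h.e₂_orth₁]
  ring

theorem exists_e₂ (X : Fin 4 → HalfParam) :
    ∃ a b c : ℝ, unitVec (gs₂ X) = a • X 0 + b • X 1 + c • X 2 := by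
  obtain ⟨a, b, hab⟩ := exists_e₁ X
  set s := (Real.sqrt (lor (gs₂ X) (gs₂ X)))⁻¹ with hs
  set t := lor (X 2) (unitVec (gs₁ X)) with ht
  refine ⟨s * (lor (X 2) (X 0) - t * a), s * (-t * b), s, ?_⟩
  rw [unitVec, ← hs, gs₂, ← ht, hab]
  module

theorem gs₃_pos (h : IsFrame X) : 0 < lor (gs₃ X) (gs₃ X) := by
  refine lor_pos_of_orthogonal (X := X 0) (by rw [h.self]; norm_num) h.gs₃_orth ?_
  obtain ⟨a, b, hab⟩ := exists_e₁ X
  obtain ⟨a', b', c', hab'⟩ := exists_e₂ X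
  set t := lor (X 3) (unitVec (gs₁ X)) with ht
  set t' := lor (X 3) (unitVec (gs₂ X)) with ht'
  have := h.comb_ne_zero (a := ![lor (X 3) (X 0) - t * a - t' * a', - t * b - t' * b',
    - t' * c', 1]) (i := 3) (by simp)
  rw [Fin.sum_univ_four] at this
  intro e
  refine this ?_
  rw [← e, gs₃, ← ht, ← ht', hab, hab']
  simp
  module

theorem e₃_orth (h : IsFrame X) : lor (X 0) (unitVec (gs₃ X)) = 0 :=
  lor_unitVec_eq_zero (by rw [lor_comm, h.gs₃_orth])

theorem e₃_orth₁ (h : IsFrame X) : lor (unitVec (gs₁ X)) (unitVec (gs₃ X)) = 0 :=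
  lor_unitVec_eq_zero (by rw [lor_comm, h.gs₃_orth₁])

theorem e₃_orth₂ (h : IsFrame X) : lor (unitVec (gs₂ X)) (unitVec (gs₃ X)) = 0 :=
  lor_unitVec_eq_zero (by rw [lor_comm, h.gs₃_orth₂])

theorem e₃_self (h : IsFrame X) : lor (unitVec (gs₃ X)) (unitVec (gs₃ X)) = 1 :=
  lor_unitVec_self h.gs₃_pos

/-- The Lorentz transformation with inverse `coords X`. -/
theorem exists_lorentz (h : IsFrame X) :
    ∃ A : HalfParam ≃ₗ[ℝ] HalfParam, IsLorentz A ∧ ∀ W, A W = coords X W := by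
  set e₁ := unitVec (gs₁ X) with he₁
  set e₂ := unitVec (gs₂ X) with he₂
  set e₃ := unitVec (gs₃ X) with he₃
  have a1 : lor (X 0) e₁ = 0 := h.e₁_orth
  have a2 : lor (X 0) e₂ = 0 := h.e₂_orth
  have a3 : lor (X 0) e₃ = 0 := h.e₃_orth
  have a12 : lor e₁ e₂ = 0 := h.e₂_orth₁
  have a13 : lor e₁ e₃ = 0 := h.e₃_orth₁
  have a23 : lor e₂ e₃ = 0 := h.e₃_orth₂
  have b1 : lor e₁ e₁ = 1 := h.e₁_self
  have b2 : lor e₂ e₂ = 1 := h.e₂_self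
  have b3 : lor e₃ e₃ = 1 := h.e₃_self
  have b0 := h.self
  let B : HalfParam →ₗ[ℝ] HalfParam :=
    { toFun := fun w => w.1 0 • e₁ + w.1 1 • e₂ + w.1 2 • e₃ + w.2 • X 0
      map_add' := fun v w => by simp only [Prod.fst_add, Prod.snd_add, PiLp.add_apply]; module
      map_smul' := fun c w => by
        simp only [Prod.smul_fst, Prod.smul_snd, PiLp.smul_apply, smul_eq_mul, RingHom.id_apply]
        module }
  have hB : ∀ w, B w = w.1 0 • e₁ + w.1 1 • e₂ + w.1 2 • e₃ + w.2 • X 0 := fun w => rfl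
  have hco : ∀ w, coords X (B w) = w := by
    intro w
    have h1 : lor (B w) e₁ = w.1 0 := by
      rw [hB]
      simp only [lor_add_left, lor_smul_left, a1, b1, lor_comm e₂ e₁, lor_comm e₃ e₁, a12, a13]
      ring
    have h2 : lor (B w) e₂ = w.1 1 := by
      rw [hB]
      simp only [lor_add_left, lor_smul_left, a2, b2, lor_comm e₃ e₂, a12, a23]
      ring
    have h3 : lor (B w) e₃ = w.1 2 := by
      rw [hB]
      simp only [lor_add_left, lor_smul_left, a3, b3, a13, a23]
      ring
    have h0 : lor (B w) (X 0) = -w.2 := by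
      rw [hB]
      simp only [lor_add_left, lor_smul_left, b0, lor_comm e₁ (X 0), lor_comm e₂ (X 0),
        lor_comm e₃ (X 0), a1, a2, a3]
      ring
    refine Prod.ext ?_ ?_
    · ext i
      fin_cases i
      exacts [h1, h2, h3]
    · change -lor (B w) (X 0) = w.2
      rw [h0, neg_neg]
  have hinj : Function.Injective B := fun v w hvw => by rw [← hco v, hvw, hco w]
  let A := LinearEquiv.ofInjectiveEndo B hinj
  have hA : IsLorentz A := by
    refine ⟨fun v w => ?_, ?_⟩
    · change lor (B v) (B w) = lor v w
      have e : lor v w = v.1 0 * w.1 0 + v.1 1 * w.1 1 + v.1 2 * w.1 2 - v.2 * w.2 := by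
        simp only [lor, PiLp.inner_apply, Fin.sum_univ_three]
        simp [mul_comm]
      rw [e, hB, hB]
      simp only [lor_add_left, lor_smul_left, lor_add_right, lor_smul_right, a1, a2, a3, a12, a13,
        a23, b0, b1, b2, b3, lor_comm e₁ (X 0), lor_comm e₂ (X 0), lor_comm e₃ (X 0),
        lor_comm e₂ e₁, lor_comm e₃ e₁, lor_comm e₃ e₂]
      ring
    · change 0 < (B origin).2
      have : B origin = X 0 := by rw [hB]; simp [origin]
      rw [this]
      exact h.future
  refine ⟨A.symm, hA.symm, fun W => ?_⟩
  obtain ⟨w, rfl⟩ := A.surjective W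
  rw [A.symm_apply_apply]
  exact (hco w).symm

theorem map (h : IsFrame X) {A : HalfParam ≃ₗ[ℝ] HalfParam} (hA : IsLorentz A) :
    IsFrame fun i => A (X i) where
  indep := h.indep.map' A.toLinearMap A.ker
  self := by rw [hA.lor_map, h.self]
  future := hA.future_map h.future (by rw [h.self]; norm_num)

end IsFrame

/-! ### Smoothness -/

section Smooth

variable {E : Type*} [NormedAddCommGroup E] [NormedSpace ℝ E] {y : E}

theorem contDiffAt_lor {f g : E → HalfParam} (hf : ContDiffAt ℝ ∞ f y) (hg : ContDiffAt ℝ ∞ g y) :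
    ContDiffAt ℝ ∞ (fun z => lor (f z) (g z)) y :=
  (hf.fst.inner ℝ hg.fst).sub (hf.snd.mul hg.snd)

theorem contDiffAt_unitVec {f : E → HalfParam} (hf : ContDiffAt ℝ ∞ f y)
    (h : 0 < lor (f y) (f y)) : ContDiffAt ℝ ∞ (fun z => unitVec (f z)) y :=
  (((contDiffAt_lor hf hf).sqrt h.ne').inv (Real.sqrt_pos.2 h).ne').smul hf

theorem contDiffAt_coords {X : E → Fin 4 → HalfParam} {W : E → HalfParam}
    (hX : ∀ i, ContDiffAt ℝ ∞ (fun z => X z i) y) (hW : ContDiffAt ℝ ∞ W y) (h : IsFrame (X y)) :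
    ContDiffAt ℝ ∞ (fun z => coords (X z) (W z)) y := by
  have h1 : ContDiffAt ℝ ∞ (fun z => unitVec (gs₁ (X z))) y :=
    contDiffAt_unitVec ((hX 1).add ((contDiffAt_lor (hX 1) (hX 0)).smul (hX 0))) h.gs₁_pos
  have h2 : ContDiffAt ℝ ∞ (fun z => unitVec (gs₂ (X z))) y :=
    contDiffAt_unitVec (((hX 2).add ((contDiffAt_lor (hX 2) (hX 0)).smul (hX 0))).sub
      ((contDiffAt_lor (hX 2) h1).smul h1)) h.gs₂_pos
  have h3 : ContDiffAt ℝ ∞ (fun z => unitVec (gs₃ (X z))) y :=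
    contDiffAt_unitVec ((((hX 3).add ((contDiffAt_lor (hX 3) (hX 0)).smul (hX 0))).sub
      ((contDiffAt_lor (hX 3) h1).smul h1)).sub ((contDiffAt_lor (hX 3) h2).smul h2)) h.gs₃_pos
  refine ContDiffAt.prodMk ?_ (contDiffAt_lor hW (hX 0)).neg
  rw [contDiffAt_euclidean]
  intro i
  fin_cases i
  exacts [contDiffAt_lor hW h1, contDiffAt_lor hW h2, contDiffAt_lor hW h3]

theorem contDiffAt_lift {f : E → E3} (hf : ContDiffAt ℝ ∞ f y) (h : ‖f y‖ < 1) :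
    ContDiffAt ℝ ∞ (fun z => lift (f z)) y := by
  have h1 : 0 < 1 - ‖f y‖ ^ 2 := by nlinarith [norm_nonneg (f y)]
  refine (((contDiffAt_const.sub (hf.norm_sq ℝ)).sqrt h1.ne').inv (Real.sqrt_pos.2 h1).ne').smul ?_
  exact hf.prodMk contDiffAt_const

theorem contDiffAt_proj {f : E → HalfParam} (hf : ContDiffAt ℝ ∞ f y) (h : (f y).2 ≠ 0) :
    ContDiffAt ℝ ∞ (fun z => proj (f z)) y :=
  (hf.snd.inv h).smul hf.fst

theorem contDiffAt_unitize {f : E → HalfParam} (hf : ContDiffAt ℝ ∞ f y) (h : (f y).1 ≠ 0) :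
    ContDiffAt ℝ ∞ (fun z => unitize (f z)) y :=
  ((hf.fst.norm ℝ h).inv (norm_ne_zero_iff.2 h)).smul hf

end Smooth

end HypPoly

namespace HypPoly

/-! ### The normal form of a marked polyhedron -/

section NormalForm

variable {V F : Type*} (on : V → F → Prop) (ν : Fin 4 → V)

/-- The points `x` of hyperbolic space are cut out by the walls of `p` incident to them, and the
four points chosen by `ν` are in general position. -/
structure Realizes (p : F → HalfParam) (x : V → E3) : Prop where
  unit : ∀ f, ‖(p f).1‖ = 1
  ball : ∀ v, ‖x v‖ < 1
  incident : ∀ v f, on v f → lor (p f) (lift (x v)) = 0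
  det : ∀ v W, (∀ f, on v f → lor (p f) W = 0) → ∃ c : ℝ, W = c • lift (x v)
  indep : LinearIndependent ℝ fun i => lift (x (ν i))

/-- A Lorentz transformation acting on families of half spaces. -/
noncomputable def move (A : HalfParam ≃ₗ[ℝ] HalfParam) (p : F → HalfParam) : F → HalfParam :=
  fun f => unitize (A (p f))

/-- A family of half spaces and points in the frame of the points chosen by `ν`. -/
noncomputable def normalize (p : F → HalfParam) (x : V → E3) : (F → HalfParam) × (V → E3) :=
  (fun f => unitize (coords (fun i => lift (x (ν i))) (p f)),
    fun v => proj (coords (fun i => lift (x (ν i))) (lift (x v))))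

variable {on ν} {p : F → HalfParam} {x : V → E3}

theorem det_of_normals {v : V} (hx : ‖x v‖ < 1)
    (hi : ∀ f, on v f → ⟪(p f).1, x v⟫ = (p f).2)
    (h : ∀ y, (∀ f, on v f → ⟪(p f).1, y⟫ = 0) → y = 0) (W : HalfParam)
    (hW : ∀ f, on v f → lor (p f) W = 0) : ∃ c : ℝ, W = c • lift (x v) := by
  have hp := lift_snd_pos hx
  set c := W.2 / (lift (x v)).2 with hc
  have h2 : (W - c • lift (x v)).2 = 0 := by
    rw [Prod.snd_sub, Prod.smul_snd, smul_eq_mul, hc, div_mul_cancel₀ _ hp.ne', sub_self]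
  refine ⟨c, sub_eq_zero.1 (Prod.ext (h _ fun f hf => ?_) h2)⟩
  have h0 : lor (p f) (W - c • lift (x v)) = 0 := by
    rw [lor_sub_right, lor_smul_right, hW f hf, (inner_eq_iff_lor hx).1 (hi f hf)]; ring
  rwa [lor, h2, mul_zero, sub_zero] at h0

namespace Realizes

theorem isFrame (h : Realizes on ν p x) : IsFrame fun i => lift (x (ν i)) :=
  ⟨h.indep, lor_lift_self (h.ball _), lift_snd_pos (h.ball _)⟩

theorem normal_ne (h : Realizes on ν p x) (f : F) : (p f).1 ≠ 0 := fun h0 => by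
  have := h.unit f
  rw [h0, norm_zero] at this
  exact zero_ne_one this

theorem inner_eq (h : Realizes on ν p x) {v : V} {f : F} (hf : on v f) :
    ⟪(p f).1, x v⟫ = (p f).2 := (inner_eq_iff_lor (h.ball v)).2 (h.incident v f hf)

theorem normals_det (h : Realizes on ν p x) (v : V) {y : E3}
    (hy : ∀ f, on v f → ⟪(p f).1, y⟫ = 0) : y = 0 := by
  obtain ⟨c, hc⟩ := h.det v (y, 0) fun f hf => by rw [lor, hy f hf]; simp
  have h2 := congrArg Prod.snd hc
  have hc0 : c = 0 :=
    (mul_eq_zero.1 (show c * (lift (x v)).2 = 0 from h2.symm)).resolve_right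
      (lift_snd_pos (h.ball v)).ne'
  rw [hc0, zero_smul] at hc
  exact congrArg Prod.fst hc

theorem map_ne (h : Realizes on ν p x) (hon : ∀ f, ∃ v, on v f) {A : HalfParam ≃ₗ[ℝ] HalfParam}
    (hA : IsLorentz A) (f : F) : (A (p f)).1 ≠ 0 := by
  obtain ⟨v, hv⟩ := hon f
  refine fst_ne_zero_of_wall (fun h0 => h.normal_ne f ?_) (hA.norm_proj_map_lt (h.ball v)) ?_
  · rw [A.map_eq_zero_iff.1 h0]; rfl
  · rw [hA.lift_proj_map (h.ball v), hA.lor_map, h.incident v f hv]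

theorem lor_move (A : HalfParam ≃ₗ[ℝ] HalfParam) (f : F) (W : HalfParam) :
    lor (move A p f) W = ‖(A (p f)).1‖⁻¹ * lor (A (p f)) W := lor_smul_left _ _ _

theorem move_realizes (h : Realizes on ν p x) (hon : ∀ f, ∃ v, on v f)
    {A : HalfParam ≃ₗ[ℝ] HalfParam} (hA : IsLorentz A) :
    Realizes on ν (move A p) fun v => proj (A (lift (x v))) where
  unit f := norm_unitize (h.map_ne hon hA f)
  ball v := hA.norm_proj_map_lt (h.ball v)
  incident v f hf := by
    rw [hA.lift_proj_map (h.ball v), lor_move, hA.lor_map, h.incident v f hf, mul_zero]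
  det v W hW := by
    obtain ⟨c, hc⟩ := h.det v (A.symm W) fun f hf => by
      have := hW f hf
      rw [lor_move, mul_eq_zero, or_iff_right (inv_ne_zero (norm_ne_zero_iff.2 (h.map_ne hon hA f)))]
        at this
      rw [← hA.lor_map, A.apply_symm_apply, this]
    refine ⟨c, ?_⟩
    rw [hA.lift_proj_map (h.ball v), ← map_smul, ← hc, A.apply_symm_apply]
  indep := by
    have := (h.isFrame.map hA).indep
    simpa only [hA.lift_proj_map (h.ball _)] using this

theorem unique {x' : V → E3} (h : Realizes on ν p x) (h' : Realizes on ν p x') : x = x' := by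
  funext v
  obtain ⟨c, hc⟩ := h.det v (lift (x' v)) fun f hf => h'.incident v f hf
  have h1 := lift_snd_pos (h'.ball v)
  rw [hc, Prod.smul_snd, smul_eq_mul] at h1
  have hc0 : c ≠ 0 := by rintro rfl; simp at h1
  rw [← proj_lift (h.ball v), ← proj_lift (h'.ball v), hc, proj, proj, Prod.smul_snd,
    Prod.smul_fst, smul_smul, smul_eq_mul, mul_inv, mul_right_comm, inv_mul_cancel₀ hc0, one_mul]

/-- The normal form is obtained by a Lorentz transformation. -/
theorem exists_normalize (h : Realizes on ν p x) :
    ∃ A : HalfParam ≃ₗ[ℝ] HalfParam, IsLorentz A ∧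
      normalize ν p x = (move A p, fun v => proj (A (lift (x v)))) := by
  obtain ⟨A, hA, hAc⟩ := h.isFrame.exists_lorentz
  refine ⟨A, hA, Prod.ext (funext fun f => ?_) (funext fun v => ?_)⟩
  · change _ = unitize (A (p f))
    rw [hAc]; rfl
  · change _ = proj (A (lift (x v)))
    rw [hAc]; rfl

/-- Moving only rescales the half space parameters by positive factors, which the final `unitize`
removes. -/
theorem normalize_move (h : Realizes on ν p x) (hon : ∀ f, ∃ v, on v f)
    {A : HalfParam ≃ₗ[ℝ] HalfParam} (hA : IsLorentz A) :
    normalize ν (move A p) (fun v => proj (A (lift (x v)))) = normalize ν p x := by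
  have e : ∀ v, lift (proj (A (lift (x v)))) = A (lift (x v)) := fun v => hA.lift_proj_map (h.ball v)
  refine Prod.ext (funext fun f => ?_) (funext fun v => ?_)
  · simp only [normalize, e]
    rw [move, show unitize (A (p f)) = ‖(A (p f)).1‖⁻¹ • A (p f) from rfl, coords_smul,
      coords_map hA,
      unitize_smul (inv_pos.2 (norm_pos_iff.2 (h.map_ne hon hA f)))]
  · simp only [normalize, e]
    rw [coords_map hA]

theorem move_symm (h : Realizes on ν p x) (hon : ∀ f, ∃ v, on v f)
    {A : HalfParam ≃ₗ[ℝ] HalfParam} (hA : IsLorentz A) : move A.symm (move A p) = p := by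
  funext f
  rw [move, move, show unitize (A (p f)) = ‖(A (p f)).1‖⁻¹ • A (p f) from rfl, map_smul, A.symm_apply_apply,
    unitize_smul (inv_pos.2 (norm_pos_iff.2 (h.map_ne hon hA f))), unitize_eq_self (h.unit f)]

theorem image_move (h : Realizes on ν p x) (hon : ∀ f, ∃ v, on v f)
    {A : HalfParam ≃ₗ[ℝ] HalfParam} (hA : IsLorentz A) (f : F) :
    isoOf hA '' hypHalfSpace (p f) = hypHalfSpace (move A p f) := by
  rw [image_isoOf, move, hypHalfSpace_unitize (h.map_ne hon hA f)]

/-- Isometric families differ by a Lorentz transformation. -/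
theorem exists_move (h : Realizes on ν p x) {q : F → HalfParam} (hq : ∀ f, ‖(q f).1‖ = 1)
    (hon : ∀ f, ∃ v, on v f) {g : Equiv.Perm HypPoly.ball} (hg : g ∈ isoH3)
    (hgp : ∀ f, g '' hypHalfSpace (p f) = hypHalfSpace (q f)) :
    ∃ A : HalfParam ≃ₗ[ℝ] HalfParam, IsLorentz A ∧ q = move A p := by
  obtain ⟨A, hA, hAg⟩ := HypPoly.exists_lorentz hg
  have hgA : g = isoOf hA := by
    ext1 y
    refine Subtype.ext ?_
    rw [← proj_lift (norm_lt_of_ball (g y)), hAg, ← lift_isoOf hA,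
      proj_lift (norm_lt_of_ball _)]
  refine ⟨A, hA, funext fun f => ?_⟩
  have hm := h.image_move hon hA f
  rw [← hgA, hgp f] at hm
  obtain ⟨v, hv⟩ := hon f
  have hm' := h.move_realizes hon hA
  have hqn : (q f).1 ≠ 0 := fun h0 => by
    have := hq f
    rw [h0, norm_zero] at this
    exact zero_ne_one this
  obtain ⟨c, hc, e⟩ := eq_smul_of_hypHalfSpace_eq (hm'.normal_ne f) hqn
    ⟨_, mem_ball_zero_iff.2 (hm'.ball v)⟩ (hm'.inner_eq hv) hm.symm
  rw [← unitize_eq_self (hq f), e, unitize_smul hc, unitize_eq_self (hm'.unit f)]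

end Realizes

/-! ### Vertices as smooth functions of the walls -/

section Vertex

variable [Fintype F]

variable (on) in
open Classical in
/-- The matrix of the normal equations at a vertex. -/
noncomputable def normalOp (p : F → HalfParam) (v : V) : E3 →L[ℝ] E3 :=
  ∑ f with on v f, (innerSL ℝ (p f).1).smulRight (p f).1

variable (on) in
open Classical in
/-- The common point of the walls at a vertex, as a function of the walls. -/
noncomputable def vertexOf (p : F → HalfParam) (v : V) : E3 :=
  Ring.inverse (normalOp on p v) (∑ f with on v f, (p f).2 • (p f).1)

theorem normalOp_apply (p : F → HalfParam) (v : V) (y : E3) [DecidablePred (on v)] :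
    normalOp on p v y = ∑ f with on v f, ⟪(p f).1, y⟫ • (p f).1 := by
  rw [normalOp, sum_apply]
  simp only [ContinuousLinearMap.smulRight_apply, innerSL_apply_apply]
  congr!

namespace Realizes

/-- The operator is a sum of squares of the normals at the vertex, and no nonzero vector is
orthogonal to all of these. -/
theorem isUnit_normalOp (h : Realizes on ν p x) (v : V) : IsUnit (normalOp on p v) := by
  classical
  have hinj : Function.Injective (normalOp on p v : E3 →ₗ[ℝ] E3) := by
    rw [injective_iff_map_eq_zero]
    intro y hy
    refine h.normals_det v fun f hf => ?_
    have h1 : ⟪normalOp on p v y, y⟫ = 0 := by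
      rw [show normalOp on p v y = 0 from hy, inner_zero_left]
    rw [normalOp_apply, sum_inner] at h1
    simp only [inner_smul_left, conj_trivial] at h1
    have := (Finset.sum_eq_zero_iff_of_nonneg fun f _ => mul_self_nonneg _).1 h1 f (by simp [hf])
    exact mul_self_eq_zero.1 this
  rw [ContinuousLinearMap.isUnit_iff_bijective]
  exact ⟨hinj, LinearMap.surjective_of_injective hinj⟩

theorem vertexOf_eq (h : Realizes on ν p x) : vertexOf on p = x := by
  classical
  funext v
  have h1 : ∑ f with on v f, (p f).2 • (p f).1 = normalOp on p v (x v) := by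
    rw [normalOp_apply]
    refine Finset.sum_congr rfl fun f hf => ?_
    rw [h.inner_eq (Finset.mem_filter.1 hf).2]
  rw [vertexOf]
  have h2 : ∀ d : DecidablePred (on v), (∑ f ∈ @Finset.filter F (on v) d Finset.univ,
      (p f).2 • (p f).1) = normalOp on p v (x v) := fun d => by convert h1
  rw [h2, ← mul_apply_eq_comp, Ring.inverse_mul_cancel _ (h.isUnit_normalOp v)]
  rfl

/-- When more than three walls pass through a vertex, nearby tuples may have no common point. The
least squares point is defined and smooth for them too, which gives smoothness in the ambient space.
-/
theorem contDiffAt_vertexOf (h : Realizes on ν p x) (v : V) :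
    ContDiffAt ℝ ∞ (fun q : F → HalfParam => vertexOf on q v) p := by
  classical
  have hf : ∀ f : F, ContDiff ℝ ∞ (fun q : F → HalfParam => q f) := fun f => contDiff_apply ℝ _ f
  have h1 : ContDiff ℝ ∞ (fun q : F → HalfParam => normalOp on q v) := by
    refine ContDiff.sum fun f _ => ?_
    exact ((innerSL ℝ).contDiff.comp (hf f).fst).smulRight (hf f).fst
  have h2 : ContDiff ℝ ∞ (fun q : F → HalfParam => ∑ f with on v f, (q f).2 • (q f).1) :=
    ContDiff.sum fun f _ => (hf f).snd.smul (hf f).fst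
  obtain ⟨u, hu⟩ := h.isUnit_normalOp v
  have h3 : ContDiffAt ℝ ∞ Ring.inverse (normalOp on p v) := hu ▸ contDiffAt_ringInverse ℝ u
  have h4 := (h3.comp p h1.contDiffAt).clm_apply h2.contDiffAt
  refine h4.congr_of_eventuallyEq (Filter.Eventually.of_forall fun q => ?_)
  simp only [vertexOf, Function.comp]

end Realizes

variable (on ν) in
/-- The normal form of a family of half spaces. -/
noncomputable def normalForm (p : F → HalfParam) : (F → HalfParam) × (V → E3) :=
  normalize ν p (vertexOf on p)

theorem Realizes.normalForm_eq (h : Realizes on ν p x) : normalForm on ν p = normalize ν p x := by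
  rw [normalForm, h.vertexOf_eq]

theorem Realizes.normalForm_move (h : Realizes on ν p x) (hon : ∀ f, ∃ v, on v f)
    {A : HalfParam ≃ₗ[ℝ] HalfParam} (hA : IsLorentz A) :
    normalForm on ν (move A p) = normalForm on ν p := by
  rw [(h.move_realizes hon hA).normalForm_eq, h.normalize_move hon hA, h.normalForm_eq]

theorem Realizes.contDiffAt_normalForm [Fintype V] (h : Realizes on ν p x)
    (hon : ∀ f, ∃ v, on v f) : ContDiffAt ℝ ∞ (normalForm on ν) p := by
  have hf : ∀ f : F, ContDiffAt ℝ ∞ (fun q : F → HalfParam => q f) p := fun f =>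
    (contDiff_apply ℝ _ f).contDiffAt
  have e := h.vertexOf_eq
  have hl : ∀ v, ContDiffAt ℝ ∞ (fun q : F → HalfParam => lift (vertexOf on q v)) p := fun v =>
    contDiffAt_lift (h.contDiffAt_vertexOf v) (by rw [e]; exact h.ball v)
  have hfr : IsFrame fun i => lift (vertexOf on p (ν i)) := by rw [e]; exact h.isFrame
  obtain ⟨A, hA, hAc⟩ := hfr.exists_lorentz
  refine ContDiffAt.prodMk (contDiffAt_pi.2 fun f => ?_) (contDiffAt_pi.2 fun v => ?_)
  · refine contDiffAt_unitize (contDiffAt_coords (fun i => hl (ν i)) (hf f) hfr) ?_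
    rw [← hAc]
    exact h.map_ne hon hA f
  · refine contDiffAt_proj (contDiffAt_coords (fun i => hl (ν i)) (hl v) hfr) ?_
    rw [← hAc, e]
    exact (hA.future_map (lift_snd_pos (h.ball v)) (by rw [lor_lift_self (h.ball v)]; norm_num)).ne'

end Vertex

end NormalForm

/-! ### Slices -/

/-- `N` picks smoothly one element (with auxiliary data) from each orbit in `S`. -/
structure IsSlice {F : Type*} [Fintype F] {W : Type*} [NormedAddCommGroup W] [NormedSpace ℝ W]
    (S : Set (F → HalfParam)) (N : (F → HalfParam) → (F → HalfParam) × W) : Prop where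
  smooth : ∀ p ∈ S, ContDiffAt ℝ ∞ N p
  mem : ∀ p ∈ S, (N p).1 ∈ S
  idem : ∀ p ∈ S, N (N p).1 = N p
  rel : ∀ p q : S, (isoSetoid S) p q ↔ N p = N q
  -- A smooth return from the slice to a neighbourhood of `p` staying in the same orbits. It gives
  -- the direction from smooth pullbacks to smooth functions on the quotient.
  back : ∀ p ∈ S, ∃ T : (F → HalfParam) × W → (F → HalfParam), ContDiffAt ℝ ∞ T (N p) ∧
    T (N p) = p ∧ ∀ q ∈ S, T (N q) ∈ S ∧ N (T (N q)) = N q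

/-- Normalising is a Lorentz move, so it stays in the orbit, and moved families have equal normal
forms. The return map is the inverse of the fixed transformation that normalises `p`. -/
theorem isSlice_normalForm {V F : Type*} [Fintype V] [Fintype F] {on : V → F → Prop}
    {ν : Fin 4 → V} {S : Set (F → HalfParam)} (hS : ∀ p ∈ S, ∃ x, Realizes on ν p x)
    (hon : ∀ f, ∃ v, on v f)
    (hmove : ∀ p ∈ S, ∀ A : HalfParam ≃ₗ[ℝ] HalfParam, IsLorentz A → move A p ∈ S) :
    IsSlice S (normalForm on ν) := by
  have hnf : ∀ p ∈ S, ∃ A : HalfParam ≃ₗ[ℝ] HalfParam, IsLorentz A ∧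
      (normalForm on ν p).1 = move A p := by
    intro p hp
    obtain ⟨x, hx⟩ := hS p hp
    obtain ⟨A, hA, e⟩ := hx.exists_normalize
    exact ⟨A, hA, by rw [hx.normalForm_eq, e]⟩
  have hmem : ∀ p ∈ S, (normalForm on ν p).1 ∈ S := by
    intro p hp
    obtain ⟨A, hA, e⟩ := hnf p hp
    rw [e]
    exact hmove p hp A hA
  refine ⟨fun p hp => ?_, hmem, fun p hp => ?_, fun p q => ⟨?_, fun h => ?_⟩, fun p hp => ?_⟩
  · obtain ⟨x, hx⟩ := hS p hp
    exact hx.contDiffAt_normalForm hon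
  · obtain ⟨A, hA, e⟩ := hnf p hp
    obtain ⟨x, hx⟩ := hS p hp
    rw [e, hx.normalForm_move hon hA]
  · rintro ⟨g, hg, hgp⟩
    obtain ⟨x, hx⟩ := hS p p.2
    obtain ⟨x', hx'⟩ := hS q q.2
    obtain ⟨A, hA, e⟩ := hx.exists_move hx'.unit hon hg hgp
    rw [e, hx.normalForm_move hon hA]
  · have key : ∀ p : S, (isoSetoid S) p ⟨_, hmem p p.2⟩ := by
      intro p
      obtain ⟨x, hx⟩ := hS p p.2
      obtain ⟨A, hA, e⟩ := hnf p p.2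
      refine ⟨isoOf hA, isoOf_mem hA, fun f => ?_⟩
      rw [hx.image_move hon hA, ← e]
    have h1 := key p
    have h2 := key q
    have h3 : (⟨_, hmem p p.2⟩ : S) = ⟨_, hmem q q.2⟩ := Subtype.ext (congrArg Prod.fst h)
    rw [h3] at h1
    exact (isoSetoid S).trans h1 ((isoSetoid S).symm h2)
  · obtain ⟨A, hA, e⟩ := hnf p hp
    obtain ⟨x, hx⟩ := hS p hp
    refine ⟨fun y => move A.symm y.1, contDiffAt_pi.2 fun f => ?_, ?_, fun q hq => ?_⟩
    · have hl : ContDiff ℝ ∞ (fun y : (F → HalfParam) × (V → E3) => A.symm (y.1 f)) :=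
        (LinearMap.toContinuousLinearMap (A.symm : HalfParam →ₗ[ℝ] HalfParam)).contDiff.comp
          ((contDiff_apply ℝ _ f).comp contDiff_fst)
      refine contDiffAt_unitize hl.contDiffAt ?_
      rw [e]
      exact (hx.move_realizes hon hA).map_ne hon hA.symm f
    · change move A.symm (normalForm on ν p).1 = p
      rw [e, hx.move_symm hon hA]
    · obtain ⟨B, hB, e'⟩ := hnf q hq
      obtain ⟨y, hy⟩ := hS q hq
      refine ⟨hmove _ (hmem q hq) _ hA.symm, ?_⟩
      change normalForm on ν (move A.symm (normalForm on ν q).1) = _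
      rw [e', (hy.move_realizes hon hB).normalForm_move hon hA.symm, hy.normalForm_move hon hB]

end HypPoly

/-! ### From charts of the slice to an atlas of the quotient -/

namespace HypPoly

/-- A chart, with values in the model `I`, of the subset `Z` of a normed space near `y₀`. -/
structure LocalModel {m : ℕ} {H : Type*} [TopologicalSpace H]
    (I : ModelWithCorners ℝ (EuclideanSpace ℝ (Fin m)) H) {Y : Type*} [NormedAddCommGroup Y]
    [NormedSpace ℝ Y] (Z : Set Y) (y₀ : Y) where
  chart : Y → EuclideanSpace ℝ (Fin m)
  param : EuclideanSpace ℝ (Fin m) → Y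
  dom : Set (EuclideanSpace ℝ (Fin m))
  nhd : Set Y
  isOpen_dom : IsOpen dom
  isOpen_nhd : IsOpen nhd
  mem_nhd : y₀ ∈ nhd
  contDiff_chart : ContDiff ℝ ∞ chart
  contDiffOn_param : ContDiffOn ℝ ∞ param dom
  chart_mem : ∀ y ∈ Z, y ∈ nhd → chart y ∈ dom ∧ chart y ∈ range I ∧ param (chart y) = y
  param_mem : ∀ t ∈ dom, t ∈ range I → param t ∈ Z ∧ param t ∈ nhd ∧ chart (param t) = t

section Slice

variable {F : Type*} [Fintype F] {W : Type*} [NormedAddCommGroup W] [NormedSpace ℝ W]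
  [SecondCountableTopology W] {S : Set (F → HalfParam)} {N : (F → HalfParam) → (F → HalfParam) × W}

namespace IsSlice

/-- The embedding of the quotient as the slice. -/
def emb (hN : IsSlice S N) : Moduli S → (F → HalfParam) × W :=
  Quotient.lift (fun p : S => N p) fun p q h => (hN.rel p q).1 h

theorem emb_cls (hN : IsSlice S N) (p : S) : hN.emb (cls p) = N p := rfl

theorem injective_emb (hN : IsSlice S N) : Function.Injective hN.emb := by
  rintro ⟨p⟩ ⟨q⟩ h
  exact Quotient.sound ((hN.rel p q).2 h)

theorem range_emb (hN : IsSlice S N) : range hN.emb = N '' S := by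
  ext y
  constructor
  · rintro ⟨⟨p⟩, rfl⟩
    exact ⟨p, p.2, rfl⟩
  · rintro ⟨p, hp, rfl⟩
    exact ⟨cls ⟨p, hp⟩, rfl⟩

theorem emb_mem (hN : IsSlice S N) (q : Moduli S) : hN.emb q ∈ N '' S :=
  hN.range_emb ▸ mem_range_self q

theorem continuous_emb (hN : IsSlice S N) : Continuous hN.emb := by
  refine Continuous.quotient_lift (continuous_iff_continuousAt.2 fun p => ?_) _
  exact (hN.smooth p p.2).continuousAt.comp continuousAt_subtype_val

theorem fst_mem (hN : IsSlice S N) {y : (F → HalfParam) × W} (hy : y ∈ N '' S) : y.1 ∈ S := by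
  obtain ⟨p, hp, rfl⟩ := hy
  exact hN.mem p hp

theorem apply_fst (hN : IsSlice S N) {y : (F → HalfParam) × W} (hy : y ∈ N '' S) : N y.1 = y := by
  obtain ⟨p, hp, rfl⟩ := hy
  exact hN.idem p hp

/-- The inverse sends a normal form to the class of its first component, a restriction of the
quotient map, hence continuous. -/
theorem isEmbedding_emb (hN : IsSlice S N) : IsEmbedding hN.emb := by
  let g : N '' S → Moduli S := fun y => cls ⟨y.1.1, hN.fst_mem y.2⟩
  have hg : Continuous g :=
    continuous_quotient_mk'.comp ((continuous_fst.comp continuous_subtype_val).subtype_mk _)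
  let e : Moduli S ≃ₜ N '' S :=
    { toFun := fun q => ⟨hN.emb q, hN.emb_mem q⟩
      invFun := g
      left_inv := fun q => hN.injective_emb (hN.apply_fst (hN.emb_mem q))
      right_inv := fun y => Subtype.ext (hN.apply_fst y.2)
      continuous_toFun := hN.continuous_emb.subtype_mk _
      continuous_invFun := hg }
  exact IsEmbedding.subtypeVal.comp e.isEmbedding

open Classical in
/-- The class with a given normal form. -/
noncomputable def inv (_ : IsSlice S N) (q₀ : Moduli S) (y : (F → HalfParam) × W) : Moduli S :=
  if h : y.1 ∈ S then cls ⟨y.1, h⟩ else q₀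

theorem emb_inv (hN : IsSlice S N) (q₀ : Moduli S) {y : (F → HalfParam) × W} (hy : y ∈ N '' S) :
    hN.emb (hN.inv q₀ y) = y := by
  rw [inv, dif_pos (hN.fst_mem hy), hN.emb_cls]
  exact hN.apply_fst hy

theorem inv_emb (hN : IsSlice S N) (q₀ q : Moduli S) : hN.inv q₀ (hN.emb q) = q :=
  hN.injective_emb (hN.emb_inv q₀ (hN.emb_mem q))

variable {m : ℕ} {H : Type*} [TopologicalSpace H]
  {I : ModelWithCorners ℝ (EuclideanSpace ℝ (Fin m)) H}

/-- The chart of the quotient given by a chart of the slice. -/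
noncomputable def chart (hN : IsSlice S N) (q : Moduli S) (L : LocalModel I (N '' S) (hN.emb q)) :
    OpenPartialHomeomorph (Moduli S) H where
  toFun x := I.symm (L.chart (hN.emb x))
  invFun t := hN.inv q (L.param (I t))
  source := hN.emb ⁻¹' L.nhd
  target := I ⁻¹' L.dom
  map_source' x hx := by
    obtain ⟨h1, h2, -⟩ := L.chart_mem _ (hN.emb_mem x) hx
    rwa [mem_preimage, I.right_inv h2]
  map_target' t ht := by
    obtain ⟨h1, h2, -⟩ := L.param_mem _ ht (mem_range_self t)
    rwa [mem_preimage, hN.emb_inv q h1]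
  left_inv' x hx := by
    obtain ⟨-, h2, h3⟩ := L.chart_mem _ (hN.emb_mem x) hx
    rw [I.right_inv h2, h3, hN.inv_emb]
  right_inv' t ht := by
    obtain ⟨h1, -, h3⟩ := L.param_mem _ ht (mem_range_self t)
    rw [hN.emb_inv q h1, h3, I.left_inv]
  open_source := L.isOpen_nhd.preimage hN.continuous_emb
  open_target := L.isOpen_dom.preimage I.continuous
  continuousOn_toFun :=
    (I.continuous_symm.comp (L.contDiff_chart.continuous.comp hN.continuous_emb)).continuousOn
  continuousOn_invFun := by
    rw [hN.isEmbedding_emb.continuousOn_iff]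
    refine ContinuousOn.congr (f := fun t => L.param (I t)) ?_ fun t ht => ?_
    · exact L.contDiffOn_param.continuousOn.comp I.continuous.continuousOn fun t ht => ht
    · exact hN.emb_inv q (L.param_mem _ ht (mem_range_self t)).1

/-- The atlas given by charts of the slice. -/
noncomputable abbrev chartedSpace (hN : IsSlice S N)
    (L : ∀ q, LocalModel I (N '' S) (hN.emb q)) : ChartedSpace H (Moduli S) where
  atlas := range fun q => hN.chart q (L q)
  chartAt q := hN.chart q (L q)
  mem_chart_source q := (L q).mem_nhd
  chart_mem_atlas q := mem_range_self q

/-- An atlas of the quotient for which the embedding as a slice is smooth, and the charts are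
restrictions of smooth functions. -/
structure IsAtlas (hN : IsSlice S N) (I : ModelWithCorners ℝ (EuclideanSpace ℝ (Fin m)) H)
    [ChartedSpace H (Moduli S)] : Prop where
  quotient : IsQuotientManifold S I
  smooth : ContMDiff I 𝓘(ℝ, (F → HalfParam) × W) ∞ hN.emb
  chart : ∀ q, ∃ κ : (F → HalfParam) × W → EuclideanSpace ℝ (Fin m), ContDiff ℝ ∞ κ ∧
    ∀ᶠ x in 𝓝 q, extChartAt I q x = κ (hN.emb x)

/-- Coordinate changes are a smooth chart function after a smooth parametrisation. For functions,
one direction composes with chart and normal form, the other with the parametrisation and the return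
map of the slice. -/
theorem isAtlas_chartedSpace (hN : IsSlice S N) (L : ∀ q, LocalModel I (N '' S) (hN.emb q)) :
    let _ : ChartedSpace H (Moduli S) := hN.chartedSpace L
    hN.IsAtlas I ∧ ∀ q : Moduli S, extChartAt I q q = (L q).chart (hN.emb q) := by
  let _ : ChartedSpace H (Moduli S) := hN.chartedSpace L
  have hext : ∀ q x : Moduli S, extChartAt I q x = I (I.symm ((L q).chart (hN.emb x))) := fun q x => rfl
  have hsymm : ∀ (q : Moduli S) t, (extChartAt I q).symm t = hN.inv q ((L q).param (I (I.symm t))) :=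
    fun q t => rfl
  have hext' : ∀ q x : Moduli S, hN.emb x ∈ (L q).nhd → extChartAt I q x = (L q).chart (hN.emb x) := by
    intro q x hx
    rw [hext, I.right_inv ((L q).chart_mem _ (hN.emb_mem x) hx).2.1]
  have hsymm' : ∀ (q : Moduli S) t, t ∈ (L q).dom → t ∈ range I →
      hN.emb ((extChartAt I q).symm t) = (L q).param t := by
    intro q t ht ht'
    rw [hsymm, I.right_inv ht', hN.emb_inv q ((L q).param_mem t ht ht').1]
  have hself : ∀ q : Moduli S, extChartAt I q q = (L q).chart (hN.emb q) := fun q => hext' q q (L q).mem_nhd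
  have hdom : ∀ q : Moduli S, (L q).dom ∈ 𝓝 (extChartAt I q q) := fun q => by
    rw [hself]
    exact (L q).isOpen_dom.mem_nhds ((L q).chart_mem _ (hN.emb_mem q) (L q).mem_nhd).1
  have hparam : ∀ q : Moduli S, ContDiffAt ℝ ∞ (L q).param (extChartAt I q q) := fun q =>
    (L q).contDiffOn_param.contDiffAt (hdom q)
  have hmem : ∀ q : Moduli S, extChartAt I q q ∈ range I := fun q => mem_range_self _
  have hev : ∀ q : Moduli S, ∀ᶠ t in 𝓝[range I] (extChartAt I q q), t ∈ (L q).dom ∧ t ∈ range I := fun q =>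
    (Filter.Eventually.filter_mono nhdsWithin_le_nhds (hdom q)).and self_mem_nhdsWithin
  have hsm : ContMDiff I 𝓘(ℝ, (F → HalfParam) × W) ∞ hN.emb := by
    intro q
    rw [contMDiffAt_iff]
    refine ⟨hN.continuous_emb.continuousAt, ?_⟩
    refine (hparam q).contDiffWithinAt.congr_of_eventuallyEq_of_mem ?_ (hmem q)
    filter_upwards [hev q] with t ht
    exact hsymm' q t ht.1 ht.2
  have hman : IsManifold I ∞ (Moduli S) := by
    refine isManifold_of_contDiffOn I ∞ _ ?_
    rintro _ _ ⟨q, rfl⟩ ⟨q', rfl⟩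
    have hset : ∀ t ∈ I.symm ⁻¹' ((hN.chart q (L q)).symm ≫ₕ hN.chart q' (L q')).source ∩ range I,
        t ∈ (L q).dom ∧ (L q).param t ∈ (L q').nhd := by
      rintro t ⟨⟨h1, h2⟩, h3⟩
      have h1' : I (I.symm t) ∈ (L q).dom := h1
      rw [I.right_inv h3] at h1'
      have h2' : hN.emb (hN.inv q ((L q).param (I (I.symm t)))) ∈ (L q').nhd := h2
      rw [I.right_inv h3, hN.emb_inv q ((L q).param_mem t h1' h3).1] at h2'
      exact ⟨h1', h2'⟩
    refine ContDiffOn.congr (f := fun t => (L q').chart ((L q).param t)) ?_ fun t ht => ?_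
    · exact (L q').contDiff_chart.comp_contDiffOn
        ((L q).contDiffOn_param.mono fun t ht => (hset t ht).1)
    · obtain ⟨h1, h2⟩ := hset t ht
      have hZ := ((L q).param_mem t h1 ht.2).1
      change I (I.symm ((L q').chart (hN.emb (hN.inv q ((L q).param (I (I.symm t))))))) = _
      rw [I.right_inv ht.2, hN.emb_inv q hZ, I.right_inv ((L q').chart_mem _ hZ h2).2.1]
  have hnear : ∀ q, ∀ᶠ x in 𝓝 q, hN.emb x ∈ (L q).nhd := fun q =>
    hN.continuous_emb.continuousAt.eventually ((L q).isOpen_nhd.mem_nhds (L q).mem_nhd)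
  refine ⟨⟨⟨hN.isEmbedding_emb.t2Space, hN.isEmbedding_emb.secondCountableTopology, hman,
    fun h p => ?_⟩, hsm, fun q => ⟨(L q).chart, (L q).contDiff_chart, ?_⟩⟩, hself⟩
  · set q : Moduli S := cls p with hq
    have hextend : ∀ r : S, Function.extend Subtype.val (fun q : S => h (cls q)) (fun _ => 0) r.1 =
        h (cls r) := fun r => Subtype.val_injective.extend_apply _ _ r
    constructor
    · intro hh
      have h1 := (contMDiffAt_iff.1 hh).2
      have h2 : ContDiffAt ℝ ∞ (fun r => (L q).chart (N r)) p.1 :=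
        (L q).contDiff_chart.contDiffAt.comp p.1 (hN.smooth p p.2)
      have hNe : ∀ᶠ r in 𝓝 p.1, N r ∈ (L q).nhd :=
        (hN.smooth p p.2).continuousAt.eventually ((L q).isOpen_nhd.mem_nhds (L q).mem_nhd)
      have e1 : extChartAt I q q = (L q).chart (N p) := hself q
      rw [e1] at h1
      have h3 := h1.comp_of_preimage_mem_nhdsWithin (f := fun r => (L q).chart (N r)) p.1
        (h2.contDiffWithinAt (s := S)) (by
          filter_upwards [self_mem_nhdsWithin,
            Filter.Eventually.filter_mono nhdsWithin_le_nhds hNe] with r hr hr'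
          exact ((L q).chart_mem _ ⟨r, hr, rfl⟩ hr').2.1)
      refine h3.congr_of_eventuallyEq_of_mem ?_ p.2
      filter_upwards [self_mem_nhdsWithin, Filter.Eventually.filter_mono nhdsWithin_le_nhds hNe]
        with r hr hr'
      rw [hextend ⟨r, hr⟩]
      change _ = h ((extChartAt I q).symm ((L q).chart (N r)))
      rw [hsymm, I.right_inv ((L q).chart_mem _ ⟨r, hr, rfl⟩ hr').2.1,
        ((L q).chart_mem _ ⟨r, hr, rfl⟩ hr').2.2]
      rw [← hN.emb_cls ⟨r, hr⟩, hN.inv_emb]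
    · intro hh
      obtain ⟨T, hT1, hT2, hT3⟩ := hN.back p p.2
      have e1 : extChartAt I q q = (L q).chart (N p) := hself q
      have e2 : (L q).param (extChartAt I q q) = N p := by
        rw [e1]; exact ((L q).chart_mem _ (hN.emb_mem q) (L q).mem_nhd).2.2
      have hTS : ∀ t ∈ (L q).dom, t ∈ range I → ∃ h' : T ((L q).param t) ∈ S,
          cls ⟨_, h'⟩ = (extChartAt I q).symm t := by
        intro t ht ht'
        have hZ := ((L q).param_mem t ht ht').1
        have h1 : T ((L q).param t) ∈ S ∧ N (T ((L q).param t)) = (L q).param t := by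
          obtain ⟨r, hr, e⟩ := hZ
          rw [← e]
          exact hT3 r hr
        exact ⟨h1.1, hN.injective_emb (h1.2.trans (hsymm' q t ht ht').symm)⟩
      have hg : ContDiffWithinAt ℝ ∞ (h ∘ (extChartAt I q).symm) (range I) (extChartAt I q q) := by
        have h1 : ContDiffAt ℝ ∞ (fun t => T ((L q).param t)) (extChartAt I q q) :=
          ContDiffAt.comp _ (by rw [e2]; exact hT1) (hparam q)
        have h2 := ContDiffWithinAt.comp_of_preimage_mem_nhdsWithin_of_eq (t := S) (y := p.1)
          (extChartAt I q q) hh (h1.contDiffWithinAt (s := range I)) (by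
            filter_upwards [hev q] with t ht
            exact (hTS t ht.1 ht.2).1) (by rw [e2, hT2])
        refine h2.congr_of_eventuallyEq_of_mem ?_ (hmem q)
        filter_upwards [hev q] with t ht
        obtain ⟨h', e⟩ := hTS t ht.1 ht.2
        simp only [Function.comp]
        rw [hextend ⟨_, h'⟩, e]
      refine contMDiffAt_iff.2 ⟨?_, hg⟩
      -- Manifold smoothness also asks for continuity of `h`, which is recovered from that of its
      -- coordinate expression.
      have h3 : Filter.Tendsto (extChartAt I q) (𝓝 q) (𝓝[range I] (extChartAt I q q)) :=
        tendsto_nhdsWithin_iff.2 ⟨continuousAt_extChartAt q,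
          Filter.Eventually.of_forall fun x => mem_range_self _⟩
      have h4 := hg.continuousWithinAt.tendsto.comp h3
      have h5 : (extChartAt I q).symm (extChartAt I q q) = q := extChartAt_to_inv q
      simp only [Function.comp, h5] at h4
      refine h4.congr' ?_
      filter_upwards [extChartAt_source_mem_nhds (I := I) q] with x hx
      simp only [Function.comp, (extChartAt I q).left_inv hx]
  · filter_upwards [hnear q] with x hx
    exact hext' q x hx

section Maps

variable [ChartedSpace H (Moduli S)] {E' H' X : Type*} [NormedAddCommGroup E'] [NormedSpace ℝ E']
  [TopologicalSpace H'] {J : ModelWithCorners ℝ E' H'} [TopologicalSpace X] [ChartedSpace H' X]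
  {hN : IsSlice S N}

theorem IsAtlas.contMDiffAt (hA : hN.IsAtlas I) {f : X → Moduli S} {x : X} (hf : ContinuousAt f x)
    (h : ContMDiffAt J 𝓘(ℝ, (F → HalfParam) × W) ∞ (fun y => hN.emb (f y)) x) :
    ContMDiffAt J I ∞ f x := by
  rw [contMDiffAt_iff_target]
  refine ⟨hf, ?_⟩
  obtain ⟨κ, hκ, he⟩ := hA.chart (f x)
  refine ContMDiffAt.congr_of_eventuallyEq (f := fun y => κ (hN.emb (f y))) ?_ (hf.eventually he)
  exact hκ.contMDiff.contMDiffAt.comp x h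

/-- A chart at `q`, whose derivative is invertible, factors locally through `j`, because `g`
recovers the slice embedding from `j`. -/
theorem IsAtlas.injective_mfderiv (hA : hN.IsAtlas I) {j : Moduli S → X} (hj : ContMDiff I J ∞ j)
    {g : X → (F → HalfParam) × W} (hg : ContMDiff J 𝓘(ℝ, (F → HalfParam) × W) ∞ g)
    (hgj : ∀ q, g (j q) = hN.emb q) (q : Moduli S) : Function.Injective (mfderiv I J j q) := by
  have hman : IsManifold I ∞ (Moduli S) := hA.quotient.2.2.1
  have hman1 : IsManifold I 1 (Moduli S) := IsManifold.of_le (n := ∞) (by norm_cast)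
  obtain ⟨κ, hκ, he⟩ := hA.chart q
  have h1 := isInvertible_mfderiv_extChartAt (I := I) (mem_extChartAt_source (I := I) q)
  have h2 : MDifferentiableAt I J j q := (hj q).mdifferentiableAt (by simp)
  have h3 : MDifferentiableAt J 𝓘(ℝ, EuclideanSpace ℝ (Fin m)) (fun x => κ (g x)) (j q) :=
    (hκ.contMDiff.comp hg (j q)).mdifferentiableAt (by simp)
  have h4 : mfderiv I 𝓘(ℝ, EuclideanSpace ℝ (Fin m)) (extChartAt I q) q =
      (mfderiv J 𝓘(ℝ, EuclideanSpace ℝ (Fin m)) (fun x => κ (g x)) (j q)).comp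
        (mfderiv I J j q) := by
    rw [← mfderiv_comp q h3 h2]
    refine Filter.EventuallyEq.mfderiv_eq ?_
    filter_upwards [he] with x hx
    simp only [Function.comp, hx, hgj]
  rw [h4] at h1
  intro v w hvw
  refine h1.injective ?_
  change mfderiv J 𝓘(ℝ, EuclideanSpace ℝ (Fin m)) (fun x => κ (g x)) (j q) (mfderiv I J j q v) = _
  rw [hvw]
  rfl

end Maps

end IsSlice

end Slice

end HypPoly

/-! ### Charts of regular solution sets, with and without a boundary inequality -/

namespace HypPoly

section Equations

variable {Y : Type*} [NormedAddCommGroup Y] [NormedSpace ℝ Y] [FiniteDimensional ℝ Y]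
  {ι : Type*} [Fintype ι] {φ : ι → Y → ℝ} {y₀ : Y}

/-- Independent equations can be completed to local coordinates by linear functions. -/
theorem exists_complement {k : ℕ} {l : ι → Y →L[ℝ] ℝ} (hl : LinearIndependent ℝ l)
    (hk : Module.finrank ℝ Y = Fintype.card ι + k) :
    ∃ L : Y →L[ℝ] EuclideanSpace ℝ (Fin k), ∀ u, (∀ i, l i u = 0) → L u = 0 → u = 0 := by
  let l' : ι → Module.Dual ℝ Y := fun i => (l i : Y →ₗ[ℝ] ℝ)
  have hl' : LinearIndependent ℝ l' := by
    rw [Fintype.linearIndependent_iff] at hl ⊢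
    intro g hg
    refine hl g (ContinuousLinearMap.ext fun u => ?_)
    have := LinearMap.congr_fun hg u
    simpa [l', LinearMap.sum_apply] using this
  set W := Submodule.span ℝ (range l') with hW
  have h1 : Module.finrank ℝ W = Fintype.card ι := finrank_span_eq_card hl'
  have h2 := Subspace.finrank_add_finrank_dualCoannihilator_eq W
  have h3 : Module.finrank ℝ W.dualCoannihilator = Module.finrank ℝ (EuclideanSpace ℝ (Fin k)) := by
    rw [finrank_euclideanSpace_fin]; omega
  obtain ⟨L, hL⟩ := LinearMap.exists_extend (LinearEquiv.ofFinrankEq _ _ h3).toLinearMap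
  refine ⟨LinearMap.toContinuousLinearMap L, fun u hu hLu => ?_⟩
  have hmem : u ∈ W.dualCoannihilator := by
    rw [Submodule.mem_dualCoannihilator]
    intro w hw
    induction hw using Submodule.span_induction with
    | mem w hw => obtain ⟨i, rfl⟩ := hw; exact hu i
    | zero => rfl
    | add a b _ _ ha hb => rw [LinearMap.add_apply, ha, hb, add_zero]
    | smul c a _ ha => rw [LinearMap.smul_apply, ha, smul_zero]
  have := LinearMap.congr_fun hL ⟨u, hmem⟩
  have h4 : LinearEquiv.ofFinrankEq _ _ h3 ⟨u, hmem⟩ = 0 := this.symm.trans hLu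
  exact congrArg Subtype.val ((LinearEquiv.map_eq_zero_iff _).1 h4)

/-- The solution set of independent equations has a chart by complementary functions. -/
theorem exists_localModel {m : ℕ} {H : Type*} [TopologicalSpace H]
    (I : ModelWithCorners ℝ (EuclideanSpace ℝ (Fin m)) H) {Z O : Set Y}
    (hφ : ∀ i, ContDiff ℝ ∞ (φ i)) {κ : Y → EuclideanSpace ℝ (Fin m)} (hκ : ContDiff ℝ ∞ κ)
    (hm : Module.finrank ℝ Y = Fintype.card ι + m)
    (hinj : ∀ u, (∀ i, fderiv ℝ (φ i) y₀ u = 0) → fderiv ℝ κ y₀ u = 0 → u = 0)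
    (hO : O ∈ 𝓝 y₀) (hZ : ∀ y ∈ O, y ∈ Z ↔ (∀ i, φ i y = 0) ∧ κ y ∈ range I) :
    ∃ L : LocalModel I Z y₀, L.chart = κ := by
  let ψ : Y → (ι → ℝ) × EuclideanSpace ℝ (Fin m) := fun y => (fun i => φ i y, κ y)
  have hψ : ContDiff ℝ ∞ ψ := (contDiff_pi.2 hφ).prodMk hκ
  have hφd : ∀ i, DifferentiableAt ℝ (φ i) y₀ := fun i =>
    (hφ i).contDiffAt.differentiableAt (by simp)
  have hκd : DifferentiableAt ℝ κ y₀ := hκ.contDiffAt.differentiableAt (by simp)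
  have hd : HasFDerivAt ψ ((ContinuousLinearMap.pi fun i => fderiv ℝ (φ i) y₀).prod
      (fderiv ℝ κ y₀)) y₀ :=
    (hasFDerivAt_pi.2 fun i => (hφd i).hasFDerivAt).prodMk hκd.hasFDerivAt
  set D := (ContinuousLinearMap.pi fun i => fderiv ℝ (φ i) y₀).prod (fderiv ℝ κ y₀) with hD
  have hDinj : Function.Injective (D : Y →ₗ[ℝ] (ι → ℝ) × EuclideanSpace ℝ (Fin m)) := by
    rw [injective_iff_map_eq_zero]
    intro u hu
    exact hinj u (fun i => congrFun (congrArg Prod.fst hu) i) (congrArg Prod.snd hu)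
  have hdim : Module.finrank ℝ Y = Module.finrank ℝ ((ι → ℝ) × EuclideanSpace ℝ (Fin m)) := by
    rw [Module.finrank_prod, Module.finrank_fintype_fun_eq_card, finrank_euclideanSpace_fin, hm]
  let D' : Y ≃L[ℝ] (ι → ℝ) × EuclideanSpace ℝ (Fin m) :=
    (LinearEquiv.ofInjectiveOfFinrankEq (D : Y →ₗ[ℝ] (ι → ℝ) × EuclideanSpace ℝ (Fin m)) hDinj
      hdim).toContinuousLinearEquiv
  have hD' : (D' : Y →L[ℝ] (ι → ℝ) × EuclideanSpace ℝ (Fin m)) = D := by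
    ext u <;> rfl
  rw [← hD'] at hd
  let e := hψ.contDiffAt.toOpenPartialHomeomorph ψ hd (by simp)
  have he : ∀ y, e y = ψ y := fun y => rfl
  have hmem : y₀ ∈ e.source := hψ.contDiffAt.mem_toOpenPartialHomeomorph_source hd (by simp)
  -- The inverse must be smooth on the whole domain of the chart and not just at one point, so the
  -- source is cut down to where the derivative is invertible.
  let Inv : Set Y := fderiv ℝ ψ ⁻¹' range
    ((↑) : (Y ≃L[ℝ] (ι → ℝ) × EuclideanSpace ℝ (Fin m)) → Y →L[ℝ] (ι → ℝ) ×
      EuclideanSpace ℝ (Fin m))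
  have hInv : IsOpen Inv := ContinuousLinearEquiv.isOpen.preimage (hψ.continuous_fderiv (by simp))
  set O' : Set Y := interior O ∩ Inv with hO'
  have hO'o : IsOpen O' := isOpen_interior.inter hInv
  have hO'm : y₀ ∈ O' := ⟨mem_interior_iff_mem_nhds.2 hO, D', hd.fderiv.symm⟩
  let e' := e.restrOpen O' hO'o
  have hsrc : ∀ y, y ∈ e'.source ↔ y ∈ e.source ∧ y ∈ O' := fun y => by
    rw [e.restrOpen_source]; rfl
  have hzero : Continuous fun t : EuclideanSpace ℝ (Fin m) => ((0 : ι → ℝ), t) := by fun_prop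
  refine ⟨{ chart := κ
            param := fun t => e'.symm (0, t)
            dom := (fun t => ((0 : ι → ℝ), t)) ⁻¹' e'.target
            nhd := e'.source
            isOpen_dom := e'.open_target.preimage hzero
            isOpen_nhd := e'.open_source
            mem_nhd := (hsrc y₀).2 ⟨hmem, hO'm⟩
            contDiff_chart := hκ
            contDiffOn_param := ?_
            chart_mem := ?_
            param_mem := ?_ }, rfl⟩
  · intro t ht
    obtain ⟨-, -, D₁, hD₁⟩ := (hsrc _).1 (e'.map_target ht)
    have h1 : HasFDerivAt ψ (D₁ : Y →L[ℝ] (ι → ℝ) × EuclideanSpace ℝ (Fin m)) (e'.symm (0, t)) := by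
      rw [hD₁]
      exact (hψ.contDiffAt.differentiableAt (by simp)).hasFDerivAt
    have h2 : ContDiffAt ℝ ∞ e'.symm (0, t) :=
      e'.contDiffAt_symm ht h1 hψ.contDiffAt
    exact (h2.comp t (contDiff_const.prodMk contDiff_id).contDiffAt).contDiffWithinAt
  · intro y hy hys
    obtain ⟨h1, h2⟩ := (hZ y (interior_subset ((hsrc y).1 hys).2.1)).1 hy
    have h3 : ψ y = (0, κ y) := Prod.ext (funext h1) rfl
    have h4 : e' y = (0, κ y) := h3
    refine ⟨?_, h2, ?_⟩
    · change ((0 : ι → ℝ), κ y) ∈ e'.target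
      rw [← h4]
      exact e'.map_source hys
    · rw [← h4]
      exact e'.left_inv hys
  · intro t ht htI
    have h1 := e'.map_target ht
    have h2 : ψ (e'.symm (0, t)) = (0, t) := e'.right_inv ht
    have h3 : κ (e'.symm (0, t)) = t := congrArg Prod.snd h2
    refine ⟨(hZ _ (interior_subset ((hsrc _).1 h1).2.1)).2 ⟨fun i => ?_, ?_⟩, h1, h3⟩
    · exact congrFun (congrArg Prod.fst h2) i
    · rw [h3]; exact htI

/-- Local model at a point where the space is given by equations only. -/
theorem exists_localModel_interior {m : ℕ} {H : Type*} [TopologicalSpace H]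
    (I : ModelWithCorners ℝ (EuclideanSpace ℝ (Fin m)) H) {Z : Set Y}
    (hφ : ∀ i, ContDiff ℝ ∞ (φ i)) (hli : LinearIndependent ℝ fun i => fderiv ℝ (φ i) y₀)
    (hm : Module.finrank ℝ Y = Fintype.card ι + m) (hZ : ∀ᶠ y in 𝓝 y₀, y ∈ Z ↔ ∀ i, φ i y = 0)
    {t₀ : EuclideanSpace ℝ (Fin m)} (ht₀ : t₀ ∈ interior (range I)) :
    ∃ L : LocalModel I Z y₀, L.chart y₀ = t₀ := by
  obtain ⟨L, hL⟩ := exists_complement hli hm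
  -- Centred at an interior point of the model, so that nearby coordinates stay in its range; this
  -- lets the half space model serve at interior points.
  let κ : Y → EuclideanSpace ℝ (Fin m) := fun y => t₀ + L (y - y₀)
  have hκ : ContDiff ℝ ∞ κ := contDiff_const.add (L.contDiff.comp (contDiff_id.sub contDiff_const))
  have hκ0 : κ y₀ = t₀ := by simp [κ]
  have hκd : HasFDerivAt κ L y₀ := by
    have h1 : HasFDerivAt (fun y : Y => L (y - y₀)) L y₀ := by
      have h2 := L.hasFDerivAt.comp y₀ ((hasFDerivAt_id y₀).sub_const y₀)
      rwa [ContinuousLinearMap.comp_id] at h2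
    exact h1.const_add t₀
  have hev : ∀ᶠ y in 𝓝 y₀, κ y ∈ range I := by
    have h1 : interior (range I) ∈ 𝓝 (κ y₀) := by
      rw [hκ0]; exact isOpen_interior.mem_nhds ht₀
    filter_upwards [hκ.continuous.continuousAt.eventually h1] with y hy
    exact interior_subset hy
  obtain ⟨M, hM⟩ := exists_localModel (y₀ := y₀) I (Z := Z) hφ hκ hm
    (fun u hu hu' => hL u hu (by rwa [hκd.fderiv] at hu')) (hZ.and hev)
    (fun y hy => hy.1.trans ⟨fun h => ⟨h, hy.2⟩, fun h => h.1⟩)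
  exact ⟨M, by rw [hM, hκ0]⟩

/-- Local model at a point where the space is given by equations and one inequality. -/
theorem exists_localModel_boundary {n : ℕ} {Z : Set Y} {β : Y → ℝ} (hβ : ContDiff ℝ ∞ β)
    (hφ : ∀ i, ContDiff ℝ ∞ (φ i))
    (hli : LinearIndependent ℝ fun i : Option ι => fderiv ℝ (i.elim β φ) y₀)
    (hm : Module.finrank ℝ Y = Fintype.card ι + (n + 1))
    (hZ : ∀ᶠ y in 𝓝 y₀, y ∈ Z ↔ (∀ i, φ i y = 0) ∧ 0 ≤ β y) :
    ∃ L : LocalModel (𝓡∂ (n + 1)) Z y₀, L.chart y₀ 0 = β y₀ := by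
  obtain ⟨L, hL⟩ := exists_complement (k := n) hli (by rw [Fintype.card_option, hm]; ring)
  -- The inequality function is the zeroth coordinate, the one constrained in the model half space.
  let κ : Y → EuclideanSpace ℝ (Fin (n + 1)) := fun y =>
    WithLp.toLp 2 (Fin.cons (β y) (fun i => L y i))
  have hκ : ContDiff ℝ ∞ κ := by
    rw [contDiff_euclidean]
    intro i
    refine Fin.cases ?_ (fun i => ?_) i
    · exact hβ
    · exact contDiff_euclidean.1 L.contDiff i
  have hκd : ∀ u i, fderiv ℝ κ y₀ u i = fderiv ℝ (fun y => κ y i) y₀ u := by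
    intro u i
    have h1 : HasFDerivAt (fun y => κ y i)
        ((EuclideanSpace.proj i : EuclideanSpace ℝ (Fin (n + 1)) →L[ℝ] ℝ).comp (fderiv ℝ κ y₀)) y₀ :=
      (EuclideanSpace.proj (𝕜 := ℝ) i).hasFDerivAt.comp y₀
        (hκ.contDiffAt.differentiableAt (by simp)).hasFDerivAt
    rw [h1.fderiv]
    rfl
  obtain ⟨M, hM⟩ := exists_localModel (y₀ := y₀) (𝓡∂ (n + 1)) (Z := Z) hφ hκ hm
    (fun u hu hu' => by
      refine hL u (fun i => ?_) ?_
      · cases i with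
        | none =>
          have := hκd u 0
          rw [hu'] at this
          exact this.symm
        | some i => exact hu i
      · ext i
        have := hκd u i.succ
        rw [hu'] at this
        have h2 : HasFDerivAt (fun y => κ y i.succ)
            ((EuclideanSpace.proj i : EuclideanSpace ℝ (Fin n) →L[ℝ] ℝ).comp L) y₀ :=
          (EuclideanSpace.proj (𝕜 := ℝ) i).hasFDerivAt.comp y₀ L.hasFDerivAt
        rw [h2.fderiv] at this
        exact this.symm)
    hZ (fun y hy => by
      rw [range_modelWithCornersEuclideanHalfSpace]
      exact hy)
  exact ⟨M, by rw [hM]; rfl⟩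

end Equations

end HypPoly

namespace HypPoly

/-! ### Polyhedra carry no stress -/

namespace IsStrict

variable {V : Type*} [Finite V] {G : SimpleGraph V} {M : SphereEmbedding G}
  {p : M.Face → HalfParam} {x : V → E3}

/-- By the sign lemma all coefficients but that of `d₀` may be taken nonnegative. The sum of the
directions from `v` to the vertices of the face of `d₀` lies in that wall and strictly inside the
others, so pairing with it kills those coefficients. -/
theorem normals_indep_of_card (h : IsStrict M p x) (hM : M.Polyhedral) {v : V} (s : Finset G.Dart)
    (hs : s.card ≤ 3) (hv : ∀ d ∈ s, d.fst = v) (τ : G.Dart → ℝ)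
    (h0 : ∑ d ∈ s, τ d • (p (M.face d)).1 = 0) : ∀ d ∈ s, τ d = 0 := by
  classical
  have := Fintype.ofFinite V
  rcases s.eq_empty_or_nonempty with rfl | ⟨e, he⟩
  · simp
  have hne : Nonempty G.Dart := ⟨e⟩
  have key : ∀ τ : G.Dart → ℝ, ∑ d ∈ s, τ d • (p (M.face d)).1 = 0 → ∀ d₀ ∈ s,
      (∀ d ∈ s, d ≠ d₀ → 0 ≤ τ d) → ∀ d ∈ s, τ d = 0 := by
    intro τ h0 d₀ hd₀ hpos
    set T : Finset V := Finset.univ.filter fun u => M.OnFace u (M.face d₀) with hT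
    have hin : ∀ f, ⟪(p f).1, ∑ u ∈ T, (x u - x v)⟫ = ∑ u ∈ T, ⟪(p f).1, x u - x v⟫ := fun f =>
      inner_sum _ _ _
    have hon : ∀ d ∈ s, M.OnFace v (M.face d) := fun d hd => hv d hd ▸ M.onFace_fst d
    have hzero : ⟪(p (M.face d₀)).1, ∑ u ∈ T, (x u - x v)⟫ = 0 := by
      rw [hin]
      exact Finset.sum_eq_zero fun u hu =>
        h.inner_eq_zero (hon d₀ hd₀) (Finset.mem_filter.1 hu).2
    have hneg : ∀ d ∈ s, d ≠ d₀ → ⟪(p (M.face d)).1, ∑ u ∈ T, (x u - x v)⟫ < 0 := by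
      intro d hd hdd
      rw [hin]
      obtain ⟨u, hu, hud⟩ : ∃ u, M.OnFace u (M.face d₀) ∧ ¬ M.OnFace u (M.face d) := by
        by_contra! hall
        obtain ⟨a, b, c, h1, h2, h3, ha, hb, hc⟩ := M.exists_three_onFace hM.rot_ne (M.face d₀)
        exact hdd (hM.dart_unique _ _ ((hv d hd).trans (hv d₀ hd₀).symm)
          (hM.three _ _ a b c h1 h2 h3 (hall a ha) (hall b hb) (hall c hc) ha hb hc))
      exact Finset.sum_neg' (fun u _ => h.inner_nonpos (hon d hd))
        ⟨u, by simp [hT, hu], h.inner_neg (hon d hd) hud⟩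
    have hsum : ∑ d ∈ s, τ d * ⟪(p (M.face d)).1, ∑ u ∈ T, (x u - x v)⟫ = 0 := by
      have := congrArg (fun y => ⟪y, ∑ u ∈ T, (x u - x v)⟫) h0
      simpa only [sum_inner, inner_smul_left, conj_trivial, inner_zero_left] using this
    have hterm := (Finset.sum_eq_zero_iff_of_nonpos fun d hd => by
      by_cases hdd : d = d₀
      · rw [hdd, hzero, mul_zero]
      · exact mul_nonpos_of_nonneg_of_nonpos (hpos d hd hdd) (hneg d hd hdd).le).1 hsum
    have hoff : ∀ d ∈ s, d ≠ d₀ → τ d = 0 := fun d hd hdd =>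
      (mul_eq_zero.1 (hterm d hd)).resolve_right (hneg d hd hdd).ne
    intro d hd
    by_cases hdd : d = d₀
    · rw [Finset.sum_eq_single_of_mem d hd fun e he hne => by
        rw [hoff e he (hdd ▸ hne), zero_smul]] at h0
      exact (smul_eq_zero.1 h0).resolve_right (h.normal_ne _)
    · exact hoff d hd hdd
  have key' : ∀ τ : G.Dart → ℝ, ∑ d ∈ s, τ d • (p (M.face d)).1 = 0 → ∀ d₀,
      (∀ d ∈ s, d ≠ d₀ → 0 ≤ τ d) → ∀ d ∈ s, τ d = 0 := by
    intro τ h0 d₀ hpos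
    by_cases hd₀ : d₀ ∈ s
    · exact key τ h0 d₀ hd₀ hpos
    · exact key τ h0 e he fun d hd _ => hpos d hd fun e => hd₀ (e ▸ hd)
  obtain ⟨d₀, hd₀ | hd₀⟩ := exists_sign_index s hs τ
  · exact key' τ h0 d₀ hd₀
  · have := key' (fun d => -τ d) (by simp only [neg_smul, Finset.sum_neg_distrib, h0, neg_zero]) d₀
      (fun d hd hne => neg_nonneg.2 (hd₀ d hd hne))
    exact fun d hd => neg_eq_zero.1 (this d hd)

open Classical in
/-- Forces along the incidences of a polyhedron in equilibrium at all vertices and faces vanish. -/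
theorem no_stress (h : IsStrict M p x) (hM : M.Polyhedral) (τ : G.Dart → ℝ)
    (h1 : ∀ v, ∑ d : G.Dart with d.fst = v, τ d • (p (M.face d)).1 = 0)
    (h2 : ∀ f, ∑ d : G.Dart with M.face d = f, τ d = 0)
    (h3 : ∀ f, ∑ d : G.Dart with M.face d = f, τ d • x d.fst = 0) : τ = 0 := by
  have := Fintype.ofFinite V
  have hm := h.isMarked hM
  by_contra hne
  set K : Finset G.Dart := Finset.univ.filter fun d => τ d ≠ 0 with hK
  have hKne : K.Nonempty := by
    by_contra hemp
    rw [Finset.not_nonempty_iff_eq_empty] at hemp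
    refine hne (funext fun d => ?_)
    by_contra hd
    have : d ∈ K := by simpa [hK] using hd
    rw [hemp] at this
    simp at this
  have hKτ : ∀ d ∈ K, τ d ≠ 0 := fun d hd => (Finset.mem_filter.1 hd).2
  have hsub : ∀ (P : G.Dart → Prop) [DecidablePred P] {A : Type} [AddCommGroup A] [Module ℝ A]
      (g : G.Dart → A), ∑ d ∈ K.filter P, τ d • g d = ∑ d : G.Dart with P d, τ d • g d := by
    intro P _ A _ _ g
    refine Finset.sum_subset (Finset.filter_subset_filter _ (Finset.subset_univ _)) fun d hd hd' => ?_
    have : d ∉ K := fun hdK => hd' (Finset.mem_filter.2 ⟨hdK, (Finset.mem_filter.1 hd).2⟩)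
    have h0 : τ d = 0 := by simpa [hK] using this
    rw [h0, zero_smul]
  -- The support of the stress has a vertex or a face with at most three corners. There equilibrium
  -- is a relation between at most three independent normals, or between at most three affinely
  -- independent points.
  rcases M.exists_low_degree hM.dart_unique hM.exists_dart K hKne with ⟨d, hd, hc⟩ | ⟨d, hd, hc⟩
  · refine hKτ d hd (h.normals_indep_of_card hM (v := d.fst) (K.filter fun e => e.fst = d.fst) ?_
      (fun e he => (Finset.mem_filter.1 he).2) τ ?_ d (Finset.mem_filter.2 ⟨hd, rfl⟩))
    · convert hc
    · rw [hsub]; exact h1 d.fst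
  · set T := K.filter fun e => M.face e = M.face d with hT
    have hTc : T.card ≤ 3 := by convert hc
    have h4 : ∑ e ∈ T, τ e = 0 := by
      have := hsub (fun e => M.face e = M.face d) fun _ => (1 : ℝ)
      simp only [smul_eq_mul, mul_one] at this
      rw [hT, this]; exact h2 _
    have h5 : ∑ e ∈ T, τ e • x e.fst = 0 := by
      rw [hT, hsub]; exact h3 _
    have h6 := affine_indep (convex_body p) hm.inj hm.range_eq (T.image fun e => e.fst)
      (Finset.card_image_le.trans hTc) (fun v => ∑ e ∈ T with e.fst = v, τ e)
      (fun v hv => by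
        refine Finset.sum_eq_zero fun e he => absurd ?_ hv
        obtain ⟨he1, he2⟩ := Finset.mem_filter.1 he
        exact Finset.mem_image.2 ⟨e, he1, he2⟩)
      ((Finset.sum_fiberwise T (fun e => e.fst) τ).trans h4)
      (by
        simp only [Finset.sum_smul]
        rw [← h5]
        refine Eq.trans ?_ (Finset.sum_fiberwise T (fun e => e.fst) fun e => τ e • x e.fst)
        refine Finset.sum_congr rfl fun v _ => Finset.sum_congr rfl fun e he => ?_
        rw [(Finset.mem_filter.1 he).2])
    have h7 : ∑ e ∈ T with e.fst = d.fst, τ e = 0 := congrFun h6 d.fst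
    have h8 : T.filter (fun e => e.fst = d.fst) = {d} := by
      ext e
      simp only [Finset.mem_filter, Finset.mem_singleton, hT]
      refine ⟨fun ⟨⟨_, he1⟩, he2⟩ => hM.dart_unique e d he2 he1, ?_⟩
      rintro rfl
      exact ⟨⟨hd, rfl⟩, rfl⟩
    rw [h8, Finset.sum_singleton] at h7
    exact hKτ d hd h7

end IsStrict

/-! ### The equations of marked polyhedra in normal form -/

section Equations

variable {V F : Type*} [Fintype V] [Fintype F]

/-- The wall `f` contains the vertex `v`. -/
noncomputable def incEq (f : F) (v : V) (y : (F → HalfParam) × (V → E3)) : ℝ :=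
  ⟪(y.1 f).1, y.2 v⟫ - (y.1 f).2

/-- The normal of `f` has length one. -/
noncomputable def unitEq (f : F) (y : (F → HalfParam) × (V → E3)) : ℝ :=
  ⟪(y.1 f).1, (y.1 f).1⟫ - 1

/-- A coordinate that vanishes in normal form. -/
def normEq (ν : Fin 4 → V) (k : Fin 6) (y : (F → HalfParam) × (V → E3)) : ℝ :=
  y.2 (ν (![0, 0, 0, 1, 1, 2] k)) (![0, 1, 2, 1, 2, 2] k)

/-- All equations. -/
noncomputable def eqn {Q : Type*} (fq : Q → F) (vq : Q → V) (ν : Fin 4 → V) :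
    Q ⊕ F ⊕ Fin 6 → (F → HalfParam) × (V → E3) → ℝ
  | .inl q => incEq (fq q) (vq q)
  | .inr (.inl f) => unitEq f
  | .inr (.inr k) => normEq ν k

/-- The normal of a face, as a linear function. -/
noncomputable def normalL (V : Type*) [Fintype V] (f : F) :
    ((F → HalfParam) × (V → E3)) →L[ℝ] E3 :=
  (ContinuousLinearMap.fst ℝ E3 ℝ).comp ((ContinuousLinearMap.proj f).comp
    (ContinuousLinearMap.fst ℝ (F → HalfParam) (V → E3)))

/-- The offset of a face, as a linear function. -/
noncomputable def offsetL (V : Type*) [Fintype V] (f : F) :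
    ((F → HalfParam) × (V → E3)) →L[ℝ] ℝ :=
  (ContinuousLinearMap.snd ℝ E3 ℝ).comp ((ContinuousLinearMap.proj f).comp
    (ContinuousLinearMap.fst ℝ (F → HalfParam) (V → E3)))

/-- A vertex, as a linear function. -/
noncomputable def vertexL (F : Type*) [Fintype F] (v : V) :
    ((F → HalfParam) × (V → E3)) →L[ℝ] E3 :=
  (ContinuousLinearMap.proj v).comp (ContinuousLinearMap.snd ℝ (F → HalfParam) (V → E3))

theorem contDiff_incEq (f : F) (v : V) : ContDiff ℝ ∞ (incEq f v) :=
  ((normalL V f).contDiff.inner ℝ (vertexL F v).contDiff).sub (offsetL V f).contDiff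

theorem contDiff_unitEq (f : F) : ContDiff ℝ ∞ (unitEq (V := V) f) :=
  ((normalL V f).contDiff.inner ℝ (normalL V f).contDiff).sub contDiff_const

theorem contDiff_normEq (ν : Fin 4 → V) (k : Fin 6) : ContDiff ℝ ∞ (normEq (F := F) ν k) :=
  ((EuclideanSpace.proj (𝕜 := ℝ) (![0, 1, 2, 1, 2, 2] k)).comp
    (vertexL F (ν (![0, 0, 0, 1, 1, 2] k)))).contDiff

theorem contDiff_eqn {Q : Type*} (fq : Q → F) (vq : Q → V) (ν : Fin 4 → V) :
    ∀ i, ContDiff ℝ ∞ (eqn fq vq ν i)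
  | .inl q => contDiff_incEq (fq q) (vq q)
  | .inr (.inl f) => contDiff_unitEq f
  | .inr (.inr k) => contDiff_normEq ν k

theorem fderiv_incEq (f : F) (v : V) (y u : (F → HalfParam) × (V → E3)) :
    fderiv ℝ (incEq f v) y u = ⟪(y.1 f).1, u.2 v⟫ + ⟪(u.1 f).1, y.2 v⟫ - (u.1 f).2 := by
  have h := ((normalL V f).hasFDerivAt (x := y)).inner ℝ ((vertexL F v).hasFDerivAt (x := y))
  have h' := (h.sub ((offsetL V f).hasFDerivAt (x := y))).fderiv
  have e : fderiv ℝ (incEq f v) y = _ := h'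
  rw [e]
  rfl

theorem fderiv_unitEq (f : F) (y u : (F → HalfParam) × (V → E3)) :
    fderiv ℝ (unitEq f) y u = 2 * ⟪(y.1 f).1, (u.1 f).1⟫ := by
  have h := ((normalL V f).hasFDerivAt (x := y)).inner ℝ ((normalL V f).hasFDerivAt (x := y))
  have h' := (h.sub_const 1).fderiv
  have e : fderiv ℝ (unitEq f) y = _ := h'
  rw [e]
  change ⟪(y.1 f).1, (u.1 f).1⟫ + ⟪(u.1 f).1, (y.1 f).1⟫ = _
  rw [real_inner_comm (y.1 f).1]; ring

theorem fderiv_normEq (ν : Fin 4 → V) (k : Fin 6) (y u : (F → HalfParam) × (V → E3)) :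
    fderiv ℝ (normEq ν k) y u = normEq ν k u := by
  have h' := ((EuclideanSpace.proj (𝕜 := ℝ) (![0, 1, 2, 1, 2, 2] k : Fin 3)).comp
    (vertexL F (ν (![0, 0, 0, 1, 1, 2] k)))).fderiv (x := y)
  have e : fderiv ℝ (normEq ν k) y = _ := h'
  rw [e]
  rfl

open Classical in
/-- The equations are independent if there is no stress. -/
theorem linearIndependent_eqn {Q : Type*} [Fintype Q] (fq : Q → F) (vq : Q → V) (ν : Fin 4 → V)
    {y : (F → HalfParam) × (V → E3)} (hinc : ∀ q, ⟪(y.1 (fq q)).1, y.2 (vq q)⟫ = (y.1 (fq q)).2)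
    (hunit : ∀ f, ‖(y.1 f).1‖ = 1) (h0 : y.2 (ν 0) = 0) (h10 : y.2 (ν 1) 0 ≠ 0)
    (h11 : y.2 (ν 1) 1 = 0) (h21 : y.2 (ν 2) 1 ≠ 0)
    (hstress : ∀ τ : Q → ℝ, (∀ v, ∑ q with vq q = v, τ q • (y.1 (fq q)).1 = 0) →
      (∀ f, ∑ q with fq q = f, τ q = 0) → (∀ f, ∑ q with fq q = f, τ q • y.2 (vq q) = 0) → τ = 0) :
    LinearIndependent ℝ fun i => fderiv ℝ (eqn fq vq ν i) y := by
  rw [Fintype.linearIndependent_iff]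
  intro g hg
  set τ : Q → ℝ := fun q => g (.inl q) with hτ
  set μ : F → ℝ := fun f => g (.inr (.inl f)) with hμ
  set c : Fin 6 → ℝ := fun k => g (.inr (.inr k)) with hc
  have hall : ∀ u : (F → HalfParam) × (V → E3),
      (∑ q, τ q * (⟪(y.1 (fq q)).1, u.2 (vq q)⟫ + ⟪(u.1 (fq q)).1, y.2 (vq q)⟫ - (u.1 (fq q)).2)) +
      ((∑ f, μ f * (2 * ⟪(y.1 f).1, (u.1 f).1⟫)) + ∑ k, c k * normEq ν k u) = 0 := by
    intro u
    have := congrArg (fun l : ((F → HalfParam) × (V → E3)) →L[ℝ] ℝ => l u) hg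
    simp only [Fintype.sum_sum_type, add_apply, sum_apply, smul_apply, smul_eq_mul,
      zero_apply, eqn, fderiv_incEq, fderiv_unitEq, fderiv_normEq] at this
    exact this
  -- The relation is tested on tangent vectors that change a single unknown. Changing one offset
  -- gives equilibrium of weights at the face.
  have hfs : ∀ f, ∑ q with fq q = f, τ q = 0 := by
    intro f
    have := hall (Pi.single f ((0 : E3), (-1 : ℝ)), 0)
    have e1 : ∀ f', ((Pi.single f ((0 : E3), (-1 : ℝ)) : F → HalfParam) f').1 = 0 := fun f' => by
      by_cases h : f' = f
      · subst h; simp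
      · simp [h]
    have e2 : ∀ f', ((Pi.single f ((0 : E3), (-1 : ℝ)) : F → HalfParam) f').2 =
        if f' = f then -1 else 0 := fun f' => by
      by_cases h : f' = f
      · subst h; simp
      · simp [h]
    simp only [e1, e2, Pi.zero_apply, inner_zero_right, inner_zero_left, normEq, PiLp.zero_apply,
      mul_zero, Finset.sum_const_zero, add_zero, zero_sub, mul_neg, mul_ite] at this
    rw [Finset.sum_filter]
    refine Eq.trans (Finset.sum_congr rfl fun q _ => ?_) this
    split_ifs <;> simp
  -- Changing one normal by `w`. The choice of `w` as the normal itself then isolates the multiplier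
  -- of its length.
  have hfv : ∀ f (w : E3), ∑ q with fq q = f, τ q * ⟪w, y.2 (vq q)⟫ + μ f * (2 * ⟪(y.1 f).1, w⟫) = 0 := by
    intro f w
    have := hall (Pi.single f (w, (0 : ℝ)), 0)
    have e1 : ∀ f', ((Pi.single f (w, (0 : ℝ)) : F → HalfParam) f').1 = if f' = f then w else 0 :=
      fun f' => by
        by_cases h : f' = f
        · subst h; simp
        · simp [h]
    have e2 : ∀ f', ((Pi.single f (w, (0 : ℝ)) : F → HalfParam) f').2 = 0 := fun f' => by
      by_cases h : f' = f
      · subst h; simp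
      · simp [h]
    simp only [e1, e2, Pi.zero_apply, inner_zero_right, normEq, PiLp.zero_apply,
      mul_zero, Finset.sum_const_zero, add_zero, zero_add, sub_zero] at this
    rw [← this, Finset.sum_filter]
    congr 1
    · refine Finset.sum_congr rfl fun q _ => ?_
      split_ifs <;> simp
    · rw [Finset.sum_eq_single f]
      · simp
      · intro f' _ hf'; simp [hf']
      · simp
  have hμ0 : ∀ f, μ f = 0 := by
    intro f
    have h1 := hfv f (y.1 f).1
    have h2 : ∑ q with fq q = f, τ q * ⟪(y.1 f).1, y.2 (vq q)⟫ = 0 := by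
      rw [← mul_zero (y.1 f).2, ← hfs f, Finset.mul_sum]
      refine Finset.sum_congr rfl fun q hq => ?_
      rw [← (Finset.mem_filter.1 hq).2, hinc q, mul_comm]
    rw [h2, real_inner_self_eq_norm_sq, hunit] at h1
    linarith
  have hfx : ∀ f, ∑ q with fq q = f, τ q • y.2 (vq q) = 0 := by
    intro f
    rw [← inner_self_eq_zero (𝕜 := ℝ), inner_sum]
    have := hfv f (∑ q with fq q = f, τ q • y.2 (vq q))
    rw [hμ0, zero_mul, add_zero] at this
    rw [← this]
    refine Finset.sum_congr rfl fun q _ => ?_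
    rw [inner_smul_right]
  -- By equilibrium at the faces the incidence terms vanish on all affine velocity fields of the
  -- vertices. Three translations and three shears among these form a triangular system for the six
  -- normalising coordinates, whose multipliers therefore vanish.
  have hnorm : ∀ ξ : V → E3, (∑ q, τ q * ⟪(y.1 (fq q)).1, ξ (vq q)⟫ = 0) →
      ∑ k, c k * normEq (F := F) ν k (0, ξ) = 0 := by
    intro ξ hξ
    have := hall (0, ξ)
    simp only [hμ0, Pi.zero_apply, Prod.fst_zero, Prod.snd_zero, inner_zero_left, add_zero,
      sub_zero, hξ, zero_add, zero_mul, Finset.sum_const_zero] at this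
    exact this
  have hconst : ∀ w : E3, ∑ k, c k * normEq (F := F) ν k (0, fun _ => w) = 0 := by
    intro w
    refine hnorm _ ?_
    rw [← Finset.sum_fiberwise Finset.univ fq]
    refine Finset.sum_eq_zero fun f _ => ?_
    rw [← mul_zero ⟪(y.1 f).1, w⟫, ← hfs f, Finset.mul_sum]
    refine Finset.sum_congr rfl fun q hq => ?_
    rw [(Finset.mem_filter.1 hq).2, mul_comm]
  have hlin : ∀ z w : E3, ∑ k, c k * normEq (F := F) ν k (0, fun v => ⟪z, y.2 v⟫ • w) = 0 := by
    intro z w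
    refine hnorm _ ?_
    rw [← Finset.sum_fiberwise Finset.univ fq]
    refine Finset.sum_eq_zero fun f _ => ?_
    have := congrArg (fun t => ⟪(y.1 f).1, w⟫ * ⟪z, t⟫) (hfx f)
    simp only [inner_sum, inner_smul_right, inner_zero_right, mul_zero, Finset.mul_sum] at this
    rw [← this]
    refine Finset.sum_congr rfl fun q hq => ?_
    rw [(Finset.mem_filter.1 hq).2, inner_smul_right]
    ring
  have hexp : ∀ ξ : V → E3, ∑ k, c k * normEq (F := F) ν k (0, ξ) = c 0 * ξ (ν 0) 0 +
      c 1 * ξ (ν 0) 1 + c 2 * ξ (ν 0) 2 + c 3 * ξ (ν 1) 1 + c 4 * ξ (ν 1) 2 + c 5 * ξ (ν 2) 2 := by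
    intro ξ
    rw [Fin.sum_univ_six]
    rfl
  have hbasis : ∀ (i : Fin 3) (z : E3), ⟪EuclideanSpace.single i (1 : ℝ), z⟫ = z i := fun i z => by
    rw [EuclideanSpace.inner_single_left]; simp
  have k0 := hconst (EuclideanSpace.single 0 1)
  have k1 := hconst (EuclideanSpace.single 1 1)
  have k2 := hconst (EuclideanSpace.single 2 1)
  have l01 := hlin (EuclideanSpace.single 0 1) (EuclideanSpace.single 1 1)
  have l12 := hlin (EuclideanSpace.single 1 1) (EuclideanSpace.single 2 1)
  have l02 := hlin (EuclideanSpace.single 0 1) (EuclideanSpace.single 2 1)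
  rw [hexp] at k0 k1 k2 l01 l12 l02
  simp [hbasis, h0, h11] at k0 k1 k2 l01 l12 l02
  have c3 : c 3 = 0 := l01.resolve_right h10
  have c5 : c 5 = 0 := l12.resolve_right h21
  have c4 : c 4 = 0 := by
    rw [c5, zero_mul, add_zero] at l02
    exact (mul_eq_zero.1 l02).resolve_right h10
  have c1 : c 1 = 0 := by rw [c3, add_zero] at k1; exact k1
  have c2 : c 2 = 0 := by rw [c4, c5, add_zero, add_zero] at k2; exact k2
  have hc0 : ∀ k, c k = 0 := by
    intro k
    fin_cases k
    exacts [k0, c1, c2, c3, c4, c5]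
  have hvs : ∀ v, ∑ q with vq q = v, τ q • (y.1 (fq q)).1 = 0 := by
    intro v
    rw [← inner_self_eq_zero (𝕜 := ℝ), sum_inner]
    set w := ∑ q with vq q = v, τ q • (y.1 (fq q)).1 with hw
    have := hall (0, Pi.single v w)
    simp only [hμ0, hc0, Pi.zero_apply, Prod.fst_zero, Prod.snd_zero, inner_zero_left, add_zero,
      sub_zero, zero_mul, Finset.sum_const_zero] at this
    rw [← this, Finset.sum_filter]
    refine Finset.sum_congr rfl fun q _ => ?_
    by_cases h : vq q = v
    · rw [if_pos h, h, Pi.single_eq_same, inner_smul_left]; rfl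
    · rw [if_neg h, Pi.single_eq_of_ne h, inner_zero_right, mul_zero]
  have hτ0 := hstress τ hvs hfs hfx
  rintro (q | f | k)
  exacts [congrFun hτ0 q, hμ0 f, hc0 k]

end Equations

end HypPoly

namespace HypPoly

/-! ### Normal position -/

section Normal

variable {V F : Type*}

/-- The points chosen by `ν` lie at the origin, on a half-axis, in a half-plane and in a
half-space. -/
structure IsNormal (ν : Fin 4 → V) (y : (F → HalfParam) × (V → E3)) : Prop where
  zero : ∀ k, normEq ν k y = 0
  pos₁ : 0 < y.2 (ν 1) 0
  pos₂ : 0 < y.2 (ν 2) 1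
  pos₃ : 0 < y.2 (ν 3) 2

theorem lor_gs_unitVec {u : HalfParam} (h : 0 < lor u u) : 0 < lor u (unitVec u) := by
  rw [lor_unitVec_right]
  exact mul_pos (inv_pos.2 (Real.sqrt_pos.2 h)) h

theorem unitVec_smul {u : HalfParam} (hu : lor u u = 1) {c : ℝ} (hc : 0 < c) :
    unitVec (c • u) = u := by
  rw [unitVec, lor_smul_left, lor_smul_right, hu, mul_one, Real.sqrt_mul_self hc.le, smul_smul,
    inv_mul_cancel₀ hc.ne', one_smul]

variable {on : V → F → Prop} {ν : Fin 4 → V} {p : F → HalfParam} {x : V → E3}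

/-- Gram-Schmidt makes the coordinates of the four vectors triangular with positive diagonal, and
projection only divides by a positive number. -/
theorem Realizes.isNormal_normalize (h : Realizes on ν p x) : IsNormal ν (normalize ν p x) := by
  have hf := h.isFrame
  set X : Fin 4 → HalfParam := fun i => lift (x (ν i)) with hX
  obtain ⟨A, hA, hAc⟩ := hf.exists_lorentz
  have hpos : ∀ i, 0 < (coords X (X i)).2⁻¹ := fun i => by
    rw [← hAc]
    exact inv_pos.2 (hA.future_map (lift_snd_pos (h.ball _))
      (by rw [lor_lift_self (h.ball _)]; norm_num))
  have hz : ∀ i, (normalize ν p x).2 (ν i) = (coords X (X i)).2⁻¹ • (coords X (X i)).1 :=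
    fun i => rfl
  have h1 : X 1 = gs₁ X - lor (X 1) (X 0) • X 0 := by rw [gs₁]; module
  have h2 : X 2 = gs₂ X - lor (X 2) (X 0) • X 0 + lor (X 2) (unitVec (gs₁ X)) • unitVec (gs₁ X) := by
    rw [gs₂]; module
  have h3 : X 3 = gs₃ X - lor (X 3) (X 0) • X 0 + lor (X 3) (unitVec (gs₁ X)) • unitVec (gs₁ X) +
      lor (X 3) (unitVec (gs₂ X)) • unitVec (gs₂ X) := by
    rw [gs₃]; module
  have e12 : lor (gs₁ X) (unitVec (gs₂ X)) = 0 := by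
    have := hf.e₂_orth₁
    rw [unitVec, lor_smul_left] at this
    exact (mul_eq_zero.1 this).resolve_left (inv_pos.2 (Real.sqrt_pos.2 hf.gs₁_pos)).ne'
  have e13 : lor (gs₁ X) (unitVec (gs₃ X)) = 0 := by
    have := hf.e₃_orth₁
    rw [unitVec, lor_smul_left] at this
    exact (mul_eq_zero.1 this).resolve_left (inv_pos.2 (Real.sqrt_pos.2 hf.gs₁_pos)).ne'
  have e23 : lor (gs₂ X) (unitVec (gs₃ X)) = 0 := by
    have := hf.e₃_orth₂
    rw [unitVec, lor_smul_left] at this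
    exact (mul_eq_zero.1 this).resolve_left (inv_pos.2 (Real.sqrt_pos.2 hf.gs₂_pos)).ne'
  have k11 : 0 < lor (X 1) (unitVec (gs₁ X)) := by
    rw [h1, lor_sub_left, lor_smul_left, hf.e₁_orth, mul_zero, sub_zero]
    exact lor_gs_unitVec hf.gs₁_pos
  have k12 : lor (X 1) (unitVec (gs₂ X)) = 0 := by
    rw [h1, lor_sub_left, lor_smul_left, hf.e₂_orth, e12]; ring
  have k13 : lor (X 1) (unitVec (gs₃ X)) = 0 := by
    rw [h1, lor_sub_left, lor_smul_left, hf.e₃_orth, e13]; ring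
  have k22 : 0 < lor (X 2) (unitVec (gs₂ X)) := by
    rw [h2, lor_add_left, lor_sub_left, lor_smul_left, lor_smul_left, hf.e₂_orth, hf.e₂_orth₁,
      mul_zero, mul_zero, sub_zero, add_zero]
    exact lor_gs_unitVec hf.gs₂_pos
  have k23 : lor (X 2) (unitVec (gs₃ X)) = 0 := by
    rw [h2, lor_add_left, lor_sub_left, lor_smul_left, lor_smul_left, hf.e₃_orth, hf.e₃_orth₁,
      e23]
    ring
  have k33 : 0 < lor (X 3) (unitVec (gs₃ X)) := by
    rw [h3, lor_add_left, lor_add_left, lor_sub_left, lor_smul_left, lor_smul_left, lor_smul_left,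
      hf.e₃_orth, hf.e₃_orth₁, hf.e₃_orth₂, mul_zero, mul_zero, mul_zero, sub_zero, add_zero,
      add_zero]
    exact lor_gs_unitVec hf.gs₃_pos
  refine ⟨fun k => ?_, ?_, ?_, ?_⟩
  · rw [normEq, hz]
    fin_cases k <;> simp [coords, hf.e₁_orth, hf.e₂_orth, hf.e₃_orth, k12, k13, k23]
  · rw [hz]; exact mul_pos (hpos 1) k11
  · rw [hz]; exact mul_pos (hpos 2) k22
  · rw [hz]; exact mul_pos (hpos 3) k33

/-- Four points in normal position have the standard basis as their Gram-Schmidt frame, so the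
coordinate map is the identity. Hence the slice is cut out by the six coordinate equations together
with three open conditions. -/
theorem Realizes.normalize_eq_self (h : Realizes on ν p x) (hn : IsNormal ν (p, x)) :
    normalize ν p x = (p, x) := by
  set X : Fin 4 → HalfParam := fun i => lift (x (ν i)) with hX
  have hz := hn.zero
  have z00 : x (ν 0) 0 = 0 := hz 0
  have z01 : x (ν 0) 1 = 0 := hz 1
  have z02 : x (ν 0) 2 = 0 := hz 2
  have z11 : x (ν 1) 1 = 0 := hz 3
  have z12 : x (ν 1) 2 = 0 := hz 4
  have z22 : x (ν 2) 2 = 0 := hz 5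
  have hs : ∀ i, 0 < (X i).2 := fun i => lift_snd_pos (h.ball _)
  have hXi : ∀ i, X i = (X i).2 • (x (ν i), (1 : ℝ)) := fun i => by simp [hX, lift]
  have x0 : x (ν 0) = 0 := by
    ext i; fin_cases i
    exacts [z00, z01, z02]
  have hX0 : X 0 = origin := by
    change lift (x (ν 0)) = _
    rw [x0, lift]; simp [origin]
  let E : Fin 3 → HalfParam := fun i => (EuclideanSpace.single i 1, 0)
  have hE : ∀ W i, lor W (E i) = W.1 i := fun W i => by
    change ⟪W.1, EuclideanSpace.single i (1 : ℝ)⟫ - W.2 * 0 = _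
    rw [EuclideanSpace.inner_single_right]; simp
  have hEE : ∀ i, lor (E i) (E i) = 1 := fun i => by rw [hE]; simp [E]
  have hX1 : ∀ i j, (X i).1 j = (X i).2 * x (ν i) j := fun i j => by
    conv_lhs => rw [hXi]
    simp
  have hproj : ∀ W : HalfParam, W + lor W (X 0) • X 0 = (W.1, 0) := fun W => by
    rw [hX0, lor_origin, origin]
    ext <;> simp
  have g1 : gs₁ X = ((X 1).2 * x (ν 1) 0) • E 0 := by
    rw [gs₁, hproj]
    refine Prod.ext ?_ (by simp [E])
    ext i; fin_cases i <;> simp [E, hX1, z11, z12]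
  have u1 : unitVec (gs₁ X) = E 0 := by
    rw [g1]; exact unitVec_smul (hEE 0) (mul_pos (hs 1) hn.pos₁)
  have g2 : gs₂ X = ((X 2).2 * x (ν 2) 1) • E 1 := by
    rw [gs₂, hproj, u1, hE]
    refine Prod.ext ?_ (by simp [E])
    ext i; fin_cases i <;> simp [E, hX1, z22]
  have u2 : unitVec (gs₂ X) = E 1 := by
    rw [g2]; exact unitVec_smul (hEE 1) (mul_pos (hs 2) hn.pos₂)
  have g3 : gs₃ X = ((X 3).2 * x (ν 3) 2) • E 2 := by
    rw [gs₃, hproj, u1, u2, hE, hE]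
    refine Prod.ext ?_ (by simp [E])
    ext i; fin_cases i <;> simp [E, hX1]
  have u3 : unitVec (gs₃ X) = E 2 := by
    rw [g3]; exact unitVec_smul (hEE 2) (mul_pos (hs 3) hn.pos₃)
  have hc : ∀ W, coords X W = W := fun W => by
    rw [coords, u1, u2, u3, hE, hE, hE, hX0, lor_origin, neg_neg]
    refine Prod.ext ?_ rfl
    ext i; fin_cases i <;> rfl
  refine Prod.ext (funext fun f => ?_) (funext fun v => ?_)
  · change unitize (coords X (p f)) = p f
    rw [hc, unitize_eq_self (h.unit f)]
  · change proj (coords X (lift (x v))) = x v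
    rw [hc, proj_lift (h.ball v)]

theorem mem_image_normalForm_iff [Fintype F] {S : Set (F → HalfParam)}
    (hS : ∀ p ∈ S, ∃ x, Realizes on ν p x) (hon : ∀ f, ∃ v, on v f)
    (hmove : ∀ p ∈ S, ∀ A : HalfParam ≃ₗ[ℝ] HalfParam, IsLorentz A → move A p ∈ S)
    {y : (F → HalfParam) × (V → E3)} :
    y ∈ normalForm on ν '' S ↔ y.1 ∈ S ∧ Realizes on ν y.1 y.2 ∧ IsNormal ν y := by
  constructor
  · rintro ⟨p, hp, rfl⟩
    obtain ⟨x, hx⟩ := hS p hp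
    have hn := hx.isNormal_normalize
    obtain ⟨A, hA, e⟩ := hx.exists_normalize
    rw [hx.normalForm_eq]
    refine ⟨?_, ?_, hn⟩ <;> rw [e]
    exacts [hmove p hp A hA, hx.move_realizes hon hA]
  · rintro ⟨h1, h2, h3⟩
    exact ⟨y.1, h1, h2.normalForm_eq.trans (h2.normalize_eq_self h3)⟩

theorem unitEq_eq_zero_iff {f : F} {y : (F → HalfParam) × (V → E3)} :
    unitEq f y = 0 ↔ ‖(y.1 f).1‖ = 1 := by
  rw [unitEq, real_inner_self_eq_norm_sq, sub_eq_zero,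
    pow_eq_one_iff_of_nonneg (norm_nonneg _) two_ne_zero]

theorem continuous_coord (v : V) (i : Fin 3) :
    Continuous fun y : (F → HalfParam) × (V → E3) => y.2 v i := by
  fun_prop

theorem IsNormal.eventually {y₀ : (F → HalfParam) × (V → E3)} (h : IsNormal ν y₀) :
    ∀ᶠ y in 𝓝 y₀, IsNormal ν y ↔ ∀ k, normEq ν k y = 0 := by
  have hc : ∀ (v : V) (i : Fin 3), 0 < y₀.2 v i → ∀ᶠ y in 𝓝 y₀, 0 < y.2 v i := fun v i hv =>
    (continuous_coord v i).continuousAt.eventually (lt_mem_nhds hv)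
  filter_upwards [hc _ _ h.pos₁, hc _ _ h.pos₂, hc _ _ h.pos₃] with y h1 h2 h3
  exact ⟨fun h => h.zero, fun h => ⟨h, h1, h2, h3⟩⟩

end Normal

/-! ### Realisations of planar maps -/

variable {V : Type*} {G G₀ : SimpleGraph V} {M : SphereEmbedding G} {M' : SphereEmbedding G₀}

/-- Three vertices chosen on the face `f₀` and one outside. -/
structure IsChoice (M : SphereEmbedding G) (ν : Fin 4 → V) (f₀ : M.Face) : Prop where
  ne₁ : ν 0 ≠ ν 1
  ne₂ : ν 0 ≠ ν 2
  ne₃ : ν 1 ≠ ν 2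
  on₀ : M.OnFace (ν 0) f₀
  on₁ : M.OnFace (ν 1) f₀
  on₂ : M.OnFace (ν 2) f₀
  off : ¬ M.OnFace (ν 3) f₀

/-- The face after the two sides of `d` at `d.fst` supplies three vertices, and it misses `d.snd`.
Being neither side of `d`, it is untouched by merging, so the same four vertices serve for both
graphs. -/
theorem SphereEmbedding.Polyhedral.exists_choice (hM : M.Polyhedral) (d : G.Dart) :
    ∃ ν f₀, IsChoice M ν f₀ ∧ f₀ ≠ M.face d ∧ f₀ ≠ M.face d.symm := by
  set f₀ := M.face (M.rot (M.rot d)) with hf₀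
  have h1 : f₀ ≠ M.face d := fun e =>
    hM.rot_rot_ne d (hM.dart_unique _ _ (by rw [M.rot_fst, M.rot_fst]) e)
  have h2 : f₀ ≠ M.face (M.rot d) := fun e =>
    hM.rot_ne (M.rot d) (hM.dart_unique _ _ (by rw [M.rot_fst]) e)
  have ha : M.OnFace d.fst f₀ := by
    have := M.onFace_fst (M.rot (M.rot d))
    rwa [M.rot_fst, M.rot_fst] at this
  obtain ⟨u, v, w, h3, h4, h5, hu, hv, hw⟩ := M.exists_three_onFace hM.rot_ne f₀
  refine ⟨![u, v, w, d.snd], f₀, ⟨h3, h4, h5, hu, hv, hw, fun hb => ?_⟩, h1, ?_⟩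
  · exact (hM.edge_faces d f₀ ha hb).elim h1 h2
  · rwa [M.face_symm]

theorem IsChoice.merge {ν : Fin 4 → V} {f₀ : M.Face} (h : IsChoice M ν f₀) {d : G.Dart}
    (h1 : f₀ ≠ M.face d) (h2 : f₀ ≠ M.face d.symm) {π : M.Face → M'.Face}
    (hπ : M.IsMerge d M'.verts π) : IsChoice M' ν (π f₀) where
  ne₁ := h.ne₁
  ne₂ := h.ne₂
  ne₃ := h.ne₃
  on₀ := hπ.mem _ _ h.on₀
  on₁ := hπ.mem _ _ h.on₁
  on₂ := hπ.mem _ _ h.on₂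
  off := fun h3 => by
    obtain ⟨f, hf, hv⟩ := hπ.exists_face _ _ h3
    rcases hπ.eq_or _ _ hf with rfl | ⟨-, e⟩ | ⟨-, e⟩
    exacts [h.off hv, h2 e, h1 e]

theorem SphereEmbedding.exists_onFace (M : SphereEmbedding G) (f : M.Face) : ∃ v, M.OnFace v f := by
  obtain ⟨d, rfl⟩ := M.face_surjective f
  exact ⟨_, M.onFace_fst d⟩

section Strict

variable [Finite V] {p : M.Face → HalfParam} {x : V → E3} {ν : Fin 4 → V} {f₀ : M.Face}

theorem IsStrict.realizes (h : IsStrict M p x) (hM : M.Polyhedral) (hν : IsChoice M ν f₀) :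
    Realizes M.OnFace ν p x where
  unit := h.unit
  ball := h.ball
  incident v f hf := (inner_eq_iff_lor (h.ball v)).1 (h.on v f hf)
  det v W hW := by
    have := Fintype.ofFinite V
    refine det_of_normals (on := M.OnFace) (h.ball v) (fun f hf => h.on v f hf) (fun y hy => ?_) W hW
    exact (h.isMarked hM).normals_span v fun f hf => hy f (h.onFace_iff.2 hf)
  indep := by
    have := Fintype.ofFinite V
    have hl : ∀ v, lift (x v) = (lift (x v)).2 • (x v, (1 : ℝ)) := fun v => by simp [lift]
    have hpos : ∀ v, 0 < (lift (x v)).2 := fun v => lift_snd_pos (h.ball v)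
    have h0 : ∀ v, M.OnFace v f₀ → lor (p f₀) (lift (x v)) = 0 := fun v hv =>
      (inner_eq_iff_lor (h.ball v)).1 (h.on v f₀ hv)
    have h3 := (inner_lt_iff_lor (h.ball _)).1 (h.off _ _ hν.off)
    rw [Fintype.linearIndependent_iff]
    intro g hg
    -- Only the fourth point is off the wall of `f₀`; the other three are not collinear.
    have hg3 : g 3 = 0 := by
      have := congrArg (lor (p f₀)) hg
      simp only [Fin.sum_univ_four, lor_add_right, lor_smul_right, h0 _ hν.on₀, h0 _ hν.on₁,
        h0 _ hν.on₂, lor_zero_right, mul_zero, zero_add] at this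
      exact (mul_eq_zero.1 this).resolve_right h3.ne
    rw [Fin.sum_univ_four, hg3, zero_smul, add_zero, hl (ν 0), hl (ν 1), hl (ν 2), smul_smul,
      smul_smul, smul_smul] at hg
    set a := g 0 * (lift (x (ν 0))).2 with ha
    set b := g 1 * (lift (x (ν 1))).2 with hb
    set c := g 2 * (lift (x (ν 2))).2 with hc
    have hsum : a + b + c = 0 := by simpa using congrArg Prod.snd hg
    have hvec : a • x (ν 0) + b • x (ν 1) + c • x (ν 2) = 0 := by simpa using congrArg Prod.fst hg
    have hind := LinearIndependent.pair_iff.1 ((h.isMarked hM).not_collinear hν.ne₁ hν.ne₂ hν.ne₃)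
      b c (by
        rw [← hvec, show a = -b - c by linarith]; module)
    have h1 : g 1 = 0 := (mul_eq_zero.1 hind.1).resolve_right (hpos _).ne'
    have h2 : g 2 = 0 := (mul_eq_zero.1 hind.2).resolve_right (hpos _).ne'
    have ha0 : a = 0 := by rw [hind.1, hind.2] at hsum; linarith
    have h0 : g 0 = 0 := (mul_eq_zero.1 ha0).resolve_right (hpos _).ne'
    intro i
    fin_cases i <;> assumption

theorem Realizes.comp_merge {p' : M'.Face → HalfParam} (h : Realizes M'.OnFace ν p' x)
    {d : G.Dart} {π : M.Face → M'.Face} (hπ : M.IsMerge d M'.verts π) :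
    Realizes M.OnFace ν (p' ∘ π) x where
  unit f := h.unit _
  ball := h.ball
  incident v f hf := h.incident v _ (hπ.mem v f hf)
  det v W hW := h.det v W fun t ht => by
    obtain ⟨f, rfl, hf⟩ := hπ.exists_face t v ht
    exact hW f hf
  indep := h.indep

theorem IsStrict.move (h : IsStrict M p x) {A : HalfParam ≃ₗ[ℝ] HalfParam} (hA : IsLorentz A) :
    IsStrict M (move A p) fun v => proj (A (lift (x v))) := by
  have hb : ∀ v, ‖proj (A (lift (x v)))‖ < 1 := fun v => hA.norm_proj_map_lt (h.ball v)
  have hne : ∀ f, (A (p f)).1 ≠ 0 := fun f => by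
    obtain ⟨v, hv⟩ := M.exists_onFace f
    refine fst_ne_zero_of_wall (fun h0 => h.normal_ne f ?_) (hb v) ?_
    · rw [A.map_eq_zero_iff.1 h0]; rfl
    · rw [hA.lift_proj_map (h.ball v), hA.lor_map, (inner_eq_iff_lor (h.ball v)).1 (h.on v f hv)]
  have hl : ∀ v f, lor (HypPoly.move A p f) (lift (proj (A (lift (x v))))) =
      ‖(A (p f)).1‖⁻¹ * lor (p f) (lift (x v)) := fun v f => by
    rw [hA.lift_proj_map (h.ball v), Realizes.lor_move, hA.lor_map]
  refine ⟨fun f => norm_unitize (hne f), hb, fun v f hf => ?_, fun v f hf => ?_⟩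
  · rw [inner_eq_iff_lor (hb v), hl, (inner_eq_iff_lor (h.ball v)).1 (h.on v f hf), mul_zero]
  · rw [inner_lt_iff_lor (hb v), hl]
    exact mul_neg_of_pos_of_neg (inv_pos.2 (norm_pos_iff.2 (hne f)))
      ((inner_lt_iff_lor (h.ball v)).1 (h.off v f hf))

theorem polySpace_move (hdeg : MinDegThree G) (hp : p ∈ polySpace M)
    {A : HalfParam ≃ₗ[ℝ] HalfParam} (hA : IsLorentz A) : move A p ∈ polySpace M := by
  obtain ⟨hM, x, hx⟩ := exists_isStrict M hdeg hp
  exact (hx.move hA).mem_polySpace hM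

theorem weakPolySpace_move {d : G.Dart} (M' : SphereEmbedding G₀) (hle : G₀ ≤ G)
    (hdeg : MinDegThree G₀) (hd : ¬ G₀.Adj d.fst d.snd)
    (hG : ∀ u v, G.Adj u v → G₀.Adj u v ∨ s(u, v) = s(d.fst, d.snd))
    (hp : p ∈ weakPolySpace M d.fst d.snd) {A : HalfParam ≃ₗ[ℝ] HalfParam} (hA : IsLorentz A) :
    move A p ∈ weakPolySpace M d.fst d.snd := by
  rcases weak_cases M' hle hdeg hd hG hp with h | ⟨-, π, p', hπ, hp', rfl⟩
  · obtain ⟨hM, x, hx⟩ := exists_isStrict M (SphereEmbedding.minDegThree_mono hle hdeg) h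
    exact (hx.move hA).mem_weakPolySpace hM d
  · obtain ⟨hM', x, hx⟩ := exists_isStrict M' hdeg hp'
    exact (hx.move hA).comp_mem_weakPolySpace hM' hπ hle hG

/-- Near a strict realisation only the equations matter. -/
theorem IsStrict.eventually {y₀ : (M.Face → HalfParam) × (V → E3)} (h : IsStrict M y₀.1 y₀.2) :
    ∀ᶠ y in 𝓝 y₀, IsStrict M y.1 y.2 ↔
      (∀ d : G.Dart, incEq (M.face d) d.fst y = 0) ∧ ∀ f : M.Face, unitEq f y = 0 := by
  have := Fintype.ofFinite V
  have h1 : ∀ᶠ y in 𝓝 y₀, ∀ v, ‖y.2 v‖ < 1 := by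
    refine Filter.eventually_all.2 fun v => ?_
    exact (show Continuous fun y : (M.Face → HalfParam) × (V → E3) => ‖y.2 v‖ by
      fun_prop).continuousAt.eventually (gt_mem_nhds (h.ball v))
  have h2 : ∀ᶠ y in 𝓝 y₀, ∀ v f, ¬ M.OnFace v f → incEq f v y < 0 := by
    refine Filter.eventually_all.2 fun v => Filter.eventually_all.2 fun f => ?_
    by_cases hf : M.OnFace v f
    · exact Filter.Eventually.of_forall fun y hy => absurd hf hy
    · have := (contDiff_incEq f v).continuous.continuousAt.eventually
        (gt_mem_nhds (sub_neg.2 (h.off v f hf) : incEq f v y₀ < 0))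
      exact this.mono fun y hy _ => hy
  filter_upwards [h1, h2] with y h1 h2
  refine ⟨fun hy => ⟨fun d => sub_eq_zero.2 (hy.on _ _ (M.onFace_fst d)), fun f =>
    unitEq_eq_zero_iff.2 (hy.unit f)⟩, fun ⟨h3, h4⟩ => ⟨fun f => unitEq_eq_zero_iff.1 (h4 f), h1,
    ?_, fun v f hf => sub_neg.1 (h2 v f hf)⟩⟩
  rintro v f ⟨d, rfl, rfl⟩
  exact sub_eq_zero.1 (h3 d)

end Strict

end HypPoly

namespace HypPoly

/-! ### Local models at strict realisations -/

variable {V : Type*} [Fintype V] {G G₀ : SimpleGraph V} {M : SphereEmbedding G}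
  {M' : SphereEmbedding G₀} {ν : Fin 4 → V}

/-- The equations of realisations of `M` in normal position. -/
noncomputable def mapEqn (M : SphereEmbedding G) (ν : Fin 4 → V) :
    G.Dart ⊕ M.Face ⊕ Fin 6 → (M.Face → HalfParam) × (V → E3) → ℝ :=
  eqn M.face (fun d => d.fst) ν

theorem mapEqn_eq_zero_iff {y : (M.Face → HalfParam) × (V → E3)} :
    (∀ i, mapEqn M ν i y = 0) ↔ (∀ d : G.Dart, incEq (M.face d) d.fst y = 0) ∧
      (∀ f : M.Face, unitEq f y = 0) ∧ ∀ k, normEq ν k y = 0 :=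
  ⟨fun h => ⟨fun d => h (.inl d), fun f => h (.inr (.inl f)), fun k => h (.inr (.inr k))⟩,
    fun h => by
      rintro (d | f | k)
      exacts [h.1 d, h.2.1 f, h.2.2 k]⟩

/-- By Euler's formula `4F + 3V - (2E + F + 6) = 3(V + F) - 2E - 6 = E`. -/
theorem finrank_eq_card_mapEqn (M : SphereEmbedding G) :
    Module.finrank ℝ ((M.Face → HalfParam) × (V → E3)) =
      Fintype.card (G.Dart ⊕ M.Face ⊕ Fin 6) + Nat.card G.edgeSet := by
  classical
  have h1 := M.euler
  have h2 := G.dart_card_eq_twice_card_edges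
  rw [← SimpleGraph.coe_edgeFinset, Nat.card_coe_set_eq, Set.ncard_coe_finset] at *
  have h3 : Fintype.card G.Dart = 2 * G.edgeFinset.card := by
    rw [← h2]; convert rfl
  have h4 : Nat.card M.Face = Fintype.card M.Face := Nat.card_eq_fintype_card
  have h5 : Nat.card V + Nat.card M.Face = G.edgeFinset.card + 2 := h1
  rw [Module.finrank_prod, Module.finrank_pi_fintype, Module.finrank_pi_fintype]
  simp only [Module.finrank_prod, finrank_E3, Module.finrank_self, Finset.sum_const,
    Finset.card_univ, smul_eq_mul, Fintype.card_sum, Fintype.card_fin, h3]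
  rw [h4, Nat.card_eq_fintype_card] at h5
  omega

theorem IsStrict.linearIndependent {y₀ : (M.Face → HalfParam) × (V → E3)}
    (h : IsStrict M y₀.1 y₀.2) (hM : M.Polyhedral) (hn : IsNormal ν y₀) :
    LinearIndependent ℝ fun i => fderiv ℝ (mapEqn M ν i) y₀ := by
  have h0 : y₀.2 (ν 0) = 0 := by
    ext i; fin_cases i
    exacts [hn.zero 0, hn.zero 1, hn.zero 2]
  exact linearIndependent_eqn M.face (fun d => d.fst) ν (fun d => h.on _ _ (M.onFace_fst d)) h.unit
    h0 hn.pos₁.ne' (hn.zero 3) hn.pos₂.ne' fun τ h1 h2 h3 => h.no_stress hM τ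
      (fun v => by convert h1 v) (fun f => by convert h2 f) fun f => by convert h3 f

theorem IsStrict.eventually_normal {y₀ : (M.Face → HalfParam) × (V → E3)}
    (h : IsStrict M y₀.1 y₀.2) (hn : IsNormal ν y₀) :
    ∀ᶠ y in 𝓝 y₀, (IsStrict M y.1 y.2 ∧ IsNormal ν y) ↔ ∀ i, mapEqn M ν i y = 0 := by
  filter_upwards [h.eventually, hn.eventually] with y h1 h2
  rw [h1, h2, mapEqn_eq_zero_iff, and_assoc]

theorem IsStrict.unique {p : M.Face → HalfParam} {x x' : V → E3} (h : IsStrict M p x)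
    (hM : M.Polyhedral) {f₀ : M.Face} (hν : IsChoice M ν f₀) (h' : Realizes M.OnFace ν p x') :
    IsStrict M p x' := (h.realizes hM hν).unique h' ▸ h

theorem mem_image_polySpace_iff (hdeg : MinDegThree G) {f₀ : M.Face} (hν : IsChoice M ν f₀)
    (hM : M.Polyhedral) {y : (M.Face → HalfParam) × (V → E3)} :
    y ∈ normalForm M.OnFace ν '' polySpace M ↔ IsStrict M y.1 y.2 ∧ IsNormal ν y := by
  rw [mem_image_normalForm_iff (fun p hp => ?_) M.exists_onFace
    fun p hp A hA => polySpace_move hdeg hp hA]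
  · refine ⟨fun ⟨h1, h2, h3⟩ => ⟨?_, h3⟩, fun ⟨h1, h2⟩ =>
      ⟨h1.mem_polySpace hM, h1.realizes hM hν, h2⟩⟩
    obtain ⟨-, x, hx⟩ := exists_isStrict M hdeg h1
    exact hx.unique hM hν h2
  · obtain ⟨hM, x, hx⟩ := exists_isStrict M hdeg hp
    exact ⟨x, hx.realizes hM hν⟩

theorem exists_localModel_polySpace (hdeg : MinDegThree G) {f₀ : M.Face} (hν : IsChoice M ν f₀)
    {m : ℕ} (hm : Nat.card G.edgeSet = m) {y₀ : (M.Face → HalfParam) × (V → E3)}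
    (hy₀ : y₀ ∈ normalForm M.OnFace ν '' polySpace M) :
    Nonempty (LocalModel (𝓡 m) (normalForm M.OnFace ν '' polySpace M) y₀) := by
  have hM : M.Polyhedral := by
    obtain ⟨p, hp, -⟩ := hy₀
    exact (exists_isStrict M hdeg hp).1
  obtain ⟨h1, h2⟩ := (mem_image_polySpace_iff hdeg hν hM).1 hy₀
  obtain ⟨L, -⟩ := exists_localModel_interior (𝓡 m) (Z := normalForm M.OnFace ν '' polySpace M)
    (contDiff_eqn M.face (fun d => d.fst) ν) (h1.linearIndependent hM h2)
    (by rw [finrank_eq_card_mapEqn, hm])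
    ((h1.eventually_normal h2).mono fun y hy => (mem_image_polySpace_iff hdeg hν hM).trans hy)
    (t₀ := 0) (by simp)
  exact ⟨L⟩

section Weak

variable {d : G.Dart} {f₀ : M.Face}

/-- `G₀` is `G` without the edge of `d`. -/
structure IsDeletion (G₀ : SimpleGraph V) (d : G.Dart) : Prop where
  le : G₀ ≤ G
  deg : MinDegThree G₀
  not_adj : ¬ G₀.Adj d.fst d.snd
  adj_or : ∀ u v, G.Adj u v → G₀.Adj u v ∨ s(u, v) = s(d.fst, d.snd)

theorem IsDeletion.deg' (hD : IsDeletion G₀ d) : MinDegThree G :=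
  SphereEmbedding.minDegThree_mono hD.le hD.deg

/-- A flat realisation: the two faces along `d` lie in one face. -/
structure IsFlat (M : SphereEmbedding G) (M' : SphereEmbedding G₀) (d : G.Dart)
    (p : M.Face → HalfParam) (x : V → E3) (π : M.Face → M'.Face) (p' : M'.Face → HalfParam) :
    Prop where
  merge : M.IsMerge d M'.verts π
  strict : IsStrict M' p' x
  eq : p = p' ∘ π

theorem IsDeletion.realizes (hD : IsDeletion G₀ d) (hν : IsChoice M ν f₀) (h1 : f₀ ≠ M.face d)
    (h2 : f₀ ≠ M.face d.symm) {p : M.Face → HalfParam} (hp : p ∈ weakPolySpace M d.fst d.snd) :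
    ∃ x, Realizes M.OnFace ν p x ∧ ((M.Polyhedral ∧ IsStrict M p x) ∨
      M'.Polyhedral ∧ ∃ π p', IsFlat M M' d p x π p') := by
  rcases weak_cases M' hD.le hD.deg hD.not_adj hD.adj_or hp with h | ⟨-, π, p', hπ, hp', rfl⟩
  · obtain ⟨hM, x, hx⟩ := exists_isStrict M hD.deg' h
    exact ⟨x, hx.realizes hM hν, Or.inl ⟨hM, hx⟩⟩
  · obtain ⟨hM', x, hx⟩ := exists_isStrict M' hD.deg hp'
    exact ⟨x, (hx.realizes hM' (hν.merge h1 h2 hπ)).comp_merge hπ, Or.inr ⟨hM', π, p', hπ, hx, rfl⟩⟩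

theorem IsDeletion.mem_image_iff (hD : IsDeletion G₀ d) (hν : IsChoice M ν f₀)
    (h1 : f₀ ≠ M.face d) (h2 : f₀ ≠ M.face d.symm) {y : (M.Face → HalfParam) × (V → E3)} :
    y ∈ normalForm M.OnFace ν '' weakPolySpace M d.fst d.snd ↔ IsNormal ν y ∧
      ((M.Polyhedral ∧ IsStrict M y.1 y.2) ∨
        M'.Polyhedral ∧ ∃ π p', IsFlat M M' d y.1 y.2 π p') := by
  rw [mem_image_normalForm_iff (fun p hp => (hD.realizes (M' := M') hν h1 h2 hp).imp fun _ h => h.1)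
    M.exists_onFace
    fun p hp A hA => weakPolySpace_move M' hD.le hD.deg hD.not_adj hD.adj_or hp hA]
  constructor
  · rintro ⟨hp, hr, hn⟩
    obtain ⟨x, hx, h⟩ := hD.realizes hν h1 h2 hp
    rw [hx.unique hr] at h
    exact ⟨hn, h⟩
  · rintro ⟨hn, ⟨hM, h⟩ | ⟨hM', π, p', hπ, h, e⟩⟩
    · exact ⟨h.mem_weakPolySpace hM d, h.realizes hM hν, hn⟩
    · rw [e]
      exact ⟨h.comp_mem_weakPolySpace hM' hπ hD.le hD.adj_or,
        (h.realizes hM' (hν.merge h1 h2 hπ)).comp_merge hπ, hn⟩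

theorem IsFlat.face_eq {p : M.Face → HalfParam} {x : V → E3} {π : M.Face → M'.Face}
    {p' : M'.Face → HalfParam} (h : IsFlat M M' d p x π p') : p (M.face d) = p (M.face d.symm) := by
  rw [h.eq, Function.comp, Function.comp, h.merge.same]

theorem face_ne_face_symm (hM : M.Polyhedral) (d : G.Dart) : M.face d ≠ M.face d.symm := by
  rw [M.face_symm]
  exact fun e => hM.rot_ne d (hM.dart_unique _ _ (M.rot_fst d) e.symm)

/-- At a strict realisation the weak space is a manifold. -/
theorem IsDeletion.exists_localModel_strict (hD : IsDeletion G₀ d) (M' : SphereEmbedding G₀)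
    (hν : IsChoice M ν f₀) (h1 : f₀ ≠ M.face d) (h2 : f₀ ≠ M.face d.symm) {n : ℕ}
    (hm : Nat.card G.edgeSet = n + 1)
    (hM : M.Polyhedral) {y₀ : (M.Face → HalfParam) × (V → E3)} (hs : IsStrict M y₀.1 y₀.2)
    (hn : IsNormal ν y₀) :
    ∃ L : LocalModel (𝓡∂ (n + 1)) (normalForm M.OnFace ν '' weakPolySpace M d.fst d.snd) y₀,
      0 < L.chart y₀ 0 := by
  -- Flat realisations have equal half spaces along `d`, so none occurs near a strict one.
  have hne : ∀ᶠ y in 𝓝 y₀, y.1 (M.face d) ≠ y.1 (M.face d.symm) :=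
    (isOpen_ne_fun (by fun_prop) (by fun_prop)).mem_nhds
      fun e => face_ne_face_symm hM d (hs.injective hM e)
  obtain ⟨L, hL⟩ := exists_localModel_interior (𝓡∂ (n + 1))
    (Z := normalForm M.OnFace ν '' weakPolySpace M d.fst d.snd)
    (contDiff_eqn M.face (fun d => d.fst) ν) (hs.linearIndependent hM hn)
    (by rw [finrank_eq_card_mapEqn, hm]) (by
      filter_upwards [hs.eventually_normal hn, hne] with y hy hy'
      refine Iff.trans ?_ hy
      rw [hD.mem_image_iff (M' := M') hν h1 h2]
      refine ⟨?_, fun h => ⟨h.2, Or.inl ⟨hM, h.1⟩⟩⟩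
      rintro ⟨h3, ⟨-, h4⟩ | ⟨-, π, p', h4⟩⟩
      exacts [⟨h4, h3⟩, absurd h4.face_eq hy'])
    (t₀ := EuclideanSpace.single 0 1) (by
      rw [interior_range_modelWithCornersEuclideanHalfSpace]
      simp)
  exact ⟨L, by rw [hL]; simp⟩

end Weak

end HypPoly

namespace HypPoly

/-! ### The side of a line in a plane -/

/-- The cross product. -/
noncomputable def cross (n u : E3) : E3 :=
  !₂[n 1 * u 2 - n 2 * u 1, n 2 * u 0 - n 0 * u 2, n 0 * u 1 - n 1 * u 0]

theorem inner_E3 (y z : E3) : ⟪y, z⟫ = y 0 * z 0 + y 1 * z 1 + y 2 * z 2 := by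
  simp only [PiLp.inner_apply, Fin.sum_univ_three, RCLike.inner_apply, conj_trivial]
  ring

theorem inner_cross (n u z : E3) : ⟪cross n u, z⟫ = (n 1 * u 2 - n 2 * u 1) * z 0 +
    (n 2 * u 0 - n 0 * u 2) * z 1 + (n 0 * u 1 - n 1 * u 0) * z 2 := by
  rw [inner_E3]; rfl

theorem inner_cross_swap (n u m : E3) : ⟪cross m u, n⟫ = -⟪cross n u, m⟫ := by
  rw [inner_cross, inner_cross]; ring

theorem inner_cross_self (n u : E3) : ⟪cross n u, u⟫ = 0 := by
  rw [inner_cross]; ring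

/-- The Gram determinant of two triples is the product of the triple products. -/
theorem inner_cross_mul (n u y z : E3) (h1 : ⟪n, u⟫ = 0) (h2 : ⟪n, z⟫ = 0) :
    ⟪cross n u, y⟫ * ⟪cross n u, z⟫ = ⟪n, n⟫ * (⟪u, u⟫ * ⟪y, z⟫ - ⟪u, z⟫ * ⟪y, u⟫) := by
  have key : ⟪cross n u, y⟫ * ⟪cross n u, z⟫ = ⟪n, n⟫ * (⟪u, u⟫ * ⟪y, z⟫ - ⟪u, z⟫ * ⟪y, u⟫) -
      ⟪n, u⟫ * (⟪n, u⟫ * ⟪y, z⟫ - ⟪u, z⟫ * ⟪y, n⟫) +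
      ⟪n, z⟫ * (⟪n, u⟫ * ⟪y, u⟫ - ⟪u, u⟫ * ⟪y, n⟫) := by
    rw [inner_cross, inner_cross]
    simp only [inner_E3]
    ring
  rw [key, h1, h2]; ring

theorem exists_smul_of_inner_cross {n u z : E3} (hn : ‖n‖ = 1) (hu : u ≠ 0) (h1 : ⟪n, u⟫ = 0)
    (h2 : ⟪n, z⟫ = 0) (h : ⟪cross n u, z⟫ = 0) : ∃ β : ℝ, z = β • u := by
  have hnn : ⟪n, n⟫ = 1 := by rw [real_inner_self_eq_norm_sq, hn, one_pow]
  have huu : ⟪u, u⟫ ≠ 0 := inner_self_ne_zero.2 hu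
  have key := inner_cross_mul n u z z h1 h2
  rw [h, hnn, zero_mul, one_mul, real_inner_comm z u] at key
  have h3 : ⟪⟪u, u⟫ • z - ⟪u, z⟫ • u, ⟪u, u⟫ • z - ⟪u, z⟫ • u⟫ = 0 := by
    simp only [inner_sub_left, inner_sub_right, inner_smul_left, inner_smul_right, conj_trivial]
    rw [real_inner_comm u z] at key ⊢
    linear_combination -⟪u, u⟫ * key
  refine ⟨⟪u, u⟫⁻¹ * ⟪u, z⟫, ?_⟩
  rw [mul_smul, ← sub_eq_zero.1 (inner_self_eq_zero.1 h3), smul_smul, inv_mul_cancel₀ huu, one_smul]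

/-! ### Flat realisations carry no stress -/

theorem sum_filter_fiberwise {Q D A : Type*} [Fintype Q] [Fintype D] [DecidableEq D]
    [AddCommMonoid A] (δ : Q → D) (P : D → Prop) [DecidablePred P] (g : Q → A) :
    ∑ d with P d, ∑ q with δ q = d, g q = ∑ q with P (δ q), g q := by
  rw [← Finset.sum_fiberwise_of_maps_to (s := Finset.univ.filter fun q => P (δ q))
    (t := Finset.univ.filter P) (g := δ) (by simp)]
  refine Finset.sum_congr rfl fun d hd => Finset.sum_congr ?_ fun _ _ => rfl
  ext q
  simp only [Finset.mem_filter, Finset.mem_univ, true_and] at hd ⊢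
  exact ⟨fun h => ⟨h ▸ hd, h⟩, fun h => h.2⟩

variable {V : Type*} [Fintype V] {G G₀ : SimpleGraph V} {M : SphereEmbedding G}
  {M' : SphereEmbedding G₀} {ν : Fin 4 → V} {d : G.Dart} {p : M.Face → HalfParam} {x : V → E3}
  {π : M.Face → M'.Face} {p' : M'.Face → HalfParam}

open Classical in
/-- There is no stress even if one more vertex lies on the first of the merged faces. -/
theorem IsFlat.no_stress (h : IsFlat M M' d p x π p') (hM : M.Polyhedral) (hM' : M'.Polyhedral)
    {w : V} (hw : M.OnFace w (M.face d.symm)) (hwa : w ≠ d.fst) (hwb : w ≠ d.snd)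
    (τ : Option G.Dart → ℝ)
    (h1 : ∀ v, ∑ q with Option.elim q w (fun e => e.fst) = v,
      τ q • (p (Option.elim q (M.face d) M.face)).1 = 0)
    (h2 : ∀ f, ∑ q with Option.elim q (M.face d) M.face = f, τ q = 0)
    (h3 : ∀ f, ∑ q with Option.elim q (M.face d) M.face = f,
      τ q • x (Option.elim q w fun e => e.fst) = 0) : τ = 0 := by
  set fq : Option G.Dart → M.Face := fun q => Option.elim q (M.face d) M.face with hfq
  set vq : Option G.Dart → V := fun q => Option.elim q w fun e => e.fst with hvq
  have hπ := h.merge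
  have hm := h.strict.isMarked hM'
  have hon : ∀ q, q ≠ none → M.OnFace (vq q) (fq q) := by
    rintro (_ | e) hq
    exacts [absurd rfl hq, M.onFace_fst e]
  have hon' : ∀ q, M'.OnFace (vq q) (π (fq q)) := by
    rintro (_ | e)
    · have := hπ.mem _ _ hw
      rwa [← hπ.same] at this
    · exact hπ.mem _ _ (M.onFace_fst e)
  have hwf : ¬ M.OnFace w (M.face d) := fun h => (hπ.inter w h hw).elim hwa hwb
  have hinj : ∀ q q', fq q = fq q' → vq q = vq q' → q = q' := by
    rintro (_ | e) (_ | e') h4 h5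
    · rfl
    · exact absurd ⟨e', h5.symm, h4.symm⟩ hwf
    · exact absurd ⟨e, h5, h4⟩ hwf
    · exact congrArg some (hM.dart_unique e e' h5 h4)
  -- Each incidence, including the extra one, is pushed to the corner of `M'` at the same vertex in
  -- the merged face. Sums over fibres form a stress of `M'`, which vanishes.
  choose δ hδ1 hδ2 using hon'
  replace hδ2 : ∀ q, M'.face (δ q) = π (fq q) := hδ2
  have hδ : ∀ q q', δ q' = δ q ↔ vq q' = vq q ∧ π (fq q') = π (fq q) := by
    intro q q'
    rw [← hδ1, ← hδ1, ← hδ2, ← hδ2]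
    exact ⟨fun e => by rw [e]; exact ⟨rfl, rfl⟩, fun e => hM'.dart_unique _ _ e.1 e.2⟩
  have hfib : (fun d' : G₀.Dart => ∑ q with δ q = d', τ q) = 0 := by
    refine h.strict.no_stress hM' _ (fun v => ?_) (fun t => ?_) fun t => ?_
    · refine Eq.trans (Finset.sum_congr rfl fun d' _ => ?_) ((sum_filter_fiberwise δ
        (fun d' => d'.fst = v) fun q => τ q • (p (fq q)).1).trans ?_)
      · rw [Finset.sum_smul]
        refine Finset.sum_congr rfl fun q hq => ?_
        rw [h.eq, Function.comp, ← hδ2, (Finset.mem_filter.1 hq).2]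
      · simp only [hδ1]
        exact h1 v
    · refine (sum_filter_fiberwise δ (fun d' => M'.face d' = t) τ).trans ?_
      simp only [hδ2]
      rw [← sum_filter_fiberwise fq fun f => π f = t]
      exact Finset.sum_eq_zero fun f _ => h2 f
    · refine Eq.trans (Finset.sum_congr rfl fun d' _ => ?_) ((sum_filter_fiberwise δ
        (fun d' => M'.face d' = t) fun q => τ q • x (vq q)).trans ?_)
      · rw [Finset.sum_smul]
        refine Finset.sum_congr rfl fun q hq => ?_
        rw [← hδ1, (Finset.mem_filter.1 hq).2]
      · simp only [hδ2]
        rw [← sum_filter_fiberwise fq fun f => π f = t]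
        exact Finset.sum_eq_zero fun f _ => h3 f
  have hfib' : ∀ q, ∑ q' with δ q' = δ q, τ q' = 0 := fun q => congrFun hfib (δ q)
  set T : Finset (Option G.Dart) := Finset.univ.filter fun q => fq q = M.face d with hT
  -- Within the merged facet only the two ends of `d` and `w` carry an incidence with both faces. At
  -- every other vertex the fibre is a single incidence, so on the face of `d` the stress lives on
  -- three affinely independent points and vanishes.
  have hσ := affine_indep (convex_body p') hm.inj hm.range_eq {d.fst, d.snd, w} Finset.card_le_three
    (fun v => ∑ q ∈ T with vq q = v, τ q)
    (fun v hv => by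
      simp only [Finset.mem_insert, Finset.mem_singleton, not_or] at hv
      by_cases hex : ∃ q₀, fq q₀ = M.face d ∧ vq q₀ = v
      · obtain ⟨q₀, hq₀, hqv⟩ := hex
        rw [← hfib' q₀]
        refine Finset.sum_congr ?_ fun _ _ => rfl
        ext q'
        simp only [hT, Finset.mem_filter, Finset.mem_univ, true_and, hδ, hq₀, hqv]
        refine ⟨fun e => ⟨e.2, by rw [e.1]⟩, fun e => ⟨?_, e.1⟩⟩
        rcases hπ.eq_or _ _ e.2 with e' | ⟨e', -⟩ | ⟨e', -⟩
        · exact e'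
        · exact e'
        · have h4 : M.OnFace v (M.face d.symm) := by
            rw [← e', ← e.1]
            exact hon q' fun hn => hπ.ne (by rw [← e', hn, hfq]; rfl)
          have h5 : M.OnFace v (M.face d) := by
            rw [← hq₀, ← hqv]
            exact hon q₀ fun hn => hv.2.2 (by rw [← hqv, hn, hvq]; rfl)
          exact ((hπ.inter v h5 h4).elim hv.1 hv.2.1).elim
      · refine Finset.sum_eq_zero fun q hq => absurd ⟨q, ?_, (Finset.mem_filter.1 hq).2⟩ hex
        exact (Finset.mem_filter.1 (Finset.mem_filter.1 hq).1).2)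
    ((Finset.sum_fiberwise T vq τ).trans (h2 _))
    (by
      simp only [Finset.sum_smul]
      refine Eq.trans ?_ ((Finset.sum_fiberwise T vq fun q => τ q • x (vq q)).trans (h3 _))
      refine Finset.sum_congr rfl fun v _ => Finset.sum_congr rfl fun q hq => ?_
      rw [(Finset.mem_filter.1 hq).2])
  have hfirst : ∀ q, fq q = M.face d → τ q = 0 := by
    intro q hq
    have h4 : ∑ q' ∈ T with vq q' = vq q, τ q' = 0 := congrFun hσ (vq q)
    have h5 : T.filter (fun q' => vq q' = vq q) = {q} := by
      ext q'
      simp only [hT, Finset.mem_filter, Finset.mem_univ, true_and, Finset.mem_singleton]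
      refine ⟨fun e => hinj _ _ (e.1.trans hq.symm) e.2, ?_⟩
      rintro rfl
      exact ⟨hq, rfl⟩
    rwa [h5, Finset.sum_singleton] at h4
  funext q
  by_cases hq : fq q = M.face d
  · exact hfirst q hq
  · refine Eq.trans (Eq.symm (Finset.sum_eq_single_of_mem (s := Finset.univ.filter fun q' =>
      δ q' = δ q) q (Finset.mem_filter.2 ⟨Finset.mem_univ q, rfl⟩) fun q' hq' hne => ?_)) (hfib' q)
    · obtain ⟨e1, e2⟩ := (hδ _ _).1 (Finset.mem_filter.1 hq').2
      rcases hπ.eq_or _ _ e2 with e' | ⟨e', -⟩ | ⟨-, e'⟩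
      -- Once the stress is zero on the face of `d`, every remaining fibre sum has only one possibly
      -- nonzero term.
      exacts [absurd (hinj _ _ e' e1) hne, hfirst _ e', absurd e' hq]

/-- The equations at a flat realisation together with one more incidence are independent. -/
theorem IsFlat.linearIndependent {y₀ : (M.Face → HalfParam) × (V → E3)}
    (h : IsFlat M M' d y₀.1 y₀.2 π p') (hM : M.Polyhedral) (hM' : M'.Polyhedral)
    (hn : IsNormal ν y₀) {w : V} (hw : M.OnFace w (M.face d.symm)) (hwa : w ≠ d.fst)
    (hwb : w ≠ d.snd) : LinearIndependent ℝ fun i : Option (G.Dart ⊕ M.Face ⊕ Fin 6) =>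
      fderiv ℝ (i.elim (fun y => -incEq (M.face d) w y) (mapEqn M ν)) y₀ := by
  have h0 : y₀.2 (ν 0) = 0 := by
    ext i; fin_cases i
    exacts [hn.zero 0, hn.zero 1, hn.zero 2]
  have h1 : ∀ q : Option G.Dart, M'.OnFace (q.elim w fun e => e.fst)
      (π (q.elim (M.face d) M.face)) := by
    rintro (_ | e)
    · have := h.merge.mem _ _ hw
      rwa [← h.merge.same] at this
    · exact h.merge.mem _ _ (M.onFace_fst e)
  have key := linearIndependent_eqn (y := y₀) (fun q : Option G.Dart => q.elim (M.face d) M.face)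
    (fun q => q.elim w fun e => e.fst) ν
    (fun q => by rw [h.eq]; exact h.strict.on _ _ (h1 q))
    (fun f => by rw [h.eq]; exact h.strict.unit _) h0 hn.pos₁.ne' (hn.zero 3) hn.pos₂.ne'
    fun τ h1 h2 h3 => h.no_stress hM hM' hw hwa hwb τ
      (fun v => by convert h1 v) (fun f => by convert h2 f) fun f => by convert h3 f
  -- The extra function is the negative of an incidence equation, hence the reindexing and the unit
  -- factor `-1` on it.
  let e : Option (G.Dart ⊕ M.Face ⊕ Fin 6) → Option G.Dart ⊕ M.Face ⊕ Fin 6 := fun i =>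
    i.elim (.inl none) (Sum.map some id)
  have he : Function.Injective e := by
    rintro (_ | d | i) (_ | d' | i') h <;> simp_all [e]
  have h2 := (key.comp e he).units_smul fun i => i.elim (-1) 1
  convert h2 using 2 with i
  rcases i with _ | d | f | k
  · change fderiv ℝ (fun y => -incEq (M.face d) w y) y₀ = (-1 : ℝˣ) • fderiv ℝ (incEq (M.face d) w) y₀
    rw [fderiv_fun_neg]
    exact (neg_one_smul ℝ _).symm
  · exact (one_smul ℝ (fderiv ℝ (incEq (M.face d) d.fst) y₀)).symm
  · exact (one_smul ℝ (fderiv ℝ (unitEq f) y₀)).symm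
  · exact (one_smul ℝ (fderiv ℝ (normEq ν k) y₀)).symm

end HypPoly

namespace HypPoly

variable {V : Type*} [Fintype V] {G G₀ : SimpleGraph V} {M : SphereEmbedding G}
  {M' : SphereEmbedding G₀} {ν : Fin 4 → V} {d : G.Dart} {p : M.Face → HalfParam} {x : V → E3}
  {π : M.Face → M'.Face} {p' : M'.Face → HalfParam}

/-! ### The two sides of a diagonal of a face -/

/-- A function whose sign does not change along the edges of a face off the ends of `d` has a
constant sign there. -/
theorem same_sign_of_face (hM : M.Polyhedral) {T : V → ℝ} (d : G.Dart)
    (h : ∀ e : G.Dart, M.face e = M.face d → e.fst ≠ d.fst → e.fst ≠ d.snd → e.snd ≠ d.fst →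
      e.snd ≠ d.snd → 0 < T e.fst * T e.snd)
    (h0 : ∀ v, M.OnFace v (M.face d) → v ≠ d.fst → v ≠ d.snd → T v ≠ 0) :
    ∀ u v, M.OnFace u (M.face d) → u ≠ d.fst → u ≠ d.snd → M.OnFace v (M.face d) → v ≠ d.fst →
      v ≠ d.snd → 0 < T u * T v := by
  have hw := M.face_three hM.rot_ne d
  set w := (M.step d).snd with hwd
  have key : ∀ v, M.OnFace v (M.face d) → v ≠ d.fst → v ≠ d.snd → 0 < T w * T v := by
    rintro v ⟨e, rfl, he⟩ ha hb
    have := M.face_induction (P := fun e => e.fst ≠ d.fst → e.fst ≠ d.snd → 0 < T w * T e.fst) d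
      (fun hne => absurd rfl hne) (fun e he hP h1 h2 => ?_) e he
    · exact this ha hb
    rw [M.step_fst] at h1 h2 ⊢
    by_cases h3 : e.fst = d.fst
    · rw [hM.dart_unique e d h3 he] at h2
      exact absurd rfl h2
    by_cases h4 : e.fst = d.snd
    · rw [hM.dart_unique e (M.step d) (h4.trans (M.step_fst d).symm) (he.trans (M.face_step d).symm)]
      refine mul_self_pos.2 (h0 w ?_ hw.2.1.symm hw.2.2.symm)
      rw [← M.face_step]
      exact M.onFace_snd _
    have h5 := mul_pos (hP h3 h4) (h e he h3 h4 h1 h2)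
    have h6 : T w * T e.fst * (T e.fst * T e.snd) = (T e.fst * T e.fst) * (T w * T e.snd) := by ring
    rw [h6] at h5
    exact pos_of_mul_pos_right h5 (mul_self_nonneg _)
  intro u v hu ha hb hv ha' hb'
  have h5 := mul_pos (key u hu ha hb) (key v hv ha' hb')
  have h6 : T w * T u * (T w * T v) = (T w * T w) * (T u * T v) := by ring
  rw [h6] at h5
  exact pos_of_mul_pos_right h5 (mul_self_nonneg _)

namespace IsStrict

variable {a b : V} {t : M'.Face}

theorem inner_cross_ne_zero (h : IsStrict M' p' x) (hM' : M'.Polyhedral) (hab : a ≠ b)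
    (ha : M'.OnFace a t) (hb : M'.OnFace b t) {v : V} (hv : M'.OnFace v t) (hva : v ≠ a)
    (hvb : v ≠ b) : ⟪cross (p' t).1 (x b - x a), x v - x a⟫ ≠ 0 := fun h0 => by
  have hli := (h.isMarked hM').not_collinear hab hva.symm hvb.symm
  have hu : x b - x a ≠ 0 := sub_ne_zero.2 fun e => hab (h.inj hM' e).symm
  obtain ⟨β, hβ⟩ := exists_smul_of_inner_cross (h.unit t) hu (h.inner_eq_zero ha hb)
    (h.inner_eq_zero ha hv) h0
  have := (LinearIndependent.pair_iff.1 hli β (-1) (by rw [hβ]; module)).2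
  norm_num at this

/-- A point of the plane of a face on the line through two of its vertices lies between them. -/
theorem mem_segment_of_inner_cross (h : IsStrict M' p' x) (hM' : M'.Polyhedral) (hab : a ≠ b)
    (ha : M'.OnFace a t) (hb : M'.OnFace b t) {y : E3} (hy : y ∈ body p') (hyt : y ∈ wall (p' t))
    (h0 : ⟪cross (p' t).1 (x b - x a), y - x a⟫ = 0) : y ∈ segment ℝ (x a) (x b) := by
  have hm := h.isMarked hM'
  have hu : x b - x a ≠ 0 := sub_ne_zero.2 fun e => hab (h.inj hM' e).symm
  obtain ⟨β, hβ⟩ := exists_smul_of_inner_cross (h.unit t) hu (h.inner_eq_zero ha hb)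
    (by rw [inner_sub_right, show ⟪(p' t).1, y⟫ = (p' t).2 from hyt, h.on a t ha, sub_self]) h0
  exact mem_segment_of_line hm.inj hm.range_eq hab hy hβ

/-- Edges of a face do not cross its diagonals. -/
theorem inner_cross_mul_pos (h : IsStrict M' p' x) (hM' : M'.Polyhedral) (hab : a ≠ b)
    (ha : M'.OnFace a t) (hb : M'.OnFace b t) {v w : V} (hvw : G₀.Adj v w) (hv : M'.OnFace v t)
    (hw : M'.OnFace w t) (hva : v ≠ a) (hvb : v ≠ b) (hwa : w ≠ a) (hwb : w ≠ b) :
    0 < ⟪cross (p' t).1 (x b - x a), x v - x a⟫ * ⟪cross (p' t).1 (x b - x a), x w - x a⟫ := by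
  have hm := h.isMarked hM'
  have hTv := h.inner_cross_ne_zero hM' hab ha hb hv hva hvb
  have hTw := h.inner_cross_ne_zero hM' hab ha hb hw hwa hwb
  set k := cross (p' t).1 (x b - x a) with hk
  by_contra! hle
  -- The other face through the edge. If the edge crossed the diagonal, the crossing point would lie
  -- on the wall of `g` and also on the segment from `a` to `b`, whose ends are strictly inside that
  -- wall.
  obtain ⟨g, hgt, hgv, hgw⟩ : ∃ g, g ≠ t ∧ M'.OnFace v g ∧ M'.OnFace w g := by
    let e : G₀.Dart := ⟨(v, w), hvw⟩
    by_cases he : M'.face e = t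
    · exact ⟨M'.face (M'.rot e), fun e' => hM'.rot_ne e (hM'.dart_unique _ _ (M'.rot_fst e)
        (e'.trans he.symm)), M'.onFace_fst_rot e, M'.onFace_snd_rot e⟩
    · exact ⟨M'.face e, he, M'.onFace_fst e, M'.onFace_snd e⟩
  have hoff : ∀ c, c ≠ v → c ≠ w → M'.OnFace c t → ⟪(p' g).1, x c⟫ < (p' g).2 :=
    fun c h1 h2 hc => h.off c g fun hcg =>
      hgt (hM'.three g t c v w h1 h2 hvw.ne hcg hgv hgw hc hv hw)
  set s := ⟪k, x v - x a⟫ with hs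
  set r := ⟪k, x w - x a⟫ with hr
  have hsr : 0 < |s| + |r| := add_pos (abs_pos.2 hTv) (abs_pos.2 hTw)
  have habs : |r| * s + |s| * r = 0 := by
    rcases lt_or_gt_of_ne hTv with h1 | h1 <;> rcases lt_or_gt_of_ne hTw with h2 | h2
    · exact absurd hle (not_le.2 (mul_pos_of_neg_of_neg h1 h2))
    · rw [abs_of_neg h1, abs_of_pos h2]; ring
    · rw [abs_of_pos h1, abs_of_neg h2]; ring
    · exact absurd hle (not_le.2 (mul_pos h1 h2))
  -- The weights at which the segment from `v` to `w` meets the line through `a` and `b`.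
  set α := |r| / (|s| + |r|) with hα
  set β := |s| / (|s| + |r|) with hβ
  have hα0 : 0 ≤ α := by positivity
  have hβ0 : 0 ≤ β := by positivity
  have hαβ : α + β = 1 := by rw [hα, hβ, ← add_div, add_comm, div_self hsr.ne']
  have hin : ∀ n : E3, ⟪n, α • x v + β • x w⟫ = α * ⟪n, x v⟫ + β * ⟪n, x w⟫ := fun n => by
    rw [inner_add_right, inner_smul_right, inner_smul_right]
  have hwall : ∀ g, M'.OnFace v g → M'.OnFace w g → ⟪(p' g).1, α • x v + β • x w⟫ = (p' g).2 :=
    fun g h1 h2 => by rw [hin, h.on v g h1, h.on w g h2, ← add_mul, hαβ, one_mul]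
  have hy : α • x v + β • x w ∈ body p' := convex_body p' (hm.mem v) (hm.mem w) hα0 hβ0 hαβ
  obtain ⟨α', β', h1, h2, h3, h4⟩ := h.mem_segment_of_inner_cross hM' hab ha hb hy (hwall t hv hw) (by
    rw [inner_sub_right, hin]
    rw [inner_sub_right] at hs hr
    have e1 : ⟪k, x v⟫ = s + ⟪k, x a⟫ := by rw [hs]; ring
    have e2 : ⟪k, x w⟫ = r + ⟪k, x a⟫ := by rw [hr]; ring
    have e3 : α * s + β * r = 0 := by
      rw [hα, hβ, div_mul_eq_mul_div, div_mul_eq_mul_div, ← add_div, habs, zero_div]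
    rw [e1, e2]
    linear_combination e3 + ⟪k, x a⟫ * hαβ)
  have h5 := hwall g hgv hgw
  rw [← h4, inner_add_right, inner_smul_right, inner_smul_right] at h5
  have h6 := hoff a hva.symm hwa.symm ha
  have h7 := hoff b hvb.symm hwb.symm hb
  have h8 : α' * ((p' g).2 - ⟪(p' g).1, x a⟫) + β' * ((p' g).2 - ⟪(p' g).1, x b⟫) = 0 := by
    linear_combination (p' g).2 * h3 - h5
  have h9 : α' = 0 := by
    by_contra hne
    have := mul_pos (lt_of_le_of_ne h1 (Ne.symm hne)) (sub_pos.2 h6)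
    have := mul_nonneg h2 (sub_pos.2 h7).le
    linarith
  rw [h9, zero_mul, zero_add] at h8
  have h10 := (mul_eq_zero.1 h8).resolve_right (sub_pos.2 h7).ne'
  rw [h9, h10] at h3
  norm_num at h3

/-- If a face lies on one side of the line through two of its vertices, these are adjacent. -/
theorem adj_of_inner_cross (h : IsStrict M' p' x) (hM' : M'.Polyhedral) (hab : a ≠ b)
    (ha : M'.OnFace a t) (hb : M'.OnFace b t) {s : ℝ}
    (hs : ∀ v, M'.OnFace v t → v ≠ a → v ≠ b →
      0 < s * ⟪cross (p' t).1 (x b - x a), x v - x a⟫) (hs0 : s ≠ 0) : G₀.Adj a b := by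
  have hm := h.isMarked hM'
  set k := cross (p' t).1 (x b - x a) with hk
  have hle : ∀ y ∈ body p', ⟪(p' t).1, y⟫ ≤ (p' t).2 := fun y hy => (mem_body_iff.1 hy).2 t
  -- On the facet the side function is a supporting functional vanishing on the segment, which makes
  -- the segment extreme.
  have hnonneg : ∀ y ∈ body p', y ∈ wall (p' t) → 0 ≤ s * ⟪k, y - x a⟫ := by
    intro y hy hyt
    rw [h.body_eq hM'] at hy
    obtain ⟨α, h1, h2, rfl⟩ := exists_weights y hy
    have h3 : ∑ v, α v * ((p' t).2 - ⟪(p' t).1, x v⟫) = 0 := by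
      have : ⟪(p' t).1, ∑ v, α v • x v⟫ = (p' t).2 := hyt
      simp only [inner_sum, inner_smul_right] at this
      simp only [mul_sub, Finset.sum_sub_distrib, ← Finset.sum_mul, h2, this, one_mul, sub_self]
    have h4 := (Finset.sum_eq_zero_iff_of_nonneg fun v _ =>
      mul_nonneg (h1 v) (sub_nonneg.2 (h.le v t))).1 h3
    have h5 : ∑ v, α v • x v - x a = ∑ v, α v • (x v - x a) := by
      simp only [smul_sub, Finset.sum_sub_distrib, ← Finset.sum_smul, h2, one_smul]
    rw [h5, inner_sum, Finset.mul_sum]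
    refine Finset.sum_nonneg fun v hv => ?_
    rw [inner_smul_right, mul_left_comm]
    by_cases hvt : M'.OnFace v t
    · refine mul_nonneg (h1 v) ?_
      by_cases hva : v = a
      · rw [hva, sub_self, inner_zero_right, mul_zero]
      by_cases hvb : v = b
      · rw [hvb, hk, inner_cross_self, mul_zero]
      exact (hs v hvt hva hvb).le
    · rw [(mul_eq_zero.1 (h4 v hv)).resolve_right (sub_pos.2 (h.off v t hvt)).ne', zero_mul]
  rw [hm.adj_iff]
  refine ⟨fun e => hab (h.inj hM' e), (convex_body p').segment_subset (hm.mem a) (hm.mem b), ?_⟩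
  intro y hy z hz w hw hw'
  have hwt : w ∈ wall (p' t) := by
    obtain ⟨α, β, -, -, h3, rfl⟩ := hw
    change ⟪(p' t).1, _⟫ = _
    rw [inner_add_right, inner_smul_right, inner_smul_right, h.on a t ha, h.on b t hb, ← add_mul, h3,
      one_mul]
  have hw0 : ⟪k, w - x a⟫ = 0 := by
    obtain ⟨α, β, -, -, h3, rfl⟩ := hw
    rw [show α • x a + β • x b - x a = β • (x b - x a) by
      rw [show α = 1 - β by linarith]; module, inner_smul_right, hk, inner_cross_self, mul_zero]
  have hyt := wall_of_openSegment (hle y hy) (hle z hz) hw' hwt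
  have hzt := wall_of_openSegment (hle z hz) (hle y hy) (openSegment_symm ℝ y z ▸ hw') hwt
  refine h.mem_segment_of_inner_cross hM' hab ha hb hy hyt ?_
  have h1 := hnonneg y hy hyt
  have h2 := hnonneg z hz hzt
  obtain ⟨α, β, h3, h4, h5, rfl⟩ := hw'
  have h6 : α * (s * ⟪k, y - x a⟫) + β * (s * ⟪k, z - x a⟫) = 0 := by
    rw [show α • y + β • z - x a = α • (y - x a) + β • (z - x a) by
      rw [show α = 1 - β by linarith]; module, inner_add_right, inner_smul_right,
      inner_smul_right] at hw0
    linear_combination s * hw0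
  have h7 := mul_nonneg h3.le h1
  have h8 := mul_nonneg h4.le h2
  have h9 : s * ⟪k, y - x a⟫ = 0 := (mul_eq_zero.1 (by linarith)).resolve_left h3.ne'
  exact (mul_eq_zero.1 h9).resolve_left hs0

end IsStrict

theorem merge_onFace (hπ : M.IsMerge d M'.verts π) {v : V} (hv : M'.OnFace v (π (M.face d))) :
    M.OnFace v (M.face d) ∨ M.OnFace v (M.face d.symm) := by
  obtain ⟨f, hf, hvf⟩ := hπ.exists_face _ _ hv
  rcases hπ.eq_or _ _ hf with rfl | ⟨rfl, -⟩ | ⟨rfl, -⟩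
  exacts [Or.inl hvf, Or.inl hvf, Or.inr hvf]

/-- The merged faces lie on the two sides of the diagonal. -/
theorem IsFlat.exists_sides (h : IsFlat M M' d p x π p') (hD : IsDeletion G₀ d)
    (hM : M.Polyhedral) (hM' : M'.Polyhedral) : ∃ s : ℝ,
    (∀ v, M.OnFace v (M.face d.symm) → v ≠ d.fst → v ≠ d.snd →
      0 < s * ⟪cross (p (M.face d.symm)).1 (x d.snd - x d.fst), x v - x d.fst⟫) ∧
    ∀ v, M.OnFace v (M.face d) → v ≠ d.fst → v ≠ d.snd →
      s * ⟪cross (p (M.face d)).1 (x d.snd - x d.fst), x v - x d.fst⟫ < 0 := by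
  have hs := h.strict
  have hπ := h.merge
  rw [← h.face_eq, h.eq, Function.comp]
  set t := π (M.face d) with ht
  have hon : ∀ v, M.OnFace v (M.face d) → M'.OnFace v t := fun v hv => hπ.mem v _ hv
  have hon' : ∀ v, M.OnFace v (M.face d.symm) → M'.OnFace v t := fun v hv => by
    rw [ht, hπ.same]; exact hπ.mem v _ hv
  have ha := hon _ (M.onFace_fst d)
  have hb := hon _ (M.onFace_snd d)
  have hab := d.fst_ne_snd
  set T : V → ℝ := fun v => ⟪cross (p' t).1 (x d.snd - x d.fst), x v - x d.fst⟫ with hT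
  have hT0 : ∀ v, M'.OnFace v t → v ≠ d.fst → v ≠ d.snd → T v ≠ 0 := fun v hv h1 h2 =>
    hs.inner_cross_ne_zero hM' hab ha hb hv h1 h2
  have hadj : ∀ e : G.Dart, e.fst ≠ d.fst → e.fst ≠ d.snd → G₀.Adj e.fst e.snd := fun e h1 h2 =>
    (hD.adj_or _ _ e.adj).resolve_right fun h3 => by
      rcases Sym2.eq_iff.1 h3 with ⟨h4, -⟩ | ⟨h4, -⟩
      exacts [h1 h4, h2 h4]
  have hS1 := same_sign_of_face hM (T := T) d
    (fun e he h1 h2 h3 h4 => hs.inner_cross_mul_pos hM' hab ha hb (hadj e h1 h2)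
      (hon _ (he ▸ M.onFace_fst e)) (hon _ (he ▸ M.onFace_snd e)) h1 h2 h3 h4)
    fun v hv => hT0 v (hon v hv)
  have hS2 := same_sign_of_face hM (T := T) d.symm
    (fun e he h1 h2 h3 h4 => hs.inner_cross_mul_pos hM' hab ha hb (hadj e h2 h1)
      (hon' _ (he ▸ M.onFace_fst e)) (hon' _ (he ▸ M.onFace_snd e)) h2 h1 h4 h3)
    fun v hv h1 h2 => hT0 v (hon' v hv) h2 h1
  have hw := M.face_three hM.rot_ne d.symm
  set w := (M.step d.symm).snd with hwd
  have hwf : M.OnFace w (M.face d.symm) := by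
    rw [← M.face_step]
    exact M.onFace_snd _
  have hwa : w ≠ d.fst := hw.2.2.symm
  have hwb : w ≠ d.snd := hw.2.1.symm
  refine ⟨T w, fun v hv h1 h2 => hS2 w v hwf hwb hwa hv h2 h1, fun v hv h1 h2 => ?_⟩
  by_contra! hle
  have hpos : 0 < T w * T v := lt_of_le_of_ne hle
    (mul_ne_zero (hT0 w (hon' w hwf) hwa hwb) (hT0 v (hon v hv) h1 h2)).symm
  -- Each of the two faces keeps a constant sign. If the signs agreed, the whole facet would lie on
  -- one side of the diagonal, which would then be an edge of the smaller graph.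
  refine hD.not_adj (hs.adj_of_inner_cross hM' hab ha hb (s := T w) (fun u hu h3 h4 => ?_)
    (hT0 w (hon' w hwf) hwa hwb))
  change 0 < T w * T u
  rcases merge_onFace hπ hu with h5 | h5
  · have h6 := mul_pos hpos (hS1 v u hv h1 h2 h5 h3 h4)
    have h7 : T w * T v * (T v * T u) = T v * T v * (T w * T u) := by ring
    rw [h7] at h6
    exact pos_of_mul_pos_right h6 (mul_self_nonneg _)
  · exact hS2 w u hwf hwb hwa h5 h4 h3

end HypPoly

namespace HypPoly

variable {V : Type*} [Fintype V] {G G₀ : SimpleGraph V} {M : SphereEmbedding G}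
  {M' : SphereEmbedding G₀} {ν : Fin 4 → V} {d : G.Dart} {π : M.Face → M'.Face}
  {p' : M'.Face → HalfParam} {f₀ : M.Face}

/-! ### Local models at flat realisations -/

theorem inner_cross_left (n u : E3) : ⟪cross n u, n⟫ = 0 := by
  rw [inner_cross]; ring

/-- Unit vectors orthogonal to `u` and coplanar with `u`, in the same half-plane, agree. -/
theorem eq_of_inner_cross {n m u : E3} (hn : ‖n‖ = 1) (hm : ‖m‖ = 1) (hu : u ≠ 0) (h1 : ⟪n, u⟫ = 0)
    (h2 : ⟪m, u⟫ = 0) (h : ⟪cross n u, m⟫ = 0) (hpos : 0 < ⟪n, m⟫) : m = n := by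
  have hnn : ⟪n, n⟫ = 1 := by rw [real_inner_self_eq_norm_sq, hn, one_pow]
  obtain ⟨β, hβ⟩ := exists_smul_of_inner_cross (z := m - ⟪n, m⟫ • n) hn hu h1
    (by rw [inner_sub_right, inner_smul_right, hnn]; ring)
    (by rw [inner_sub_right, inner_smul_right, inner_cross_left, h]; ring)
  have h3 : β * ⟪u, u⟫ = 0 := by
    have := congrArg (fun y => ⟪y, u⟫) hβ
    simp only [inner_sub_left, inner_smul_left, conj_trivial, h1, h2] at this
    linarith
  rw [(mul_eq_zero.1 h3).resolve_right (inner_self_ne_zero.2 hu), zero_smul, sub_eq_zero] at hβ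
  have h4 := congrArg norm hβ
  rw [norm_smul, hn, hm, mul_one, Real.norm_of_nonneg hpos.le] at h4
  rw [hβ, ← h4, one_smul]

theorem cross_continuous : Continuous fun z : E3 × E3 => cross z.1 z.2 := by
  refine (PiLp.continuous_toLp 2 _).comp (continuous_pi fun i => ?_)
  fin_cases i <;> simp only [Fin.zero_eta, Fin.mk_one, Fin.reduceFinMk, Matrix.cons_val] <;> fun_prop

/-- The conditions on realisations near a flat one that are not equations. -/
structure IsNearFlat (π : M.Face → M'.Face) (d : G.Dart) (s : ℝ)
    (y : (M.Face → HalfParam) × (V → E3)) : Prop where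
  ball : ∀ v, ‖y.2 v‖ < 1
  off : ∀ v f, ¬ M'.OnFace v (π f) → ⟪(y.1 f).1, y.2 v⟫ < (y.1 f).2
  side : ∀ v, M.OnFace v (M.face d.symm) → v ≠ d.fst → v ≠ d.snd →
    0 < s * ⟪cross (y.1 (M.face d.symm)).1 (y.2 d.snd - y.2 d.fst), y.2 v - y.2 d.fst⟫
  side' : ∀ v, M.OnFace v (M.face d) → v ≠ d.fst → v ≠ d.snd →
    s * ⟪cross (y.1 (M.face d)).1 (y.2 d.snd - y.2 d.fst), y.2 v - y.2 d.fst⟫ < 0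
  pos : 0 < ⟪(y.1 (M.face d.symm)).1, (y.1 (M.face d)).1⟫

theorem IsFlat.eventually_isNearFlat {y₀ : (M.Face → HalfParam) × (V → E3)}
    (h : IsFlat M M' d y₀.1 y₀.2 π p') (hD : IsDeletion G₀ d) (hM : M.Polyhedral)
    (hM' : M'.Polyhedral) : ∃ s, ∀ᶠ y in 𝓝 y₀, IsNearFlat π d s y := by
  obtain ⟨s, hs, hs'⟩ := h.exists_sides hD hM hM'
  refine ⟨s, ?_⟩
  have hside : ∀ f v, Continuous fun y : (M.Face → HalfParam) × (V → E3) =>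
      s * ⟪cross (y.1 f).1 (y.2 d.snd - y.2 d.fst), y.2 v - y.2 d.fst⟫ := fun f v => by
    have h1 : Continuous fun y : (M.Face → HalfParam) × (V → E3) =>
        cross (y.1 f).1 (y.2 d.snd - y.2 d.fst) :=
      cross_continuous.comp (by fun_prop :
        Continuous fun y : (M.Face → HalfParam) × (V → E3) => ((y.1 f).1, y.2 d.snd - y.2 d.fst))
    fun_prop
  have imp : ∀ {P : Prop} {Q : (M.Face → HalfParam) × (V → E3) → Prop},
      (P → ∀ᶠ y in 𝓝 y₀, Q y) → ∀ᶠ y in 𝓝 y₀, P → Q y := fun {P Q} hPQ => by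
    by_cases hP : P
    · exact (hPQ hP).mono fun y hy _ => hy
    · exact Filter.Eventually.of_forall fun y hP' => absurd hP' hP
  have h1 : ∀ᶠ y in 𝓝 y₀, ∀ v, ‖y.2 v‖ < 1 := Filter.eventually_all.2 fun v =>
    (show Continuous fun y : (M.Face → HalfParam) × (V → E3) => ‖y.2 v‖ by
      fun_prop).continuousAt.eventually (gt_mem_nhds (h.strict.ball v))
  have h2 : ∀ᶠ y in 𝓝 y₀, ∀ v f, ¬ M'.OnFace v (π f) → ⟪(y.1 f).1, y.2 v⟫ < (y.1 f).2 :=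
    Filter.eventually_all.2 fun v => Filter.eventually_all.2 fun f => imp fun hf =>
      (isOpen_lt (by fun_prop) (by fun_prop)).mem_nhds (by
        change ⟪(y₀.1 f).1, y₀.2 v⟫ < (y₀.1 f).2
        rw [h.eq]; exact h.strict.off v _ hf)
  have h3 : ∀ᶠ y in 𝓝 y₀, ∀ v, M.OnFace v (M.face d.symm) → v ≠ d.fst → v ≠ d.snd →
      0 < s * ⟪cross (y.1 (M.face d.symm)).1 (y.2 d.snd - y.2 d.fst), y.2 v - y.2 d.fst⟫ :=
    Filter.eventually_all.2 fun v => imp fun hv => imp fun ha => imp fun hb =>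
      (hside _ v).continuousAt.eventually (lt_mem_nhds (hs v hv ha hb))
  have h4 : ∀ᶠ y in 𝓝 y₀, ∀ v, M.OnFace v (M.face d) → v ≠ d.fst → v ≠ d.snd →
      s * ⟪cross (y.1 (M.face d)).1 (y.2 d.snd - y.2 d.fst), y.2 v - y.2 d.fst⟫ < 0 :=
    Filter.eventually_all.2 fun v => imp fun hv => imp fun ha => imp fun hb =>
      (hside _ v).continuousAt.eventually (gt_mem_nhds (hs' v hv ha hb))
  have h5 : ∀ᶠ y in 𝓝 y₀, 0 < ⟪(y.1 (M.face d.symm)).1, (y.1 (M.face d)).1⟫ :=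
    (isOpen_lt (by fun_prop) (by fun_prop)).mem_nhds (by
      change 0 < ⟪(y₀.1 (M.face d.symm)).1, (y₀.1 (M.face d)).1⟫
      rw [h.face_eq, real_inner_self_eq_norm_sq, h.eq, Function.comp, h.strict.unit]
      norm_num)
  filter_upwards [h1, h2, h3, h4, h5] with y h1 h2 h3 h4 h5 using ⟨h1, h2, h3, h4, h5⟩

namespace IsNearFlat

variable {s : ℝ} {y : (M.Face → HalfParam) × (V → E3)}

/-- Along the common edge the position of one face relative to the wall of the other is governed by
the single number `σ`, whose sign is that of the fold. The depth of `w` thus decides it for all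
vertices of both faces: a convex fold is strict, and no fold makes the two half spaces equal. -/
theorem strict_or_flat (h : IsNearFlat π d s y) (hπ : M.IsMerge d M'.verts π)
    (hunit : ∀ f, ‖(y.1 f).1‖ = 1) (hinc : ∀ v f, M.OnFace v f → ⟪(y.1 f).1, y.2 v⟫ = (y.1 f).2)
    {w : V} (hw : M.OnFace w (M.face d.symm)) (hwa : w ≠ d.fst) (hwb : w ≠ d.snd)
    (hle : ⟪(y.1 (M.face d)).1, y.2 w⟫ ≤ (y.1 (M.face d)).2) :
    IsStrict M y.1 y.2 ∨ ∃ p', IsFlat M M' d y.1 y.2 π p' := by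
  have ha1 := M.onFace_fst d
  have hb1 := M.onFace_snd d
  have hb2 : M.OnFace d.snd (M.face d.symm) := M.onFace_fst d.symm
  have ha2 : M.OnFace d.fst (M.face d.symm) := M.onFace_snd d.symm
  set f₁ := M.face d with hf₁
  set f₂ := M.face d.symm with hf₂
  set n₁ := (y.1 f₁).1 with hn₁
  set n₂ := (y.1 f₂).1 with hn₂
  set u := y.2 d.snd - y.2 d.fst with hu
  have hsub : ∀ v v' f, M.OnFace v f → M.OnFace v' f → ⟪(y.1 f).1, y.2 v - y.2 v'⟫ = 0 :=
    fun v v' f hv hv' => by rw [inner_sub_right, hinc v f hv, hinc v' f hv', sub_self]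
  have hu1 : ⟪n₁, u⟫ = 0 := hsub _ _ _ hb1 ha1
  have hu2 : ⟪n₂, u⟫ = 0 := hsub _ _ _ hb2 ha2
  have hTw := h.side w hw hwa hwb
  have hs0 : s ≠ 0 := by
    rintro rfl
    rw [zero_mul] at hTw
    exact lt_irrefl _ hTw
  have hu0 : u ≠ 0 := fun e => by
    rw [← hu, ← hn₂, e, inner_cross] at hTw
    simp at hTw
  have huu : 0 < ⟪u, u⟫ := real_inner_self_pos.2 hu0
  have hss : 0 < s * s := mul_self_pos.2 hs0
  have hsq : ∀ f, ⟪(y.1 f).1, (y.1 f).1⟫ = 1 := fun f => by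
    rw [real_inner_self_eq_norm_sq, hunit, one_pow]
  set σ := s * ⟪cross n₂ u, n₁⟫ with hσ
  -- The Gram identity turns "side of the diagonal" times "sign of the fold" into a positive
  -- multiple of the height above the other wall. In `key1` the roles of the faces are exchanged and
  -- the fold changes sign.
  have key2 : ∀ v, M.OnFace v f₂ → σ * (s * ⟪cross n₂ u, y.2 v - y.2 d.fst⟫) =
      s * s * ⟪u, u⟫ * ⟪n₁, y.2 v - y.2 d.fst⟫ := fun v hv => by
    have := inner_cross_mul n₂ u n₁ _ hu2 (hsub v d.fst f₂ hv ha2)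
    rw [hu1, hsq] at this
    linear_combination s * s * this
  have key1 : ∀ v, M.OnFace v f₁ → -σ * (s * ⟪cross n₁ u, y.2 v - y.2 d.fst⟫) =
      s * s * ⟪u, u⟫ * ⟪n₂, y.2 v - y.2 d.fst⟫ := fun v hv => by
    have := inner_cross_mul n₁ u n₂ _ hu1 (hsub v d.fst f₁ hv ha1)
    rw [hu2, hsq, inner_cross_swap n₂ u n₁] at this
    linear_combination s * s * this
  have hpos : 0 < s * s * ⟪u, u⟫ := mul_pos hss huu
  have hwa' : ⟪n₁, y.2 w - y.2 d.fst⟫ = ⟪n₁, y.2 w⟫ - (y.1 f₁).2 := by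
    rw [inner_sub_right, hinc _ _ ha1]
  rcases hle.lt_or_eq with hlt | heq
  · left
    have hσ0 : σ < 0 := by
      by_contra! hge
      have h1 := mul_nonneg hge hTw.le
      rw [key2 w hw] at h1
      have := mul_neg_of_pos_of_neg hpos (show ⟪n₁, y.2 w - y.2 d.fst⟫ < 0 by rw [hwa']; linarith)
      linarith
    have hneg : ∀ {r : ℝ}, s * s * ⟪u, u⟫ * r < 0 → r < 0 := fun {r} hr => by
      by_contra! hge
      exact absurd hr (not_lt.2 (mul_nonneg hpos.le hge))
    refine ⟨hunit, h.ball, hinc, fun v f hvf => ?_⟩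
    by_cases hv : M'.OnFace v (π f)
    · obtain ⟨f', hf', hvf'⟩ := hπ.exists_face _ _ hv
      rcases hπ.eq_or _ _ hf' with rfl | ⟨rfl, rfl⟩ | ⟨rfl, rfl⟩
      · exact absurd hvf' hvf
      · have hva : v ≠ d.fst := fun e => hvf (e ▸ ha2)
        have hvb : v ≠ d.snd := fun e => hvf (e ▸ hb2)
        have h1 : ⟪n₂, y.2 v - y.2 d.fst⟫ < 0 := hneg (by
          rw [← key1 v hvf']
          exact mul_neg_of_pos_of_neg (neg_pos.2 hσ0) (h.side' v hvf' hva hvb))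
        rw [inner_sub_right, hinc _ _ ha2] at h1
        exact sub_neg.1 h1
      · have hva : v ≠ d.fst := fun e => hvf (e ▸ ha1)
        have hvb : v ≠ d.snd := fun e => hvf (e ▸ hb1)
        have h1 : ⟪n₁, y.2 v - y.2 d.fst⟫ < 0 := hneg (by
          rw [← key2 v hvf']
          exact mul_neg_of_neg_of_pos hσ0 (h.side v hvf' hva hvb))
        rw [inner_sub_right, hinc _ _ ha1] at h1
        exact sub_neg.1 h1
    · exact h.off v f hv
  · right
    have hk := key2 w hw
    rw [hwa', heq, sub_self, mul_zero] at hk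
    have hσ0 : ⟪cross n₂ u, n₁⟫ = 0 :=
      (mul_eq_zero.1 ((mul_eq_zero.1 hk).resolve_right hTw.ne')).resolve_left hs0
    -- With zero fold the unit normals are parallel; the opposite direction is excluded near a flat
    -- realisation by `pos`.
    have hnn : n₁ = n₂ := eq_of_inner_cross (hunit _) (hunit _) hu0 hu2 hu1 hσ0 h.pos
    have hff : y.1 f₁ = y.1 f₂ := Prod.ext hnn (by
      rw [← hinc _ _ ha1, ← hinc _ _ ha2]
      exact congrArg (fun n => ⟪n, y.2 d.fst⟫) hnn)
    have hcong : ∀ f f', π f = π f' → y.1 f = y.1 f' := by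
      intro f f' hff'
      rcases hπ.eq_or _ _ hff' with rfl | ⟨rfl, rfl⟩ | ⟨rfl, rfl⟩
      exacts [rfl, hff, hff.symm]
    let σ' := Function.surjInv (merge_surjective hπ)
    have hσ' : ∀ t, π (σ' t) = t := Function.surjInv_eq _
    refine ⟨fun t => y.1 (σ' t), hπ, ⟨fun t => hunit _, h.ball, fun v t hv => ?_, fun v t hv => ?_⟩,
      funext fun f => hcong _ _ (hσ' _).symm⟩
    · obtain ⟨f, rfl, hvf⟩ := hπ.exists_face t v hv
      rw [hcong _ _ (hσ' (π f))]
      exact hinc v f hvf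
    · exact h.off v _ (by rwa [hσ'])

end IsNearFlat

theorem exists_third (hM : M.Polyhedral) (d : G.Dart) :
    ∃ w, M.OnFace w (M.face d.symm) ∧ w ≠ d.fst ∧ w ≠ d.snd := by
  have hw := M.face_three hM.rot_ne d.symm
  refine ⟨(M.step d.symm).snd, ?_, hw.2.2.symm, hw.2.1.symm⟩
  rw [← M.face_step]
  exact M.onFace_snd _

/-- At a flat realisation the weak space is a manifold with boundary. -/
theorem IsDeletion.exists_localModel_flat (hD : IsDeletion G₀ d)
    (hν : IsChoice M ν f₀) (h1 : f₀ ≠ M.face d) (h2 : f₀ ≠ M.face d.symm) {n : ℕ}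
    (hm : Nat.card G.edgeSet = n + 1) (hM : M.Polyhedral) (hM' : M'.Polyhedral)
    {y₀ : (M.Face → HalfParam) × (V → E3)} (hf : IsFlat M M' d y₀.1 y₀.2 π p')
    (hn : IsNormal ν y₀) :
    ∃ L : LocalModel (𝓡∂ (n + 1)) (normalForm M.OnFace ν '' weakPolySpace M d.fst d.snd) y₀,
      L.chart y₀ 0 = 0 := by
  obtain ⟨w, hw, hwa, hwb⟩ := exists_third hM d
  obtain ⟨s, hs⟩ := hf.eventually_isNearFlat hD hM hM'
  have hwt : M'.OnFace w (π (M.face d)) := by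
    rw [hf.merge.same]; exact hf.merge.mem _ _ hw
  have hβ : incEq (M.face d) w y₀ = 0 := sub_eq_zero.2 (by
    rw [hf.eq]; exact hf.strict.on w _ hwt)
  obtain ⟨L, hL⟩ := exists_localModel_boundary
    (Z := normalForm M.OnFace ν '' weakPolySpace M d.fst d.snd)
    -- The depth of `w`, a vertex of the opposite face, below the wall of the face of `d`.
    (β := fun y => -incEq (M.face d) w y) (φ := mapEqn M ν) (contDiff_incEq (M.face d) w).neg
    (contDiff_eqn M.face (fun d => d.fst) ν) (hf.linearIndependent hM hM' hn hw hwa hwb)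
    (by rw [finrank_eq_card_mapEqn, hm]) (by
      filter_upwards [hs, hn.eventually] with y hy hny
      rw [hD.mem_image_iff (M' := M') hν h1 h2, hny, mapEqn_eq_zero_iff]
      constructor
      · rintro ⟨h3, ⟨-, h4⟩ | ⟨-, π', q, h4⟩⟩
        · exact ⟨⟨fun e => sub_eq_zero.2 (h4.on _ _ (M.onFace_fst e)),
            fun f => unitEq_eq_zero_iff.2 (h4.unit f), h3⟩, neg_nonneg.2 (sub_nonpos.2 (h4.le _ _))⟩
        · refine ⟨⟨fun e => sub_eq_zero.2 ?_, fun f => unitEq_eq_zero_iff.2 ?_, h3⟩,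
            neg_nonneg.2 (sub_nonpos.2 ?_)⟩ <;> rw [h4.eq]
          exacts [h4.strict.on _ _ (h4.merge.mem _ _ (M.onFace_fst e)), h4.strict.unit _,
            h4.strict.le _ _]
      · rintro ⟨⟨h3, h4, h5⟩, h6⟩
        refine ⟨h5, ?_⟩
        rcases hy.strict_or_flat hf.merge (fun f => unitEq_eq_zero_iff.1 (h4 f)) (by
          rintro v f ⟨e, rfl, rfl⟩
          exact sub_eq_zero.1 (h3 e)) hw hwa hwb (sub_nonpos.1 (neg_nonneg.1 h6)) with h7 | ⟨q, h7⟩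
        exacts [Or.inl ⟨hM, h7⟩, Or.inr ⟨hM', π, q, h7⟩])
  exact ⟨L, by rw [hL, hβ, neg_zero]⟩

end HypPoly

namespace HypPoly

/-! ### The moduli spaces -/

variable {V : Type*} [Fintype V] {G G₀ : SimpleGraph V} {M : SphereEmbedding G}
  {M' : SphereEmbedding G₀} {ν : Fin 4 → V} {d : G.Dart} {π : M.Face → M'.Face}
  {f₀ : M.Face}

/-- Choices compatible with the deletion of an edge. -/
structure IsSetup (M : SphereEmbedding G) (M' : SphereEmbedding G₀) (d : G.Dart) (ν : Fin 4 → V)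
    (f₀ : M.Face) (π : M.Face → M'.Face) : Prop where
  del : IsDeletion G₀ d
  -- The choices exist once there is a polyhedron to supply the face structure. Making them
  -- conditional covers empty spaces without proving that polyhedra exist.
  choice : (weakPolySpace M d.fst d.snd).Nonempty →
    IsChoice M ν f₀ ∧ f₀ ≠ M.face d ∧ f₀ ≠ M.face d.symm
  merge : (polySpace M').Nonempty → M.IsMerge d M'.verts π

theorem IsDeletion.polyhedral (hD : IsDeletion G₀ d) (M' : SphereEmbedding G₀)
    (h : (weakPolySpace M d.fst d.snd).Nonempty) : M.Polyhedral := by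
  obtain ⟨p, hp⟩ := h
  rcases weak_cases M' hD.le hD.deg hD.not_adj hD.adj_or hp with h | ⟨h, -⟩
  exacts [(exists_isStrict M hD.deg' h).1, h]

theorem IsDeletion.exists_isSetup (hD : IsDeletion G₀ d) (M : SphereEmbedding G)
    (M' : SphereEmbedding G₀) (t : M'.Face) : ∃ ν f₀ π, IsSetup M M' d ν f₀ π := by
  obtain ⟨ν, f₀, h1⟩ : ∃ ν f₀, (weakPolySpace M d.fst d.snd).Nonempty →
      IsChoice M ν f₀ ∧ f₀ ≠ M.face d ∧ f₀ ≠ M.face d.symm := by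
    by_cases h : (weakPolySpace M d.fst d.snd).Nonempty
    · obtain ⟨ν, f₀, h1⟩ := (hD.polyhedral M' h).exists_choice d
      exact ⟨ν, f₀, fun _ => h1⟩
    · exact ⟨fun _ => d.fst, M.face d, fun h' => absurd h' h⟩
  obtain ⟨π, h2⟩ : ∃ π, (polySpace M').Nonempty → M.IsMerge d M'.verts π := by
    by_cases h : (polySpace M').Nonempty
    · obtain ⟨p, hp⟩ := h
      obtain ⟨hM', x, hx⟩ := exists_isStrict M' hD.deg hp
      obtain ⟨-, π, hπ⟩ := exists_merge hx hM' M hD.le hD.deg hD.not_adj hD.adj_or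
      exact ⟨π, fun _ => hπ⟩
    · exact ⟨fun _ => t, fun h' => absurd h' h⟩
  exact ⟨ν, f₀, π, hD, h1, h2⟩

namespace IsSetup

variable (hS : IsSetup M M' d ν f₀ π)
include hS

theorem subset : polySpace M ⊆ weakPolySpace M d.fst d.snd := fun p hp => by
  obtain ⟨hM, x, hx⟩ := exists_isStrict M hS.del.deg' hp
  exact hx.mem_weakPolySpace hM d

theorem comp_mem {p : M'.Face → HalfParam} (hp : p ∈ polySpace M') :
    p ∘ π ∈ weakPolySpace M d.fst d.snd := by
  obtain ⟨hM', x, hx⟩ := exists_isStrict M' hS.del.deg hp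
  exact hx.comp_mem_weakPolySpace hM' (hS.merge ⟨p, hp⟩) hS.del.le hS.del.adj_or

theorem isChoice' (h : (polySpace M').Nonempty) : IsChoice M' ν (π f₀) := by
  obtain ⟨p, hp⟩ := h
  obtain ⟨h1, h2, h3⟩ := hS.choice ⟨_, hS.comp_mem hp⟩
  exact h1.merge h2 h3 (hS.merge ⟨p, hp⟩)

theorem isSlice_weak : IsSlice (weakPolySpace M d.fst d.snd) (normalForm M.OnFace ν) :=
  isSlice_normalForm (fun p hp => by
    obtain ⟨h1, h2, h3⟩ := hS.choice ⟨p, hp⟩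
    exact (hS.del.realizes (M' := M') h1 h2 h3 hp).imp fun _ h => h.1) M.exists_onFace
    fun p hp A hA => weakPolySpace_move M' hS.del.le hS.del.deg hS.del.not_adj hS.del.adj_or hp hA

theorem isSlice : IsSlice (polySpace M) (normalForm M.OnFace ν) :=
  isSlice_normalForm (fun p hp => by
    obtain ⟨hM, x, hx⟩ := exists_isStrict M hS.del.deg' hp
    exact ⟨x, hx.realizes hM (hS.choice ⟨p, hS.subset hp⟩).1⟩) M.exists_onFace
    fun p hp A hA => polySpace_move hS.del.deg' hp hA

theorem isSlice' : IsSlice (polySpace M') (normalForm M'.OnFace ν) :=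
  isSlice_normalForm (fun p hp => by
    obtain ⟨hM, x, hx⟩ := exists_isStrict M' hS.del.deg hp
    exact ⟨x, hx.realizes hM (hS.isChoice' ⟨p, hp⟩)⟩) M'.exists_onFace
    fun p hp A hA => polySpace_move hS.del.deg hp hA

theorem exists_localModel {m : ℕ} (hm : Nat.card G.edgeSet = m) (q : ASpace M) :
    Nonempty (LocalModel (𝓡 m) (normalForm M.OnFace ν '' polySpace M) (hS.isSlice.emb q)) := by
  have hq := hS.isSlice.emb_mem q
  obtain ⟨p, hp, -⟩ := id hq
  exact exists_localModel_polySpace hS.del.deg' (hS.choice ⟨p, hS.subset hp⟩).1 hm hq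

theorem exists_localModel' {m : ℕ} (hm : Nat.card G₀.edgeSet = m) (q : ASpace M') :
    Nonempty (LocalModel (𝓡 m) (normalForm M'.OnFace ν '' polySpace M') (hS.isSlice'.emb q)) := by
  have hq := hS.isSlice'.emb_mem q
  obtain ⟨p, hp, -⟩ := id hq
  exact exists_localModel_polySpace hS.del.deg (hS.isChoice' ⟨p, hp⟩) hm hq

/-- A strict realisation has distinct half spaces and a flat one repeats that of the merged faces.
So equality of two components of the normal form separates the two kinds, and serves to describe
interior and boundary. -/
theorem weak_emb_cases (q : AWeakSpace M d.fst d.snd) : M.Polyhedral ∧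
    IsNormal ν (hS.isSlice_weak.emb q) ∧
    ((hS.isSlice_weak.emb q).1 (M.face d) ≠ (hS.isSlice_weak.emb q).1 (M.face d.symm) ∧
      IsStrict M (hS.isSlice_weak.emb q).1 (hS.isSlice_weak.emb q).2 ∨
    (hS.isSlice_weak.emb q).1 (M.face d) = (hS.isSlice_weak.emb q).1 (M.face d.symm) ∧
      M'.Polyhedral ∧
      ∃ p', IsFlat M M' d (hS.isSlice_weak.emb q).1 (hS.isSlice_weak.emb q).2 π p') := by
  have hq := hS.isSlice_weak.emb_mem q
  obtain ⟨p, hp, -⟩ := id hq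
  obtain ⟨h1, h2, h3⟩ := hS.choice ⟨p, hp⟩
  have hM := hS.del.polyhedral M' ⟨p, hp⟩
  obtain ⟨h4, h5⟩ := (hS.del.mem_image_iff (M' := M') h1 h2 h3).1 hq
  refine ⟨hM, h4, h5.imp (fun h => ⟨fun e => face_ne_face_symm hM d (h.2.injective hM e), h.2⟩) ?_⟩
  rintro ⟨hM', π', p', h⟩
  refine ⟨h.face_eq, hM', p', ?_⟩
  obtain rfl := merge_unique hM.rot_ne hM' (hS.merge ⟨p', h.strict.mem_polySpace hM'⟩) h.merge
  exact h

theorem exists_localModel_weak {n : ℕ} (hm : Nat.card G.edgeSet = n + 1)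
    (q : AWeakSpace M d.fst d.snd) :
    ∃ L : LocalModel (𝓡∂ (n + 1)) (normalForm M.OnFace ν '' weakPolySpace M d.fst d.snd)
        (hS.isSlice_weak.emb q), 0 < L.chart (hS.isSlice_weak.emb q) 0 ↔
      (hS.isSlice_weak.emb q).1 (M.face d) ≠ (hS.isSlice_weak.emb q).1 (M.face d.symm) := by
  obtain ⟨p, hp, -⟩ := hS.isSlice_weak.emb_mem q
  obtain ⟨h1, h2, h3⟩ := hS.choice ⟨p, hp⟩
  obtain ⟨hM, hn, ⟨hne, h⟩ | ⟨he, hM', p', h⟩⟩ := hS.weak_emb_cases q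
  · obtain ⟨L, hL⟩ := hS.del.exists_localModel_strict M' h1 h2 h3 hm hM h hn
    exact ⟨L, iff_of_true hL hne⟩
  · obtain ⟨L, hL⟩ := hS.del.exists_localModel_flat h1 h2 h3 hm hM hM' h hn
    exact ⟨L, iff_of_false (by rw [hL]; exact lt_irrefl _) fun h => h he⟩

/-- The inclusion of the space of polyhedra into the space of weak polyhedra. -/
def incl : ASpace M → AWeakSpace M d.fst d.snd :=
  Quotient.map' (fun p => ⟨p.1, hS.subset p.2⟩) fun _ _ h => h

theorem emb_incl (q : ASpace M) : hS.isSlice_weak.emb (hS.incl q) = hS.isSlice.emb q := by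
  obtain ⟨p⟩ := q
  rfl

theorem continuous_incl : Continuous hS.incl := by
  rw [hS.isSlice_weak.isEmbedding_emb.continuous_iff]
  exact hS.isSlice.continuous_emb.congr fun q => (hS.emb_incl q).symm

theorem range_incl : range hS.incl = {q | (hS.isSlice_weak.emb q).1 (M.face d) ≠
    (hS.isSlice_weak.emb q).1 (M.face d.symm)} := by
  ext q
  constructor
  · rintro ⟨q, rfl⟩
    rw [mem_ofPred_eq, hS.emb_incl]
    obtain ⟨hM, x, hx⟩ := exists_isStrict M hS.del.deg' (hS.isSlice.fst_mem (hS.isSlice.emb_mem q))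
    exact fun e => face_ne_face_symm hM d (hx.injective hM e)
  · intro hq
    obtain ⟨hM, -, ⟨-, h⟩ | ⟨he, -⟩⟩ := hS.weak_emb_cases q
    · have hp := h.mem_polySpace hM
      refine ⟨cls ⟨_, hp⟩, hS.isSlice_weak.injective_emb ?_⟩
      rw [hS.emb_incl]
      exact hS.isSlice_weak.apply_fst (hS.isSlice_weak.emb_mem q)
    · exact absurd he hq

theorem isOpenEmbedding_incl : IsOpenEmbedding hS.incl := by
  refine ⟨IsEmbedding.of_comp hS.continuous_incl hS.isSlice_weak.continuous_emb ?_, ?_⟩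
  · convert hS.isSlice.isEmbedding_emb using 1
    exact funext hS.emb_incl
  · rw [hS.range_incl]
    have h := hS.isSlice_weak.continuous_emb.fst
    exact isOpen_ne_fun ((continuous_apply _).comp h) ((continuous_apply _).comp h)

/-- The map from the space of polyhedra for the smaller graph to the space of weak polyhedra. -/
def glue : ASpace M' → AWeakSpace M d.fst d.snd :=
  Quotient.map' (fun p => ⟨p.1 ∘ π, hS.comp_mem p.2⟩) fun _ _ ⟨g, hg, h⟩ => ⟨g, hg, fun f => h (π f)⟩

/-- The frame of the normal form depends only on the marked vertices, which are the same for both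
graphs, so repeating a half space commutes with normalising. -/
theorem emb_glue (q : ASpace M') : hS.isSlice_weak.emb (hS.glue q) =
    ((hS.isSlice'.emb q).1 ∘ π, (hS.isSlice'.emb q).2) := by
  obtain ⟨p, hp⟩ := q
  obtain ⟨hM', x, hx⟩ := exists_isStrict M' hS.del.deg hp
  have h := hx.realizes hM' (hS.isChoice' ⟨p, hp⟩)
  change normalForm M.OnFace ν (p ∘ π) = ((normalForm M'.OnFace ν p).1 ∘ π, _)
  rw [(h.comp_merge (hS.merge ⟨p, hp⟩)).normalForm_eq]
  change _ = (_, (normalForm M'.OnFace ν p).2)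
  rw [h.normalForm_eq]
  rfl

theorem range_glue : range hS.glue = {q | (hS.isSlice_weak.emb q).1 (M.face d) =
    (hS.isSlice_weak.emb q).1 (M.face d.symm)} := by
  ext q
  constructor
  · rintro ⟨q, rfl⟩
    rw [mem_ofPred_eq, hS.emb_glue]
    change (hS.isSlice'.emb q).1 (π _) = (hS.isSlice'.emb q).1 (π _)
    rw [(hS.merge ⟨_, hS.isSlice'.fst_mem (hS.isSlice'.emb_mem q)⟩).same]
  · intro hq
    obtain ⟨hM, -, ⟨hne, -⟩ | ⟨-, hM', p', h⟩⟩ := hS.weak_emb_cases q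
    · exact absurd hq hne
    · have hp := h.strict.mem_polySpace hM'
      refine ⟨cls ⟨p', hp⟩, hS.isSlice_weak.injective_emb ?_⟩
      change normalForm M.OnFace ν (p' ∘ π) = _
      rw [← h.eq]
      exact hS.isSlice_weak.apply_fst (hS.isSlice_weak.emb_mem q)

theorem continuous_glue : Continuous hS.glue := by
  rw [hS.isSlice_weak.isEmbedding_emb.continuous_iff]
  refine Continuous.congr (f := fun q => ((hS.isSlice'.emb q).1 ∘ π, (hS.isSlice'.emb q).2)) ?_
    fun q => (hS.emb_glue q).symm
  have h := hS.isSlice'.continuous_emb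
  exact (continuous_pi fun f => (continuous_apply (π f)).comp h.fst).prodMk h.snd

/-- Choosing one face of `M` over each face of `M'` forgets the repeated half space. This smooth
left inverse makes the gluing map an embedding and an immersion. -/
theorem exists_retract : ∃ g : (M.Face → HalfParam) × (V → E3) → (M'.Face → HalfParam) × (V → E3),
    ContDiff ℝ ∞ g ∧ ∀ q, g (hS.isSlice_weak.emb (hS.glue q)) = hS.isSlice'.emb q := by
  rcases isEmpty_or_nonempty (ASpace M') with he | ⟨⟨q₀⟩⟩
  · exact ⟨fun _ => 0, contDiff_const, fun q => he.elim q⟩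
  · have hsurj := merge_surjective (hS.merge ⟨_, hS.isSlice'.fst_mem (hS.isSlice'.emb_mem q₀)⟩)
    refine ⟨fun y => (fun t => y.1 (Function.surjInv hsurj t), y.2), ?_, fun q => ?_⟩
    · exact (contDiff_pi.2 fun t => (contDiff_apply ℝ _ _).comp contDiff_fst).prodMk contDiff_snd
    · rw [hS.emb_glue]
      refine Prod.ext (funext fun t => ?_) rfl
      change (hS.isSlice'.emb q).1 (π (Function.surjInv hsurj t)) = _
      rw [Function.surjInv_eq hsurj]

theorem isEmbedding_glue : IsEmbedding hS.glue := by
  obtain ⟨g, hg, hgj⟩ := hS.exists_retract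
  refine IsEmbedding.of_comp hS.continuous_glue
    (hg.continuous.comp hS.isSlice_weak.continuous_emb) ?_
  have e : (g ∘ hS.isSlice_weak.emb) ∘ hS.glue = hS.isSlice'.emb := funext hgj
  rw [e]
  exact hS.isSlice'.isEmbedding_emb

theorem sameMarked {p : M'.Face → HalfParam} (hp : p ∈ polySpace M') : SameMarked M' p M (p ∘ π) := by
  obtain ⟨hM', x, hx⟩ := exists_isStrict M' hS.del.deg hp
  have hπ := hS.merge ⟨p, hp⟩
  exact ⟨(body_comp_merge hπ p).symm, x, hx.range_eq hM', fun f v hv => hx.on v f hv,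
    fun f v hv => hx.on v _ (hπ.mem v f hv)⟩

section Smooth

variable {n : ℕ} [ChartedSpace (EuclideanSpace ℝ (Fin (n + 1))) (ASpace M)]
  [ChartedSpace (EuclideanSpace ℝ (Fin n)) (ASpace M')]
  [ChartedSpace (EuclideanHalfSpace (n + 1)) (AWeakSpace M d.fst d.snd)]

/-- Both spaces are embedded by the same normal form, so the inclusion and its local inverse are the
identity in the slice. -/
theorem isLocalDiffeomorph_incl (hA : hS.isSlice.IsAtlas (𝓡 (n + 1)))
    (hAw : hS.isSlice_weak.IsAtlas (𝓡∂ (n + 1))) :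
    IsLocalDiffeomorph (𝓡 (n + 1)) (𝓡∂ (n + 1)) ∞ hS.incl := by
  intro q
  have hne : Nonempty (ASpace M) := ⟨q⟩
  let e := hS.isOpenEmbedding_incl.toOpenPartialHomeomorph
  have he : ∀ q, e q = hS.incl q := fun q => rfl
  refine ⟨⟨e.toPartialEquiv, e.open_source, e.open_target, fun x _ => ?_, fun x hx => ?_⟩, ?_,
    fun x _ => rfl⟩
  · refine ContMDiffAt.contMDiffWithinAt (hAw.contMDiffAt hS.continuous_incl.continuousAt ?_)
    exact (hA.smooth x).congr_of_eventuallyEq (Filter.Eventually.of_forall fun y => hS.emb_incl y)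
  · refine ContMDiffAt.contMDiffWithinAt (hA.contMDiffAt
      (e.symm.continuousOn.continuousAt (e.open_target.mem_nhds hx)) ?_)
    refine (hAw.smooth x).congr_of_eventuallyEq ?_
    filter_upwards [e.open_target.mem_nhds hx] with y hy
    have := hS.emb_incl (e.symm y)
    change hS.isSlice.emb (e.symm y) = _
    rw [← this, ← he, e.right_inv hy]
  · change q ∈ e.source
    simp [e]

theorem contMDiff_glue (hA' : hS.isSlice'.IsAtlas (𝓡 n))
    (hAw : hS.isSlice_weak.IsAtlas (𝓡∂ (n + 1))) :
    ContMDiff (𝓡 n) (𝓡∂ (n + 1)) ∞ hS.glue := fun q => by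
  refine hAw.contMDiffAt hS.continuous_glue.continuousAt ?_
  have hJ : ContDiff ℝ ∞ fun y : (M'.Face → HalfParam) × (V → E3) => (y.1 ∘ π, y.2) :=
    (contDiff_pi.2 fun f => (contDiff_apply ℝ _ (π f)).comp contDiff_fst).prodMk contDiff_snd
  exact (hJ.contMDiff.contMDiffAt.comp q (hA'.smooth q)).congr_of_eventuallyEq
    (Filter.Eventually.of_forall fun y => hS.emb_glue y)

theorem injective_mfderiv_glue (hA' : hS.isSlice'.IsAtlas (𝓡 n))
    (hAw : hS.isSlice_weak.IsAtlas (𝓡∂ (n + 1))) (q : ASpace M') :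
    Function.Injective (mfderiv (𝓡 n) (𝓡∂ (n + 1)) hS.glue q) := by
  obtain ⟨g, hg, hgj⟩ := hS.exists_retract
  exact hA'.injective_mfderiv (hS.contMDiff_glue hA' hAw) (hg.contMDiff.comp hAw.smooth) hgj q

theorem interior_eq (h : ∀ q : AWeakSpace M d.fst d.snd, 0 < extChartAt (𝓡∂ (n + 1)) q q 0 ↔
      (hS.isSlice_weak.emb q).1 (M.face d) ≠ (hS.isSlice_weak.emb q).1 (M.face d.symm)) :
    range hS.incl = (𝓡∂ (n + 1)).interior (AWeakSpace M d.fst d.snd) := by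
  rw [hS.range_incl]
  ext q
  rw [mem_ofPred_eq, ← h q]
  change _ ↔ extChartAt (𝓡∂ (n + 1)) q q ∈ interior (range (𝓡∂ (n + 1)))
  rw [interior_range_modelWithCornersEuclideanHalfSpace]
  rfl

theorem boundary_eq (h : ∀ q : AWeakSpace M d.fst d.snd, 0 < extChartAt (𝓡∂ (n + 1)) q q 0 ↔
      (hS.isSlice_weak.emb q).1 (M.face d) ≠ (hS.isSlice_weak.emb q).1 (M.face d.symm)) :
    range hS.glue = (𝓡∂ (n + 1)).boundary (AWeakSpace M d.fst d.snd) := by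
  rw [← ModelWithCorners.compl_interior, ← hS.interior_eq h, hS.range_incl, hS.range_glue]
  ext q
  simp

end Smooth

end IsSetup

end HypPoly

open HypPoly

theorem mainTheorem7 {V : Type*} [Finite V]
    (Γ' : SimpleGraph V) (hΓ' : ThreeConnected Γ') (M' : SphereEmbedding Γ')
    (f : M'.Face) (a b : V) (ha : M'.OnFace a f) (hb : M'.OnFace b f)
    (hab : a ≠ b) (hnadj : ¬ Γ'.Adj a b)
    (M : SphereEmbedding (Γ' ⊔ SimpleGraph.edge a b)) :
    ∃ (n : ℕ)
      (_ : ChartedSpace (EuclideanSpace ℝ (Fin (n + 1))) (ASpace M))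
      (_ : ChartedSpace (EuclideanSpace ℝ (Fin n)) (ASpace M'))
      (_ : ChartedSpace (EuclideanHalfSpace (n + 1)) (AWeakSpace M a b)),
      IsQuotientManifold (polySpace M) (𝓡 (n + 1)) ∧
      IsQuotientManifold (polySpace M') (𝓡 n) ∧
      IsQuotientManifold (weakPolySpace M a b) (𝓡∂ (n + 1)) ∧
      (∃ i : ASpace M → AWeakSpace M a b,
        (∀ p : polySpace M, ∃ q : weakPolySpace M a b, q.1 = p.1 ∧ i (cls p) = cls q) ∧
        IsOpenEmbedding i ∧
        IsLocalDiffeomorph (𝓡 (n + 1)) (𝓡∂ (n + 1)) ∞ i ∧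
        range i = (𝓡∂ (n + 1)).interior (AWeakSpace M a b)) ∧
      (∃ j : ASpace M' → AWeakSpace M a b,
        (∀ p : polySpace M', ∃ q : weakPolySpace M a b,
          SameMarked M' p.1 M q.1 ∧ j (cls p) = cls q) ∧
        IsEmbedding j ∧
        ContMDiff (𝓡 n) (𝓡∂ (n + 1)) ∞ j ∧
        (∀ x, Function.Injective (mfderiv (𝓡 n) (𝓡∂ (n + 1)) j x)) ∧
        range j = (𝓡∂ (n + 1)).boundary (AWeakSpace M a b)) := by
  have := Fintype.ofFinite V
  have hle : Γ' ≤ Γ' ⊔ SimpleGraph.edge a b := le_sup_left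
  let d : (Γ' ⊔ SimpleGraph.edge a b).Dart :=
    ⟨(a, b), Or.inr (by simp [SimpleGraph.edge_adj, hab])⟩
  have hD : IsDeletion Γ' d :=
    ⟨hle, hΓ'.minDegThree, hnadj, fun u v huv => huv.imp_right fun h => by
      rw [SimpleGraph.edge_adj] at h
      exact Sym2.eq_iff.2 h.1⟩
  obtain ⟨ν, f₀, π, hS⟩ := hD.exists_isSetup M M' f
  -- The dimension is the number of edges.
  obtain ⟨n, hn⟩ : ∃ n, Nat.card Γ'.edgeSet = n := ⟨_, rfl⟩
  have hn' : Nat.card (Γ' ⊔ SimpleGraph.edge a b).edgeSet = n + 1 := by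
    classical
    rw [← hn, Nat.card_eq_fintype_card, Nat.card_eq_fintype_card, ← SimpleGraph.edgeFinset_card,
      ← SimpleGraph.edgeFinset_card]
    exact Γ'.card_edgeFinset_sup_edge hnadj hab
  choose Lw hLw using hS.exists_localModel_weak hn'
  let L := fun q => (hS.exists_localModel hn' q).some
  let L' := fun q => (hS.exists_localModel' hn q).some
  let _ : ChartedSpace (EuclideanSpace ℝ (Fin (n + 1))) (ASpace M) := hS.isSlice.chartedSpace L
  let _ : ChartedSpace (EuclideanSpace ℝ (Fin n)) (ASpace M') := hS.isSlice'.chartedSpace L'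
  let _ : ChartedSpace (EuclideanHalfSpace (n + 1)) (AWeakSpace M d.fst d.snd) :=
    hS.isSlice_weak.chartedSpace Lw
  obtain ⟨hA, -⟩ := hS.isSlice.isAtlas_chartedSpace L
  obtain ⟨hA', -⟩ := hS.isSlice'.isAtlas_chartedSpace L'
  obtain ⟨hAw, hext⟩ := hS.isSlice_weak.isAtlas_chartedSpace Lw
  have hpos : ∀ q : AWeakSpace M d.fst d.snd, 0 < extChartAt (𝓡∂ (n + 1)) q q 0 ↔
      (hS.isSlice_weak.emb q).1 (M.face d) ≠ (hS.isSlice_weak.emb q).1 (M.face d.symm) := fun q => by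
    rw [hext q]; exact hLw q
  exact ⟨n, hS.isSlice.chartedSpace L, hS.isSlice'.chartedSpace L', hS.isSlice_weak.chartedSpace Lw,
    hA.quotient, hA'.quotient, hAw.quotient,
    ⟨hS.incl, fun p => ⟨⟨p.1, hS.subset p.2⟩, rfl, rfl⟩, hS.isOpenEmbedding_incl,
      hS.isLocalDiffeomorph_incl hA hAw, hS.interior_eq hpos⟩,
    ⟨hS.glue, fun p => ⟨⟨p.1 ∘ π, hS.comp_mem p.2⟩, hS.sameMarked p.2, rfl⟩, hS.isEmbedding_glue,
      hS.contMDiff_glue hA' hAw, hS.injective_mfderiv_glue hA' hAw, hS.boundary_eq hpos⟩⟩
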